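/- **Setting.** Formulas are built from propositional variables $p_0,p_1,\dots$ and $\bot$ by $\wedge,\vee,\supset,\Box$. The weight is $w(p_i)=w(\bot)=0$, $w(\Box A)=w(A)+1$, $w(A\circ B)=w(A)+w(B)+1$ for $\circ\in\{\wedge,\vee,\supset\}$. A sequent $\Gamma\Rightarrow\Delta$ consists of two finite multisets of formulas; its weight is the sum of the weights of its members. All calculi have the initial sequents $p_i,\Gamma\Rightarrow\Delta,p_i$, the zero-premiss rule $L\bot$ with conclusion $\bot,\Gamma\Rightarrow\Delta$, and the usual invertible G3 left and right rules for $\wedge,\vee,\supset$. The modal and deontic rules are (premisses / conclusion): - $LR$-$E$: $A\Rightarrow B$ and $B\Rightarrow A$ / $\Box A,\Gamma\Rightarrow\Delta,\Box B$; - $LR$-$M$: $A\Rightarrow B$ / $\Box A,\Gamma\Rightarrow\Delta,\Box B$; - $LR$-$R$: $A,\Pi\Rightarrow B$ / $\Box A,\Box\Pi,\Gamma\Rightarrow\Delta,\Box B$; - $LR$-$C$ ($k\ge1$): $A_1,\dots,A_k\Rightarrow B$ and $B\Rightarrow A_i$ for $i=1,\dots,k$ / $\Box A_1,\dots,\Box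 A_k,\Gamma\Rightarrow\Delta,\Box B$; - $LR$-$K$: $\Pi\Rightarrow B$ / $\Box\Pi,\Gamma\Rightarrow\Delta,\Box B$; - $R$-$N$: $\Rightarrow B$ / $\Gamma\Rightarrow\Delta,\Box B$; - $L$-$D^\bot$: $A\Rightarrow$ / $\Box A,\Gamma\Rightarrow\Delta$; - $L$-$D^{\Diamond_E}$ ($1\le|\Pi|\le2$): $\Pi\Rightarrow$ and $\Rightarrow\Pi$ / $\Box\Pi,\Gamma\Rightarrow\Delta$; - $L$-$D^{\Diamond_M}$ ($1\le|\Pi|\le2$): $\Pi\Rightarrow$ / $\Box\Pi,\Gamma\Rightarrow\Delta$; - $L$-$D^{\Diamond_C}$ ($\Pi,\Sigma\neq\emptyset$): $\Pi,\Sigma\Rightarrow$ and $\Rightarrow A,B$ for all $A\in\Pi$, $B\in\Sigma$ / $\Box\Pi,\Box\Sigma,\Gamma\Rightarrow\Delta$; - $L$-$D^{*}$ ($\Pi\neq\emptyset$): $\Pi\Rightarrow$ / $\Box\Pi,\Gamma\Rightarrow\Delta$. $\mathbf{G3X}$ is any of the following 22 calculi. Modal: $\mathbf{E},\mathbf{M},\mathbf{C},\mathbf{R},\mathbf{K}$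 have, respectively, $LR$-$E$, $LR$-$M$, $LR$-$C$, $LR$-$R$, $LR$-$K$, and $\mathbf{EN},\mathbf{MN},\mathbf{CN}$ have $R$-$N$ in addition. Deontic: $\mathbf{E(N)D^\bot}$ and $\mathbf{M(N)D^\bot}$ add $L$-$D^\bot$; $\mathbf{ED^\Diamond}$ adds $L$-$D^{\Diamond_E}$; $\mathbf{E(N)D}$ adds both $L$-$D^\bot$ and $L$-$D^{\Diamond_E}$; $\mathbf{M(N)D}$ adds $L$-$D^{\Diamond_M}$; $\mathbf{CD^\Diamond}$ adds $L$-$D^{\Diamond_C}$; $\mathbf{C(N)D}$, $\mathbf{RD}$, $\mathbf{KD}$ add $L$-$D^{*}$, each to the corresponding modal calculus, where (N) means with or without $\mathbf N$. An $\mathbf X$-instance is an instance of a modal or deontic rule of $\mathbf{G3X}$. *The search.* Fix, for every sequent, a finite list of the $\mathbf X$-instances concluding it (each listed, up to the order in which its premisses are written). The search starts with the end-sequent active. (i) If the active sequent is an initial sequent or a conclusion of $L\bot$, go to the leftmost unexplored premiss of the topmost AND-branching point (rule instance) on the current branch that has one; if there is none, stop with answer "derivable". (ii) Otherwise, if some propositional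 rule instance concludes the active sequent, apply one such instance, chosen arbitrarily, and activate its leftmost premiss. (iii) Otherwise, if its list of $\mathbf X$-instances is not empty, make it an OR-branching point over the list and activate the leftmost premiss of the first listed instance. (iv) Otherwise, go to the leftmost unexplored $\mathbf X$-instance of the topmost OR-branching point on the current branch that has one, and activate its leftmost premiss; if there is none, stop with answer "not derivable". *Space.* Sequents are written over a fixed finite alphabet: formulas in Polish notation, indices of variables in binary. Space is the number of work-tape cells visited by a deterministic Turing machine with a read-only input tape and finitely many work tapes. **Theorem.** Let $\mathbf{G3X}$ be any of these calculi. 1. Lists of $\mathbf X$-instances as required exist. For every choice of them, every end-sequent and every choice made in (ii), the depth-first search terminates, and it answers "derivable" if and only if the end-sequent is derivable in $\mathbf{G3X}$. 2. $\mathbf{G3X}$-derivability is decidable in $O(n\log n)$ space, where $n$ is the weight of the end-sequent, with the usual logarithmic allowance for reading the input: there are a deterministic Turing machine and a constant $c$ such that the machine halts on all inputs, accepts exactly the words that encode derivable sequents, and on every word of length $\ell$ that encodes a sequent of weight $n$ uses at most $c\,(n\lfloor\log_2 n\rfloor+\lfloor\log_2\ell\rfloor+1)$ work-tape cells (with $n\lfloor\log_2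 n\rfloor=0$ for $n=0$). 3. Hence $\mathbf{G3X}$-derivability is in $\mathrm{PSPACE}$: the set of words that encode derivable sequents is decidable in work space polynomial in the length of the input. -/

import Mathlib

namespace G3

/-! Formulas, weights, sequents. -/

inductive Formula : Type
  | var (i : ℕ)
  | bot
  | and (A B : Formula)
  | or (A B : Formula)
  | imp (A B : Formula)
  | box (A : Formula)

/-- The weight of a formula: its number of connectives and boxes (`⊥` is not counted). -/
def Formula.weight : Formula → ℕ
  | .var _ => 0
  | .bot => 0
  | .and A B => A.weight + B.weight + 1
  | .or A B => A.weight + B.weight + 1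
  | .imp A B => A.weight + B.weight + 1
  | .box A => A.weight + 1

/-- A sequent `ant ⟹ suc` of finite, possibly empty, multisets of formulas. -/
structure Sequent : Type where
  ant : Multiset Formula
  suc : Multiset Formula

def Sequent.weight (S : Sequent) : ℕ :=
  (S.ant.map Formula.weight).sum + (S.suc.map Formula.weight).sum

/-- `□Π`. -/
def boxes (P : Multiset Formula) : Multiset Formula := P.map Formula.box

/-! The calculi. -/

/-- Initial sequents `p, Γ ⟹ Δ, p` and conclusions of the zero-premiss rule `L⊥`. -/
def Sequent.IsClosed (S : Sequent) : Prop :=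
  (∃ i, Formula.var i ∈ S.ant ∧ Formula.var i ∈ S.suc) ∨ Formula.bot ∈ S.ant

open Formula in
/-- `PropInst premisses conclusion`: the instances of the propositional rules with premisses. -/
inductive PropInst : List Sequent → Sequent → Prop
  | andL (A B : Formula) (Γ Δ : Multiset Formula) :
      PropInst [⟨A ::ₘ B ::ₘ Γ, Δ⟩] ⟨and A B ::ₘ Γ, Δ⟩
  | andR (A B : Formula) (Γ Δ : Multiset Formula) :
      PropInst [⟨Γ, A ::ₘ Δ⟩, ⟨Γ, B ::ₘ Δ⟩] ⟨Γ, and A B ::ₘ Δ⟩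
  | orL (A B : Formula) (Γ Δ : Multiset Formula) :
      PropInst [⟨A ::ₘ Γ, Δ⟩, ⟨B ::ₘ Γ, Δ⟩] ⟨or A B ::ₘ Γ, Δ⟩
  | orR (A B : Formula) (Γ Δ : Multiset Formula) :
      PropInst [⟨Γ, A ::ₘ B ::ₘ Δ⟩] ⟨Γ, or A B ::ₘ Δ⟩
  | impL (A B : Formula) (Γ Δ : Multiset Formula) :
      PropInst [⟨Γ, A ::ₘ Δ⟩, ⟨B ::ₘ Γ, Δ⟩] ⟨imp A B ::ₘ Γ, Δ⟩
  | impR (A B : Formula) (Γ Δ : Multiset Formula) :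
      PropInst [⟨A ::ₘ Γ, B ::ₘ Δ⟩] ⟨Γ, imp A B ::ₘ Δ⟩

/-- Names of the modal and deontic rules. -/
inductive ModalRule : Type
  | LRE | LRM | LRR | LRC | LRK | RN
  | LDbot | LDdiaE | LDdiaM | LDdiaC | LDstar

open Formula in
/-- `RuleInst r premisses conclusion`: the instances of the modal or deontic rule `r`.
Every rule has weakening contexts `Γ`, `Δ` in its conclusion. In the left deontic rules the
principal multisets are nonempty, so that each premiss is lighter than the conclusion. -/
inductive RuleInst : ModalRule → List Sequent → Sequent → Prop
  | LRE (A B : Formula) (Γ Δ : Multiset Formula) :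
      RuleInst .LRE [⟨{A}, {B}⟩, ⟨{B}, {A}⟩] ⟨box A ::ₘ Γ, box B ::ₘ Δ⟩
  | LRM (A B : Formula) (Γ Δ : Multiset Formula) :
      RuleInst .LRM [⟨{A}, {B}⟩] ⟨box A ::ₘ Γ, box B ::ₘ Δ⟩
  | LRR (A B : Formula) (P Γ Δ : Multiset Formula) :
      RuleInst .LRR [⟨A ::ₘ P, {B}⟩] ⟨box A ::ₘ (boxes P + Γ), box B ::ₘ Δ⟩
  | LRC (As : List Formula) (B : Formula) (Γ Δ : Multiset Formula) (h : As ≠ []) :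
      RuleInst .LRC (⟨(As : Multiset Formula), {B}⟩ :: As.map fun A => ⟨{B}, {A}⟩)
        ⟨boxes As + Γ, box B ::ₘ Δ⟩
  | LRK (B : Formula) (P Γ Δ : Multiset Formula) :
      RuleInst .LRK [⟨P, {B}⟩] ⟨boxes P + Γ, box B ::ₘ Δ⟩
  | RN (B : Formula) (Γ Δ : Multiset Formula) :
      RuleInst .RN [⟨0, {B}⟩] ⟨Γ, box B ::ₘ Δ⟩
  | LDbot (A : Formula) (Γ Δ : Multiset Formula) :
      RuleInst .LDbot [⟨{A}, 0⟩] ⟨box A ::ₘ Γ, Δ⟩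
  | LDdiaE (P Γ Δ : Multiset Formula) (h0 : P ≠ 0) (h2 : P.card ≤ 2) :
      RuleInst .LDdiaE [⟨P, 0⟩, ⟨0, P⟩] ⟨boxes P + Γ, Δ⟩
  | LDdiaM (P Γ Δ : Multiset Formula) (h0 : P ≠ 0) (h2 : P.card ≤ 2) :
      RuleInst .LDdiaM [⟨P, 0⟩] ⟨boxes P + Γ, Δ⟩
  | LDdiaC (As Bs : List Formula) (Γ Δ : Multiset Formula) (hA : As ≠ []) (hB : Bs ≠ []) :
      RuleInst .LDdiaC
        (⟨(As : Multiset Formula) + (Bs : Multiset Formula), 0⟩ ::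
          (As.product Bs).map fun AB => ⟨0, {AB.1, AB.2}⟩)
        ⟨boxes As + boxes Bs + Γ, Δ⟩
  | LDstar (P Γ Δ : Multiset Formula) (h0 : P ≠ 0) :
      RuleInst .LDstar [⟨P, 0⟩] ⟨boxes P + Γ, Δ⟩

/-- The eight modal and fourteen deontic calculi `G3X`, named by `X`
(`Dbot` is `D^⊥`, `Ddia` is `D^◇`). -/
inductive Calculus : Type
  | E | EN | M | MN | C | CN | R | K
  | EDbot | ENDbot | EDdia | ED | END
  | MDbot | MNDbot | MD | MND
  | CDdia | CD | CND | RD | KD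

/-- The primitive modal and deontic rules of each calculus. -/
def Calculus.rules : Calculus → List ModalRule
  | .E => [.LRE]
  | .EN => [.LRE, .RN]
  | .M => [.LRM]
  | .MN => [.LRM, .RN]
  | .C => [.LRC]
  | .CN => [.LRC, .RN]
  | .R => [.LRR]
  | .K => [.LRK]
  | .EDbot => [.LRE, .LDbot]
  | .ENDbot => [.LRE, .RN, .LDbot]
  | .EDdia => [.LRE, .LDdiaE]
  | .ED => [.LRE, .LDbot, .LDdiaE]
  | .END => [.LRE, .RN, .LDbot, .LDdiaE]
  | .MDbot => [.LRM, .LDbot]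
  | .MNDbot => [.LRM, .RN, .LDbot]
  | .MD => [.LRM, .LDdiaM]
  | .MND => [.LRM, .RN, .LDdiaM]
  | .CDdia => [.LRC, .LDdiaC]
  | .CD => [.LRC, .LDstar]
  | .CND => [.LRC, .RN, .LDstar]
  | .RD => [.LRR, .LDstar]
  | .KD => [.LRK, .LDstar]

/-- `X`-instances: instances of the modal and deontic rules of `G3X`. -/
def XInst (X : Calculus) (ps : List Sequent) (S : Sequent) : Prop :=
  ∃ r ∈ X.rules, RuleInst r ps S

/-- Existence of a derivation in `G3X`. -/
inductive Derivable (X : Calculus) : Sequent → Prop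
  | closed {S : Sequent} (h : S.IsClosed) : Derivable X S
  | prop {ps : List Sequent} {S : Sequent} (h : PropInst ps S)
      (ih : ∀ P ∈ ps, Derivable X P) : Derivable X S
  | modal {ps : List Sequent} {S : Sequent} (h : XInst X ps S)
      (ih : ∀ P ∈ ps, Derivable X P) : Derivable X S

/-! The depth-first decision procedure. -/

/-- A fixed way of ordering the finitely many `X`-instances concluding a given sequent. An instance
is represented by its list of premisses; each instance is listed, up to the order in which its
premisses are written. -/
structure InstanceOrder (X : Calculus) where
  inst : Sequent → List (List Sequent)
  sound : ∀ S, ∀ ps ∈ inst S, XInst X ps S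
  complete : ∀ S ps, XInst X ps S → ∃ ps' ∈ inst S, ps'.Perm ps

/-- The branching points on the branch from the root to the active sequent, each with its
unexplored branches: unexplored premisses at an AND-branching point, unexplored `X`-instances at
an OR-branching point. -/
inductive Entry : Type
  | and (unexplored : List Sequent)
  | or (unexplored : List (List Sequent))

/-- A stage of the search: an active sequent together with the branching points below it (topmost
first), or the end of the procedure with its answer (`true` for "derivable"). -/
inductive Stage : Type
  | active (S : Sequent) (branch : List Entry)
  | finished (answer : Bool)

/-- After a closed leaf: move to the leftmost unexplored branch of the topmost AND-branching point
that has one; if there is none, the end-sequent is derivable. -/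
def andBacktrack : List Entry → Stage
  | [] => .finished true
  | .and (S :: rest) :: br => .active S (.and rest :: br)
  | .and [] :: br => andBacktrack br
  | .or _ :: br => andBacktrack br

/-- Extend the branch by a rule instance and activate its leftmost premiss. -/
def enter : List Sequent → List Entry → Stage
  | [], br => andBacktrack br
  | S :: rest, br => .active S (.and rest :: br)

/-- After an open leaf: move to the leftmost unexplored branch of the topmost OR-branching point
that has one; if there is none, the end-sequent is not derivable. -/
def orBacktrack : List Entry → Stage
  | [] => .finished false
  | .or (ps :: rest) :: br => enter ps (.or rest :: br)
  | .or [] :: br => orBacktrack br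
  | .and _ :: br => orBacktrack br

/-- One step of the decision procedure. Which of the applicable propositional instances is used is
left open; the `X`-instances are tried in the given order. -/
inductive Step {X : Calculus} (ord : InstanceOrder X) : Stage → Stage → Prop
  | closed {S : Sequent} {br : List Entry} (h : S.IsClosed) :
      Step ord (.active S br) (andBacktrack br)
  | prop {S : Sequent} {br : List Entry} {ps : List Sequent} (hc : ¬ S.IsClosed)
      (h : PropInst ps S) : Step ord (.active S br) (enter ps br)
  | modal {S : Sequent} {br : List Entry} {ps : List Sequent} {rest : List (List Sequent)}
      (hc : ¬ S.IsClosed) (hp : ∀ qs, ¬ PropInst qs S) (h : ord.inst S = ps :: rest) :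
      Step ord (.active S br) (enter ps (.or rest :: br))
  | openLeaf {S : Sequent} {br : List Entry} (hc : ¬ S.IsClosed) (hp : ∀ qs, ¬ PropInst qs S)
      (h : ord.inst S = []) : Step ord (.active S br) (orBacktrack br)

/-- The first stage for the end-sequent `S`. -/
def initialStage (S : Sequent) : Stage := .active S []

/-- Every run of the procedure from `S` is finite. -/
def SearchTerminates {X : Calculus} (ord : InstanceOrder X) (S : Sequent) : Prop :=
  ¬ ∃ run : ℕ → Stage, run 0 = initialStage S ∧ ∀ i, Step ord (run i) (run (i + 1))

/-- Every run of the procedure from `S` that cannot be continued has ended with the correct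
answer to the question whether `S` is derivable. -/
def SearchCorrect {X : Calculus} (ord : InstanceOrder X) (S : Sequent) : Prop :=
  ∀ s, Relation.ReflTransGen (Step ord) (initialStage S) s → (∀ t, ¬ Step ord s t) →
    ∃ answer : Bool, s = .finished answer ∧ (answer = true ↔ Derivable X S)

/-! Sequents as words over a finite alphabet. -/

inductive Sym : Type
  | var | zero | one | bot | and | or | imp | box | comma | arrow

/-- Polish notation; the index of a variable is written in binary, least significant digit
first. -/
def Formula.encode : Formula → List Sym
  | .var i => .var :: (Nat.bits i).map fun b => if b then Sym.one else Sym.zero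
  | .bot => [.bot]
  | .and A B => .and :: (A.encode ++ B.encode)
  | .or A B => .or :: (A.encode ++ B.encode)
  | .imp A B => .imp :: (A.encode ++ B.encode)
  | .box A => .box :: A.encode

/-- The formulas of a list, each followed by a comma. -/
def encodeList (As : List Formula) : List Sym :=
  As.flatMap fun A => A.encode ++ [Sym.comma]

/-- The word for the sequent whose sides are the multisets listed by `Γ` and `Δ`. -/
def encodeSequent (Γ Δ : List Formula) : List Sym :=
  encodeList Γ ++ Sym.arrow :: encodeList Δ

/-- The words that encode a `G3X`-derivable sequent. -/
def derivabilityLanguage (X : Calculus) : Language Sym :=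
  {w | ∃ Γ Δ : List Formula, w = encodeSequent Γ Δ ∧ Derivable X ⟨Γ, Δ⟩}

/-! Deterministic Turing machines with a read-only input tape and their work space. -/

inductive Move : Type
  | left | stay | right

/-- What the input head reads: a letter of the input or one of the two end markers. -/
inductive InSym (α : Type) : Type
  | leftEnd
  | letter (a : α)
  | rightEnd

/-- The visited part of a two-way infinite work tape: the cells to the left of the head (nearest
first), the scanned cell, and the cells to the right (nearest first). -/
structure WorkTape (Γ : Type) : Type where
  left : List Γ
  head : Γ
  right : List Γ

/-- The number of cells visited so far. -/
def WorkTape.cells {Γ : Type} (t : WorkTape Γ) : ℕ := t.left.length + 1 + t.right.length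

/-- Write `a` into the scanned cell. -/
def WorkTape.write {Γ : Type} (t : WorkTape Γ) (a : Γ) : WorkTape Γ := ⟨t.left, a, t.right⟩

/-- Move the head; a cell that is visited for the first time is blank. -/
def WorkTape.move {Γ : Type} (blank : Γ) : Move → WorkTape Γ → WorkTape Γ
  | .stay, t => t
  | .left, ⟨[], a, r⟩ => ⟨[], blank, a :: r⟩
  | .left, ⟨b :: l, a, r⟩ => ⟨l, b, a :: r⟩
  | .right, ⟨l, a, []⟩ => ⟨a :: l, blank, []⟩
  | .right, ⟨l, a, b :: r⟩ => ⟨a :: l, b, r⟩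

/-- A deterministic Turing machine with a two-way read-only input tape over `α` and finitely many
work tapes. A state with verdict `some b` is halting, accepting if `b = true` and rejecting
otherwise. -/
structure OfflineTM (α : Type) : Type 1 where
  tapes : ℕ
  State : Type
  [finiteState : Finite State]
  Γ : Type
  [finiteΓ : Finite Γ]
  blank : Γ
  start : State
  verdict : State → Option Bool
  δ : State → InSym α → (Fin tapes → Γ) → State × Move × (Fin tapes → Γ × Move)

namespace OfflineTM

variable {α : Type}

/-- Position `0` of the input head is the left end marker, position `i + 1` the `i`-th letter of
the input. -/
structure Cfg (M : OfflineTM α) : Type where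
  state : M.State
  pos : ℕ
  work : Fin M.tapes → WorkTape M.Γ

def init (M : OfflineTM α) : M.Cfg := ⟨M.start, 0, fun _ => ⟨[], M.blank, []⟩⟩

/-- The symbol at a position of the input tape that holds the word `w`. -/
def readInput (w : List α) : ℕ → InSym α
  | 0 => .leftEnd
  | i + 1 => match w[i]? with
    | some a => .letter a
    | none => .rightEnd

/-- The input head does not leave the word and its two end markers. -/
def moveInput (w : List α) : Move → ℕ → ℕ
  | .left, i => i - 1
  | .stay, i => i
  | .right, i => min (i + 1) (w.length + 1)

/-- One step on input `w`; halting configurations stay as they are. -/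
def step (M : OfflineTM α) (w : List α) (c : M.Cfg) : M.Cfg :=
  match M.verdict c.state with
  | some _ => c
  | none =>
    let a := M.δ c.state (readInput w c.pos) fun j => (c.work j).head
    ⟨a.1, moveInput w a.2.1 c.pos,
      fun j => ((c.work j).write (a.2.2 j).1).move M.blank (a.2.2 j).2⟩

/-- The configuration after `t` steps on input `w`. -/
def run (M : OfflineTM α) (w : List α) (t : ℕ) : M.Cfg := (M.step w)^[t] M.init

/-- `M` halts on every input, accepting the words in `L` and rejecting all others. -/
def Decides (M : OfflineTM α) (L : Language α) : Prop :=
  ∀ w, (w ∈ L → ∃ t, M.verdict (M.run w t).state = some true) ∧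
    (w ∉ L → ∃ t, M.verdict (M.run w t).state = some false)

/-- On input `w` the machine visits at most `s` cells of its work tapes altogether. -/
def SpaceAtMost (M : OfflineTM α) (w : List α) (s : ℕ) : Prop :=
  ∀ t, ∑ j, ((M.run w t).work j).cells ≤ s

end OfflineTM

/-- The languages decidable in space polynomial in the length of the input. -/
def PSPACE (α : Type) : Set (Language α) :=
  {L | ∃ (M : OfflineTM α) (p : Polynomial ℕ), M.Decides L ∧
    ∀ w, M.SpaceAtMost w (p.eval w.length)}

end G3

/-! ### Sequents, weight of premisses, inversion of the propositional rules -/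

namespace G3

/-! The search. In every rule each premiss is lighter than the conclusion (`PropInst.weight_lt`,
`RuleInst.weight_lt`). By induction on the weight, a stage with active sequent `S` is accessible as
soon as the two stages are to which a closed or an open leaf would send the search back; this gives
termination (`acc_active`). For correctness, read a branch as an AND-OR expression in the
derivability of its active sequent (`branchValue`, `stageValue`). Its truth value is the same before
and after each step: the propositional rules are invertible (`Derivable.invert_basic`), so the
choice among them is irrelevant, and a sequent that is neither closed nor the conclusion of a
propositional rule is derivable only by an `X`-instance. The lists of instances are finite because
all premisses are built from the formulas under the boxes of the conclusion.

The space bound. The machine does not keep the sequents of a branch. Derivability is recast as an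
AND-OR game in which a branch is stored as the bare sequence of its moves, and the current position
is recomputed from the initial one whenever it is needed (`pathState`, `dfsStep`, `LSP.game`). With
`N` tokens in the end-sequent, a position is an array with one small digit per token, hence has
`O(N)` bits. There are at most `N * N + 4` moves in each position, and a play has at most `3 * N +
1` moves, so a branch has `O(N log N)` bits.

For plays to be that short and positions to have so few moves, the choice of an `X`-instance, of
which there may be exponentially many, is broken up: first a rule is chosen, then each boxed formula
in turn is declared principal or dropped, then a premiss is selected (`Completable`, `choose_move`,
`prem_move`). All formulas in play are subformulas that begin at tokens and occupy disjoint segments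
of them (`PosGood`), and a potential proportional to their total length drops with each move.
Members of weight 0 in the end-sequent may be arbitrarily many in comparison with the weight. They
are not counted as tokens but represented by a single flag, which is lost at the first modal rule
because no premiss of such a rule contains weakening formulas. Thus `N` is at most three times the
weight (`numTok_le`).

The machine. Programs with counters are compiled to Turing machines that keep the counters in binary
(`Cmd.Exec.reach`, `Cmd.exists_machine`), so that the space is logarithmic in the largest counter
value. The class `LS` consists of the functions computed by programs whose counters stay polynomial
in the arguments, the length of the word and a parameter `E` of the word. It is closed under
substitution, under primitive recursion with bounded values and under iteration of any length with
bounded values, so the ingredients of the game lie in it by explicit definition. For `E = posBound`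
the logarithm of the counters is `O(n log n + log ℓ)` on sequents of weight `n` and length `ℓ`, and
polynomial in `ℓ` on all words. -/

@[ext] theorem Sequent.ext' {S T : Sequent} (h₁ : S.ant = T.ant) (h₂ : S.suc = T.suc) : S = T := by
  cases S; cases T; simp_all

instance : Add Sequent := ⟨fun S T => ⟨S.ant + T.ant, S.suc + T.suc⟩⟩

@[simp] theorem Sequent.add_ant (S T : Sequent) : (S + T).ant = S.ant + T.ant := rfl
@[simp] theorem Sequent.add_suc (S T : Sequent) : (S + T).suc = S.suc + T.suc := rfl

theorem Sequent.add_left_comm (S T U : Sequent) : S + (T + U) = T + (S + U) := by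
  ext1 <;> simp [_root_.add_left_comm]

/-- The sequent whose only member is `c`, on the left if `s` is true. -/
def single (s : Bool) (c : Formula) : Sequent := if s then ⟨{c}, 0⟩ else ⟨0, {c}⟩

theorem cons_eq_cons_split {c d : Formula} {X Y : Multiset Formula} (h : c ::ₘ X = d ::ₘ Y) :
    (c = d ∧ X = Y) ∨ ∃ Z, X = d ::ₘ Z ∧ Y = c ::ₘ Z := by
  rcases Multiset.cons_eq_cons.1 h with h | ⟨-, Z, h⟩
  · exact .inl h
  · exact .inr ⟨Z, h⟩

/-- Two formulas split off from one sequent are either the same occurrence or each belongs to the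
context of the other. This is the case distinction of the inversion proof. -/
theorem single_add_eq {s t : Bool} {c d : Formula} {X Y : Sequent}
    (h : single s c + X = single t d + Y) :
    (s = t ∧ c = d ∧ X = Y) ∨ ∃ Z, X = single t d + Z ∧ Y = single s c + Z := by
  obtain ⟨x₁, x₂⟩ := X
  obtain ⟨y₁, y₂⟩ := Y
  have h₁ := congrArg Sequent.ant h
  have h₂ := congrArg Sequent.suc h
  cases s <;> cases t <;> simp [single] at h₁ h₂
  · rcases cons_eq_cons_split h₂ with ⟨h, h'⟩ | ⟨Z, h, h'⟩
    · exact .inl ⟨rfl, h, by ext1 <;> simp [h₁, h']⟩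
    · exact .inr ⟨⟨x₁, Z⟩, by ext1 <;> simp [single, h], by ext1 <;> simp [single, h', h₁]⟩
  · exact .inr ⟨⟨y₁, x₂⟩, by ext1 <;> simp [single, h₁], by ext1 <;> simp [single, h₂]⟩
  · exact .inr ⟨⟨x₁, y₂⟩, by ext1 <;> simp [single, h₂], by ext1 <;> simp [single, h₁]⟩
  · rcases cons_eq_cons_split h₁ with ⟨h, h'⟩ | ⟨Z, h, h'⟩
    · exact .inl ⟨rfl, h, by ext1 <;> simp [h₂, h']⟩
    · exact .inr ⟨⟨Z, x₂⟩, by ext1 <;> simp [single, h], by ext1 <;> simp [single, h', h₂]⟩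

open Formula in
/-- The propositional rules without context. -/
inductive PropBasic : List Sequent → Bool → Formula → Prop
  | andL (A B : Formula) : PropBasic [⟨{A, B}, 0⟩] true (and A B)
  | andR (A B : Formula) : PropBasic [⟨0, {A}⟩, ⟨0, {B}⟩] false (and A B)
  | orL (A B : Formula) : PropBasic [⟨{A}, 0⟩, ⟨{B}, 0⟩] true (or A B)
  | orR (A B : Formula) : PropBasic [⟨0, {A, B}⟩] false (or A B)
  | impL (A B : Formula) : PropBasic [⟨0, {A}⟩, ⟨{B}, 0⟩] true (imp A B)
  | impR (A B : Formula) : PropBasic [⟨{A}, {B}⟩] false (imp A B)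

/-- Separating the active formulas from the context allows all six propositional rules to be treated
at once. -/
theorem propInst_iff {ps : List Sequent} {S : Sequent} :
    PropInst ps S ↔ ∃ acts s c ctx, PropBasic acts s c ∧ S = single s c + ctx ∧
      ps = acts.map (· + ctx) := by
  constructor
  · rintro (⟨A, B, Γ, Δ⟩ | ⟨A, B, Γ, Δ⟩ | ⟨A, B, Γ, Δ⟩ | ⟨A, B, Γ, Δ⟩ | ⟨A, B, Γ, Δ⟩ | ⟨A, B, Γ, Δ⟩)
    · exact ⟨_, _, _, ⟨Γ, Δ⟩, .andL A B, by ext1 <;> simp [single], by simp [Sequent.ext'_iff]⟩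
    · exact ⟨_, _, _, ⟨Γ, Δ⟩, .andR A B, by ext1 <;> simp [single], by simp [Sequent.ext'_iff]⟩
    · exact ⟨_, _, _, ⟨Γ, Δ⟩, .orL A B, by ext1 <;> simp [single], by simp [Sequent.ext'_iff]⟩
    · exact ⟨_, _, _, ⟨Γ, Δ⟩, .orR A B, by ext1 <;> simp [single], by simp [Sequent.ext'_iff]⟩
    · exact ⟨_, _, _, ⟨Γ, Δ⟩, .impL A B, by ext1 <;> simp [single], by simp [Sequent.ext'_iff]⟩
    · exact ⟨_, _, _, ⟨Γ, Δ⟩, .impR A B, by ext1 <;> simp [single], by simp [Sequent.ext'_iff]⟩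
  · rintro ⟨acts, s, c, ⟨Γ, Δ⟩, h, rfl, rfl⟩
    rcases h with ⟨A, B⟩ | ⟨A, B⟩ | ⟨A, B⟩ | ⟨A, B⟩ | ⟨A, B⟩ | ⟨A, B⟩
    · convert PropInst.andL A B Γ Δ using 1 <;> simp [single, Sequent.ext'_iff]
    · convert PropInst.andR A B Γ Δ using 1 <;> simp [single, Sequent.ext'_iff]
    · convert PropInst.orL A B Γ Δ using 1 <;> simp [single, Sequent.ext'_iff]
    · convert PropInst.orR A B Γ Δ using 1 <;> simp [single, Sequent.ext'_iff]
    · convert PropInst.impL A B Γ Δ using 1 <;> simp [single, Sequent.ext'_iff]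
    · convert PropInst.impR A B Γ Δ using 1 <;> simp [single, Sequent.ext'_iff]

theorem PropBasic.unique {as bs : List Sequent} {s : Bool} {c : Formula}
    (h : PropBasic as s c) (h' : PropBasic bs s c) : as = bs := by
  cases h <;> cases h' <;> rfl

theorem PropInst.weight_lt {ps : List Sequent} {S : Sequent} (h : PropInst ps S) :
    ∀ P ∈ ps, P.weight < S.weight := by
  cases h <;> simp [Sequent.weight, Formula.weight] <;> omega

theorem weight_boxes (P : Multiset Formula) :
    ((boxes P).map Formula.weight).sum = (P.map Formula.weight).sum + P.card := by
  induction P using Multiset.induction with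
  | empty => rfl
  | cons A P ih => simp_all [boxes, Formula.weight]; omega

theorem boxes_add (P Q : Multiset Formula) : boxes (P + Q) = boxes P + boxes Q :=
  Multiset.map_add _ _ _

theorem weight_le_of_mem {A : Formula} {P : Multiset Formula} (h : A ∈ P) :
    A.weight ≤ (P.map Formula.weight).sum :=
  Multiset.single_le_sum (fun _ _ => Nat.zero_le _) _ (Multiset.mem_map_of_mem _ h)

/-- The box over each principal formula is lost, which is why there must be at least one. Side
premisses use one formula from each of two disjoint parts of the conclusion. -/
theorem RuleInst.weight_lt {r : ModalRule} {ps : List Sequent} {S : Sequent}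
    (h : RuleInst r ps S) : ∀ P ∈ ps, P.weight < S.weight := by
  cases h with
  | LRE A B Γ Δ => simp [Sequent.weight, Formula.weight]; omega
  | LRM A B Γ Δ => simp [Sequent.weight, Formula.weight]; omega
  | LRR A B P Γ Δ =>
    simp [Sequent.weight, Formula.weight, weight_boxes]; omega
  | LRC As B Γ Δ h =>
    intro P hP
    rcases List.mem_cons.1 hP with rfl | hP
    · simp only [Sequent.weight, Multiset.map_add, weight_boxes, Multiset.sum_add,
        Multiset.map_cons, Multiset.sum_cons, Formula.weight, Multiset.map_singleton,
        Multiset.sum_singleton]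
      omega
    · obtain ⟨A, hA, rfl⟩ := List.mem_map.1 hP
      have := weight_le_of_mem (Multiset.mem_coe.2 hA)
      simp only [Sequent.weight, Multiset.map_add, weight_boxes, Multiset.sum_add,
        Multiset.map_cons, Multiset.sum_cons, Formula.weight, Multiset.map_singleton,
        Multiset.sum_singleton]
      omega
  | LRK B P Γ Δ => simp [Sequent.weight, Formula.weight, weight_boxes]; omega
  | RN B Γ Δ => simp [Sequent.weight, Formula.weight]; omega
  | LDbot A Γ Δ => simp [Sequent.weight, Formula.weight]; omega
  | LDdiaE P Γ Δ h0 h2 =>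
    have := Multiset.card_pos.2 h0
    simp [Sequent.weight, weight_boxes]; omega
  | LDdiaM P Γ Δ h0 h2 =>
    have := Multiset.card_pos.2 h0
    simp [Sequent.weight, weight_boxes]; omega
  | LDstar P Γ Δ h0 =>
    have := Multiset.card_pos.2 h0
    simp [Sequent.weight, weight_boxes]; omega
  | LDdiaC As Bs Γ Δ hA hB =>
    have h1 := List.length_pos_iff.2 hA
    have h2 := List.length_pos_iff.2 hB
    intro P hP
    rcases List.mem_cons.1 hP with rfl | hP
    · simp only [Sequent.weight, Multiset.map_add, weight_boxes, Multiset.sum_add,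
        Multiset.coe_card]
      simp
      omega
    · obtain ⟨⟨A, B⟩, hAB, rfl⟩ := List.mem_map.1 hP
      rw [List.pair_mem_product] at hAB
      have hA := weight_le_of_mem (Multiset.mem_coe.2 hAB.1)
      have hB := weight_le_of_mem (Multiset.mem_coe.2 hAB.2)
      simp only [Sequent.weight, Multiset.map_add, weight_boxes, Multiset.sum_add,
        Multiset.coe_card, Multiset.insert_eq_cons, Multiset.map_cons, Multiset.sum_cons,
        Multiset.map_singleton, Multiset.sum_singleton, Multiset.map_zero, Multiset.sum_zero]
      omega

theorem XInst.weight_lt {X : Calculus} {ps : List Sequent} {S : Sequent}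
    (h : XInst X ps S) : ∀ P ∈ ps, P.weight < S.weight := by
  obtain ⟨r, -, h⟩ := h
  exact h.weight_lt

/-- The principal part of a modal or deontic rule consists of boxed formulas; its context can be
replaced. -/
theorem RuleInst.principal {r : ModalRule} {ps : List Sequent} {S : Sequent}
    (h : RuleInst r ps S) : ∃ P Q : Multiset Formula, ∃ ctx : Sequent,
      S = ⟨boxes P, boxes Q⟩ + ctx ∧ ∀ ctx', RuleInst r ps (⟨boxes P, boxes Q⟩ + ctx') := by
  cases h with
  | LRE A B Γ Δ =>
    refine ⟨{A}, {B}, ⟨Γ, Δ⟩, by ext1 <;> simp [boxes], fun c => ?_⟩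
    convert RuleInst.LRE A B c.ant c.suc using 1; ext1 <;> simp [boxes]
  | LRM A B Γ Δ =>
    refine ⟨{A}, {B}, ⟨Γ, Δ⟩, by ext1 <;> simp [boxes], fun c => ?_⟩
    convert RuleInst.LRM A B c.ant c.suc using 1; ext1 <;> simp [boxes]
  | LRR A B P Γ Δ =>
    refine ⟨A ::ₘ P, {B}, ⟨Γ, Δ⟩, by ext1 <;> simp [boxes], fun c => ?_⟩
    convert RuleInst.LRR A B P c.ant c.suc using 1; ext1 <;> simp [boxes]
  | LRC As B Γ Δ h =>
    refine ⟨As, {B}, ⟨Γ, Δ⟩, by ext1 <;> simp [boxes], fun c => ?_⟩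
    convert RuleInst.LRC As B c.ant c.suc h using 1; ext1 <;> simp [boxes]
  | LRK B P Γ Δ =>
    refine ⟨P, {B}, ⟨Γ, Δ⟩, by ext1 <;> simp [boxes], fun c => ?_⟩
    convert RuleInst.LRK B P c.ant c.suc using 1; ext1 <;> simp [boxes]
  | RN B Γ Δ =>
    refine ⟨0, {B}, ⟨Γ, Δ⟩, by ext1 <;> simp [boxes], fun c => ?_⟩
    convert RuleInst.RN B c.ant c.suc using 1; ext1 <;> simp [boxes]
  | LDbot A Γ Δ =>
    refine ⟨{A}, 0, ⟨Γ, Δ⟩, by ext1 <;> simp [boxes], fun c => ?_⟩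
    convert RuleInst.LDbot A c.ant c.suc using 1; ext1 <;> simp [boxes]
  | LDdiaE P Γ Δ h0 h2 =>
    refine ⟨P, 0, ⟨Γ, Δ⟩, by ext1 <;> simp [boxes], fun c => ?_⟩
    convert RuleInst.LDdiaE P c.ant c.suc h0 h2 using 1; ext1 <;> simp [boxes]
  | LDdiaM P Γ Δ h0 h2 =>
    refine ⟨P, 0, ⟨Γ, Δ⟩, by ext1 <;> simp [boxes], fun c => ?_⟩
    convert RuleInst.LDdiaM P c.ant c.suc h0 h2 using 1; ext1 <;> simp [boxes]
  | LDdiaC As Bs Γ Δ hA hB =>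
    refine ⟨As + Bs, 0, ⟨Γ, Δ⟩, by ext1 <;> simp [boxes], fun c => ?_⟩
    convert RuleInst.LDdiaC As Bs c.ant c.suc hA hB using 1
    ext1 <;> simp [boxes]
  | LDstar P Γ Δ h0 =>
    refine ⟨P, 0, ⟨Γ, Δ⟩, by ext1 <;> simp [boxes], fun c => ?_⟩
    convert RuleInst.LDstar P c.ant c.suc h0 using 1; ext1 <;> simp [boxes]

/-- The principal formulas of a modal or deontic rule are boxed, so a formula that is not boxed can
be taken out of a conclusion without touching them. -/
theorem add_eq_single_add {P Q : Multiset Formula} {ctx ctx' : Sequent} {s : Bool} {c : Formula}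
    (hc : ∀ A, c ≠ .box A) (h : (⟨boxes P, boxes Q⟩ : Sequent) + ctx' = single s c + ctx) :
    ∃ Z, ctx = ⟨boxes P, boxes Q⟩ + Z := by
  have h₁ := congrArg Sequent.ant h
  have h₂ := congrArg Sequent.suc h
  have aux : ∀ {R Γ Γ' : Multiset Formula}, boxes R + Γ = c ::ₘ Γ' → ∃ Z, Γ' = boxes R + Z := by
    intro R Γ Γ' e
    have hm : c ∈ boxes R + Γ := by rw [e]; exact Multiset.mem_cons_self _ _
    rcases Multiset.mem_add.1 hm with hm | hm
    · obtain ⟨A, -, hA⟩ := Multiset.mem_map.1 hm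
      exact absurd hA.symm (hc A)
    · obtain ⟨Z, rfl⟩ := Multiset.exists_cons_of_mem hm
      rw [Multiset.add_cons, Multiset.cons_inj_right] at e
      exact ⟨Z, e.symm⟩
  cases s <;> simp [single] at h₁ h₂
  · obtain ⟨Z, hZ⟩ := aux h₂
    exact ⟨⟨ctx'.ant, Z⟩, by ext1 <;> simp [hZ, h₁]⟩
  · obtain ⟨Z, hZ⟩ := aux h₁
    exact ⟨⟨Z, ctx'.suc⟩, by ext1 <;> simp [hZ, h₂]⟩

/-- A compound formula contributes nothing to being closed; the context alone must be closed. -/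
theorem PropBasic.not_closed {acts : List Sequent} {s : Bool} {c : Formula} {ctx D : Sequent}
    (h : PropBasic acts s c) (hc : (single s c + ctx).IsClosed) : (D + ctx).IsClosed := by
  have hctx : ctx.IsClosed := by
    unfold Sequent.IsClosed at hc ⊢
    cases h <;> simpa [single] using hc
  rcases hctx with ⟨i, h₁, h₂⟩ | h
  · exact .inl ⟨i, by simp [h₁], by simp [h₂]⟩
  · exact .inr (by simp [h])

theorem PropBasic.ne_box {acts : List Sequent} {s : Bool} {c : Formula}
    (h : PropBasic acts s c) (A : Formula) : c ≠ .box A := by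
  cases h <;> simp

/-- Inversion, by induction on the derivation: if the last rule introduces the formula itself, its
premisses are what is wanted, as the side and the formula determine the rule; otherwise the formula
stands in the context and the last rule is applied after the induction hypothesis. -/
theorem Derivable.invert_basic {X : Calculus} {S : Sequent} (hd : Derivable X S)
    {acts : List Sequent} {s : Bool} {c : Formula} (hb : PropBasic acts s c) {D : Sequent}
    (hD : D ∈ acts) : ∀ {ctx : Sequent}, S = single s c + ctx → Derivable X (D + ctx) := by
  induction hd with
  | closed h => rintro ctx rfl; exact .closed (hb.not_closed h)
  | @prop ps S h hp ih =>
    rintro ctx rfl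
    obtain ⟨acts', s', c', ctx', hb', e, rfl⟩ := propInst_iff.1 h
    rcases single_add_eq e with ⟨rfl, rfl, rfl⟩ | ⟨Z, rfl, rfl⟩
    · cases hb.unique hb'
      exact hp _ (List.mem_map_of_mem hD)
    · rw [Sequent.add_left_comm]
      refine .prop (propInst_iff.2 ⟨acts', s', c', D + Z, hb', rfl, rfl⟩) fun P hP => ?_
      obtain ⟨D', hD', rfl⟩ := List.mem_map.1 hP
      rw [Sequent.add_left_comm]
      refine ih (D' + (single s c + Z)) (List.mem_map_of_mem hD') ?_
      rw [Sequent.add_left_comm]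
  | @modal ps S h hp ih =>
    rintro ctx rfl
    obtain ⟨r, hr, h⟩ := h
    obtain ⟨P, Q, ctx', e, hall⟩ := h.principal
    -- The formula lies in the weakening context, where it can be exchanged for the active formulas
    -- while the premisses remain as they are.
    obtain ⟨Z, rfl⟩ := add_eq_single_add hb.ne_box e.symm
    rw [Sequent.add_left_comm]
    exact .modal ⟨r, hr, hall _⟩ hp

theorem derivable_iff_of_propInst {X : Calculus} {ps : List Sequent} {S : Sequent}
    (h : PropInst ps S) : Derivable X S ↔ ∀ P ∈ ps, Derivable X P := by
  refine ⟨fun hd P hP => ?_, .prop h⟩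
  obtain ⟨acts, s, c, ctx, hb, rfl, rfl⟩ := propInst_iff.1 h
  obtain ⟨D, hD, rfl⟩ := List.mem_map.1 hP
  exact hd.invert_basic hb hD rfl

theorem derivable_iff_of_irreducible {X : Calculus} {S : Sequent} (hc : ¬ S.IsClosed)
    (hp : ∀ ps, ¬ PropInst ps S) :
    Derivable X S ↔ ∃ ps, XInst X ps S ∧ ∀ P ∈ ps, Derivable X P := by
  constructor
  · rintro (h | ⟨h, -⟩ | ⟨h, ih⟩)
    exacts [absurd h hc, absurd h (hp _), ⟨_, h, ih⟩]
  · rintro ⟨ps, h, ih⟩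
    exact .modal h ih

/-! Termination and correctness of the search. -/

section Search

variable {X : Calculus} {ord : InstanceOrder X}

/-- Induction on the premisses left: a success leads to the next premiss, while a failure skips the
AND-entry and returns to `orBacktrack br`. -/
theorem acc_enter {w : ℕ}
    (ih : ∀ S : Sequent, S.weight < w → ∀ br, Acc (fun a b => Step ord b a) (andBacktrack br) →
      Acc (fun a b => Step ord b a) (orBacktrack br) → Acc (fun a b => Step ord b a) (.active S br))
    (ps : List Sequent) (hps : ∀ P ∈ ps, P.weight < w) (br : List Entry)
    (ha : Acc (fun a b => Step ord b a) (andBacktrack br))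
    (ho : Acc (fun a b => Step ord b a) (orBacktrack br)) :
    Acc (fun a b => Step ord b a) (enter ps br) := by
  induction ps with
  | nil => exact ha
  | cons S rest ihr =>
    refine ih S (hps S (by simp)) _ ?_ ho
    have := ihr fun P hP => hps P (by simp [hP])
    -- In both cases `andBacktrack (.and rest :: br)` unfolds to `enter rest br`.
    cases rest <;> exact this

/-- The search above `S` leaves it only by success or by failure, that is, towards one of the two
backtracking stages. The bound `w` on the weight is the induction parameter. -/
theorem acc_active (w : ℕ) : ∀ S : Sequent, S.weight < w → ∀ br,
    Acc (fun a b => Step ord b a) (andBacktrack br) →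
      Acc (fun a b => Step ord b a) (orBacktrack br) →
        Acc (fun a b => Step ord b a) (.active S br) := by
  induction w with
  | zero => intro S h; omega
  | succ w ih =>
    intro S hS br ha ho
    refine ⟨_, fun t ht => ?_⟩
    have hle : ∀ P : Sequent, P.weight < S.weight → P.weight < w := fun P hP => by omega
    cases ht with
    | closed h => exact ha
    | prop hc h => exact acc_enter ih _ (fun P hP => hle P (h.weight_lt P hP)) _ ha ho
    | openLeaf hc hp h => exact ho
    | @modal _ _ ps rest hc hp h =>
      have hall : ∀ qs ∈ ps :: rest, ∀ P ∈ qs, P.weight < w := fun qs hqs P hP =>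
        hle P ((ord.sound S qs (h ▸ hqs)).weight_lt P hP)
      -- An inner induction on the instances not yet tried follows; the equation with `ord.inst S`
      -- would fix their list.
      clear h
      induction rest generalizing ps with
      | nil => exact acc_enter ih _ (hall ps (by simp)) _ ha ho
      | cons qs rest ihr =>
        refine acc_enter ih _ (hall ps (by simp)) _ ha ?_
        exact ihr (ps := qs) fun rs hrs => hall rs (List.mem_cons_of_mem _ hrs)

theorem acc_finished (b : Bool) : Acc (fun a b => Step ord b a) (.finished b) :=
  ⟨_, fun _ h => nomatch h⟩

theorem searchTerminates (ord : InstanceOrder X) (S : Sequent) : SearchTerminates ord S := by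
  rintro ⟨run, h0, hs⟩
  have hacc : Acc (fun a b => Step ord b a) (initialStage S) :=
    acc_active _ S (Nat.lt_succ_self _) [] (acc_finished _) (acc_finished _)
  have : ∀ s, Acc (fun a b => Step ord b a) s → ∀ i, run i ≠ s := by
    intro s hs'
    induction hs' with
    | intro s _ ih => rintro i rfl; exact ih _ (hs i) (i + 1) rfl
  exact this _ hacc 0 h0

/-- The answer determined by a branch once the truth value of its active sequent is known. -/
def branchValue (X : Calculus) : List Entry → Prop → Prop
  | [], b => b
  | .and rest :: br, b => branchValue X br (b ∧ ∀ P ∈ rest, Derivable X P)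
  | .or rest :: br, b => branchValue X br (b ∨ ∃ ps ∈ rest, ∀ P ∈ ps, Derivable X P)

def stageValue (X : Calculus) : Stage → Prop
  | .active S br => branchValue X br (Derivable X S)
  | .finished b => b = true

theorem stageValue_enter (ps : List Sequent) (br : List Entry)
    (h : stageValue X (andBacktrack br) ↔ branchValue X br True) :
    stageValue X (enter ps br) ↔ branchValue X br (∀ P ∈ ps, Derivable X P) := by
  cases ps with
  | nil => simpa [enter] using h
  | cons S rest => simp [enter, stageValue, branchValue]

theorem stageValue_andBacktrack (br : List Entry) :
    stageValue X (andBacktrack br) ↔ branchValue X br True := by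
  induction br with
  | nil => simp [andBacktrack, stageValue, branchValue]
  | cons e br ih =>
    rcases e with (_ | ⟨S, rest⟩) | rest
    · simpa [andBacktrack, branchValue] using ih
    · simp [andBacktrack, branchValue, stageValue]
    · simpa [andBacktrack, branchValue] using ih

theorem stageValue_orBacktrack (br : List Entry) :
    stageValue X (orBacktrack br) ↔ branchValue X br False := by
  induction br with
  | nil => simp [orBacktrack, stageValue, branchValue]
  | cons e br ih =>
    rcases e with rest | (_ | ⟨ps, rest⟩)
    · simpa [orBacktrack, branchValue] using ih
    · simpa [orBacktrack, branchValue] using ih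
    · simp [orBacktrack, stageValue_enter _ _ (stageValue_andBacktrack _), branchValue]

/-- The invariant of the search. Propositional steps preserve it by inversion, modal ones because
the list contains every instance up to the order of premisses, which does not matter for their joint
derivability. -/
theorem stageValue_step {s t : Stage} (h : Step ord s t) : stageValue X t ↔ stageValue X s := by
  cases h with
  | closed h =>
    rw [stageValue_andBacktrack, stageValue, iff_true_intro (Derivable.closed (X := X) h)]
  | prop hc h =>
    rw [stageValue_enter _ _ (stageValue_andBacktrack _), stageValue, derivable_iff_of_propInst h]
  | @modal S br ps rest hc hp h =>
    rw [stageValue_enter _ _ (stageValue_andBacktrack _), stageValue, branchValue]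
    apply iff_of_eq
    congr 1
    rw [derivable_iff_of_irreducible hc hp, eq_iff_iff]
    have key : ∀ qs, (∃ qs' ∈ ord.inst S, qs'.Perm qs) → (∀ P ∈ qs, Derivable X P) →
        ∃ qs' ∈ ord.inst S, ∀ P ∈ qs', Derivable X P := by
      rintro qs ⟨qs', hm, hperm⟩ hq
      exact ⟨qs', hm, fun P hP => hq P (hperm.subset hP)⟩
    constructor
    · intro hx
      have : ∃ qs ∈ ord.inst S, ∀ P ∈ qs, Derivable X P := by
        rw [h]; simpa using hx
      obtain ⟨qs, hm, hq⟩ := this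
      exact ⟨qs, ord.sound S qs hm, hq⟩
    · rintro ⟨qs, hx, hq⟩
      have := key qs (ord.complete S qs hx) hq
      rw [h] at this
      simpa using this
  | @openLeaf S br hc hp h =>
    rw [stageValue_orBacktrack, stageValue]
    apply iff_of_eq
    congr 1
    rw [derivable_iff_of_irreducible hc hp, eq_iff_iff, false_iff]
    rintro ⟨qs, hx, -⟩
    obtain ⟨qs', hm, -⟩ := ord.complete S qs hx
    simp [h] at hm

/-- A run can only get stuck at a finished stage, where the invariant is the answer. -/
theorem exists_step (S : Sequent) (br : List Entry) : ∃ t, Step ord (.active S br) t := by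
  by_cases hc : S.IsClosed
  · exact ⟨_, .closed hc⟩
  by_cases hp : ∃ ps, PropInst ps S
  · obtain ⟨ps, hp⟩ := hp
    exact ⟨_, .prop hc hp⟩
  push Not at hp
  cases h : ord.inst S with
  | nil => exact ⟨_, .openLeaf hc hp h⟩
  | cons ps rest => exact ⟨_, .modal hc hp h⟩

theorem searchCorrect (ord : InstanceOrder X) (S : Sequent) : SearchCorrect ord S := by
  intro s hs hmax
  have hv : stageValue X s ↔ stageValue X (initialStage S) := by
    clear hmax
    induction hs with
    | refl => exact Iff.rfl
    | tail _ ht ih => exact (stageValue_step ht).trans ih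
  cases s with
  | active S br =>
    obtain ⟨t, ht⟩ := exists_step (ord := ord) S br
    exact absurd ht (hmax t)
  | finished b => exact ⟨b, rfl, hv⟩

end Search

/-! Existence of finite lists of instances. -/

theorem finite_lists_coe_le (M : Multiset Formula) :
    {l : List Formula | (l : Multiset Formula) ≤ M}.Finite := by
  induction M using Quotient.inductionOn with
  | _ L =>
    refine ((L.sublists.flatMap List.permutations).finite_toSet).subset ?_
    intro l hl
    obtain ⟨l', hp, hs⟩ := Multiset.coe_le.1 hl
    simp only [Set.mem_ofPred_eq, List.mem_flatMap, List.mem_sublists, List.mem_permutations]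
    exact ⟨l', hs, hp.symm⟩

def Formula.unbox? : Formula → Option Formula
  | .box A => some A
  | _ => none

/-- The formulas `A` with `□A` in `M`. -/
def unboxes (M : Multiset Formula) : Multiset Formula := M.filterMap Formula.unbox?

theorem unboxes_boxes_add (P Γ : Multiset Formula) :
    unboxes (boxes P + Γ) = P + unboxes Γ := by
  induction P using Multiset.induction with
  | empty => simp [boxes]
  | cons A P ih =>
    simp only [boxes, Multiset.map_cons, Multiset.cons_add, unboxes] at ih ⊢
    rw [Multiset.filterMap_cons_some _ _ _ (rfl : Formula.unbox? (.box A) = some A), ih]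

theorem le_unboxes (P Γ : Multiset Formula) : P ≤ unboxes (boxes P + Γ) := by
  rw [unboxes_boxes_add]; exact Multiset.le_add_right _ _

theorem le_unboxes_cons (A : Formula) (Γ : Multiset Formula) : {A} ≤ unboxes (.box A ::ₘ Γ) :=
  le_unboxes {A} Γ

/-- Up to the calculus, the premiss lists have four shapes, each determined by two lists of formulas
taken from under the boxes of the conclusion; `h1` to `h4` are the images of these finitely many
pairs. -/
theorem finite_instances (X : Calculus) (S : Sequent) : {ps | XInst X ps S}.Finite := by
  set LA := {l : List Formula | (l : Multiset Formula) ≤ unboxes S.ant} with hLA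
  set LB := {l : List Formula | (l : Multiset Formula) ≤ unboxes S.suc} with hLB
  have hA : LA.Finite := finite_lists_coe_le _
  have hB : LB.Finite := finite_lists_coe_le _
  have h1 := Set.Finite.image2 (fun a b : List Formula => [Sequent.mk a b, ⟨b, a⟩]) hA hB
  have h2 := Set.Finite.image2 (fun a b : List Formula => [Sequent.mk a b]) hA hB
  have h3 := Set.Finite.image2 (fun a b : List Formula =>
    (⟨a, b⟩ : Sequent) :: a.map fun A => ⟨b, {A}⟩) hA hB
  have h4 := Set.Finite.image2 (fun a b : List Formula =>
    (⟨(a : Multiset Formula) + b, 0⟩ : Sequent) :: (a.product b).map fun AB => ⟨0, {AB.1, AB.2}⟩)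
    hA hA
  refine ((h1.union h2).union (h3.union h4)).subset ?_
  rintro ps ⟨r, -, h⟩
  have mA : ∀ l : List Formula, (l : Multiset Formula) ≤ unboxes S.ant → l ∈ LA :=
    fun l h => Set.mem_ofPred_eq ▸ h
  have mB : ∀ l : List Formula, (l : Multiset Formula) ≤ unboxes S.suc → l ∈ LB :=
    fun l h => Set.mem_ofPred_eq ▸ h
  have nilB : ([] : List Formula) ∈ LB := mB _ (Multiset.zero_le _)
  cases h with
  | LRE A B Γ Δ =>
    exact .inl (.inl ⟨[A], mA _ (le_unboxes_cons _ _), [B], mB _ (le_unboxes_cons _ _), rfl⟩)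
  | LRM A B Γ Δ =>
    exact .inl (.inr ⟨[A], mA _ (le_unboxes_cons _ _), [B], mB _ (le_unboxes_cons _ _), rfl⟩)
  | LRR A B P Γ Δ =>
    induction P using Quotient.inductionOn with
    | _ P =>
    refine .inl (.inr ⟨A :: P, mA _ ?_, [B], mB _ (le_unboxes_cons _ _), rfl⟩)
    have := le_unboxes (A ::ₘ (P : Multiset Formula)) Γ
    simp only [boxes, Multiset.map_cons, Multiset.cons_add] at this
    exact this
  | LRC As B Γ Δ h =>
    exact .inr (.inl ⟨As, mA _ (le_unboxes _ _), [B], mB _ (le_unboxes_cons _ _), rfl⟩)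
  | LRK B P Γ Δ =>
    induction P using Quotient.inductionOn with
    | _ P => exact .inl (.inr ⟨P, mA _ (le_unboxes _ _), [B], mB _ (le_unboxes_cons _ _), rfl⟩)
  | RN B Γ Δ =>
    exact .inl (.inr ⟨[], mA _ (Multiset.zero_le _), [B], mB _ (le_unboxes_cons _ _), rfl⟩)
  | LDbot A Γ Δ =>
    exact .inl (.inr ⟨[A], mA _ (le_unboxes_cons _ _), [], nilB, rfl⟩)
  | LDdiaE P Γ Δ h0 h2 =>
    induction P using Quotient.inductionOn with
    | _ P => exact .inl (.inl ⟨P, mA _ (le_unboxes _ _), [], nilB, rfl⟩)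
  | LDdiaM P Γ Δ h0 h2 =>
    induction P using Quotient.inductionOn with
    | _ P => exact .inl (.inr ⟨P, mA _ (le_unboxes _ _), [], nilB, rfl⟩)
  | LDdiaC As Bs Γ Δ hA hB =>
    have := le_unboxes ((As : Multiset Formula) + Bs) Γ
    rw [boxes_add] at this
    exact .inr (.inr ⟨As, mA _ ((Multiset.le_add_right _ _).trans this), Bs,
      mA _ ((Multiset.le_add_left _ _).trans this), rfl⟩)
  | LDstar P Γ Δ h0 =>
    induction P using Quotient.inductionOn with
    | _ P => exact .inl (.inr ⟨P, mA _ (le_unboxes _ _), [], nilB, rfl⟩)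

theorem nonempty_instanceOrder (X : Calculus) : Nonempty (InstanceOrder X) :=
  ⟨{ inst := fun S => (finite_instances X S).toFinset.toList
     sound := fun S ps h => by simpa using h
     complete := fun S ps h => ⟨ps, by simpa using h, .refl _⟩ }⟩

end G3

namespace G3

/-! A language of counter programs with a two-way read-only input, and its implementation by
Turing machines. -/

/-- Counter programs over the input alphabet `α`; counters are numbered. -/
inductive Cmd (α : Type) : Type
  | inc (r : ℕ)
  | dec (r : ℕ)
  | mv (d : Move)
  | seq (a b : Cmd α)
  | whileNZ (r : ℕ) (c : Cmd α)
  | whileSym (f : InSym α → Bool) (c : Cmd α)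
  | ifSym (f : InSym α → Bool) (c : Cmd α)
  | acc

namespace Cmd

variable {α : Type}

open OfflineTM (readInput moveInput)

/-- `Exec w B c x y`: on input `w` the program `c` leads from the store `x` (the counters and the
position of the input head) to `y`, and every counter it increments stays below `B`. -/
inductive Exec (w : List α) (B : ℕ) : Cmd α → (ℕ → ℕ) × ℕ → (ℕ → ℕ) × ℕ → Prop
  | inc {r s p} (h : s r + 1 ≤ B) : Exec w B (inc r) (s, p) (Function.update s r (s r + 1), p)
  | dec {r s p n} (h : s r = n + 1) : Exec w B (dec r) (s, p) (Function.update s r n, p)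
  | mv {d s p} : Exec w B (mv d) (s, p) (s, moveInput w d p)
  | seq {a b x y z} (h₁ : Exec w B a x y) (h₂ : Exec w B b y z) : Exec w B (seq a b) x z
  | whileNZ_done {r c x} (h : x.1 r = 0) : Exec w B (whileNZ r c) x x
  | whileNZ_step {r c x y z} (h : x.1 r ≠ 0) (h₁ : Exec w B c x y)
      (h₂ : Exec w B (whileNZ r c) y z) : Exec w B (whileNZ r c) x z
  | whileSym_done {f c x} (h : f (readInput w x.2) = false) : Exec w B (whileSym f c) x x
  | whileSym_step {f c x y z} (h : f (readInput w x.2) = true) (h₁ : Exec w B c x y)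
      (h₂ : Exec w B (whileSym f c) y z) : Exec w B (whileSym f c) x z
  | ifSym_true {f c x y} (h : f (readInput w x.2) = true) (h₁ : Exec w B c x y) :
      Exec w B (ifSym f c) x y
  | ifSym_false {f c x} (h : f (readInput w x.2) = false) : Exec w B (ifSym f c) x x

/-- All counters of the program are numbered below `K`. -/
def Below (K : ℕ) : Cmd α → Prop
  | inc r => r < K
  | dec r => r < K
  | mv _ => True
  | seq a b => a.Below K ∧ b.Below K
  | whileNZ r c => r < K ∧ c.Below K
  | whileSym _ c => c.Below K
  | ifSym _ c => c.Below K
  | acc => True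

theorem Below.mono {K K' : ℕ} (hK : K ≤ K') {c : Cmd α} (h : c.Below K) : c.Below K' := by
  induction c with
  | inc r => exact lt_of_lt_of_le h hK
  | dec r => exact lt_of_lt_of_le h hK
  | mv d => trivial
  | seq a b iha ihb => exact ⟨iha h.1, ihb h.2⟩
  | whileNZ r c ih => exact ⟨lt_of_lt_of_le h.1 hK, ih h.2⟩
  | whileSym f c ih => exact ih h
  | ifSym f c ih => exact ih h
  | acc => trivial

theorem exists_below (c : Cmd α) : ∃ K, c.Below K := by
  induction c with
  | inc r => exact ⟨r + 1, Nat.lt_succ_self r⟩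
  | dec r => exact ⟨r + 1, Nat.lt_succ_self r⟩
  | mv d => exact ⟨0, trivial⟩
  | seq a b iha ihb =>
    obtain ⟨K, hK⟩ := iha
    obtain ⟨K', hK'⟩ := ihb
    exact ⟨max K K', hK.mono (le_max_left _ _), hK'.mono (le_max_right _ _)⟩
  | whileNZ r c ih =>
    obtain ⟨K, hK⟩ := ih
    exact ⟨max K (r + 1), lt_of_lt_of_le (Nat.lt_succ_self r) (le_max_right _ _),
      hK.mono (le_max_left _ _)⟩
  | whileSym f c ih => exact ih
  | ifSym f c ih => exact ih
  | acc => exact ⟨0, trivial⟩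

/-- The continuations that occur in the execution of `c` followed by `k`, before `k`. -/
def conts : Cmd α → List (Cmd α) → Set (List (Cmd α))
  | seq a b, k => {seq a b :: k} ∪ (conts a (b :: k) ∪ conts b k)
  | whileNZ r c, k => {whileNZ r c :: k} ∪ conts c (whileNZ r c :: k)
  | whileSym f c, k => {whileSym f c :: k} ∪ conts c (whileSym f c :: k)
  | ifSym f c, k => {ifSym f c :: k} ∪ conts c k
  | c, k => {c :: k}

/-- Makes the state set of the machine finite: control consists of a continuation, of which only
finitely many occur, and a phase. -/
theorem conts_finite (c : Cmd α) (k : List (Cmd α)) : (conts c k).Finite := by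
  induction c generalizing k with
  | seq a b iha ihb => exact (Set.finite_singleton _).union ((iha _).union (ihb _))
  | whileNZ r c ih => exact (Set.finite_singleton _).union (ih _)
  | whileSym f c ih => exact (Set.finite_singleton _).union (ih _)
  | ifSym f c ih => exact (Set.finite_singleton _).union (ih _)
  | inc r => exact Set.finite_singleton _
  | dec r => exact Set.finite_singleton _
  | mv d => exact Set.finite_singleton _
  | acc => exact Set.finite_singleton _

theorem cons_mem_conts (c : Cmd α) (k : List (Cmd α)) : c :: k ∈ conts c k := by
  cases c <;> simp [conts]

/-- The continuations that can follow in one step. -/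
def succs : List (Cmd α) → List (List (Cmd α))
  | [] => []
  | seq a b :: k => [a :: b :: k]
  | whileNZ r c :: k => [c :: whileNZ r c :: k, k]
  | whileSym f c :: k => [c :: whileSym f c :: k, k]
  | ifSym _ c :: k => [c :: k, k]
  | acc :: _ => []
  | _ :: k => [k]

theorem conts_closed (c : Cmd α) (k : List (Cmd α)) :
    ∀ l ∈ conts c k, ∀ l' ∈ succs l, l' ∈ conts c k ∨ l' = k := by
  induction c generalizing k with
  | seq a b iha ihb =>
    rintro l (rfl | hl | hl) l' hl'
    · simp only [succs, List.mem_singleton] at hl'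
      subst hl'
      exact .inl (.inr (.inl (cons_mem_conts _ _)))
    · rcases iha _ l hl l' hl' with h | rfl
      · exact .inl (.inr (.inl h))
      · exact .inl (.inr (.inr (cons_mem_conts _ _)))
    · rcases ihb _ l hl l' hl' with h | h
      · exact .inl (.inr (.inr h))
      · exact .inr h
  | whileNZ r c ih =>
    rintro l (rfl | hl) l' hl'
    · simp only [succs, List.mem_cons, List.not_mem_nil, or_false] at hl'
      rcases hl' with rfl | rfl
      · exact .inl (.inr (cons_mem_conts _ _))
      · exact .inr rfl
    · rcases ih _ l hl l' hl' with h | rfl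
      · exact .inl (.inr h)
      · exact .inl (.inl rfl)
  | whileSym f c ih =>
    rintro l (rfl | hl) l' hl'
    · simp only [succs, List.mem_cons, List.not_mem_nil, or_false] at hl'
      rcases hl' with rfl | rfl
      · exact .inl (.inr (cons_mem_conts _ _))
      · exact .inr rfl
    · rcases ih _ l hl l' hl' with h | rfl
      · exact .inl (.inr h)
      · exact .inl (.inl rfl)
  | ifSym f c ih =>
    rintro l (rfl | hl) l' hl'
    · simp only [succs, List.mem_cons, List.not_mem_nil, or_false] at hl'
      rcases hl' with rfl | rfl
      · exact .inl (.inr (cons_mem_conts _ _))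
      · exact .inr rfl
    · rcases ih _ l hl l' hl' with h | h
      · exact .inl (.inr h)
      · exact .inr h
  | inc r => rintro l rfl l' hl'; simpa [succs, conts] using Or.inr hl'
  | dec r => rintro l rfl l' hl'; simpa [succs, conts] using Or.inr hl'
  | mv d => rintro l rfl l' hl'; simpa [succs, conts] using Or.inr hl'
  | acc => rintro l rfl l' hl'; simp [succs] at hl'

/-- What the machine is doing with the first command of its continuation. -/
inductive Phase : Type
  | fetch
  | scan
  | ret (r : ℕ)

/-- Control states: a continuation and a phase. -/
abbrev Ctl (α : Type) : Type := List (Cmd α) × Phase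

/-- A program that runs to its end rejects; the command `acc`, for which `Exec` has no rule, is the
only way to accept. -/
def verdict : Ctl α → Option Bool
  | ([], .fetch) => some false
  | (acc :: _, .fetch) => some true
  | _ => none

/-- An action on tape `r` that writes `a` and moves by `d`. -/
def onTape {K : ℕ} (h : Fin K → Option Bool) (r : ℕ) (a : Option Bool) (d : Move) :
    Fin K → Option Bool × Move :=
  fun j => if (j : ℕ) = r then (a, d) else (h j, .stay)

def headAt {K : ℕ} (h : Fin K → Option Bool) (r : ℕ) : Option Bool :=
  if hr : r < K then h ⟨r, hr⟩ else none

/-- The transition function. Counters are kept in binary to the right of a blank home cell, least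
significant digit first. -/
def trans {K : ℕ} (q : Ctl α) (a : InSym α) (h : Fin K → Option Bool) :
    Ctl α × Move × (Fin K → Option Bool × Move) :=
  let idle : Fin K → Option Bool × Move := fun j => (h j, .stay)
  match q with
  | (l, .ret r) =>
    match headAt h r with
    | none => ((l, .fetch), .stay, idle)
    | some b => ((l, .ret r), .stay, onTape h r (some b) .left)
  | (inc r :: k, .fetch) => ((inc r :: k, .scan), .stay, onTape h r (headAt h r) .right)
  | (inc r :: k, .scan) =>
    match headAt h r with
    | some true => ((inc r :: k, .scan), .stay, onTape h r (some false) .right)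
    | _ => ((k, .ret r), .stay, onTape h r (some true) .left)
  | (dec r :: k, .fetch) => ((dec r :: k, .scan), .stay, onTape h r (headAt h r) .right)
  | (dec r :: k, .scan) =>
    match headAt h r with
    | some false => ((dec r :: k, .scan), .stay, onTape h r (some true) .right)
    | _ => ((k, .ret r), .stay, onTape h r (some false) .left)
  | (whileNZ r c :: k, .fetch) =>
    ((whileNZ r c :: k, .scan), .stay, onTape h r (headAt h r) .right)
  | (whileNZ r c :: k, .scan) =>
    match headAt h r with
    | some false => ((whileNZ r c :: k, .scan), .stay, onTape h r (some false) .right)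
    | some true => ((c :: whileNZ r c :: k, .ret r), .stay, onTape h r (some true) .left)
    | none => ((k, .ret r), .stay, onTape h r none .left)
  | (mv d :: k, .fetch) => ((k, .fetch), d, idle)
  | (seq b c :: k, .fetch) => ((b :: c :: k, .fetch), .stay, idle)
  | (whileSym f c :: k, .fetch) =>
    (if f a then (c :: whileSym f c :: k, .fetch) else (k, .fetch), .stay, idle)
  | (ifSym f c :: k, .fetch) =>
    (if f a then (c :: k, .fetch) else (k, .fetch), .stay, idle)
  | q => (q, .stay, idle)

/-- The counter of a command. -/
def reg : Cmd α → ℕ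
  | inc r => r
  | dec r => r
  | whileNZ r _ => r
  | _ => 0

/-- Control moves only to successor continuations, and a return phase names a counter of the command
just executed, so that finitely many control states are closed under transitions. -/
theorem trans_fst {K : ℕ} (l : List (Cmd α)) (ph : Phase) (a : InSym α) (h : Fin K → Option Bool) :
    ((trans (l, ph) a h).1.1 = l ∨ (trans (l, ph) a h).1.1 ∈ succs l) ∧
      ((trans (l, ph) a h).1.2 = ph ∨ (trans (l, ph) a h).1.2 = .fetch ∨
        (trans (l, ph) a h).1.2 = .scan ∨
        ∃ c k, l = c :: k ∧ (trans (l, ph) a h).1.2 = .ret c.reg) := by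
  rcases l with _ | ⟨c, k⟩
  · cases ph with
    | ret r => simp only [trans]; split <;> simp
    | fetch => simp [trans]
    | scan => simp [trans]
  · cases ph with
    | ret r => simp only [trans]; split <;> simp
    | fetch => cases c <;> simp [trans, succs] <;> split <;> simp
    | scan => cases c <;> simp [trans, succs] <;> split <;> simp [reg]

/-- The control states that occur when `c` is executed. -/
def ctls (c : Cmd α) : Set (Ctl α) :=
  {q | q.1 ∈ conts c [] ∪ {[]} ∧ (q.2 = .fetch ∨ q.2 = .scan ∨
    q.2 ∈ (fun l : List (Cmd α) => Phase.ret ((l.head?.map reg).getD 0)) '' (conts c []))}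

theorem ctls_finite (c : Cmd α) : (ctls c).Finite := by
  refine (((conts_finite c []).union (Set.finite_singleton [])).prod
    (((Set.finite_singleton Phase.fetch).union (Set.finite_singleton Phase.scan)).union
      ((conts_finite c []).image
        fun l : List (Cmd α) => Phase.ret ((l.head?.map reg).getD 0)))).subset ?_
  rintro ⟨l, ph⟩ ⟨h₁, h₂⟩
  refine ⟨h₁, ?_⟩
  rcases h₂ with h | h | h
  · exact .inl (.inl h)
  · exact .inl (.inr h)
  · exact .inr h

theorem trans_mem_ctls {K : ℕ} {c : Cmd α} {q : Ctl α} (hq : q ∈ ctls c) (a : InSym α)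
    (h : Fin K → Option Bool) : (trans q a h).1 ∈ ctls c := by
  obtain ⟨l, ph⟩ := q
  obtain ⟨h₁, h₂⟩ := trans_fst l ph a h
  obtain ⟨hl, hph⟩ := hq
  constructor
  · rcases h₁ with h₁ | h₁
    · rw [h₁]; exact hl
    · rcases hl with hl | hl
      · exact conts_closed c [] l hl _ h₁
      · rw [Set.mem_singleton_iff] at hl
        simp only at hl
        simp [hl, succs] at h₁
  · rcases h₂ with h₂ | h₂ | h₂ | ⟨c', k, hk, h₂⟩
    · rw [h₂]; exact hph
    · exact .inl h₂
    · exact .inr (.inl h₂)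
    · refine .inr (.inr ⟨l, ?_, ?_⟩)
      · rcases hl with hl | hl
        · exact hl
        · rw [Set.mem_singleton_iff] at hl
          simp only at hl
          simp [hl] at hk
      · rw [h₂, hk]; rfl

/-- The Turing machine with `K` work tapes that executes `c`. -/
def machine (K : ℕ) (c : Cmd α) : OfflineTM α where
  tapes := K
  State := ctls c
  finiteState := ctls_finite c
  Γ := Option Bool
  blank := none
  start := ⟨([c], .fetch), .inl (cons_mem_conts c []), .inl rfl⟩
  verdict q := verdict q.1
  δ q a h := (⟨(trans q.1 a h).1, trans_mem_ctls q.2 a h⟩, (trans q.1 a h).2)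

/-- Configurations of the machine, without the restriction to finitely many control states. -/
abbrev Conf (α : Type) (K : ℕ) : Type := Ctl α × ℕ × (Fin K → WorkTape (Option Bool))

def conf {K : ℕ} {c : Cmd α} (x : (machine K c).Cfg) : Conf α K := (x.state.1, x.pos, x.work)

def confStep {K : ℕ} (w : List α) (x : Conf α K) : Conf α K :=
  match verdict x.1 with
  | some _ => x
  | none =>
    let a := trans x.1 (readInput w x.2.1) fun j => (x.2.2 j).head
    (a.1, moveInput w a.2.1 x.2.1, fun j => ((x.2.2 j).write (a.2.2 j).1).move none (a.2.2 j).2)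

/-- From here on the simulation ignores that the states form a subtype. -/
theorem conf_step {K : ℕ} {c : Cmd α} (w : List α) (x : (machine K c).Cfg) :
    conf ((machine K c).step w x) = confStep w (conf x) := by
  have hv : (machine K c).verdict x.state = verdict x.state.1 := rfl
  unfold OfflineTM.step confStep conf
  simp only [hv]
  cases verdict x.state.1 <;> rfl

theorem conf_run {K : ℕ} {c : Cmd α} (w : List α) (t : ℕ) :
    conf ((machine K c).run w t) = (confStep w)^[t] (conf (machine K c).init) := by
  induction t with
  | zero => rfl
  | succ t ih =>
    rw [Function.iterate_succ_apply', ← ih, ← conf_step, OfflineTM.run, OfflineTM.run,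
      Function.iterate_succ_apply']

/-- No work tape has more than `m` visited cells. -/
def Fits {K : ℕ} (m : ℕ) (x : Conf α K) : Prop := ∀ j, (x.2.2 j).cells ≤ m

/-- `y` is reached from `x`, with at most `m` visited cells on each work tape on the way. -/
def Reach {K : ℕ} (w : List α) (m : ℕ) (x y : Conf α K) : Prop :=
  Fits m x ∧ Relation.ReflTransGen (fun a b => confStep w a = b ∧ Fits m b) x y

section Sim

variable {K m : ℕ} {w : List α}

theorem Reach.fits {x y : Conf α K} (h : Reach w m x y) : Fits m y := by
  obtain ⟨h₁, h₂⟩ := h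
  cases h₂ with
  | refl => exact h₁
  | tail _ h => exact h.2

theorem Reach.trans {x y z : Conf α K} (h : Reach w m x y) (h' : Reach w m y z) :
    Reach w m x z := ⟨h.1, h.2.trans h'.2⟩

theorem Reach.head {x y z : Conf α K} (hx : Fits m x) (e : confStep w x = y)
    (h : Reach w m y z) : Reach w m x z := ⟨hx, .head ⟨e, h.1⟩ h.2⟩

theorem Reach.refl {x : Conf α K} (hx : Fits m x) : Reach w m x x := ⟨hx, .refl⟩

theorem Reach.exists_iterate {x y : Conf α K} (h : Reach w m x y) :
    ∃ t, (confStep w)^[t] x = y ∧ ∀ i ≤ t, Fits m ((confStep w)^[i] x) := by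
  obtain ⟨h₁, h₂⟩ := h
  induction h₂ using Relation.ReflTransGen.head_induction_on with
  | refl => exact ⟨0, rfl, fun i hi => by simpa [Nat.le_zero.1 hi] using h₁⟩
  | head h _ ih =>
    obtain ⟨t, ht, hf⟩ := ih h.2
    refine ⟨t + 1, by rw [Function.iterate_succ_apply, h.1, ht], fun i hi => ?_⟩
    cases i with
    | zero => exact h₁
    | succ i => rw [Function.iterate_succ_apply, h.1]; exact hf i (by omega)

/-- A tape at the cell that follows the digits `l` (in reverse), with `r` from there on. -/
def scanTape (l : List Bool) (r : List (Option Bool)) : WorkTape (Option Bool) :=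
  ⟨l.map some ++ [none], r.headD none, r.tail⟩

/-- A tape at the last of the digits `l` (in reverse; at the home cell if there are none), with `r`
to the right of it. -/
def retTape (l : List Bool) (r : List (Option Bool)) : WorkTape (Option Bool) :=
  match l with
  | [] => ⟨[], none, r⟩
  | b :: l => ⟨l.map some ++ [none], some b, r⟩

theorem move_right_retTape (r : List (Option Bool)) :
    ((retTape [] r).write (retTape [] r).head).move none .right = scanTape [] r := by
  cases r <;> rfl

theorem scanTape_right (l : List Bool) (r : List (Option Bool)) (b : Bool) :
    ((scanTape l r).write (some b)).move none .right = scanTape (b :: l) r.tail := by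
  rcases r with _ | ⟨x, _ | ⟨y, r⟩⟩ <;> rfl

theorem scanTape_left (l : List Bool) (r : List (Option Bool)) (a : Option Bool) :
    ((scanTape l r).write a).move none .left = retTape l (a :: r.tail) := by
  cases l <;> rfl

theorem retTape_left (l : List Bool) (r : List (Option Bool)) (b : Bool) :
    ((retTape (b :: l) r).write (some b)).move none .left = retTape l (some b :: r) := by
  cases l <;> rfl

theorem cells_retTape (l : List Bool) (r : List (Option Bool)) :
    (retTape l r).cells = l.length + 1 + r.length := by
  cases l <;> simp [retTape, WorkTape.cells]

theorem cells_scanTape (l : List Bool) (r : List (Option Bool)) :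
    (scanTape l r).cells ≤ l.length + 2 + r.length := by
  simp [scanTape, WorkTape.cells]

theorem fits_update {q : Ctl α} {p : ℕ} {W : Fin K → WorkTape (Option Bool)} {r : Fin K}
    {t : WorkTape (Option Bool)} (hW : ∀ j, (W j).cells ≤ m) (ht : t.cells ≤ m) :
    Fits m (q, p, Function.update W r t) := by
  intro j
  by_cases h : j = r
  · subst h; simpa using ht
  · simpa [h] using hW j

theorem headAt_update {W : Fin K → WorkTape (Option Bool)} {r : Fin K} {t : WorkTape (Option Bool)} :
    headAt (fun j => (Function.update W r t j).head) r = t.head := by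
  simp [headAt]

theorem write_head_move_stay {t : WorkTape (Option Bool)} :
    (t.write t.head).move none .stay = t := rfl

theorem work_onTape {W : Fin K → WorkTape (Option Bool)} {r : Fin K} {t : WorkTape (Option Bool)}
    {a : Option Bool} {d : Move} :
    (fun j => ((Function.update W r t j).write
      (onTape (fun j => (Function.update W r t j).head) r a d j).1).move none
      (onTape (fun j => (Function.update W r t j).head) r a d j).2) =
    Function.update W r ((t.write a).move none d) := by
  funext j
  by_cases h : j = r
  · subst h; simp [onTape]
  · have : (j : ℕ) ≠ r := fun e => h (Fin.ext e)
    simp [onTape, this, h, write_head_move_stay]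

/-- Return to the home cell. -/
theorem reach_ret (k : List (Cmd α)) (p : ℕ) {W : Fin K → WorkTape (Option Bool)} (r : Fin K)
    (hW : ∀ j, (W j).cells ≤ m) (l : List Bool) (x : List (Option Bool))
    (hx : l.length + 1 + x.length ≤ m) :
    Reach w m ((k, .ret r), p, Function.update W r (retTape l x))
      ((k, .fetch), p, Function.update W r (retTape [] (l.reverse.map some ++ x))) := by
  induction l generalizing x with
  | nil =>
    have hf := fun q : Ctl α => fits_update (q := q) (p := p) (r := r) hW
      (t := retTape [] x) (by simpa [cells_retTape] using hx)
    refine .head (hf _) ?_ (.refl (hf _))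
    simp only [confStep, verdict, Cmd.trans, headAt_update]
    simp [retTape, moveInput, write_head_move_stay]
  | cons b l ih =>
    have hf := fun q : Ctl α => fits_update (q := q) (p := p) (r := r) hW
      (t := retTape (b :: l) x) (by simpa [cells_retTape] using hx)
    have := ih (some b :: x) (by simp at hx ⊢; omega)
    rw [List.reverse_cons, List.map_append, List.append_assoc]
    refine .head (hf _) ?_ this
    simp only [confStep, verdict, Cmd.trans, headAt_update]
    have hh : (retTape (b :: l) x).head = some b := rfl
    simp only [hh, work_onTape, retTape_left, moveInput]

/-- The number with the binary digits `ds`, least significant first. -/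
def binVal : List Bool → ℕ
  | [] => 0
  | b :: ds => b.toNat + 2 * binVal ds

/-- Binary successor. -/
def binSucc : List Bool → List Bool
  | [] => [true]
  | false :: ds => true :: ds
  | true :: ds => false :: binSucc ds

/-- Binary predecessor of a positive number. -/
def binPred : List Bool → List Bool
  | [] => []
  | false :: ds => true :: binPred ds
  | true :: ds => false :: ds

theorem binVal_binSucc (ds : List Bool) : binVal (binSucc ds) = binVal ds + 1 := by
  induction ds with
  | nil => rfl
  | cons b ds ih => cases b <;> simp [binSucc, binVal, ih] <;> omega

theorem binVal_binPred {ds : List Bool} {n : ℕ} (h : binVal ds = n + 1) :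
    binVal (binPred ds) = n := by
  induction ds generalizing n with
  | nil => simp [binVal] at h
  | cons b ds ih =>
    cases b
    · simp only [binVal, Bool.toNat_false, zero_add] at h
      have := @ih (binVal ds - 1) (by omega)
      simp only [binPred, binVal, this, Bool.toNat_true]
      omega
    · simp only [binVal, Bool.toNat_true] at h
      simp only [binPred, binVal, Bool.toNat_false]
      omega

theorem length_binPred (ds : List Bool) : (binPred ds).length = ds.length := by
  induction ds with
  | nil => rfl
  | cons b ds ih => cases b <;> simp [binPred, ih]

/-- A numeral becomes longer only when all its digits are ones. Hence counters bounded by `B` never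
need more than `Nat.log 2 B + 1` digits, even though decrementing does not shorten them. -/
theorem length_binSucc (ds : List Bool) : ds.length ≤ (binSucc ds).length ∧
    ((binSucc ds).length = ds.length ∨
      ((binSucc ds).length = ds.length + 1 ∧ 2 ^ ds.length ≤ binVal ds + 1)) := by
  induction ds with
  | nil => simp [binSucc, binVal]
  | cons b ds ih =>
    cases b
    · simp [binSucc]
    · simp only [binSucc, List.length_cons, binVal, Bool.toNat_true, pow_succ]
      omega

/-- The tape that holds the digits `ds` followed by `e` visited blank cells, with its head at
home. -/
def homeTape (ds : List Bool) (e : ℕ) : WorkTape (Option Bool) :=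
  retTape [] (ds.map some ++ List.replicate e none)

theorem scanTape_cons_head (l : List Bool) (b : Bool) (ds : List Bool) (x : List (Option Bool)) :
    (scanTape l ((b :: ds).map some ++ x)).head = some b := rfl

theorem scanTape_nil_head (l : List Bool) (e : ℕ) :
    (scanTape l (([] : List Bool).map some ++ List.replicate e none)).head = none := by
  cases e <;> rfl

/-- The digits `l` already passed were ones and have become zeros. A carry past the last digit takes
over a visited blank if there is one, so the reserve of blanks does not grow. -/
theorem reach_inc_scan {r : Fin K} (k : List (Cmd α)) (p : ℕ) {W : Fin K → WorkTape (Option Bool)}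
    (hW : ∀ j, (W j).cells ≤ m) (e : ℕ) (ds l : List Bool)
    (hm : l.length + ds.length + e + 2 ≤ m) :
    ∃ e' ≤ e, Reach w m
      ((inc r :: k, .scan), p, Function.update W r (scanTape l (ds.map some ++ .replicate e none)))
      ((k, .fetch), p, Function.update W r (homeTape (l.reverse ++ binSucc ds) e')) := by
  induction ds generalizing l with
  | nil =>
    refine ⟨e - 1, by omega, .head (fits_update hW ?_) ?_ (Reach.trans (reach_ret k p r hW l
      (some true :: List.replicate (e - 1) none) ?_) ?_)⟩
    · refine (cells_scanTape _ _).trans ?_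
      simp at hm ⊢; omega
    · simp only [confStep, verdict, Cmd.trans, headAt_update, scanTape_nil_head]
      simp only [work_onTape, scanTape_left, moveInput]
      simp
    · simp at hm ⊢; omega
    · have : homeTape (l.reverse ++ binSucc []) (e - 1) =
          retTape [] (l.reverse.map some ++ some true :: List.replicate (e - 1) none) := by
        simp [homeTape, binSucc]
      rw [this]
      refine .refl (fits_update hW ?_)
      simp [cells_retTape] at hm ⊢; omega
  | cons b ds ih =>
    cases b
    · refine ⟨e, le_rfl, .head (fits_update hW ?_) ?_ (Reach.trans (reach_ret k p r hW l
        (some true :: (ds.map some ++ List.replicate e none)) ?_) ?_)⟩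
      · refine (cells_scanTape _ _).trans ?_
        simp at hm ⊢; omega
      · simp only [confStep, verdict, Cmd.trans, headAt_update, scanTape_cons_head]
        simp only [work_onTape, scanTape_left, moveInput]
        rfl
      · simp at hm ⊢; omega
      · have : homeTape (l.reverse ++ binSucc (false :: ds)) e =
            retTape [] (l.reverse.map some ++ some true :: (ds.map some ++ .replicate e none)) := by
          simp [homeTape, binSucc]
        rw [this]
        refine .refl (fits_update hW ?_)
        simp [cells_retTape] at hm ⊢; omega
    · obtain ⟨e', he, h⟩ := ih (false :: l) (by simp at hm ⊢; omega)
      have e₁ : (false :: l).reverse ++ binSucc ds = l.reverse ++ binSucc (true :: ds) := by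
        simp [binSucc]
      rw [e₁] at h
      refine ⟨e', he, .head (fits_update hW ?_) ?_ h⟩
      · refine (cells_scanTape _ _).trans ?_
        simp at hm ⊢; omega
      · simp only [confStep, verdict, Cmd.trans, headAt_update, scanTape_cons_head]
        simp only [work_onTape, scanTape_right, moveInput]
        rfl

theorem reach_dec_scan {r : Fin K} (k : List (Cmd α)) (p : ℕ) {W : Fin K → WorkTape (Option Bool)}
    (hW : ∀ j, (W j).cells ≤ m) (e : ℕ) (ds l : List Bool) (hds : binVal ds ≠ 0)
    (hm : l.length + ds.length + e + 2 ≤ m) :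
    Reach w m
      ((dec r :: k, .scan), p, Function.update W r (scanTape l (ds.map some ++ .replicate e none)))
      ((k, .fetch), p, Function.update W r (homeTape (l.reverse ++ binPred ds) e)) := by
  induction ds generalizing l with
  | nil => simp [binVal] at hds
  | cons b ds ih =>
    cases b
    · have h := ih (true :: l) (by simpa [binVal] using hds) (by simp at hm ⊢; omega)
      have e₁ : (true :: l).reverse ++ binPred ds = l.reverse ++ binPred (false :: ds) := by
        simp [binPred]
      rw [e₁] at h
      refine .head (fits_update hW ?_) ?_ h
      · refine (cells_scanTape _ _).trans ?_
        simp at hm ⊢; omega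
      · simp only [confStep, verdict, Cmd.trans, headAt_update, scanTape_cons_head]
        simp only [work_onTape, scanTape_right, moveInput]
        rfl
    · refine .head (fits_update hW ?_) ?_ (Reach.trans (reach_ret k p r hW l
        (some false :: (ds.map some ++ List.replicate e none)) ?_) ?_)
      · refine (cells_scanTape _ _).trans ?_
        simp at hm ⊢; omega
      · simp only [confStep, verdict, Cmd.trans, headAt_update, scanTape_cons_head]
        simp only [work_onTape, scanTape_left, moveInput]
        rfl
      · simp at hm ⊢; omega
      · have : homeTape (l.reverse ++ binPred (true :: ds)) e =
            retTape [] (l.reverse.map some ++ some false :: (ds.map some ++ .replicate e none)) := by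
          simp [homeTape, binPred]
        rw [this]
        refine .refl (fits_update hW ?_)
        simp [cells_retTape] at hm ⊢; omega

/-- Decrementing leaves high-order zeros in place, so a counter vanishes when all its digits do. The
test looks for a digit 1 and may visit one blank behind the digits, whence the bound 1. -/
theorem reach_test_scan {r : Fin K} (c : Cmd α) (k : List (Cmd α)) (p : ℕ)
    {W : Fin K → WorkTape (Option Bool)} (hW : ∀ j, (W j).cells ≤ m) (e : ℕ) (he : e ≤ 1)
    (ds l : List Bool) (hm : l.length + ds.length + e + 2 ≤ m) :
    ∃ e' ≤ 1, Reach w m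
      ((whileNZ r c :: k, .scan), p,
        Function.update W r (scanTape l (ds.map some ++ .replicate e none)))
      ((if binVal ds = 0 then k else c :: whileNZ r c :: k, .fetch), p,
        Function.update W r (homeTape (l.reverse ++ ds) e')) := by
  induction ds generalizing l with
  | nil =>
    refine ⟨1, le_rfl, .head (fits_update hW ?_) ?_ (Reach.trans (reach_ret k p r hW l
      [none] ?_) ?_)⟩
    · refine (cells_scanTape _ _).trans ?_
      simp at hm ⊢; omega
    · simp only [confStep, verdict, Cmd.trans, headAt_update, scanTape_nil_head]
      simp only [work_onTape, scanTape_left, moveInput]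
      have : ((([] : List Bool).map some ++ List.replicate e none).tail : List (Option Bool)) = [] := by
        interval_cases e <;> rfl
      rw [this]
    · simp at hm ⊢; omega
    · have : homeTape (l.reverse ++ []) 1 = retTape [] (l.reverse.map some ++ [none]) := by
        simp [homeTape]
      rw [this]
      simp only [binVal, if_true]
      refine .refl (fits_update hW ?_)
      simp [cells_retTape] at hm ⊢; omega
  | cons b ds ih =>
    cases b
    · obtain ⟨e', he, h⟩ := ih (false :: l) (by simp at hm ⊢; omega)
      have e₁ : (false :: l).reverse ++ ds = l.reverse ++ (false :: ds) := by simp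
      have e₂ : binVal (false :: ds) = 0 ↔ binVal ds = 0 := by simp [binVal]
      rw [e₁] at h
      simp only [e₂]
      refine ⟨e', he, .head (fits_update hW ?_) ?_ h⟩
      · refine (cells_scanTape _ _).trans ?_
        simp at hm ⊢; omega
      · simp only [confStep, verdict, Cmd.trans, headAt_update, scanTape_cons_head]
        simp only [work_onTape, scanTape_right, moveInput]
        rfl
    · have e₂ : ¬ binVal (true :: ds) = 0 := by simp [binVal]
      rw [if_neg e₂]
      refine ⟨e, he, .head (fits_update hW ?_) ?_ (Reach.trans (reach_ret
        (c :: whileNZ r c :: k) p r hW l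
        (some true :: (ds.map some ++ List.replicate e none)) ?_) ?_)⟩
      · refine (cells_scanTape _ _).trans ?_
        simp at hm ⊢; omega
      · simp only [confStep, verdict, Cmd.trans, headAt_update, scanTape_cons_head]
        simp only [work_onTape, scanTape_left, moveInput]
        rfl
      · simp at hm ⊢; omega
      · have : homeTape (l.reverse ++ (true :: ds)) e =
            retTape [] (l.reverse.map some ++ some true :: (ds.map some ++ .replicate e none)) := by
          simp [homeTape]
        rw [this]
        refine .refl (fits_update hW ?_)
        simp [cells_retTape] at hm ⊢; omega

/-- The work tapes hold the counters `s`, with at most `L` digits each. -/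
def Holds (L : ℕ) (W : Fin K → WorkTape (Option Bool)) (s : ℕ → ℕ) : Prop :=
  ∀ j : Fin K, ∃ ds e, W j = homeTape ds e ∧ binVal ds = s j ∧ ds.length ≤ L ∧ e ≤ 1

theorem Holds.cells {L : ℕ} {W : Fin K → WorkTape (Option Bool)} {s : ℕ → ℕ} (h : Holds L W s)
    (hm : L + 3 ≤ m) (j : Fin K) : (W j).cells ≤ m := by
  obtain ⟨ds, e, h, -, hd, he⟩ := h j
  rw [h, homeTape, cells_retTape]
  simp; omega

theorem Holds.update {L : ℕ} {W : Fin K → WorkTape (Option Bool)} {s : ℕ → ℕ} (h : Holds L W s)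
    (r : Fin K) {ds : List Bool} {e v : ℕ} (hv : binVal ds = v) (hd : ds.length ≤ L) (he : e ≤ 1) :
    Holds L (Function.update W r (homeTape ds e)) (Function.update s r v) := by
  intro j
  by_cases hj : j = r
  · subst hj
    exact ⟨ds, e, by simp, by simp [hv], hd, he⟩
  · have : (j : ℕ) ≠ r := fun e => hj (Fin.ext e)
    simpa [hj, this] using h j

theorem reach_fetch {r : Fin K} {c : Cmd α} (k : List (Cmd α)) {p : ℕ}
    {W : Fin K → WorkTape (Option Bool)} (hW : ∀ j, (W j).cells ≤ m) {ds : List Bool} {e : ℕ}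
    (h : W r = homeTape ds e)
    (hc : c = inc r ∨ c = dec r ∨ ∃ b, c = whileNZ r b) {y : Conf α K}
    (hy : Reach w m ((c :: k, .scan), p,
      Function.update W r (scanTape [] (ds.map some ++ .replicate e none))) y) :
    Reach w m ((c :: k, .fetch), p, W) y := by
  refine .head (fun j => hW j) ?_ hy
  have hW' : W = Function.update W r (homeTape ds e) := by rw [← h, Function.update_eq_self]
  rw [hW']
  have hh : (homeTape ds e).head = none := rfl
  have hr : ((homeTape ds e).write none).move none .right =
      scanTape [] (ds.map some ++ .replicate e none) := move_right_retTape _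
  rcases hc with rfl | rfl | ⟨b, rfl⟩ <;>
  · simp only [confStep, verdict, Cmd.trans, headAt_update, work_onTape, moveInput, hh, hr,
      Function.update_idem]

/-- Induction on the execution, for every continuation. Besides its digits a counter needs the home
cell and room for the scan behind them, which `L + 3` cells provide. -/
theorem Exec.reach {B L : ℕ} (hL : Nat.log 2 B + 1 ≤ L) (hm : L + 3 ≤ m) {c : Cmd α}
    {x y : (ℕ → ℕ) × ℕ} (h : Exec w B c x y) (hc : c.Below K) (k : List (Cmd α))
    {W : Fin K → WorkTape (Option Bool)} (hW : Holds L W x.1) :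
    ∃ W', Holds L W' y.1 ∧
      Reach w m ((c :: k, .fetch), x.2, W) ((k, .fetch), y.2, W') := by
  induction h generalizing k W with
  | @inc r s p hB =>
    obtain ⟨ds, e, h, hv, hd, he⟩ := hW ⟨r, hc⟩
    have hcells := hW.cells hm
    obtain ⟨e', he', hr⟩ := reach_inc_scan (r := ⟨r, hc⟩) (w := w) k p hcells e ds []
      (by simp; omega)
    refine ⟨_, hW.update ⟨r, hc⟩ (ds := binSucc ds) (e := e') ?_ ?_ (by omega), ?_⟩
    · rw [binVal_binSucc, hv]
    -- If the numeral grows, its old length is at most the logarithm of the new value, which is at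
    -- most `B`.
    · rcases (length_binSucc ds).2 with h | ⟨h, h2⟩
      · omega
      · have : 2 ^ ds.length ≤ B := by rw [hv] at h2; exact h2.trans hB
        have := Nat.le_log_of_pow_le one_lt_two this
        omega
    · exact reach_fetch (r := ⟨r, hc⟩) k hcells h (.inl rfl) hr
  | @dec r s p n hn =>
    obtain ⟨ds, e, h, hv, hd, he⟩ := hW ⟨r, hc⟩
    have hcells := hW.cells hm
    have hv' : binVal ds = n + 1 := hv.trans hn
    have hr := reach_dec_scan (r := ⟨r, hc⟩) (w := w) k p hcells e ds [] (by omega)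
      (by simp; omega)
    refine ⟨_, hW.update ⟨r, hc⟩ (ds := binPred ds) (e := e) (binVal_binPred hv') ?_ he, ?_⟩
    · rw [length_binPred]; exact hd
    · exact reach_fetch (r := ⟨r, hc⟩) k hcells h (.inr (.inl rfl)) hr
  | mv => exact ⟨W, hW, .head (hW.cells hm) rfl (.refl (hW.cells hm))⟩
  | seq _ _ ih₁ ih₂ =>
    obtain ⟨W₁, h₁, r₁⟩ := ih₁ hc.1 (_ :: k) hW
    obtain ⟨W₂, h₂, r₂⟩ := ih₂ hc.2 k h₁
    exact ⟨W₂, h₂, .head (hW.cells hm) rfl (r₁.trans r₂)⟩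
  | @whileNZ_done r c x hx =>
    obtain ⟨ds, e, h, hv, hd, he⟩ := hW ⟨r, hc.1⟩
    have hcells := hW.cells hm
    obtain ⟨e', he', hr⟩ := reach_test_scan (r := ⟨r, hc.1⟩) (w := w) c k x.2 hcells e he ds []
      (by simp; omega)
    have hv' : binVal ds = 0 := hv.trans hx
    rw [if_pos hv'] at hr
    refine ⟨_, ?_, reach_fetch (r := ⟨r, hc.1⟩) k hcells h (.inr (.inr ⟨c, rfl⟩)) hr⟩
    have := hW.update ⟨r, hc.1⟩ hv hd he'
    simpa using this
  | @whileNZ_step r c x y z hx _ _ ih₁ ih₂ =>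
    obtain ⟨ds, e, h, hv, hd, he⟩ := hW ⟨r, hc.1⟩
    have hcells := hW.cells hm
    obtain ⟨e', he', hr⟩ := reach_test_scan (r := ⟨r, hc.1⟩) (w := w) c k x.2 hcells e he ds []
      (by simp; omega)
    have hv' : ¬ binVal ds = 0 := fun h => hx (hv.symm.trans h)
    rw [if_neg hv'] at hr
    have h₀ := hW.update ⟨r, hc.1⟩ hv hd he'
    simp only [Function.update_eq_self] at h₀
    obtain ⟨W₁, h₁, r₁⟩ := ih₁ hc.2 (whileNZ r c :: k) h₀
    obtain ⟨W₂, h₂, r₂⟩ := ih₂ hc k h₁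
    exact ⟨W₂, h₂, (reach_fetch (r := ⟨r, hc.1⟩) k hcells h (.inr (.inr ⟨c, rfl⟩)) hr).trans
      (r₁.trans r₂)⟩
  | @whileSym_done f c x hx =>
    exact ⟨W, hW, .head (hW.cells hm) (by simp [confStep, verdict, Cmd.trans, hx, moveInput,
      write_head_move_stay]) (.refl (hW.cells hm))⟩
  | @whileSym_step f c x y z hx _ _ ih₁ ih₂ =>
    obtain ⟨W₁, h₁, r₁⟩ := ih₁ hc (whileSym f c :: k) hW
    obtain ⟨W₂, h₂, r₂⟩ := ih₂ hc k h₁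
    exact ⟨W₂, h₂, .head (hW.cells hm) (by simp [confStep, verdict, Cmd.trans, hx, moveInput,
      write_head_move_stay]) (r₁.trans r₂)⟩
  | @ifSym_true f c x y hx _ ih =>
    obtain ⟨W₁, h₁, r₁⟩ := ih hc k hW
    exact ⟨W₁, h₁, .head (hW.cells hm) (by simp [confStep, verdict, Cmd.trans, hx, moveInput,
      write_head_move_stay]) r₁⟩
  | @ifSym_false f c x hx =>
    exact ⟨W, hW, .head (hW.cells hm) (by simp [confStep, verdict, Cmd.trans, hx, moveInput,
      write_head_move_stay]) (.refl (hW.cells hm))⟩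

end Sim

theorem confStep_iterate_of_verdict {K : ℕ} {w : List α} {x : Conf α K} {b : Bool}
    (h : verdict x.1 = some b) (t : ℕ) : (confStep w)^[t] x = x := by
  induction t with
  | zero => rfl
  | succ t ih => rw [Function.iterate_succ_apply', ih, confStep, h]

/-- A program that computes a characteristic function with counters bounded by `B w` on input `w`
yields a machine whose space is logarithmic in `B w`. -/
theorem exists_machine (c : Cmd α) (L : Language α) (B : List α → ℕ)
    (h : ∀ w, ∃ s p, Exec w (B w) c (fun _ => 0, 0) (s, p) ∧ (w ∈ L ↔ s 0 ≠ 0)) :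
    ∃ (M : OfflineTM α) (K : ℕ), M.Decides L ∧
      ∀ w, M.SpaceAtMost w (K * (Nat.log 2 (B w) + 4)) := by
  -- The final loop turns the result in counter 0 into a verdict: its body, which accepts, is
  -- reached exactly if the counter is not zero.
  obtain ⟨K₀, hK₀⟩ := exists_below (seq c (whileNZ 0 acc))
  set K := max K₀ 1
  have hK := hK₀.mono (le_max_left K₀ 1)
  set P := seq c (whileNZ 0 acc) with hP
  have key : ∀ w, ∃ y, Reach w (Nat.log 2 (B w) + 4) (conf (machine K P).init) y ∧
      (w ∈ L → verdict y.1 = some true) ∧ (w ∉ L → verdict y.1 = some false) := by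
    intro w
    obtain ⟨s, p, he, hs⟩ := h w
    set W₀ : Fin K → WorkTape (Option Bool) := fun _ => ⟨[], none, []⟩
    have h₀ : Holds (Nat.log 2 (B w) + 1) W₀ (fun _ => 0) :=
      fun j => ⟨[], 0, rfl, rfl, by simp, by simp⟩
    have hinit : conf (machine K P).init = (([P], .fetch), 0, W₀) := rfl
    have hfit := h₀.cells (m := Nat.log 2 (B w) + 4) (by omega)
    rw [hinit]
    by_cases hw : w ∈ L
    · obtain ⟨W₁, h₁, r₁⟩ := he.reach (m := Nat.log 2 (B w) + 4) le_rfl (by omega) hK.1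
        [whileNZ 0 acc] h₀
      have hK1 : 0 < K := lt_of_lt_of_le one_pos (le_max_right K₀ 1)
      obtain ⟨ds, e, hd, hv, hl, he'⟩ := h₁ ⟨0, hK1⟩
      have hcells := h₁.cells (m := Nat.log 2 (B w) + 4) (by omega)
      obtain ⟨e', he', hr⟩ := reach_test_scan (r := ⟨0, hK1⟩) (w := w) (acc : Cmd α) [] p
        hcells e he' ds [] (by simp; omega)
      have hv' : ¬ binVal ds = 0 := fun h => hs.1 hw (hv.symm.trans h)
      rw [if_neg hv'] at hr
      have hr' := reach_fetch (r := ⟨0, hK1⟩) [] hcells hd (.inr (.inr ⟨acc, rfl⟩)) hr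
      exact ⟨_, .head hfit rfl (r₁.trans hr'), fun _ => rfl, fun h => absurd hw h⟩
    · have hs0 : s 0 = 0 := by
        by_contra h0; exact hw (hs.2 h0)
      obtain ⟨W₁, h₁, r₁⟩ := (Exec.seq he (.whileNZ_done hs0)).reach
        (m := Nat.log 2 (B w) + 4) le_rfl (by omega) hK [] h₀
      exact ⟨_, r₁, fun h => absurd h hw, fun _ => rfl⟩
  refine ⟨machine K P, K, fun w => ?_, fun w t => ?_⟩
  · obtain ⟨y, hy, h₁, h₂⟩ := key w
    obtain ⟨t, ht, -⟩ := hy.exists_iterate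
    have hv : (machine K P).verdict ((machine K P).run w t).state = verdict y.1 := by
      rw [← ht, ← conf_run]; rfl
    exact ⟨fun hw => ⟨t, hv.trans (h₁ hw)⟩, fun hw => ⟨t, hv.trans (h₂ hw)⟩⟩
  · obtain ⟨y, hy, h₁, h₂⟩ := key w
    obtain ⟨T, hT, hf⟩ := hy.exists_iterate
    have hfit : Fits (Nat.log 2 (B w) + 4) (conf ((machine K P).run w t)) := by
      rw [conf_run]
      rcases le_total t T with h | h
      · exact hf t h
      -- After time `T` the machine has halted and the configuration does not change any more.
      · obtain ⟨d, rfl⟩ := Nat.exists_eq_add_of_le h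
        have hv : ∃ b, verdict y.1 = some b := by
          by_cases hw : w ∈ L
          exacts [⟨_, h₁ hw⟩, ⟨_, h₂ hw⟩]
        obtain ⟨b, hb⟩ := hv
        rw [add_comm T d, Function.iterate_add_apply, hT, confStep_iterate_of_verdict hb]
        exact hy.fits
    calc ∑ j, (((machine K P).run w t).work j).cells
        ≤ ∑ _j : Fin K, (Nat.log 2 (B w) + 4) := Finset.sum_le_sum fun j _ => hfit j
      _ = K * (Nat.log 2 (B w) + 4) := by simp

end Cmd
end G3

/-! ### Basic counter programs -/

namespace G3

namespace Cmd

variable {α : Type} {w : List α} {B : ℕ}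

open OfflineTM (readInput moveInput)

theorem Exec.of_eq {c : Cmd α} {x y z : (ℕ → ℕ) × ℕ} (h : Exec w B c x y) (e : y = z) :
    Exec w B c x z := e ▸ h

/-- Renumbering of the counters. -/
def map (ρ : ℕ → ℕ) : Cmd α → Cmd α
  | inc r => inc (ρ r)
  | dec r => dec (ρ r)
  | mv d => mv d
  | seq a b => seq (a.map ρ) (b.map ρ)
  | whileNZ r c => whileNZ (ρ r) (c.map ρ)
  | whileSym f c => whileSym f (c.map ρ)
  | ifSym f c => ifSym f (c.map ρ)
  | acc => acc

/-- A frame rule: a renumbered program behaves as before on its own counters and leaves all others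
alone. It underlies every change of context below. -/
theorem Exec.map {ρ : ℕ → ℕ} (hρ : ρ.Injective) {c : Cmd α} {x y : (ℕ → ℕ) × ℕ}
    (h : Exec w B c x y) (t : ℕ → ℕ) (ht : ∀ i, t (ρ i) = x.1 i) :
    ∃ t', Exec w B (c.map ρ) (t, x.2) (t', y.2) ∧ (∀ i, t' (ρ i) = y.1 i) ∧
      ∀ j, (∀ i, j ≠ ρ i) → t' j = t j := by
  induction h generalizing t with
  | @inc r s p hB =>
    refine ⟨Function.update t (ρ r) (t (ρ r) + 1), .inc (by rw [ht]; exact hB), fun i => ?_,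
      fun j hj => by simp [hj r]⟩
    by_cases hi : i = r
    · subst hi; simp [ht]
    · simp [hi, hρ.ne hi, ht]
  | @dec r s p n hn =>
    refine ⟨Function.update t (ρ r) n, .dec (by rw [ht]; exact hn), fun i => ?_,
      fun j hj => by simp [hj r]⟩
    by_cases hi : i = r
    · subst hi; simp
    · simp [hi, hρ.ne hi, ht]
  | mv => exact ⟨t, .mv, ht, fun _ _ => rfl⟩
  | seq _ _ h₁ h₂ =>
    obtain ⟨t₁, e₁, g₁, o₁⟩ := h₁ t ht
    obtain ⟨t₂, e₂, g₂, o₂⟩ := h₂ t₁ g₁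
    exact ⟨t₂, .seq e₁ e₂, g₂, fun j hj => (o₂ j hj).trans (o₁ j hj)⟩
  | @whileNZ_done r c x h => exact ⟨t, .whileNZ_done (by simpa [ht] using h), ht, fun _ _ => rfl⟩
  | @whileNZ_step r c x y z h _ _ h₁ h₂ =>
    obtain ⟨t₁, e₁, g₁, o₁⟩ := h₁ t ht
    obtain ⟨t₂, e₂, g₂, o₂⟩ := h₂ t₁ g₁
    exact ⟨t₂, .whileNZ_step (by simpa [ht] using h) e₁ e₂, g₂,
      fun j hj => (o₂ j hj).trans (o₁ j hj)⟩
  | whileSym_done h => exact ⟨t, .whileSym_done h, ht, fun _ _ => rfl⟩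
  | whileSym_step h _ _ h₁ h₂ =>
    obtain ⟨t₁, e₁, g₁, o₁⟩ := h₁ t ht
    obtain ⟨t₂, e₂, g₂, o₂⟩ := h₂ t₁ g₁
    exact ⟨t₂, .whileSym_step h e₁ e₂, g₂, fun j hj => (o₂ j hj).trans (o₁ j hj)⟩
  | ifSym_true h _ h₁ =>
    obtain ⟨t₁, e₁, g₁, o₁⟩ := h₁ t ht
    exact ⟨t₁, .ifSym_true h e₁, g₁, o₁⟩
  | ifSym_false h => exact ⟨t, .ifSym_false h, ht, fun _ _ => rfl⟩

def skip : Cmd α := ifSym (fun _ => false) acc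

theorem exec_skip (x : (ℕ → ℕ) × ℕ) : Exec w B skip x x := .ifSym_false rfl

/-- Set a counter to zero. -/
def clear (r : ℕ) : Cmd α := whileNZ r (dec r)

theorem exec_clear (r : ℕ) (s : ℕ → ℕ) (p : ℕ) :
    Exec w B (clear r) (s, p) (Function.update s r 0, p) := by
  generalize hn : s r = n
  induction n generalizing s with
  | zero =>
    have : Function.update s r 0 = s := by rw [← hn, Function.update_eq_self]
    rw [this]; exact .whileNZ_done hn
  | succ n ih =>
    have := ih (Function.update s r n) (by simp)
    rw [Function.update_idem] at this
    exact .whileNZ_step (by simp [hn]) (.dec hn) this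

/-- Add counter `r` to counter `r'` and clear it. -/
def transfer (r r' : ℕ) : Cmd α := whileNZ r (seq (dec r) (inc r'))

theorem exec_transfer {r r' : ℕ} (hr : r ≠ r') (s : ℕ → ℕ) (p : ℕ) (hB : s r' + s r ≤ B) :
    Exec w B (transfer r r') (s, p)
      (Function.update (Function.update s r 0) r' (s r' + s r), p) := by
  generalize hn : s r = n
  induction n generalizing s with
  | zero =>
    have h : Function.update s r 0 = s := by rw [← hn, Function.update_eq_self]
    rw [h, add_zero, Function.update_eq_self]; exact .whileNZ_done hn
  | succ n ih =>
    have := ih (Function.update (Function.update s r n) r' (s r' + 1))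
      (by simp [hr]; omega) (by simp [hr])
    refine .whileNZ_step (by simp [hn]) (.seq (.dec hn) (.inc ?_)) ?_
    · simp [hr.symm]; omega
    · have e : Function.update s r n r' = s r' := by simp [hr.symm]
      rw [e]
      refine this.of_eq (congrArg (·, p) (funext fun j => ?_))
      by_cases h₁ : j = r'
      · subst h₁; simp; omega
      · by_cases h₂ : j = r
        · subst h₂; simp [h₁]
        · simp [h₁, h₂]

/-- Add counter `r` to counter `r'`, by way of the auxiliary counter `t`. -/
def copy (r r' t : ℕ) : Cmd α :=
  seq (whileNZ r (seq (dec r) (seq (inc r') (inc t)))) (transfer t r)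

theorem exec_copy_loop {r r' t : ℕ} (h₁ : r ≠ r') (h₂ : r ≠ t) (h₃ : r' ≠ t) (s : ℕ → ℕ) (p : ℕ)
    (hB : s r' + s r ≤ B) (hB' : s t + s r ≤ B) :
    Exec w B (whileNZ r (seq (dec r) (seq (inc r') (inc t)))) (s, p)
      (Function.update (Function.update (Function.update s r 0) r' (s r' + s r)) t (s t + s r),
        p) := by
  generalize hn : s r = n
  induction n generalizing s with
  | zero =>
    have h : Function.update s r 0 = s := by rw [← hn, Function.update_eq_self]
    rw [h, add_zero, add_zero, Function.update_eq_self, Function.update_eq_self]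
    exact .whileNZ_done hn
  | succ n ih =>
    have := ih (Function.update (Function.update (Function.update s r n) r' (s r' + 1)) t (s t + 1))
      (by simp [h₁, h₂, h₃]; omega) (by simp [h₁, h₂]; omega) (by simp [h₁, h₂])
    refine .whileNZ_step (by simp [hn]) (.seq (.dec hn) (.seq (.inc ?_) (.inc ?_))) ?_
    · simp [h₁.symm]; omega
    · simp [h₂.symm, h₃.symm]; omega
    · have e : Function.update s r n r' = s r' := by simp [h₁.symm]
      have e' : Function.update (Function.update s r n) r' (s r' + 1) t = s t := by
        simp [h₂.symm, h₃.symm]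
      rw [e, e']
      refine this.of_eq (congrArg (·, p) (funext fun j => ?_))
      by_cases e₁ : j = t
      · subst e₁; simp; omega
      by_cases e₂ : j = r'
      · subst e₂; simp [h₃]; omega
      by_cases e₃ : j = r
      · subst e₃; simp [h₁, h₂]
      · simp [e₁, e₂, e₃]

theorem exec_copy {r r' t : ℕ} (h₁ : r ≠ r') (h₂ : r ≠ t) (h₃ : r' ≠ t) (s : ℕ → ℕ) (p : ℕ)
    (ht : s t = 0) (hr' : s r' = 0) (hB : s r ≤ B) :
    Exec w B (copy r r' t) (s, p) (Function.update s r' (s r), p) := by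
  refine .seq (exec_copy_loop h₁ h₂ h₃ s p (by omega) (by omega)) ?_
  refine (exec_transfer h₂.symm _ p ?_).of_eq (congrArg (·, p) (funext fun j => ?_))
  rotate_left
  · change _ = Function.update s r' (s r) j
    by_cases e₁ : j = t
    · subst e₁; simp [h₂.symm, h₃.symm, ht]
    by_cases e₂ : j = r'
    · subst e₂; simp [h₁.symm, h₃, hr']
    by_cases e₃ : j = r
    · subst e₃; simp [h₁, h₂, ht]
    · simp [e₁, e₂, e₃]
  · simp [h₁, h₂, ht]; exact hB

end Cmd

/-! Functions computed by programs whose counters are polynomially bounded. -/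

/-- Contexts: an input word and finitely many numbers. -/
class Ctx (α : Type) where
  arity : ℕ
  word : α → List Sym
  vals : α → List ℕ
  length_vals : ∀ a, (vals a).length = arity

open Ctx (word vals arity)

instance : Ctx (List Sym) := ⟨0, id, fun _ => [], fun _ => rfl⟩

instance {α : Type} [Ctx α] : Ctx (α × ℕ) :=
  ⟨arity α + 1, fun a => word a.1, fun a => vals a.1 ++ [a.2],
    fun a => by simp [Ctx.length_vals]⟩

/-- The counters that hold the numbers in `l`. -/
def store (l : List ℕ) : ℕ → ℕ := fun i => l.getD i 0

theorem store_append_singleton (l : List ℕ) (x : ℕ) :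
    store (l ++ [x]) = Function.update (store l) l.length x := by
  funext j
  rcases lt_trichotomy j l.length with h | h | h
  · rw [Function.update_of_ne h.ne]
    exact List.getD_append _ _ _ _ h
  · subst h; simp [store]
  · rw [Function.update_of_ne h.ne']
    simp only [store]
    rw [List.getD_eq_default _ _ (by simp; omega), List.getD_eq_default _ _ (by omega)]

theorem store_of_le {l : List ℕ} {j : ℕ} (h : l.length ≤ j) : store l j = 0 := by
  simp only [store]; rw [List.getD_eq_default _ _ h]

section LS

variable (E : List Sym → ℕ) {α : Type} [Ctx α]

/-- The summand 2 makes this a base of at least 2, so that sums and constants are absorbed by larger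
powers. -/
def ctxSize (a : α) : ℕ := (word a).length + (vals a).sum + E (word a) + 2

/-- `f` is computed by a program that leaves its arguments in place, appends the value and keeps
all counters polynomial in the arguments, the length of the word and the parameter `E`. -/
def LS (f : α → ℕ) : Prop :=
  ∃ (c : Cmd Sym) (K : ℕ), ∀ a, f a ≤ ctxSize E a ^ K ∧
    ∀ B, ctxSize E a ^ K ≤ B →
      c.Exec (word a) B (store (vals a), 0) (store (vals a ++ [f a]), 0)

variable {E}

theorem two_le_ctxSize (a : α) : 2 ≤ ctxSize E a := by unfold ctxSize; omega

theorem ctxSize_pow_mono (a : α) {K K' : ℕ} (h : K ≤ K') : ctxSize E a ^ K ≤ ctxSize E a ^ K' :=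
  Nat.pow_le_pow_right (by have := two_le_ctxSize (E := E) a; omega) h

theorem ctxSize_pair (a : α) (x : ℕ) : ctxSize E (a, x) = ctxSize E a + x := by
  simp [ctxSize, vals, word]; omega

theorem ctxSize_pair_le (a : α) {x K : ℕ} (h : x ≤ ctxSize E a ^ K) :
    ctxSize E (a, x) ≤ ctxSize E a ^ (K + 2) := by
  rw [ctxSize_pair]
  have h1 : ctxSize E a ≤ ctxSize E a ^ (K + 1) := Nat.le_self_pow (by omega) _
  have h2 : ctxSize E a ^ K ≤ ctxSize E a ^ (K + 1) := ctxSize_pow_mono a (by omega)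
  have h3 := Nat.mul_le_mul_left (ctxSize E a ^ (K + 1)) (two_le_ctxSize (E := E) a)
  rw [pow_succ]
  omega

theorem ctxSize_pair_pow_le (a : α) {x K K' : ℕ} (h : x ≤ ctxSize E a ^ K) :
    ctxSize E (a, x) ^ K' ≤ ctxSize E a ^ ((K + 2) * K') := by
  rw [pow_mul]; exact Nat.pow_le_pow_left (ctxSize_pair_le a h) _

theorem le_ctxSize_two_pow (a : α) {n : ℕ} : n ≤ ctxSize E a ^ n :=
  (Nat.lt_two_pow_self).le.trans (Nat.pow_le_pow_left (two_le_ctxSize a) n)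

theorem store_pair (a : α) (x : ℕ) :
    store (vals (a, x)) = Function.update (store (vals a)) (arity α) x := by
  rw [← Ctx.length_vals a]; exact store_append_singleton _ _

theorem store_append_val (a : α) (x : ℕ) : store (vals a ++ [x]) = store (vals (a, x)) := rfl

theorem store_vals_ge (a : α) {j : ℕ} (h : arity α ≤ j) : store (vals a) j = 0 :=
  store_of_le (by rw [Ctx.length_vals]; exact h)

theorem arity_pair : arity (α × ℕ) = arity α + 1 := rfl

/-- The general form of weakening and of discarding arguments: an injective renumbering must match
the arguments and send the place of the result to the place of the result. -/
theorem LS.rename {β : Type} [Ctx β] {f : β → ℕ} (hf : LS E f) (φ : α → β)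
    (hw : ∀ a, word (φ a) = word a) (hs : ∀ a, (vals (φ a)).sum ≤ (vals a).sum) (ρ : ℕ → ℕ)
    (hρ : ρ.Injective) (hv : ∀ a i, store (vals a) (ρ i) = store (vals (φ a)) i)
    (hm : ρ (arity β) = arity α) : LS E fun a => f (φ a) := by
  obtain ⟨c, K, h⟩ := hf
  have hsize : ∀ a, ctxSize E (φ a) ≤ ctxSize E a := fun a => by
    have := hs a
    simp only [ctxSize, hw]; omega
  refine ⟨c.map ρ, K, fun a => ⟨(h (φ a)).1.trans (Nat.pow_le_pow_left (hsize a) K), fun B hB => ?_⟩⟩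
  have he := (h (φ a)).2 B ((Nat.pow_le_pow_left (hsize a) K).trans hB)
  rw [hw] at he
  obtain ⟨t', e, h₁, h₂⟩ := he.map hρ (store (vals a)) (hv a)
  convert e using 2
  funext j
  rw [store_append_val, store_pair]
  by_cases hj : ∃ i, j = ρ i
  · obtain ⟨i, rfl⟩ := hj
    rw [h₁, store_append_val, store_pair, ← hm]
    by_cases hi : i = arity β
    · subst hi; simp
    · simp [hρ.ne hi, hi, hv]
  · push Not at hj
    rw [h₂ j hj, Function.update_of_ne]
    rw [← hm]; exact hj _

/-- The renumbering that leaves room for a counter `m`. -/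
def skipAt (m i : ℕ) : ℕ := if i < m then i else i + 1

theorem skipAt_injective (m : ℕ) : (skipAt m).Injective := by
  intro i j h
  simp only [skipAt] at h
  split at h <;> split at h <;> omega

theorem LS.lift {f : α → ℕ} (hf : LS E f) : LS E fun a : α × ℕ => f a.1 := by
  refine hf.rename Prod.fst (fun _ => rfl) (fun a => by simp [vals]) (skipAt (arity α))
    (skipAt_injective _) (fun ⟨a, x⟩ i => ?_) (by simp [skipAt, arity_pair])
  rw [store_pair]
  by_cases hi : i < arity α
  · simp [skipAt, hi, hi.ne]
  · have : ¬ i + 1 = arity α := by omega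
    simp only [skipAt, hi, if_false, Function.update_of_ne this]
    rw [store_vals_ge _ (by omega), store_vals_ge _ (by omega)]

/-- Makes room for the countdown that the loop of `LS.recNat` keeps in front of its index and its
value. -/
theorem LS.lift_mid₂ {f : (α × ℕ) × ℕ → ℕ} (hf : LS E f) :
    LS E fun a : ((α × ℕ) × ℕ) × ℕ => f ((a.1.1.1, a.1.2), a.2) := by
  refine hf.rename (fun a : ((α × ℕ) × ℕ) × ℕ => ((a.1.1.1, a.1.2), a.2)) (fun _ => rfl)
    (fun a => by simp [vals]) (skipAt (arity α))
    (skipAt_injective _) (fun ⟨⟨⟨a, n⟩, x⟩, y⟩ i => ?_) (by simp [skipAt, arity_pair]; omega)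
  simp only [store_pair, arity_pair]
  by_cases hi : i < arity α
  · have h1 : ¬ i = arity α := by omega
    have h2 : ¬ i = arity α + 1 := by omega
    have h3 : ¬ i = arity α + 1 + 1 := by omega
    simp [skipAt, hi, h1, h2, h3]
  · simp only [skipAt, hi, if_false]
    by_cases h1 : i = arity α
    · subst h1; simp
    by_cases h2 : i = arity α + 1
    · subst h2; simp
    have h3 : ¬ i + 1 = arity α := by omega
    simp [h1, h2, h3]
    rw [store_vals_ge _ (by omega), store_vals_ge _ (by omega)]

theorem LS.zero : LS E fun _ : α => 0 := by
  refine ⟨.skip, 0, fun a => ⟨by simp, fun B _ => ?_⟩⟩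
  have : store (vals a ++ [0]) = store (vals a) := by
    rw [store_append_val, store_pair]
    conv_rhs => rw [← Function.update_eq_self (arity α) (store (vals a))]
    rw [store_vals_ge _ le_rfl]
  rw [this]
  exact Cmd.exec_skip _

theorem LS.succ {f : α → ℕ} (hf : LS E f) : LS E fun a => f a + 1 := by
  obtain ⟨c, K, h⟩ := hf
  have key : ∀ a, f a + 1 ≤ ctxSize E a ^ (K + 1) := fun a => by
    have h2 := Nat.mul_le_mul_left (ctxSize E a ^ K) (two_le_ctxSize (E := E) a)
    have h3 : 1 ≤ ctxSize E a ^ K := Nat.one_le_pow _ _ (by have := two_le_ctxSize (E := E) a; omega)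
    have := (h a).1
    rw [pow_succ]; omega
  refine ⟨.seq c (.inc (arity α)), K + 1, fun a => ⟨key a, fun B hB => ?_⟩⟩
  refine .seq ((h a).2 B ((ctxSize_pow_mono a (by omega)).trans hB)) ?_
  have := Cmd.Exec.inc (w := word a) (B := B) (r := arity α) (s := store (vals a ++ [f a])) (p := 0)
  rw [store_append_val, store_pair] at this ⊢
  rw [store_append_val, store_pair]
  simpa using this (by simpa using (key a).trans hB)

theorem LS.const (n : ℕ) : LS E fun _ : α => n := by
  induction n with
  | zero => exact .zero
  | succ n ih => exact ih.succ

theorem LS.var : LS E fun a : α × ℕ => a.2 := by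
  have key : ∀ a : α × ℕ, a.2 ≤ ctxSize E a ^ 1 := fun a => by
    rw [pow_one, ← Prod.mk.eta (p := a), ctxSize_pair]; simp
  refine ⟨.copy (arity α) (arity α + 1) (arity α + 2), 1, fun ⟨a, x⟩ => ⟨key _, fun B hB => ?_⟩⟩
  have := Cmd.exec_copy (w := word (a, x)) (B := B) (r := arity α) (r' := arity α + 1)
    (t := arity α + 2) (by omega) (by omega) (by omega) (store (vals (a, x))) 0
    (store_vals_ge _ (by rw [arity_pair]; omega)) (store_vals_ge _ (by rw [arity_pair]))
  rw [store_append_val, store_pair (a, x), arity_pair]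
  have hx : store (vals (a, x)) (arity α) = x := by simp [store_pair]
  rw [hx] at this
  exact this ((key (a, x)).trans hB)

/-- The value of `g` is left where `F` expects its last argument; afterwards the value of `F` is
moved down over it. -/
theorem LS.subst {F : α × ℕ → ℕ} (hF : LS E F) {g : α → ℕ} (hg : LS E g) :
    LS E fun a => F (a, g a) := by
  obtain ⟨c₁, K₁, h₁⟩ := hg
  obtain ⟨c₂, K₂, h₂⟩ := hF
  have hb : ∀ a, ctxSize E (a, g a) ^ K₂ ≤ ctxSize E a ^ ((K₁ + 2) * K₂) := fun a =>
    ctxSize_pair_pow_le a (h₁ a).1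
  have hK : ∀ a, F (a, g a) ≤ ctxSize E a ^ (K₁ + (K₁ + 2) * K₂) := fun a =>
    ((h₂ _).1.trans (hb a)).trans (ctxSize_pow_mono a (by omega))
  refine ⟨.seq c₁ (.seq c₂ (.seq (.clear (arity α)) (.transfer (arity α + 1) (arity α)))),
    K₁ + (K₁ + 2) * K₂, fun a => ⟨hK a, fun B hB => ?_⟩⟩
  refine .seq ((h₁ a).2 B ((ctxSize_pow_mono a (by omega)).trans hB))
    (.seq ((h₂ (a, g a)).2 B (((hb a).trans (ctxSize_pow_mono a (by omega))).trans hB)) (.seq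
      (Cmd.exec_clear _ _ _) ?_))
  have hstore : ∀ x y, store (vals (a, x) ++ [y]) = Function.update (Function.update
      (store (vals a)) (arity α) x) (arity α + 1) y := fun x y => by
    rw [store_append_val, store_pair (a, x), store_pair, arity_pair]
  rw [hstore]
  refine (Cmd.exec_transfer (w := word a) (B := B) (r := arity α + 1)
    (r' := arity α) (by omega) _ 0 ?_).of_eq (congrArg (·, 0) (funext fun j => ?_))
  rotate_left
  · rw [store_append_val, store_pair]
    by_cases e₁ : j = arity α
    · subst e₁; simp
    by_cases e₂ : j = arity α + 1
    · subst e₂; simp [store_vals_ge]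
    · simp [e₁, e₂]
  · simpa using (hK a).trans hB

/-- Primitive recursion. -/
def recNat (b : ℕ) (f : ℕ → ℕ → ℕ) : ℕ → ℕ
  | 0 => b
  | n + 1 => f n (recNat b f n)

/-- The loop uses three counters: the rounds left, the index and the value. As in limited recursion,
the bound on all intermediate values is a hypothesis of its own, since recursion may otherwise leave
the class. -/
theorem LS.recNat {n init : α → ℕ} {step : (α × ℕ) × ℕ → ℕ} (hn : LS E n) (hi : LS E init)
    (hs : LS E step)
    (hb : ∃ K, ∀ a, ∀ i ≤ n a,
      recNat (init a) (fun i y => step ((a, i), y)) i ≤ ctxSize E a ^ K) :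
    LS E fun a => recNat (init a) (fun i y => step ((a, i), y)) (n a) := by
  obtain ⟨K₀, hK₀⟩ := hb
  obtain ⟨cn, K₁, h₁⟩ := hn
  obtain ⟨ci, K₂, h₂⟩ := hi.lift.lift (α := (α × ℕ))
  obtain ⟨cs, K₃, h₃⟩ := hs.lift_mid₂
  set m := arity α with hm
  set R := fun a => G3.recNat (init a) (fun i y => step ((a, i), y)) with hR
  have hst : ∀ (a : α) k i y, store (vals (((a, k), i), y)) = Function.update (Function.update
      (Function.update (store (vals a)) m k) (m + 1) i) (m + 2) y := fun a k i y => by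
    rw [store_pair, store_pair, store_pair]; rfl
  have hz : ∀ (a : α) j, m ≤ j → store (vals a) j = 0 := fun a j h => store_vals_ge a h
  set body : Cmd Sym := .seq cs (.seq (.clear (m + 2)) (.seq (.transfer (m + 3) (m + 2))
    (.seq (.inc (m + 1)) (.dec m)))) with hbody
  have hsize : ∀ (a : α) k i y, k ≤ n a → i ≤ n a → y ≤ ctxSize E a ^ K₀ →
      ctxSize E (((a, k), i), y) ≤ ctxSize E a ^ (K₁ + K₀ + 3) := by
    intro a k i y hk hi hy
    rw [ctxSize_pair, ctxSize_pair, ctxSize_pair]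
    have e1 : ctxSize E a ≤ ctxSize E a ^ (K₁ + K₀ + 1) := Nat.le_self_pow (by omega) _
    have e2 : k ≤ ctxSize E a ^ (K₁ + K₀ + 1) :=
      (hk.trans (h₁ a).1).trans (ctxSize_pow_mono a (by omega))
    have e3 : i ≤ ctxSize E a ^ (K₁ + K₀ + 1) :=
      (hi.trans (h₁ a).1).trans (ctxSize_pow_mono a (by omega))
    have e4 : y ≤ ctxSize E a ^ (K₁ + K₀ + 1) := hy.trans (ctxSize_pow_mono a (by omega))
    have e5 := Nat.mul_le_mul_left (ctxSize E a ^ (K₁ + K₀ + 1)) (Nat.pow_le_pow_left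
      (two_le_ctxSize (E := E) a) 2)
    rw [show K₁ + K₀ + 3 = K₁ + K₀ + 1 + 2 from rfl, pow_add]
    omega
  -- The context enlarged by countdown, index and value is at most the `K₁ + K₀ + 3`-th power of the
  -- original one; the second factor exceeds all exponents that occur.
  set T := (K₁ + K₀ + 3) * (K₁ + K₂ + K₃ + K₀ + 1) with hT
  have hT' : ∀ (a : α) k i y, k ≤ n a → i ≤ n a → y ≤ ctxSize E a ^ K₀ →
      ∀ K ≤ K₁ + K₂ + K₃ + K₀ + 1, ctxSize E (((a, k), i), y) ^ K ≤ ctxSize E a ^ T := by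
    intro a k i y hk hi hy K hK
    refine (Nat.pow_le_pow_left (hsize a k i y hk hi hy) K).trans ?_
    rw [← pow_mul]
    exact ctxSize_pow_mono a (Nat.mul_le_mul_left _ hK)
  have hT1 : ∀ a : α, ∀ K ≤ K₁ + K₂ + K₃ + K₀ + 1, ctxSize E a ^ K ≤ ctxSize E a ^ T := by
    intro a K hK
    exact ctxSize_pow_mono a (hK.trans (Nat.le_mul_of_pos_left _ (by omega)))
  have hloop : ∀ (a : α) B, ctxSize E a ^ T ≤ B → ∀ k i, k + i = n a →
      Cmd.Exec (word a) B (.whileNZ m body) (store (vals (((a, k), i), R a i)), 0)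
        (store (vals (((a, 0), n a), R a (n a))), 0) := by
    intro a B hB k
    induction k with
    | zero =>
      intro i hi
      have : i = n a := by omega
      subst this
      exact .whileNZ_done (by rw [hst]; simp)
    | succ k ih =>
      intro i hik
      refine .whileNZ_step (by rw [hst]; simp) ?_ (ih (i + 1) (by omega))
      have hRi := hK₀ a i (by omega)
      have hRi' := hK₀ a (i + 1) (by omega)
      have e := (h₃ (((a, k + 1), i), R a i)).2 B
        ((hT' a (k + 1) i _ (by omega) (by omega) hRi K₃ (by omega)).trans hB)
      refine .seq e (.seq (Cmd.exec_clear _ _ _) (.seq (Cmd.exec_transfer (by omega) _ _ ?_)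
        (.seq (.inc ?_) ((Cmd.Exec.dec (n := k) ?_).of_eq ?_))))
      · rw [store_append_val, store_pair, hst]
        simp only [arity_pair, ← hm]
        simp
        exact (hRi'.trans (hT1 a K₀ (by omega))).trans hB
      · rw [store_append_val, store_pair, hst]
        simp only [arity_pair, ← hm]
        simp
        have := (h₁ a).1.trans (hT1 a K₁ (by omega))
        omega
      · rw [store_append_val, store_pair, hst]
        simp only [arity_pair, ← hm]
        simp [show ¬ m = m + 1 + 1 + 1 by omega]
      · rw [store_append_val, store_pair, hst, hst]
        simp only [arity_pair, ← hm]
        refine congrArg (·, 0) (funext fun j => ?_)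
        by_cases e0 : j = m
        · subst e0; simp
        by_cases e1 : j = m + 1
        · subst e1; simp
        by_cases e2 : j = m + 2
        · subst e2; simp; rfl
        by_cases e3 : j = m + 3
        · subst e3; simp [hz]
        · simp [e0, e1, e2, e3]
  refine ⟨.seq cn (.seq ci (.seq (.whileNZ m body) (.seq (.clear (m + 1))
    (.transfer (m + 2) m)))), T, fun a => ⟨(hK₀ a _ le_rfl).trans (hT1 a _ (by omega)),
    fun B hB => ?_⟩⟩
  have i₁ := (h₁ a).2 B ((hT1 a K₁ (by omega)).trans hB)
  have h0 : store (vals ((a, n a), 0)) = store (vals a ++ [n a]) := by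
    rw [store_append_val, store_pair, arity_pair]
    conv_rhs => rw [← Function.update_eq_self (arity α + 1) (store (vals (a, n a)))]
    rw [store_vals_ge _ (by rw [arity_pair])]
  have i₂ := (h₂ ((a, n a), 0)).2 B ((Nat.pow_le_pow_left (?_ : _ ≤ ctxSize E
    (((a, n a), 0), 0)) K₂).trans ((hT' a (n a) 0 0 le_rfl (by omega) (by omega) K₂
      (by omega)).trans hB))
  · rw [h0] at i₂
    refine .seq i₁ (.seq i₂ (.seq (hloop a B hB (n a) 0 (by omega)) (.seq (Cmd.exec_clear _ _ _)
      ((Cmd.exec_transfer (by omega) _ _ ?_).of_eq ?_))))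
    · rw [hst]; simp
      exact ((hK₀ a _ le_rfl).trans (hT1 a _ (by omega))).trans hB
    · rw [hst, store_append_val, store_pair]
      refine congrArg (·, 0) (funext fun j => ?_)
      by_cases e0 : j = m
      · subst e0; simp [hm, hR]
      by_cases e1 : j = m + 1
      · subst e1; simp [hz, ← hm]
      by_cases e2 : j = m + 2
      · subst e2; simp [hz, ← hm]
      · simp [e0, e1, e2, ← hm]
  · simp [ctxSize_pair]

/-- Iteration of `step` while `cond` does not vanish. -/
theorem LS.iterUntil {cond step : α × ℕ → ℕ} {init res : α → ℕ} (hc : LS E cond) (hs : LS E step)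
    (hi : LS E init) (hb : ∃ K, ∀ a, ∃ t, (∀ i < t, cond (a, (fun y => step (a, y))^[i] (init a)) ≠ 0)
      ∧ cond (a, (fun y => step (a, y))^[t] (init a)) = 0
      ∧ res a = (fun y => step (a, y))^[t] (init a)
      ∧ ∀ i ≤ t, (fun y => step (a, y))^[i] (init a) ≤ ctxSize E a ^ K) : LS E res := by
  obtain ⟨K₀, hK₀⟩ := hb
  obtain ⟨ci, K₁, h₁⟩ := hi
  obtain ⟨cc, K₂, h₂⟩ := hc
  obtain ⟨cs, K₃, h₃⟩ := hs
  set m := arity α with hm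
  set T := (K₀ + 2) * (K₁ + K₂ + K₃ + K₀ + 1) with hT
  have hT' : ∀ (a : α) y, y ≤ ctxSize E a ^ K₀ →
      ∀ K ≤ K₁ + K₂ + K₃ + K₀ + 1, ctxSize E (a, y) ^ K ≤ ctxSize E a ^ T := by
    intro a y hy K hK
    refine (ctxSize_pair_pow_le a hy).trans ?_
    exact ctxSize_pow_mono a (Nat.mul_le_mul_left _ hK)
  have hT1 : ∀ a : α, ∀ K ≤ K₁ + K₂ + K₃ + K₀ + 1, ctxSize E a ^ K ≤ ctxSize E a ^ T := by
    intro a K hK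
    exact ctxSize_pow_mono a (hK.trans (Nat.le_mul_of_pos_left _ (by omega)))
  have hz : ∀ (a : α) j, m ≤ j → store (vals a) j = 0 := fun a j h => store_vals_ge a h
  have hst : ∀ (a : α) y v, store (vals ((a, y), v)) = Function.update (Function.update
      (store (vals a)) m y) (m + 1) v := fun a y v => by
    rw [store_pair, store_pair]; rfl
  set body : Cmd Sym := .seq (.clear (m + 1)) (.seq cs (.seq (.clear m)
    (.seq (.transfer (m + 1) m) cc))) with hbody
  refine ⟨.seq ci (.seq cc (.whileNZ (m + 1) body)), T, fun a => ?_⟩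
  obtain ⟨t, ht, hct, hr, hbd⟩ := hK₀ a
  refine ⟨by rw [hr]; exact (hbd t le_rfl).trans (hT1 a _ (by omega)), fun B hB => ?_⟩
  -- The number `t` of rounds need not be bounded, as no counter records it. This is where time may
  -- become exponential while space does not.
  have hloop : ∀ k i, k + i = t → Cmd.Exec (word a) B (.whileNZ (m + 1) body)
      (store (vals ((a, (fun y => step (a, y))^[i] (init a)),
        cond (a, (fun y => step (a, y))^[i] (init a)))), 0)
      (store (vals a ++ [res a]), 0) := by
    intro k
    induction k with
    | zero =>
      intro i hi
      have : i = t := by omega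
      subst this
      refine (Cmd.Exec.whileNZ_done (by rw [hct, hst]; simp)).of_eq
        (congrArg (·, 0) (funext fun j => ?_))
      rw [hst, hct, hr, store_append_val, store_pair]
      by_cases e1 : j = m + 1
      · subst e1; simp [hz, ← hm]
      · simp [e1, ← hm]
    | succ k ih =>
      intro i hik
      have hne := ht i (by omega)
      refine .whileNZ_step (by rw [hst]; simpa using hne) ?_ (ih (i + 1) (by omega))
      rw [Function.iterate_succ_apply']
      have b₁ := hbd i (by omega)
      have b₂ := hbd (i + 1) (by omega)
      rw [Function.iterate_succ_apply'] at b₂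
      generalize (fun y => step (a, y))^[i] (init a) = y at b₁ b₂
      have e₁ := (h₃ (a, y)).2 B ((hT' a y b₁ K₃ (by omega)).trans hB)
      have e₂ := (h₂ (a, step (a, y))).2 B ((hT' a _ b₂ K₂ (by omega)).trans hB)
      refine .seq ((Cmd.exec_clear _ _ _).of_eq ?_) (.seq e₁ (.seq (Cmd.exec_clear _ _ _)
        (.seq ((Cmd.exec_transfer (by omega) _ _ ?_).of_eq ?_) e₂)))
      · rw [hst, store_pair]
        refine congrArg (·, 0) (funext fun j => ?_)
        by_cases e1 : j = m + 1
        · subst e1; simp [hz, ← hm]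
        · simp [e1, ← hm]
      · rw [store_append_val, hst]
        simp
        exact (b₂.trans (hT1 a _ (by omega))).trans hB
      · rw [store_append_val, hst, store_pair]
        refine congrArg (·, 0) (funext fun j => ?_)
        by_cases e0 : j = m
        · subst e0; simp [← hm]
        by_cases e1 : j = m + 1
        · subst e1; simp [hz, ← hm]
        · simp [e0, e1, ← hm]
  have b₀ := hbd 0 (by omega)
  exact .seq ((h₁ a).2 B ((hT1 a _ (by omega)).trans hB))
    (.seq ((h₂ (a, init a)).2 B ((hT' a _ b₀ K₂ (by omega)).trans hB)) (hloop t 0 (by omega)))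

/-- Numbers for the letters of the input and its end markers. -/
def symCode : InSym Sym → ℕ
  | .leftEnd => 0
  | .letter .var => 1
  | .letter .zero => 2
  | .letter .one => 3
  | .letter .bot => 4
  | .letter .and => 5
  | .letter .or => 6
  | .letter .imp => 7
  | .letter .box => 8
  | .letter .comma => 9
  | .letter .arrow => 10
  | .rightEnd => 11

/-- The letter at position `p` of the input tape that holds `w`. -/
def rd (w : List Sym) (p : ℕ) : ℕ := symCode (OfflineTM.readInput w p)

theorem rd_le (w : List Sym) (p : ℕ) : rd w p ≤ 11 := by
  unfold rd; rcases OfflineTM.readInput w p with _ | (_ | _) | _ <;> simp [symCode]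

/-- Add the number of the scanned letter, at most `k`, to counter `r`. -/
def Cmd.addSym (r : ℕ) : ℕ → Cmd Sym
  | 0 => .skip
  | k + 1 => .seq (Cmd.addSym r k) (.ifSym (fun x => decide (k + 1 ≤ symCode x)) (.inc r))

theorem Cmd.exec_addSym {w : List Sym} {B : ℕ} (r k : ℕ) (s : ℕ → ℕ) (p : ℕ)
    (hB : s r + rd w p ≤ B) :
    Exec w B (addSym r k) (s, p) (Function.update s r (s r + min k (rd w p)), p) := by
  induction k with
  | zero => simpa [addSym] using exec_skip (s, p)
  | succ k ih =>
    refine .seq ih ?_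
    by_cases h : k + 1 ≤ rd w p
    · refine .ifSym_true (decide_eq_true h) ((Exec.inc ?_).of_eq ?_)
      · simp; omega
      · simp only [Function.update_self, Function.update_idem]
        congr 2; omega
    · refine (Exec.ifSym_false (decide_eq_false h)).of_eq ?_
      congr 3; omega

theorem Cmd.exec_goto {w : List Sym} {B : ℕ} {r r' : ℕ} (hr : r ≠ r') (s : ℕ → ℕ) (p : ℕ)
    (hB : s r' + s r ≤ B) :
    Exec w B (whileNZ r (seq (dec r) (seq (inc r') (mv .right)))) (s, p)
      (Function.update (Function.update s r 0) r' (s r' + s r),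
        (OfflineTM.moveInput w .right)^[s r] p) := by
  generalize hn : s r = n
  induction n generalizing s p with
  | zero =>
    have h : Function.update s r 0 = s := by rw [← hn, Function.update_eq_self]
    rw [h, add_zero, Function.update_eq_self]; exact .whileNZ_done hn
  | succ n ih =>
    have := ih (Function.update (Function.update s r n) r' (s r' + 1))
      (OfflineTM.moveInput w .right p) (by simp [hr]; omega) (by simp [hr])
    refine .whileNZ_step (by simp [hn]) (.seq (.dec hn) (.seq (.inc ?_) .mv)) ?_
    · simp [hr.symm]; omega
    · have e : Function.update s r n r' = s r' := by simp [hr.symm]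
      rw [e, Function.iterate_succ_apply]
      refine this.of_eq (congrArg (·, _) (funext fun j => ?_))
      by_cases h₁ : j = r'
      · subst h₁; simp; omega
      · by_cases h₂ : j = r
        · subst h₂; simp [h₁]
        · simp [h₁, h₂]

theorem moveInput_right_iterate (w : List Sym) (p n : ℕ) (hp : p ≤ w.length + 1) :
    (OfflineTM.moveInput w .right)^[n] p = min (p + n) (w.length + 1) := by
  induction n with
  | zero => simp [hp]
  | succ n ih => rw [Function.iterate_succ_apply', ih]; simp [OfflineTM.moveInput]; omega

/-- The input head stops at the right end marker, and positions beyond it are read as that marker.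
-/
theorem rd_min (w : List Sym) (p : ℕ) : rd w (min p (w.length + 1)) = rd w p := by
  rcases le_total p (w.length + 1) with h | h
  · rw [min_eq_left h]
  · rw [min_eq_right h]
    obtain ⟨q, rfl⟩ : ∃ q, p = q + 1 := ⟨p - 1, by omega⟩
    simp [rd, OfflineTM.readInput, List.getElem?_eq_none (show w.length ≤ q by omega)]

/-- Move the input head to the left end. -/
def Cmd.home : Cmd Sym := .whileSym (fun x => decide (symCode x ≠ 0)) (.mv .left)

/-- Only the left end marker has the code 0, which is how the head recognizes home. -/
theorem rd_eq_zero {w : List Sym} {p : ℕ} : rd w p = 0 ↔ p = 0 := by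
  cases p with
  | zero => simp [rd, OfflineTM.readInput, symCode]
  | succ p =>
    simp only [rd, OfflineTM.readInput]
    split
    · rename_i a _; cases a <;> simp [symCode]
    · simp [symCode]

theorem Cmd.exec_home {w : List Sym} {B : ℕ} (s : ℕ → ℕ) (p : ℕ) :
    Exec w B home (s, p) (s, 0) := by
  induction p with
  | zero => exact .whileSym_done rfl
  | succ p ih =>
    refine .whileSym_step (decide_eq_true ?_) .mv ih
    exact fun h => by simpa using rd_eq_zero.1 h

/-- The head walks to the right while the position is counted down into an auxiliary counter, the
letter is added to the emptied counter, and the head returns. -/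
theorem LS.rd {p : α → ℕ} (hp : LS E p) : LS E fun a => rd (word a) (p a) := by
  obtain ⟨c, K, h⟩ := hp
  set m := arity α with hm
  have hz : ∀ (a : α) j, m ≤ j → store (vals a) j = 0 := fun a j h => store_vals_ge a h
  have b : ∀ a : α, G3.rd (word a) (p a) ≤ ctxSize E a ^ (K + 11) := fun a =>
    ((rd_le _ _).trans (le_ctxSize_two_pow a)).trans (ctxSize_pow_mono a (by omega))
  refine ⟨.seq c (.seq (.whileNZ m (.seq (.dec m) (.seq (.inc (m + 1)) (.mv .right))))
    (.seq (.addSym m 11) (.seq (.clear (m + 1)) .home))), K + 11, fun a => ⟨b a, fun B hB => ?_⟩⟩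
  refine .seq ((h a).2 B ((ctxSize_pow_mono a (by omega)).trans hB))
    (.seq (Cmd.exec_goto (by omega) _ _ ?_) (.seq (Cmd.exec_addSym _ _ _ _ ?_)
      (.seq (Cmd.exec_clear _ _ _) ((Cmd.exec_home _ _).of_eq ?_))))
  · rw [store_append_val, store_pair]
    simp [← hm, hz]
    exact ((h a).1.trans (ctxSize_pow_mono a (by omega))).trans hB
  · rw [moveInput_right_iterate _ _ _ (by omega), rd_min, store_append_val, store_pair]
    simp [← hm]
    exact (b a).trans hB
  · rw [moveInput_right_iterate _ _ _ (by omega), rd_min]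
    refine congrArg (·, 0) (funext fun j => ?_)
    rw [store_append_val, store_append_val, store_pair, store_pair]
    simp only [← hm]
    by_cases e0 : j = m
    · subst e0; simp [rd_le]
    by_cases e1 : j = m + 1
    · subst e1; simp [hz]
    · simp [e0, e1]

theorem rd_eq_eleven {w : List Sym} {p : ℕ} : rd w p = 11 ↔ w.length < p := by
  cases p with
  | zero => simp [rd, OfflineTM.readInput, symCode]
  | succ p =>
    simp only [rd, OfflineTM.readInput]
    split
    · rename_i a h
      have := (List.getElem?_eq_some_iff.1 h).1
      cases a <;> simp [symCode] <;> omega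
    · rename_i h
      have := List.getElem?_eq_none_iff.1 h
      simp [symCode]; omega

theorem Cmd.exec_count {w : List Sym} {B : ℕ} (r : ℕ) (hB : w.length ≤ B) (n : ℕ) (s : ℕ → ℕ) (p : ℕ)
    (hs : s r + n = w.length) (hp : p + n = w.length + 1) :
    Exec w B (whileSym (fun x => decide (symCode x ≠ 11)) (seq (inc r) (mv .right))) (s, p)
      (Function.update s r w.length, w.length + 1) := by
  induction n generalizing s p with
  | zero =>
    obtain rfl : p = w.length + 1 := by omega
    have : Function.update s r w.length = s := by rw [← hs, add_zero, Function.update_eq_self]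
    rw [this]
    refine .whileSym_done (decide_eq_false ?_)
    exact not_not.2 (rd_eq_eleven.2 (Nat.lt_succ_self _))
  | succ n ih =>
    have := ih (Function.update s r (s r + 1)) (p + 1) (by simp; omega) (by omega)
    rw [Function.update_idem] at this
    refine .whileSym_step (decide_eq_true ?_) (.seq (.inc (by omega)) (.mv)) ?_
    · intro h
      have := rd_eq_eleven.1 h
      simp at this; omega
    · have e : OfflineTM.moveInput w .right p = p + 1 := by simp [OfflineTM.moveInput]; omega
      rw [e]; exact this

theorem LS.length : LS E fun a : α => (word a).length := by
  set m := arity α with hm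
  have b : ∀ a : α, (word a).length ≤ ctxSize E a ^ 1 := fun a => by
    rw [pow_one, ctxSize]; omega
  refine ⟨.seq (.mv .right) (.seq (.whileSym (fun x => decide (symCode x ≠ 11))
    (.seq (.inc m) (.mv .right))) .home), 1, fun a => ⟨b a, fun B hB => ?_⟩⟩
  refine .seq .mv (.seq (Cmd.exec_count m ((b a).trans hB) (word a).length _ _ ?_ ?_)
    ((Cmd.exec_home _ _).of_eq ?_))
  · rw [store_vals_ge _ le_rfl]; simp
  · simp [OfflineTM.moveInput]; omega
  · rw [store_append_val, store_pair]

end LS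
end G3

/-! ### Closure properties: arithmetic, decidable properties, bounded search, arrays -/

namespace G3

open Ctx (word vals arity)

section Library

variable {E : List Sym → ℕ} {α : Type} [Ctx α]

theorem LS.congr {f g : α → ℕ} (hf : LS E f) (h : ∀ a, f a = g a) : LS E g := by
  rwa [← funext h]

variable (E) in
/-- Polynomially bounded functions. -/
def PB (f : α → ℕ) : Prop := ∃ K, ∀ a, f a ≤ ctxSize E a ^ K

theorem LS.pb {f : α → ℕ} (hf : LS E f) : PB E f := by
  obtain ⟨c, K, h⟩ := hf
  exact ⟨K, fun a => (h a).1⟩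

theorem PB.mono {f g : α → ℕ} (hf : PB E f) (h : ∀ a, g a ≤ f a) : PB E g := by
  obtain ⟨K, hK⟩ := hf
  exact ⟨K, fun a => (h a).trans (hK a)⟩

theorem PB.mul {f g : α → ℕ} (hf : PB E f) (hg : PB E g) : PB E fun a => f a * g a := by
  obtain ⟨K, hK⟩ := hf
  obtain ⟨K', hK'⟩ := hg
  exact ⟨K + K', fun a => by rw [pow_add]; exact Nat.mul_le_mul (hK a) (hK' a)⟩

theorem PB.const (n : ℕ) : PB E fun _ : α => n := (LS.const n).pb

theorem PB.add {f g : α → ℕ} (hf : PB E f) (hg : PB E g) : PB E fun a => f a + g a := by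
  obtain ⟨K, hK⟩ := hf
  obtain ⟨K', hK'⟩ := hg
  refine ⟨max K K' + 1, fun a => ?_⟩
  have h1 := (hK a).trans (ctxSize_pow_mono a (le_max_left K K'))
  have h2 := (hK' a).trans (ctxSize_pow_mono a (le_max_right K K'))
  have h3 := Nat.mul_le_mul_left (ctxSize E a ^ max K K') (two_le_ctxSize (E := E) a)
  simp only [pow_succ]; omega

theorem PB.param : PB E fun a : α => E (word a) :=
  ⟨1, fun a => by simp only [pow_one, ctxSize]; omega⟩

theorem LS.rec_of_le {n init b : α → ℕ} {step : (α × ℕ) × ℕ → ℕ} (hn : LS E n) (hi : LS E init)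
    (hs : LS E step) (hb : PB E b)
    (h : ∀ a, ∀ i ≤ n a, G3.recNat (init a) (fun i y => step ((a, i), y)) i ≤ b a) :
    LS E fun a => G3.recNat (init a) (fun i y => step ((a, i), y)) (n a) := by
  obtain ⟨K, hK⟩ := hb
  exact LS.recNat hn hi hs ⟨K, fun a i hi => (h a i hi).trans (hK a)⟩

theorem LS.add {f g : α → ℕ} (hf : LS E f) (hg : LS E g) : LS E fun a => f a + g a := by
  have e : ∀ a i, G3.recNat (f a) (fun _ y => y + 1) i = f a + i := fun a i => by
    induction i with
    | zero => rfl
    | succ i ih => simp [G3.recNat, ih]; omega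
  refine LS.congr (LS.rec_of_le (step := fun b => b.2 + 1) hg hf LS.var.succ (hf.pb.add hg.pb)
    fun a i hi => ?_) fun a => e a (g a)
  rw [e]; omega

theorem LS.mul {f g : α → ℕ} (hf : LS E f) (hg : LS E g) : LS E fun a => f a * g a := by
  have e : ∀ a i, G3.recNat 0 (fun _ y => y + f a) i = f a * i := fun a i => by
    induction i with
    | zero => rfl
    | succ i ih => simp [G3.recNat, ih, Nat.mul_succ]
  refine LS.congr (LS.rec_of_le (step := fun b => b.2 + f b.1.1) hg LS.zero
    (LS.var.add hf.lift.lift) (hf.pb.mul hg.pb) fun a i hi => ?_) fun a => e a (g a)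
  rw [e]; exact Nat.mul_le_mul_left _ hi

theorem LS.pred {f : α → ℕ} (hf : LS E f) : LS E fun a => f a - 1 := by
  have e : ∀ i, G3.recNat 0 (fun i _ => i) i = i - 1 := fun i => by cases i <;> rfl
  refine LS.congr (LS.rec_of_le (step := fun b : (α × ℕ) × ℕ => b.1.2) hf LS.zero
    LS.var.lift hf.pb fun a i hi => ?_) fun a => e (f a)
  rw [e]; omega

theorem LS.sub {f g : α → ℕ} (hf : LS E f) (hg : LS E g) : LS E fun a => f a - g a := by
  have e : ∀ a i, G3.recNat (f a) (fun _ y => y - 1) i = f a - i := fun a i => by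
    induction i with
    | zero => rfl
    | succ i ih => simp [G3.recNat, ih]; omega
  refine LS.congr (LS.rec_of_le (step := fun b => b.2 - 1) hg hf LS.var.pred hf.pb
    fun a i hi => ?_) fun a => e a (g a)
  rw [e]; omega

/-- A recursion whose step ignores the previous value: after no round the value is `g a`, after any
positive number of rounds it is `h a`. -/
theorem LS.cond {f g h : α → ℕ} (hf : LS E f) (hg : LS E g) (hh : LS E h) :
    LS E fun a => if f a = 0 then g a else h a := by
  have e : ∀ a i, G3.recNat (g a) (fun _ _ => h a) i = if i = 0 then g a else h a := fun a i => by
    cases i <;> rfl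
  refine LS.congr (LS.rec_of_le (step := fun b => h b.1.1) hf hg hh.lift.lift
    (hg.pb.add hh.pb) fun a i hi => ?_) fun a => e a (f a)
  rw [e]; split <;> omega

variable (E) in
/-- Decidable properties in the class. -/
def LSP (p : α → Prop) : Prop := ∃ f : α → ℕ, LS E f ∧ ∀ a, p a ↔ f a ≠ 0

theorem LSP.congr {p q : α → Prop} (hp : LSP E p) (h : ∀ a, p a ↔ q a) : LSP E q := by
  obtain ⟨f, hf, e⟩ := hp
  exact ⟨f, hf, fun a => (h a).symm.trans (e a)⟩

theorem LSP.lift {p : α → Prop} (hp : LSP E p) : LSP E fun a : α × ℕ => p a.1 := by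
  obtain ⟨f, hf, e⟩ := hp
  exact ⟨_, hf.lift, fun a => e a.1⟩

theorem LSP.ite {p : α → Prop} {g h : α → ℕ} (hp : LSP E p) (hg : LS E g) (hh : LS E h)
    [DecidablePred p] : LS E fun a => if p a then g a else h a := by
  obtain ⟨f, hf, e⟩ := hp
  refine (LS.cond hf hh hg).congr fun a => ?_
  by_cases hpa : p a
  · rw [if_pos hpa, if_neg ((e a).1 hpa)]
  · rw [if_neg hpa, if_pos (not_not.1 fun h => hpa ((e a).2 h))]

theorem LSP.not {p : α → Prop} (hp : LSP E p) : LSP E fun a => ¬ p a := by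
  obtain ⟨f, hf, e⟩ := hp
  exact ⟨_, LS.cond hf (LS.const 1) LS.zero, fun a => by simp only [e a]; split <;> simp_all⟩

theorem LSP.and {p q : α → Prop} (hp : LSP E p) (hq : LSP E q) : LSP E fun a => p a ∧ q a := by
  obtain ⟨f, hf, e⟩ := hp
  obtain ⟨g, hg, e'⟩ := hq
  exact ⟨_, hf.mul hg, fun a => by simp only [e a, e' a]; simp⟩

theorem LSP.or {p q : α → Prop} (hp : LSP E p) (hq : LSP E q) : LSP E fun a => p a ∨ q a := by
  obtain ⟨f, hf, e⟩ := hp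
  obtain ⟨g, hg, e'⟩ := hq
  exact ⟨_, hf.add hg, fun a => by simp only [e a, e' a]; omega⟩

theorem LS.le {f g : α → ℕ} (hf : LS E f) (hg : LS E g) : LSP E fun a => f a ≤ g a :=
  LSP.congr (p := fun a => ¬ (f a - g a ≠ 0)) (LSP.not ⟨_, hf.sub hg, fun _ => Iff.rfl⟩)
    fun a => by omega

theorem LS.lt {f g : α → ℕ} (hf : LS E f) (hg : LS E g) : LSP E fun a => f a < g a :=
  LS.le hf.succ hg

theorem LS.eq {f g : α → ℕ} (hf : LS E f) (hg : LS E g) : LSP E fun a => f a = g a :=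
  ((hf.le hg).and (hg.le hf)).congr fun a => by omega

theorem LS.ne {f g : α → ℕ} (hf : LS E f) (hg : LS E g) : LSP E fun a => f a ≠ g a :=
  (hf.eq hg).not

open Classical in
theorem LSP.ex {n : α → ℕ} {p : α → ℕ → Prop} (hn : LS E n) (hp : LSP E fun b : α × ℕ => p b.1 b.2) :
    LSP E fun a => ∃ i < n a, p a i := by
  have e : ∀ a k, G3.recNat 0 (fun i y => if p a i then 1 else y) k =
      if ∃ i < k, p a i then 1 else 0 := fun a k => by
    induction k with
    | zero => simp [G3.recNat]
    | succ k ih =>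
      simp only [G3.recNat, ih]
      by_cases h : p a k
      · rw [if_pos h, if_pos ⟨k, Nat.lt_succ_self k, h⟩]
      · rw [if_neg h]
        congr 1
        simp only [eq_iff_iff]
        constructor
        · rintro ⟨i, hi, hpi⟩; exact ⟨i, by omega, hpi⟩
        · rintro ⟨i, hi, hpi⟩
          refine ⟨i, ?_, hpi⟩
          rcases Nat.lt_succ_iff_lt_or_eq.1 hi with h' | rfl
          exacts [h', absurd hpi h]
  refine ⟨_, LS.rec_of_le (init := fun _ => 0)
    (step := fun b : (α × ℕ) × ℕ => if p b.1.1 b.1.2 then 1 else b.2) hn LS.zero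
    (LSP.ite hp.lift (LS.const 1) LS.var) (PB.const 1) fun a i hi => ?_, fun a => ?_⟩
  · simp only; rw [e]; split <;> simp
  · simp only; rw [e]; split <;> simp_all

theorem LSP.all {n : α → ℕ} {p : α → ℕ → Prop} (hn : LS E n)
    (hp : LSP E fun b : α × ℕ => p b.1 b.2) : LSP E fun a => ∀ i < n a, p a i :=
  (LSP.not (LSP.ex (p := fun a i => ¬ p a i) hn hp.not)).congr fun a => by push Not; rfl

open Classical in
/-- The least number below `n` with property `p`; `n` if there is none. -/
noncomputable def bmin (n : ℕ) (p : ℕ → Prop) : ℕ :=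
  G3.recNat 0 (fun i y => if y = i ∧ ¬ p i then i + 1 else y) n

open Classical in
theorem bmin_spec (n : ℕ) (p : ℕ → Prop) :
    bmin n p ≤ n ∧ (∀ i < bmin n p, ¬ p i) ∧ (bmin n p < n → p (bmin n p)) := by
  induction n with
  | zero => simp [bmin, recNat]
  | succ n ih =>
    have e : bmin (n + 1) p = if bmin n p = n ∧ ¬ p n then n + 1 else bmin n p := rfl
    obtain ⟨h1, h2, h3⟩ := ih
    rw [e]
    split
    · rename_i h
      refine ⟨le_rfl, fun i hi => ?_, by omega⟩
      rcases Nat.lt_succ_iff_lt_or_eq.1 hi with h' | rfl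
      exacts [h2 i (by omega), h.2]
    · rename_i h
      refine ⟨by omega, h2, fun _ => ?_⟩
      by_cases h4 : bmin n p = n
      · rw [h4]; by_contra h5; exact h ⟨h4, h5⟩
      · exact h3 (by omega)

theorem bmin_eq {n m : ℕ} {p : ℕ → Prop} (hm : m < n) (hp : p m) (h : ∀ i < m, ¬ p i) :
    bmin n p = m := by
  obtain ⟨h1, h2, h3⟩ := bmin_spec n p
  rcases lt_trichotomy (bmin n p) m with h4 | h4 | h4
  · exact absurd (h3 (by omega)) (h _ h4)
  · exact h4
  · exact absurd hp (h2 m h4)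

theorem LS.bmin {n : α → ℕ} {p : α → ℕ → Prop} (hn : LS E n)
    (hp : LSP E fun b : α × ℕ => p b.1 b.2) : LS E fun a => G3.bmin (n a) (p a) := by
  classical
  exact LS.rec_of_le (init := fun _ => 0)
    (step := fun b : (α × ℕ) × ℕ => if b.2 = b.1.2 ∧ ¬ p b.1.1 b.1.2 then b.1.2 + 1 else b.2)
    hn LS.zero (LSP.ite ((LS.var.eq LS.var.lift).and hp.lift.not) LS.var.lift.succ LS.var)
    hn.pb fun a i hi => le_trans (bmin_spec i (p a)).1 hi

/-- The quotient is the least `q` with `f a < (q + 1) * g a`; it is found by bounded search. -/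
theorem LS.div {f g : α → ℕ} (hf : LS E f) (hg : LS E g) : LS E fun a => f a / g a := by
  refine (LSP.ite (p := fun a => g a = 0) (hg.eq LS.zero) LS.zero
    (LS.bmin (p := fun a q => f a < (q + 1) * g a) hf.succ
      (hf.lift.lt (LS.var.succ.mul hg.lift)))).congr fun a => ?_
  split
  · rename_i h; simp [h]
  · rename_i h
    refine bmin_eq (Nat.lt_succ_of_le (Nat.div_le_self _ _)) ?_ fun i hi => ?_
    · exact (Nat.div_lt_iff_lt_mul (by omega)).1 (Nat.lt_succ_self _)
    · rw [not_lt]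
      exact (Nat.le_div_iff_mul_le (by omega)).1 hi

theorem LS.mod {f g : α → ℕ} (hf : LS E f) (hg : LS E g) : LS E fun a => f a % g a :=
  (hf.sub (hg.mul (hf.div hg))).congr fun _ => (Nat.mod_eq_sub _ _).symm

/-- By repeated division, because the power itself need not be polynomially bounded. Digits of a
number are extracted in this way. -/
theorem LS.divPow {f g h : α → ℕ} (hf : LS E f) (hg : LS E g) (hh : LS E h) :
    LS E fun a => f a / g a ^ h a := by
  have e : ∀ a k, G3.recNat (f a) (fun _ y => y / g a) k = f a / g a ^ k := fun a k => by
    induction k with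
    | zero => simp [G3.recNat]
    | succ k ih => simp only [G3.recNat, ih, Nat.div_div_eq_div_mul, pow_succ]
  refine LS.congr (LS.rec_of_le (step := fun b => b.2 / g b.1.1) hh hf
    (LS.var.div hg.lift.lift) hf.pb fun a i hi => ?_) fun a => e a (h a)
  rw [e]; exact Nat.div_le_self _ _

theorem LS.count {n : α → ℕ} {p : α → ℕ → Prop} [∀ a, DecidablePred (p a)] (hn : LS E n)
    (hp : LSP E fun b : α × ℕ => p b.1 b.2) : LS E fun a => Nat.count (p a) (n a) := by
  classical
  have e : ∀ a k, G3.recNat 0 (fun i y => y + if p a i then 1 else 0) k = Nat.count (p a) k :=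
    fun a k => by
      induction k with
      | zero => simp [G3.recNat]
      | succ k ih => simp only [G3.recNat, ih, Nat.count_succ]
  refine LS.congr (LS.rec_of_le
    (step := fun b : (α × ℕ) × ℕ => b.2 + if p b.1.1 b.1.2 then 1 else 0) hn LS.zero
    (LS.var.add (LSP.ite hp.lift (LS.const 1) LS.zero)) hn.pb fun a i hi => ?_) fun a => e a (n a)
  rw [e]; exact (Nat.count_le _).trans hi

/-- The entry `u` of an array with entries below 16. -/
def get (s u : ℕ) : ℕ := s / 16 ^ u % 16

/-- The array of length `n` with entries `f u`. -/
def mkArr (n : ℕ) (f : ℕ → ℕ) : ℕ := G3.recNat 0 (fun i y => y * 16 + f (n - 1 - i) % 16) n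

theorem LS.get {f g : α → ℕ} (hf : LS E f) (hg : LS E g) : LS E fun a => G3.get (f a) (g a) :=
  (hf.divPow (LS.const 16) hg).mod (LS.const 16)

theorem arr_lt (d : ℕ → ℕ) (k : ℕ) : G3.recNat 0 (fun i y => y * 16 + d i % 16) k < 16 ^ k := by
  induction k with
  | zero => simp [G3.recNat]
  | succ k ih =>
    simp only [G3.recNat, pow_succ]
    have := Nat.mod_lt (d k) (show 0 < 16 by norm_num)
    omega

theorem get_arr (d : ℕ → ℕ) (k u : ℕ) (hu : u < k) :
    get (G3.recNat 0 (fun i y => y * 16 + d i % 16) k) u = d (k - 1 - u) % 16 := by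
  induction k generalizing u with
  | zero => omega
  | succ k ih =>
    simp only [G3.recNat]
    have hlt := Nat.mod_lt (d k) (show 0 < 16 by norm_num)
    cases u with
    | zero => simp [get]
    | succ u =>
      have := ih u (by omega)
      rw [show k + 1 - 1 - (u + 1) = k - 1 - u by omega, ← this]
      simp only [get]
      rw [pow_succ', ← Nat.div_div_eq_div_mul]
      congr 2; omega

theorem get_mkArr {n u : ℕ} (hu : u < n) (f : ℕ → ℕ) : get (mkArr n f) u = f u % 16 := by
  rw [mkArr, get_arr _ _ _ hu]
  congr 2; omega

theorem mkArr_lt (n : ℕ) (f : ℕ → ℕ) : mkArr n f < 16 ^ n := arr_lt _ _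

theorem LS.mkArr {n : α → ℕ} {f : α → ℕ → ℕ} (hn : LS E n) (hf : LS E fun b : α × ℕ => f b.1 b.2)
    (hb : PB E fun a => 16 ^ n a) : LS E fun a => G3.mkArr (n a) (f a) := by
  -- The entry with the largest index is the most significant digit and is written first, hence the
  -- reversed index. The renaming skips the two counters that the recursion adds.
  have hs : LS E fun b : (α × ℕ) × ℕ => f b.1.1 (n b.1.1 - 1 - b.1.2) := by
    refine LS.subst (F := fun c : ((α × ℕ) × ℕ) × ℕ => f c.1.1.1 c.2) ?_
      ((hn.lift.lift.sub (LS.const 1)).sub LS.var.lift)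
    refine hf.rename (fun c : ((α × ℕ) × ℕ) × ℕ => (c.1.1.1, c.2)) (fun _ => rfl)
      (fun a => by simp [vals]; omega) (fun i => if i < arity α then i else i + 2)
      (fun i j h => by simp only at h; split at h <;> split at h <;> omega)
      (fun ⟨⟨⟨a, x⟩, y⟩, z⟩ i => ?_) (by simp [arity_pair])
    simp only [store_pair, arity_pair]
    by_cases hi : i < arity α
    · simp [hi, show ¬ i = arity α by omega, show ¬ i = arity α + 1 by omega,
        show ¬ i = arity α + 1 + 1 by omega]
    · by_cases h1 : i = arity α
      · subst h1; simp
      · simp [hi, h1, show ¬ i + 2 = arity α by omega, show ¬ i + 1 = arity α by omega]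
        rw [store_vals_ge _ (by omega), store_vals_ge _ (by omega)]
  refine LS.rec_of_le (init := fun _ => 0)
    (step := fun b : (α × ℕ) × ℕ => b.2 * 16 + f b.1.1 (n b.1.1 - 1 - b.1.2) % 16) hn LS.zero
    ((LS.var.mul (LS.const 16)).add (hs.mod (LS.const 16))) hb fun a i hi => ?_
  exact (arr_lt (fun i => f a (n a - 1 - i)) i).le.trans (Nat.pow_le_pow_right (by norm_num) hi)

end Library
end G3

/-! ### Composition with functions of the word and one or two numbers -/

namespace G3

open Ctx (word vals arity)

section Comp

variable {E : List Sym → ℕ} {α : Type} [Ctx α]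

theorem LS.comp₀ {F : List Sym → ℕ} (hF : LS E F) : LS E fun a : α => F (word a) := by
  refine hF.rename (fun a : α => (word a : List Sym)) (fun _ => rfl) (fun a => by simp [vals])
    (fun i => i + arity α) (fun i j h => by simpa using h) (fun a i => ?_) (by simp [arity])
  rw [store_vals_ge _ (by omega), store_vals_ge _ (by simp [arity])]

theorem LS.comp₁ {F : List Sym → ℕ → ℕ} (hF : LS E fun b : List Sym × ℕ => F b.1 b.2)
    {f : α → ℕ} (hf : LS E f) : LS E fun a : α => F (word a) (f a) := by
  refine LS.subst (F := fun b : α × ℕ => F (word b.1) b.2) ?_ hf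
  refine hF.rename (fun b : α × ℕ => ((word b.1, b.2) : List Sym × ℕ)) (fun _ => rfl)
    (fun a => by simp [vals])
    (fun i => i + arity α) (fun i j h => by simpa using h) (fun a i => ?_)
    (by simp [arity, add_comm])
  obtain ⟨a, x⟩ := a
  simp only [store_pair]
  by_cases hi : i = 0
  · subst hi; simp [arity]
  · simp only [Function.update_of_ne (show i + arity α ≠ arity α by omega),
      Function.update_of_ne (show i ≠ arity (List Sym) from hi)]
    rw [store_vals_ge _ (by omega), store_vals_ge _ (by simp [arity])]

theorem LS.comp₂ {F : List Sym → ℕ → ℕ → ℕ} (hF : LS E fun b : (List Sym × ℕ) × ℕ => F b.1.1 b.1.2 b.2)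
    {f g : α → ℕ} (hf : LS E f) (hg : LS E g) : LS E fun a : α => F (word a) (f a) (g a) := by
  refine LS.subst (F := fun b : α × ℕ => F (word b.1) (f b.1) b.2) ?_ hg
  have h : LS E fun b : (α × ℕ) × ℕ => F (word b.1.1) b.2 b.1.2 := by
    refine LS.subst (F := fun c : ((α × ℕ) × ℕ) × ℕ => F (word c.1.1.1) c.1.2 c.2) ?_ LS.var.lift
    refine hF.rename (fun c : ((α × ℕ) × ℕ) × ℕ => (((word c.1.1.1, c.1.2), c.2) :
      (List Sym × ℕ) × ℕ)) (fun _ => rfl) (fun a => by simp [vals]; omega)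
      (fun i => i + (arity α + 1)) (fun i j h => by simpa using h) (fun a i => ?_)
      (by simp [arity]; omega)
    obtain ⟨⟨⟨a, z⟩, x⟩, y⟩ := a
    simp only [store_pair]
    by_cases hi : i = 0
    · subst hi; simp [arity]
    by_cases hi' : i = 1
    · subst hi'; simp [arity, add_comm]
    · simp [arity, hi, hi', show ¬ i + (arity α + 1) = arity α + 1 + 1 by omega,
        show ¬ i + (arity α + 1) = arity α by omega]
      rw [store_vals_ge _ (by omega), store_vals_ge _ (by simp [arity])]
  exact LS.subst h (hf.lift)

end Comp

/-! Depth-first evaluation of AND-OR trees. -/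

section Game

variable (kind : ℕ → ℕ) (next : ℕ → ℕ → ℕ) (D init : ℕ)

/-- The value of a position of an AND-OR tree with `D` moves in each inner position, with at most
`k` moves left: kind 1 is won, 2 is an AND- and 3 an OR-position, all others are lost. -/
def gval : ℕ → ℕ → Prop
  | 0, s => kind s = 1
  | k + 1, s => kind s = 1 ∨ (kind s = 2 ∧ ∀ d < D, gval k (next s d)) ∨
      (kind s = 3 ∧ ∃ d < D, gval k (next s d))

/-- All plays from a position end within `k` moves. -/
def Bdd : ℕ → ℕ → Prop
  | 0, s => kind s ≠ 2 ∧ kind s ≠ 3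
  | k + 1, s => kind s = 2 ∨ kind s = 3 → ∀ d < D, Bdd k (next s d)

/-- The position after the moves that are the digits of `x` in base `D + 2`, each increased by 1. -/
def pathState (x : ℕ) : ℕ :=
  if h : x = 0 then init
  else next (pathState (x / (D + 2))) (x % (D + 2) - 1)
termination_by x
decreasing_by exact Nat.div_lt_self (Nat.pos_of_ne_zero h) (by omega)

theorem pathState_zero : pathState next D init 0 = init := by rw [pathState]; simp

theorem pathState_of_ne {x : ℕ} (h : x ≠ 0) : pathState next D init x =
    next (pathState next D init (x / (D + 2))) (x % (D + 2) - 1) := by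
  rw [pathState]; simp [h]

theorem child_div {D x d : ℕ} (hd : d < D) : (x * (D + 2) + (d + 1)) / (D + 2) = x := by
  rw [Nat.mul_comm, Nat.mul_add_div (by omega), Nat.div_eq_of_lt (by omega), add_zero]

theorem child_mod {D x d : ℕ} (hd : d < D) : (x * (D + 2) + (d + 1)) % (D + 2) = d + 1 := by
  rw [Nat.mul_comm, Nat.mul_add_mod, Nat.mod_eq_of_lt (by omega)]

theorem pathState_child {x d : ℕ} (hd : d < D) :
    pathState next D init (x * (D + 2) + (d + 1)) = next (pathState next D init x) d := by
  rw [pathState_of_ne _ _ _ (by omega), child_div hd, child_mod hd]; rfl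

open Classical in
/-- One step of the evaluation of an AND-OR tree; a stage `3 * x + m` is at the path `x`, on the way
down for `m = 0` and on the way up with value `false` or `true` for `m = 1, 2`. -/
noncomputable def dfsStep (y : ℕ) : ℕ :=
  if y % 3 = 0 then
    if kind (pathState next D init (y / 3)) = 1 then y / 3 * 3 + 2
    else if kind (pathState next D init (y / 3)) = 2 ∨ kind (pathState next D init (y / 3)) = 3 then
      (y / 3 * (D + 2) + 1) * 3
    else y / 3 * 3 + 1
  else
    if (kind (pathState next D init (y / 3 / (D + 2))) = 3 ∧ y % 3 = 2) ∨
      (kind (pathState next D init (y / 3 / (D + 2))) = 2 ∧ y % 3 = 1) ∨ D ≤ y / 3 % (D + 2) then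
      y / 3 / (D + 2) * 3 + y % 3
    else (y / 3 + 1) * 3

/-- Steps of the evaluation that stay below `b` and do not start from a final stage. -/
def DfsStep (b y z : ℕ) : Prop :=
  z = dfsStep kind next D init y ∧ ¬ (y % 3 ≠ 0 ∧ y / 3 = 0) ∧ y ≤ b ∧ z ≤ b

variable {kind next D init}

theorem not_final_of_pos {y : ℕ} (h : y / 3 ≠ 0) : ¬ (y % 3 ≠ 0 ∧ y / 3 = 0) := fun h' => h h'.2

open Classical in
-- Induction on the number `n` of siblings after child `d`: evaluation that enters child `d` comes
-- back to the parent with the conjunction or disjunction of the values from `d` on, possibly cut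
-- short.
theorem dfs_children {b k x : ℕ} (hD : 0 < D)
    (hx : kind (pathState next D init x) = 2 ∨ kind (pathState next D init x) = 3)
    (hb : ∀ d < D, (x * (D + 2) + (d + 1)) * 3 + 2 ≤ b)
    (ih : ∀ d < D, Relation.ReflTransGen (DfsStep kind next D init b)
      ((x * (D + 2) + (d + 1)) * 3) ((x * (D + 2) + (d + 1)) * 3 +
        if gval kind next D k (next (pathState next D init x) d) then 2 else 1)) (n : ℕ) :
    ∀ d, d + n + 1 = D → Relation.ReflTransGen (DfsStep kind next D init b)
      ((x * (D + 2) + (d + 1)) * 3) (x * 3 +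
        if (kind (pathState next D init x) = 2 ∧
            ∀ e < D, d ≤ e → gval kind next D k (next (pathState next D init x) e)) ∨
          (kind (pathState next D init x) = 3 ∧
            ∃ e < D, d ≤ e ∧ gval kind next D k (next (pathState next D init x) e))
          then 2 else 1) := by
  set s := pathState next D init x with hs
  have hxb : x * 3 + 2 ≤ b := by
    have := hb 0 hD
    nlinarith
  -- The last digit of the path is `d + 1`, so `D ≤ d + 1` means that child `d` is the last one;
  -- otherwise the path of the next sibling is obtained by adding 1.
  have step : ∀ d < D, ∀ m, m = 1 ∨ m = 2 →
      dfsStep kind next D init ((x * (D + 2) + (d + 1)) * 3 + m) =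
        if (kind s = 3 ∧ m = 2) ∨ (kind s = 2 ∧ m = 1) ∨ D ≤ d + 1 then x * 3 + m
        else (x * (D + 2) + (d + 1 + 1)) * 3 := by
    intro d hd m hm
    have h1 : ((x * (D + 2) + (d + 1)) * 3 + m) % 3 = m := by omega
    have h2 : ((x * (D + 2) + (d + 1)) * 3 + m) / 3 = x * (D + 2) + (d + 1) := by omega
    have h3 : m ≠ 0 := by omega
    unfold dfsStep
    rw [h1, h2, if_neg h3, child_div hd, child_mod hd, ← hs]
    rfl
  have fin : ∀ d < D, ∀ m, m = 1 ∨ m = 2 → ∀ z, z ≤ b →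
      z = dfsStep kind next D init ((x * (D + 2) + (d + 1)) * 3 + m) →
      DfsStep kind next D init b ((x * (D + 2) + (d + 1)) * 3 + m) z := by
    intro d hd m hm z hz h
    exact ⟨h, not_final_of_pos (by omega), by have := hb d hd; omega, hz⟩
  induction n with
  | zero =>
    intro d hdn
    have hd : d < D := by omega
    refine (ih d hd).tail (fin d hd _ (by split <;> simp) _ (by split <;> omega) ?_)
    have e2 : ∀ m, m = 1 ∨ m = 2 →
        dfsStep kind next D init ((x * (D + 2) + (d + 1)) * 3 + m) = x * 3 + m := fun m hm =>
      (step d hd m hm).trans (if_pos (.inr (.inr (by omega))))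
    rw [e2 _ (by split <;> simp)]
    congr 2
    refine propext ?_
    have he : ∀ e < D, d ≤ e → e = d := fun e h1 h2 => by omega
    constructor
    · rintro (⟨-, h⟩ | ⟨-, e, h1, h2, h⟩)
      · exact h d hd le_rfl
      · rwa [he e h1 h2] at h
    · intro h
      rcases hx with hx | hx
      · exact .inl ⟨hx, fun e h1 h2 => by rwa [he e h1 h2]⟩
      · exact .inr ⟨hx, d, hd, le_rfl, h⟩
  | succ n ihn =>
    intro d hdn
    have hd : d < D := by omega
    have hnext := ihn (d + 1) (by omega)
    by_cases hg : gval kind next D k (next s d)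
    · have e1 := ih d hd
      rw [if_pos hg] at e1
      rcases hx with hx | hx
      · refine e1.trans (.head (fin d hd 2 (.inr rfl) _ ?_ ?_) (hnext.trans ?_))
        · have := hb (d + 1) (by omega); omega
        · rw [step d hd 2 (.inr rfl), if_neg (by simp [hx]; omega)]
        · have : ((kind s = 2 ∧ ∀ e < D, d + 1 ≤ e → gval kind next D k (next s e)) ∨
            kind s = 3 ∧ ∃ e < D, d + 1 ≤ e ∧ gval kind next D k (next s e)) ↔
            ((kind s = 2 ∧ ∀ e < D, d ≤ e → gval kind next D k (next s e)) ∨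
            kind s = 3 ∧ ∃ e < D, d ≤ e ∧ gval kind next D k (next s e)) := by
            simp only [hx]
            simp
            constructor
            · intro h e he hde
              rcases hde.eq_or_lt with rfl | h'
              exacts [hg, h e he h']
            · exact fun h e he hde => h e he (by omega)
          simp only [this]
          exact .refl
      · refine e1.tail (fin d hd 2 (.inr rfl) _ ?_ ?_)
        · split <;> omega
        · have e2 := step d hd 2 (.inr rfl)
          rw [if_pos (.inl ⟨hx, rfl⟩)] at e2
          rw [e2, if_pos]
          exact .inr ⟨hx, d, hd, le_rfl, hg⟩
    · have e1 := ih d hd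
      rw [if_neg hg] at e1
      rcases hx with hx | hx
      · refine e1.tail (fin d hd 1 (.inl rfl) _ ?_ ?_)
        · split <;> omega
        · have e2 := step d hd 1 (.inl rfl)
          rw [if_pos (.inr (.inl ⟨hx, rfl⟩))] at e2
          rw [e2, if_neg]
          rintro (⟨-, h⟩ | ⟨h, -⟩)
          · exact hg (h d hd le_rfl)
          · omega
      · refine e1.trans (.head (fin d hd 1 (.inl rfl) _ ?_ ?_) (hnext.trans ?_))
        · have := hb (d + 1) (by omega); omega
        · rw [step d hd 1 (.inl rfl), if_neg (by simp [hx]; omega)]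
        · have : ((kind s = 2 ∧ ∀ e < D, d + 1 ≤ e → gval kind next D k (next s e)) ∨
            kind s = 3 ∧ ∃ e < D, d + 1 ≤ e ∧ gval kind next D k (next s e)) ↔
            ((kind s = 2 ∧ ∀ e < D, d ≤ e → gval kind next D k (next s e)) ∨
            kind s = 3 ∧ ∃ e < D, d ≤ e ∧ gval kind next D k (next s e)) := by
            simp only [hx]
            simp
            constructor
            · rintro ⟨e, h1, h2, h3⟩; exact ⟨e, h1, by omega, h3⟩
            · rintro ⟨e, h1, h2, h3⟩
              rcases h2.eq_or_lt with rfl | h'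
              exacts [absurd h3 hg, ⟨e, h1, h', h3⟩]
          simp only [this]
          exact .refl

open Classical in
-- Induction on the moves left. The bound is inherited by the children, since `x * (D + 2) + (d + 1)
-- + 1 ≤ (x + 1) * (D + 2)` for `d < D`.
theorem dfs_eval {b : ℕ} (hD : 0 < D) (k : ℕ) : ∀ x, Bdd kind next D k (pathState next D init x) →
    (x + 1) * (D + 2) ^ k * 3 ≤ b →
    Relation.ReflTransGen (DfsStep kind next D init b) (x * 3)
      (x * 3 + if gval kind next D k (pathState next D init x) then 2 else 1) := by
  induction k with
  | zero =>
    intro x hx hb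
    obtain ⟨h2, h3⟩ := hx
    rw [pow_zero, mul_one] at hb
    refine .single ⟨?_, by omega, by omega, by split <;> omega⟩
    have e1 : x * 3 % 3 = 0 := by omega
    have e2 : x * 3 / 3 = x := by omega
    unfold dfsStep
    rw [if_pos e1, e2]
    simp only [gval]
    by_cases h : kind (pathState next D init x) = 1
    · simp [h]
    · simp [h, h2, h3]
  | succ k ih =>
    intro x hx hb
    have hpos : 1 ≤ (D + 2) ^ k := Nat.one_le_pow _ _ (by omega)
    have e1 : x * 3 % 3 = 0 := by omega
    have e2 : x * 3 / 3 = x := by omega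
    have hdb : ∀ d < D, (x * (D + 2) + (d + 1) + 1) * (D + 2) ^ k * 3 ≤ b := by
      intro d hd
      refine le_trans (Nat.mul_le_mul_right 3 ?_) hb
      rw [pow_succ', ← mul_assoc]
      exact Nat.mul_le_mul_right _ (by nlinarith)
    have hchild : ∀ d < D, (x * (D + 2) + (d + 1)) * 3 + 2 ≤ b := by
      intro d hd
      have := hdb d hd
      have h2 := Nat.mul_le_mul_left ((x * (D + 2) + (d + 1) + 1) * 3) hpos
      nlinarith
    have hxb : x * 3 + 2 ≤ b := by
      have := hchild 0 hD
      nlinarith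
    by_cases h23 : kind (pathState next D init x) = 2 ∨ kind (pathState next D init x) = 3
    · have hstep : DfsStep kind next D init b (x * 3) ((x * (D + 2) + (0 + 1)) * 3) := by
        refine ⟨?_, by omega, by omega, by have := hchild 0 hD; omega⟩
        unfold dfsStep
        rw [if_pos e1, e2, if_neg (by omega), if_pos h23]
      refine .head hstep ?_
      have hc := dfs_children (k := k) hD h23 hchild (fun d hd => by
        have := ih (x * (D + 2) + (d + 1)) (by
          rw [pathState_child _ _ _ hd]; exact hx h23 d hd) (hdb d hd)
        rwa [pathState_child _ _ _ hd] at this) (D - 1) 0 (by omega)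
      convert hc using 3
      simp only [gval, Nat.zero_le, true_imp_iff, true_and]
      constructor
      · rintro (h | h | h)
        · omega
        · exact .inl h
        · exact .inr h
      · rintro (h | h)
        · exact .inr (.inl h)
        · exact .inr (.inr h)
    · refine .single ⟨?_, by omega, by omega, by split <;> omega⟩
      unfold dfsStep
      rw [if_pos e1, e2]
      simp only [gval]
      push Not at h23
      by_cases h : kind (pathState next D init x) = 1
      · simp [h]
      · simp [h, h23]

theorem DfsStep.exists_iterate {b y z : ℕ} (h : Relation.ReflTransGen (DfsStep kind next D init b) y z)
    (hz : z ≤ b) : ∃ t, (dfsStep kind next D init)^[t] y = z ∧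
      (∀ i < t, ¬ (((dfsStep kind next D init)^[i] y) % 3 ≠ 0 ∧
        ((dfsStep kind next D init)^[i] y) / 3 = 0)) ∧
      ∀ i ≤ t, (dfsStep kind next D init)^[i] y ≤ b := by
  induction h using Relation.ReflTransGen.head_induction_on with
  | refl => exact ⟨0, rfl, by simp, fun i hi => by simpa [Nat.le_zero.1 hi] using hz⟩
  | head h _ ih =>
    obtain ⟨t, h1, h2, h3⟩ := ih
    obtain ⟨rfl, h4, h5, -⟩ := h
    refine ⟨t + 1, by rw [Function.iterate_succ_apply, h1], fun i hi => ?_, fun i hi => ?_⟩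
    · cases i with
      | zero => exact h4
      | succ i => rw [Function.iterate_succ_apply]; exact h2 i (by omega)
    · cases i with
      | zero => exact h5
      | succ i => rw [Function.iterate_succ_apply]; exact h3 i (by omega)

end Game

/-! ### The space needed to evaluate AND-OR trees -/

section GameLS

variable {E : List Sym → ℕ} {kind : List Sym → ℕ → ℕ} {next : List Sym → ℕ → ℕ → ℕ}
  {D L init : List Sym → ℕ}

/-- The digits of a path are read from the top, with only the current position as memory. Reading
`x` digits is always enough because `x < (D + 2) ^ x`, and leading zeros change nothing. -/
theorem pathState_eq_rec (next : ℕ → ℕ → ℕ) (D init x : ℕ) :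
    pathState next D init x = recNat init (fun i s =>
      if x / (D + 2) ^ (x - 1 - i) = 0 then s
      else next s (x / (D + 2) ^ (x - 1 - i) % (D + 2) - 1)) x := by
  have key : ∀ i ≤ x, recNat init (fun i s =>
      if x / (D + 2) ^ (x - 1 - i) = 0 then s
      else next s (x / (D + 2) ^ (x - 1 - i) % (D + 2) - 1)) i =
      pathState next D init (x / (D + 2) ^ (x - i)) := by
    intro i
    induction i with
    | zero =>
      intro _
      rw [Nat.sub_zero, Nat.div_eq_of_lt (Nat.lt_pow_self (by omega)), pathState_zero]; rfl
    | succ i ih =>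
      intro hi
      simp only [recNat]
      rw [ih (by omega)]
      have e : x - i = x - 1 - i + 1 := by omega
      have e' : x - (i + 1) = x - 1 - i := by omega
      rw [e, e', pow_succ, ← Nat.div_div_eq_div_mul]
      split
      · rename_i h; rw [h]; simp [pathState_zero]
      · rename_i h; rw [pathState_of_ne _ _ _ h]
  rw [key x le_rfl]; simp

theorem LS.pathState (hn : LS E fun b : (List Sym × ℕ) × ℕ => next b.1.1 b.1.2 b.2)
    (hi : LS E init) (hD : LS E D) (hb : ∀ w s d, next w s d ≤ E w) (hb' : ∀ w, init w ≤ E w) :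
    LS E fun b : List Sym × ℕ => pathState (next b.1) (D b.1) (init b.1) b.2 := by
  refine LS.congr (LS.rec_of_le (α := List Sym × ℕ) (n := fun b => b.2) (init := fun b => init b.1)
    (step := fun c => if c.1.1.2 / (D (word c.1.1) + 2) ^ (c.1.1.2 - 1 - c.1.2) = 0 then c.2
      else next (word c.1.1) c.2
        (c.1.1.2 / (D (word c.1.1) + 2) ^ (c.1.1.2 - 1 - c.1.2) % (D (word c.1.1) + 2) - 1))
    (b := fun b => E (word b)) LS.var hi.lift ?_ PB.param ?_)
    fun b => (pathState_eq_rec (next b.1) (D b.1) (init b.1) b.2).symm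
  · have hx : LS E fun c : ((List Sym × ℕ) × ℕ) × ℕ => c.1.1.2 := LS.var.lift.lift
    have hD' : LS E fun c : ((List Sym × ℕ) × ℕ) × ℕ => D (word c.1.1) + 2 := hD.comp₀.succ.succ
    have hp : LS E fun c : ((List Sym × ℕ) × ℕ) × ℕ =>
        c.1.1.2 / (D (word c.1.1) + 2) ^ (c.1.1.2 - 1 - c.1.2) :=
      hx.divPow hD' ((hx.sub (LS.const 1)).sub LS.var.lift)
    exact LSP.ite (hp.eq LS.zero) LS.var (LS.comp₂ hn LS.var ((hp.mod hD').sub (LS.const 1)))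
  · rintro ⟨w, x⟩ i -
    induction i with
    | zero => exact hb' w
    | succ i ih =>
      simp only [G3.recNat]
      split
      · exact ih
      · exact hb _ _ _

open Classical in
/-- The values of AND-OR trees of polynomial depth are in the class. -/
theorem LSP.game (hk : LS E fun b : List Sym × ℕ => kind b.1 b.2)
    (hn : LS E fun b : (List Sym × ℕ) × ℕ => next b.1.1 b.1.2 b.2)
    (hi : LS E init) (hD : LS E D) (hb : ∀ w s d, next w s d ≤ E w) (hb' : ∀ w, init w ≤ E w)
    (hD0 : ∀ w, 0 < D w) (hL : PB E fun w : List Sym => (D w + 2) ^ L w)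
    (hbdd : ∀ w, Bdd (kind w) (next w) (D w) (L w) (init w)) :
    LSP E fun w => gval (kind w) (next w) (D w) (L w) (init w) := by
  have hps := LS.pathState hn hi hD hb hb'
  have hkp : LS E fun b : List Sym × ℕ =>
      kind b.1 (G3.pathState (next b.1) (D b.1) (init b.1) b.2) := LS.comp₁ hk hps
  have hkp' : ∀ {f : List Sym × ℕ → ℕ}, LS E f → LS E fun b : List Sym × ℕ =>
      kind b.1 (G3.pathState (next b.1) (D b.1) (init b.1) (f b)) := fun hf =>
    LS.comp₁ (F := fun w x => kind w (G3.pathState (next w) (D w) (init w) x)) hkp hf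
  have hstep : LS E fun b : List Sym × ℕ => dfsStep (kind b.1) (next b.1) (D b.1) (init b.1) b.2 := by
    have y : LS E fun b : List Sym × ℕ => b.2 := LS.var
    have m := y.mod (LS.const 3)
    have x := y.div (LS.const 3)
    have c : LS E fun b : List Sym × ℕ => D b.1 + 2 := hD.lift.succ.succ
    have k := hkp' x
    have pk := hkp' (x.div c)
    exact LSP.ite (m.eq LS.zero)
      (LSP.ite (k.eq (LS.const 1)) ((x.mul (LS.const 3)).add (LS.const 2))
        (LSP.ite ((k.eq (LS.const 2)).or (k.eq (LS.const 3)))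
          (((x.mul c).add (LS.const 1)).mul (LS.const 3)) ((x.mul (LS.const 3)).add (LS.const 1))))
      (LSP.ite (((pk.eq (LS.const 3)).and (m.eq (LS.const 2))).or
          (((pk.eq (LS.const 2)).and (m.eq (LS.const 1))).or (hD.lift.le (x.mod c))))
        (((x.div c).mul (LS.const 3)).add m) ((x.add (LS.const 1)).mul (LS.const 3)))
  -- Final stages are those at the root, the path 0, on the way up.
  have hcond : LS E fun b : List Sym × ℕ => if b.2 % 3 ≠ 0 ∧ b.2 / 3 = 0 then 0 else 1 :=
    LSP.ite (((LS.var.mod (LS.const 3)).ne LS.zero).and ((LS.var.div (LS.const 3)).eq LS.zero))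
      LS.zero (LS.const 1)
  -- The number `3 * (D w + 2) ^ L w` bounds all stages of the evaluation.
  obtain ⟨K, hK⟩ := (hL.mul (PB.const 3))
  have hres : LS E fun w : List Sym => 0 * 3 +
      if gval (kind w) (next w) (D w) (L w) (init w) then 2 else 1 := by
    refine LS.iterUntil hcond hstep LS.zero ⟨K, fun w => ?_⟩
    have h := dfs_eval (kind := kind w) (next := next w) (init := init w) (D := D w)
      (b := ctxSize E w ^ K) (hD0 w) (L w) 0 (by rw [pathState_zero]; exact hbdd w)
      (by simpa using hK w)
    rw [pathState_zero] at h
    have hle : 0 * 3 + (if gval (kind w) (next w) (D w) (L w) (init w) then 2 else 1) ≤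
        ctxSize E w ^ K := by
      have : 1 ≤ (D w + 2) ^ L w := Nat.one_le_pow _ _ (by omega)
      refine le_trans (b := (D w + 2) ^ L w * 3) ?_ (hK w)
      split <;> omega
    obtain ⟨t, h1, h2, h3⟩ := DfsStep.exists_iterate h hle
    refine ⟨t, fun i hi => ?_, ?_, h1.symm, h3⟩
    · simp only [ne_eq]
      rw [if_neg (h2 i hi)]; simp
    · rw [show (fun y => dfsStep (kind w) (next w) (D w) (init w) y)^[t] 0 = _ from h1]
      rw [if_pos]
      split <;> simp
  exact (hres.eq (LS.const 2)).congr fun w => by split <;> simp_all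

end GameLS
end G3

namespace G3

open Ctx (word vals arity)

/-! The tokens of a word: the first letters of its subformulas. -/

section Tokens

/-- In the numbering of `symCode` these are the variable letter, `⊥`, the three binary connectives
and the box: the letters with which a formula can begin. -/
def IsTok (c : ℕ) : Prop := c = 1 ∨ c = 4 ∨ c = 5 ∨ c = 6 ∨ c = 7 ∨ c = 8

def IsLeaf (c : ℕ) : Prop := c = 1 ∨ c = 4

def IsBin (c : ℕ) : Prop := c = 5 ∨ c = 6 ∨ c = 7

def IsBit (c : ℕ) : Prop := c = 2 ∨ c = 3

open Classical

/-- A member of the sequent may begin at position `p`. -/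
def RootPos (w : List Sym) (p : ℕ) : Prop := rd w (p - 1) = 0 ∨ rd w (p - 1) = 9 ∨ rd w (p - 1) = 10

/-- The side of the sequent at position `p`: 1 for left, 2 for right. -/
noncomputable def sideAt (w : List Sym) (p : ℕ) : ℕ :=
  if Nat.count (fun q => rd w q = 10) p = 0 then 1 else 2

/-- The side on which a member of the sequent begins at position `p`; 0 if none does. -/
noncomputable def markAt (w : List Sym) (p : ℕ) : ℕ := if RootPos w p then sideAt w p else 0

/-- Position `p` holds a token that does not form a member of the sequent by itself. -/
def Rel (w : List Sym) (p : ℕ) : Prop :=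
  IsTok (rd w p) ∧ ¬ (IsLeaf (rd w p) ∧ markAt w p ≠ 0)

/-- Leaving out members that are variables or `⊥` keeps this number linear in the weight, however
many such members there are. -/
noncomputable def numTok (w : List Sym) : ℕ := Nat.count (Rel w) (w.length + 1)

/-- The position of the token with number `u`. -/
noncomputable def posOf (w : List Sym) (u : ℕ) : ℕ :=
  bmin (w.length + 1) fun p => Rel w p ∧ Nat.count (Rel w) p = u

noncomputable def kd (w : List Sym) (u : ℕ) : ℕ := rd w (posOf w u)

noncomputable def mark (w : List Sym) (u : ℕ) : ℕ := markAt w (posOf w u)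

/-- The number of binary digits that follow position `p`. -/
noncomputable def runLen (w : List Sym) (p : ℕ) : ℕ :=
  bmin (w.length + 2) fun k => ¬ IsBit (rd w (p + 1 + k))

/-- The same binary digits follow positions `p` and `q`. -/
def SameBits (w : List Sym) (p q : ℕ) : Prop :=
  runLen w p = runLen w q ∧ ∀ k < runLen w p, rd w (p + 1 + k) = rd w (q + 1 + k)

/-- The number of tokens of the subformula that begins at token `u`. -/
noncomputable def width (w : List Sym) (u : ℕ) : ℕ :=
  bmin (numTok w + 1) fun k =>
    Nat.count (fun i => IsLeaf (kd w (u + i))) k = Nat.count (fun i => IsBin (kd w (u + i))) k + 1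

/-- The variable of token `u` is a member of the sequent on side `m`. -/
def AtomAt (w : List Sym) (m u : ℕ) : Prop :=
  ∃ p < w.length + 1, rd w p = 1 ∧ markAt w p = m ∧ SameBits w p (posOf w u)

/-- The variables and `⊥` among the members of the sequent make it closed. -/
def AtomsClosed (w : List Sym) : Prop :=
  (∃ p < w.length + 1, rd w p = 4 ∧ markAt w p = 1) ∨
    ∃ p < w.length + 1, (rd w p = 1 ∧ markAt w p = 1) ∧
      ∃ q < w.length + 1, (rd w q = 1 ∧ markAt w q = 2) ∧ SameBits w p q

variable {E : List Sym → ℕ} {α : Type} [Ctx α]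

theorem LS.isTok {f : α → ℕ} (hf : LS E f) : LSP E fun a => IsTok (f a) :=
  (hf.eq (LS.const 1)).or ((hf.eq (LS.const 4)).or ((hf.eq (LS.const 5)).or
    ((hf.eq (LS.const 6)).or ((hf.eq (LS.const 7)).or (hf.eq (LS.const 8))))))

theorem LS.isLeaf {f : α → ℕ} (hf : LS E f) : LSP E fun a => IsLeaf (f a) :=
  (hf.eq (LS.const 1)).or (hf.eq (LS.const 4))

theorem LS.isBin {f : α → ℕ} (hf : LS E f) : LSP E fun a => IsBin (f a) :=
  (hf.eq (LS.const 5)).or ((hf.eq (LS.const 6)).or (hf.eq (LS.const 7)))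

theorem LS.isBit {f : α → ℕ} (hf : LS E f) : LSP E fun a => IsBit (f a) :=
  (hf.eq (LS.const 2)).or (hf.eq (LS.const 3))

theorem LS.markAt {f : α → ℕ} (hf : LS E f) : LS E fun a => G3.markAt (word a) (f a) :=
  LSP.ite (p := fun a => RootPos (word a) (f a))
    ((((hf.sub (LS.const 1)).rd).eq (LS.const 0)).or (((((hf.sub (LS.const 1)).rd).eq (LS.const 9))).or
      ((((hf.sub (LS.const 1)).rd).eq (LS.const 10)))))
    (LSP.ite (p := fun a => Nat.count (fun q => G3.rd (word a) q = 10) (f a) = 0)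
      ((LS.count (p := fun a q => G3.rd (word a) q = 10) hf ((LS.rd LS.var).eq (LS.const 10))).eq LS.zero)
      (LS.const 1) (LS.const 2)) LS.zero

theorem LS.rel {f : α → ℕ} (hf : LS E f) : LSP E fun a => Rel (word a) (f a) :=
  LSP.and hf.rd.isTok (LSP.not (LSP.and hf.rd.isLeaf (hf.markAt.ne LS.zero)))

theorem LS.numTok : LS E fun a : α => G3.numTok (word a) :=
  LS.count (p := fun a q => Rel (word a) q) LS.length.succ (LS.rel LS.var)

theorem LS.posOf {f : α → ℕ} (hf : LS E f) : LS E fun a => G3.posOf (word a) (f a) :=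
  LS.bmin (p := fun a p => Rel (word a) p ∧ Nat.count (Rel (word a)) p = f a) LS.length.succ
    (LSP.and (LS.rel LS.var)
      ((LS.count (p := fun (a : α × ℕ) q => Rel (word a.1) q) LS.var (LS.rel LS.var)).eq hf.lift))

theorem LS.kd {f : α → ℕ} (hf : LS E f) : LS E fun a => G3.kd (word a) (f a) := hf.posOf.rd

theorem LS.mark {f : α → ℕ} (hf : LS E f) : LS E fun a => G3.mark (word a) (f a) :=
  hf.posOf.markAt

theorem LS.runLen {f : α → ℕ} (hf : LS E f) : LS E fun a => G3.runLen (word a) (f a) :=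
  LS.bmin (p := fun a k => ¬ IsBit (G3.rd (word a) (f a + 1 + k))) LS.length.succ.succ
    (LSP.not (LS.isBit (LS.rd (hf.lift.succ.add LS.var))))

theorem LS.sameBits {f g : α → ℕ} (hf : LS E f) (hg : LS E g) :
    LSP E fun a => SameBits (word a) (f a) (g a) :=
  LSP.and (hf.runLen.eq hg.runLen)
    (LSP.all (p := fun a k => G3.rd (word a) (f a + 1 + k) = G3.rd (word a) (g a + 1 + k)) hf.runLen
      ((LS.rd (hf.lift.succ.add LS.var)).eq (LS.rd (hg.lift.succ.add LS.var))))

theorem LS.width {f : α → ℕ} (hf : LS E f) : LS E fun a => G3.width (word a) (f a) :=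
  LS.bmin (p := fun a k =>
    Nat.count (fun i => IsLeaf (G3.kd (word a) (f a + i))) k =
      Nat.count (fun i => IsBin (G3.kd (word a) (f a + i))) k + 1) LS.numTok.succ
    (LS.eq
      (LS.count (p := fun (b : α × ℕ) i => IsLeaf (G3.kd (word b) (f b.1 + i))) LS.var
        (LS.isLeaf (LS.kd (hf.lift.lift.add LS.var))))
      (LS.count (p := fun (b : α × ℕ) i => IsBin (G3.kd (word b) (f b.1 + i))) LS.var
        (LS.isBin (LS.kd (hf.lift.lift.add LS.var)))).succ)

theorem LS.atomAt (m : ℕ) {f : α → ℕ} (hf : LS E f) : LSP E fun a => AtomAt (word a) m (f a) :=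
  LSP.ex (p := fun a p => G3.rd (word a) p = 1 ∧ G3.markAt (word a) p = m ∧
      SameBits (word a) p (G3.posOf (word a) (f a))) LS.length.succ
    (LSP.and ((LS.rd LS.var).eq (LS.const 1)) (LSP.and ((LS.markAt LS.var).eq (LS.const m))
      (LS.sameBits LS.var hf.lift.posOf)))

theorem LSP.atomsClosed : LSP E fun a : α => AtomsClosed (word a) :=
  LSP.or
    (LSP.ex (p := fun a p => G3.rd (word a) p = 4 ∧ G3.markAt (word a) p = 1) LS.length.succ
      (LSP.and ((LS.rd LS.var).eq (LS.const 4)) ((LS.markAt LS.var).eq (LS.const 1))))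
    (LSP.ex (p := fun a p => (G3.rd (word a) p = 1 ∧ G3.markAt (word a) p = 1) ∧
        ∃ q < (word a).length + 1, (G3.rd (word a) q = 1 ∧ G3.markAt (word a) q = 2) ∧
          SameBits (word a) p q) LS.length.succ
      (LSP.and (LSP.and ((LS.rd LS.var).eq (LS.const 1)) ((LS.markAt LS.var).eq (LS.const 1)))
        (LSP.ex (p := fun (b : α × ℕ) q => (G3.rd (word b) q = 1 ∧ G3.markAt (word b) q = 2) ∧
            SameBits (word b) b.2 q) LS.length.succ
          (LSP.and (LSP.and ((LS.rd LS.var).eq (LS.const 1)) ((LS.markAt LS.var).eq (LS.const 2)))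
            (LS.sameBits LS.var.lift LS.var)))))

end Tokens
end G3

namespace G3

/-! Reading the formulas of a word. -/

section Items

def isBitSym : Sym → Bool
  | .zero => true
  | .one => true
  | _ => false

def symNum (a : Sym) : ℕ := symCode (.letter a)

theorem symNum_injective : Function.Injective symNum := by
  intro a b h; cases a <;> cases b <;> simp_all [symNum, symCode]

theorem symNum_ne (a : Sym) : symNum a ≠ 0 ∧ symNum a ≠ 11 := by
  cases a <;> simp [symNum, symCode]

theorem isBit_symNum (a : Sym) : IsBit (symNum a) ↔ isBitSym a = true := by
  cases a <;> simp [IsBit, symNum, symCode, isBitSym]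

theorem rd_succ (w : List Sym) (p : ℕ) : rd w (p + 1) = (w[p]?).elim 11 symNum := by
  simp only [rd, OfflineTM.readInput]
  cases w[p]? <;> rfl

theorem rd_add (w : List Sym) (p k : ℕ) :
    rd w (p + 1 + k) = ((w.drop p)[k]?).elim 11 symNum := by
  rw [show p + 1 + k = p + k + 1 by omega, rd_succ, List.getElem?_drop]

theorem option_elim_symNum_injective :
    Function.Injective fun o : Option Sym => o.elim 11 symNum := by
  intro a b h
  rcases a with _ | a <;> rcases b with _ | b
  · rfl
  · exact absurd h.symm (symNum_ne b).2
  · exact absurd h (symNum_ne a).2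
  · exact congrArg some (symNum_injective h)

theorem takeWhile_length_not (t : List Sym) (h : (t.takeWhile isBitSym).length < t.length) :
    ¬ isBitSym (t[(t.takeWhile isBitSym).length]'h) = true := by
  induction t with
  | nil => simp at h
  | cons a t ih =>
    by_cases ha : isBitSym a = true
    · simp only [List.takeWhile_cons_of_pos ha, List.length_cons, List.getElem_cons_succ]
      exact ih (by simpa [List.takeWhile_cons_of_pos ha] using h)
    · simpa [List.takeWhile_cons_of_neg ha] using ha

theorem runLen_eq (w : List Sym) (p : ℕ) :
    runLen w p = ((w.drop p).takeWhile isBitSym).length := by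
  have hle := (List.takeWhile_prefix isBitSym (l := w.drop p)).length_le
  rw [List.length_drop] at hle
  refine bmin_eq (by omega) ?_ fun i hi => ?_
  · rw [rd_add]
    by_cases h : ((w.drop p).takeWhile isBitSym).length < (w.drop p).length
    · rw [List.getElem?_eq_getElem h]
      exact fun h' => takeWhile_length_not _ h ((isBit_symNum _).1 h')
    · rw [List.getElem?_eq_none (by omega)]
      simp [IsBit]
  · rw [rd_add, not_not]
    have h1 := (List.takeWhile_prefix isBitSym (l := w.drop p)).getElem hi
    have h2 : ((w.drop p).takeWhile isBitSym)[i] ∈ (w.drop p).takeWhile isBitSym :=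
      List.getElem_mem _
    rw [List.getElem?_eq_getElem (lt_of_lt_of_le hi
      (List.takeWhile_prefix isBitSym (l := w.drop p)).length_le), ← h1]
    exact (isBit_symNum _).2 (List.mem_takeWhile_imp h2)

theorem sameBits_iff (w : List Sym) (p q : ℕ) :
    SameBits w p q ↔ (w.drop p).takeWhile isBitSym = (w.drop q).takeWhile isBitSym := by
  simp only [SameBits, runLen_eq, rd_add]
  set t := w.drop p; set t' := w.drop q
  have key : ∀ (t : List Sym) k, k < (t.takeWhile isBitSym).length →
      (t.takeWhile isBitSym)[k]? = t[k]? := fun t k hk => by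
    have h1 := (List.takeWhile_prefix isBitSym (l := t)).getElem hk
    rw [List.getElem?_eq_getElem hk, h1, List.getElem?_eq_getElem]
  constructor
  · rintro ⟨h1, h2⟩
    refine List.ext_getElem? fun k => ?_
    by_cases hk : k < (t.takeWhile isBitSym).length
    · rw [key _ _ hk, key _ _ (show k < (t'.takeWhile isBitSym).length by omega)]
      exact option_elim_symNum_injective (h2 k hk)
    · rw [List.getElem?_eq_none (by omega), List.getElem?_eq_none (by omega)]
  · intro h
    refine ⟨by rw [h], fun k hk => ?_⟩
    have hk' : k < (t'.takeWhile isBitSym).length := by rw [← h]; exact hk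
    rw [← key _ _ hk, ← key _ _ hk', h]

/-- What is to be known of a position: its letter, the binary digits that follow, and the side on
which a member of the sequent begins there. -/
abbrev Item : Type := ℕ × List Sym × ℕ

noncomputable def itemAt (w : List Sym) (p : ℕ) : Item :=
  (rd w p, (w.drop p).takeWhile isBitSym, markAt w p)

open Classical in
/-- The items of the tokens of a word that is read from the middle: `st` tells whether a member of
the sequent may begin here, and `sd` is the current side. -/
noncomputable def allItems : Prop → ℕ → List Sym → List Item
  | _, _, [] => []
  | st, sd, a :: t =>
    (if IsTok (symNum a) then [(symNum a, t.takeWhile isBitSym, if st then sd else 0)] else []) ++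
      allItems (a = .comma ∨ a = .arrow) (if a = .arrow then 2 else sd) t

open Classical in
-- Reading from left to right with a state agrees with what is defined by positions; `pre` is the
-- part already read.
theorem allItems_append (pre t : List Sym) :
    allItems (RootPos (pre ++ t) (pre.length + 1)) (sideAt (pre ++ t) (pre.length + 1)) t =
      ((List.range' (pre.length + 1) t.length).filter fun p => IsTok (rd (pre ++ t) p)).map
        (itemAt (pre ++ t)) := by
  induction t generalizing pre with
  | nil => simp [allItems]
  | cons a t ih =>
    have ih := ih (pre ++ [a])
    rw [List.append_assoc, List.singleton_append, List.length_append, List.length_singleton] at ih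
    have e : rd (pre ++ a :: t) (pre.length + 1) = symNum a := by
      rw [rd_succ]; simp
    have h1 : RootPos (pre ++ a :: t) (pre.length + 1 + 1) = (a = .comma ∨ a = .arrow) := by
      simp only [RootPos, Nat.add_sub_cancel, e]
      cases a <;> simp [symNum, symCode]
    have h2 : sideAt (pre ++ a :: t) (pre.length + 1 + 1) =
        if a = .arrow then 2 else sideAt (pre ++ a :: t) (pre.length + 1) := by
      simp only [sideAt, Nat.count_succ _ (pre.length + 1), e]
      cases a <;> simp [symNum, symCode]
    rw [h1, h2] at ih
    rw [allItems, ih, List.length_cons, List.range'_succ, List.filter_cons, e]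
    by_cases h : IsTok (symNum a) <;> simp [h, itemAt, e, markAt]

open Classical in
theorem allItems_eq (w : List Sym) : allItems True 1 w =
    ((List.range (w.length + 1)).filter fun p => IsTok (rd w p)).map (itemAt w) := by
  have h := allItems_append [] w
  simp only [List.nil_append, List.length_nil, zero_add] at h
  have h1 : RootPos w 1 = True := by simp [RootPos, rd_eq_zero]
  have h2 : sideAt w 1 = 1 := by
    have : rd w 0 = 0 := rd_eq_zero.2 rfl
    simp [sideAt, Nat.count_succ, this]
  rw [h1, h2] at h
  rw [h, List.range_eq_range', List.range'_succ, List.filter_cons]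
  have : rd w 0 = 0 := rd_eq_zero.2 rfl
  simp [this, IsTok]

open Classical in
theorem getElem?_filter_range {P : ℕ → Prop} {n u p : ℕ} :
    ((List.range n).filter fun p => P p)[u]? = some p ↔ p < n ∧ P p ∧ Nat.count P p = u := by
  have hl : ∀ n, ((List.range n).filter fun p => P p).length = Nat.count P n := fun n => by
    rw [Nat.count, List.countP_eq_length_filter]
  induction n with
  | zero => simp
  | succ n ih =>
    rw [List.range_succ, List.filter_append]
    by_cases hu : u < Nat.count P n
    · rw [List.getElem?_append_left (by rw [hl]; exact hu)]
      refine ih.trans ⟨fun h => ⟨by omega, h.2⟩, fun h => ⟨?_, h.2⟩⟩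
      rcases Nat.lt_succ_iff_lt_or_eq.1 h.1 with h' | rfl
      exacts [h', by omega]
    · rw [List.getElem?_append_right (by rw [hl]; omega), hl]
      have : ∀ p, p < n → P p → Nat.count P p ≠ u := fun p hp h h' =>
        hu (h' ▸ Nat.count_strict_mono h hp)
      by_cases hP : P n
      · simp only [List.filter_cons, hP, decide_true, if_true, List.filter_nil]
        constructor
        · intro h
          rw [List.getElem?_singleton] at h
          split at h
          · simp only [Option.some.injEq] at h; subst h
            exact ⟨by omega, hP, by omega⟩
          · simp at h
        · rintro ⟨h1, h2, h3⟩
          rcases Nat.lt_succ_iff_lt_or_eq.1 h1 with h' | rfl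
          · exact absurd h3 (this p h' h2)
          · simp [h3]
      · simp only [List.filter_cons, hP, decide_false, List.filter_nil]
        constructor
        · simp
        · rintro ⟨h1, h2, h3⟩
          rcases Nat.lt_succ_iff_lt_or_eq.1 h1 with h' | rfl
          · exact absurd h3 (this p h' h2)
          · exact absurd h2 hP

open Classical in
-- The search for the position with `u` relevant positions before it enumerates the relevant
-- positions in their order.
theorem map_posOf (w : List Sym) : (List.range (numTok w)).map (posOf w) =
    (List.range (w.length + 1)).filter fun p => Rel w p := by
  refine List.ext_getElem? fun u => ?_
  have hl : ((List.range (w.length + 1)).filter fun p => Rel w p).length = numTok w := by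
    rw [numTok, Nat.count, List.countP_eq_length_filter]
  by_cases hu : u < numTok w
  · have hu' : u < ((List.range (w.length + 1)).filter fun p => Rel w p).length := by omega
    obtain ⟨h1, h2, h3⟩ := getElem?_filter_range.1 (List.getElem?_eq_getElem hu')
    rw [List.getElem?_map, List.getElem?_range hu, List.getElem?_eq_getElem hu', Option.map_some]
    refine congrArg some (bmin_eq h1 ⟨h2, h3⟩ fun i hi h => ?_)
    have := Nat.count_strict_mono h.1 hi
    omega
  · rw [List.getElem?_eq_none (by simpa using hu), List.getElem?_eq_none (by omega)]

def RelItem (x : Item) : Prop := ¬ (IsLeaf x.1 ∧ x.2.2 ≠ 0)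

noncomputable def items (w : List Sym) : List Item :=
  (List.range (numTok w)).map fun u => itemAt w (posOf w u)

open Classical in
theorem items_eq (w : List Sym) : items w = (allItems True 1 w).filter fun x => RelItem x := by
  have : items w = ((List.range (numTok w)).map (posOf w)).map (itemAt w) := by simp [items]
  rw [this, map_posOf, allItems_eq, List.filter_map, List.filter_filter]
  congr 2
  ext p
  rw [Bool.eq_iff_iff]
  have h : Rel w p ↔ RelItem (itemAt w p) ∧ IsTok (rd w p) := and_comm
  simp only [Bool.and_eq_true, decide_eq_true_eq, Function.comp_apply, h]

/-- The items of the tokens of a formula, the first of which has mark `m`. -/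
def ftoks : ℕ → Formula → List Item
  | m, .var i => [(1, (Nat.bits i).map fun b => if b then Sym.one else Sym.zero, m)]
  | m, .bot => [(4, [], m)]
  | m, .and A B => (5, [], m) :: (ftoks 0 A ++ ftoks 0 B)
  | m, .or A B => (6, [], m) :: (ftoks 0 A ++ ftoks 0 B)
  | m, .imp A B => (7, [], m) :: (ftoks 0 A ++ ftoks 0 B)
  | m, .box A => (8, [], m) :: ftoks 0 A

/-- What follows a formula must not begin with a binary digit, or else it would be read as part of
the index of a final variable. -/
def NoBit (t : List Sym) : Prop := ∀ a ∈ t.head?, isBitSym a = false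

theorem NoBit.takeWhile {t : List Sym} (h : NoBit t) : t.takeWhile isBitSym = [] := by
  cases t with
  | nil => rfl
  | cons a t => simp [h a (by simp)]

theorem noBit_encode (A : Formula) (t : List Sym) : NoBit (A.encode ++ t) := by
  cases A <;> simp [NoBit, Formula.encode, isBitSym]

theorem noBit_encodeList (As : List Formula) {t : List Sym} (h : NoBit t) :
    NoBit (encodeList As ++ t) := by
  cases As with
  | nil => exact h
  | cons A As =>
    simp only [encodeList, List.flatMap_cons, List.append_assoc]
    exact noBit_encode _ _

theorem allItems_bits {bs : List Sym} (h : ∀ a ∈ bs, isBitSym a = true) (sd : ℕ) (t : List Sym) :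
    allItems False sd (bs ++ t) = allItems False sd t := by
  induction bs with
  | nil => rfl
  | cons a bs ih =>
    have h1 : ¬ IsTok (symNum a) ∧ (a = .comma ∨ a = .arrow) = False ∧ ¬ a = .arrow := by
      have := h a (by simp)
      revert this
      cases a <;> simp [isBitSym, IsTok, symNum, symCode]
    rw [List.cons_append, allItems, h1.2.1, if_neg h1.2.2, if_neg h1.1, List.nil_append]
    exact ih fun a ha => h a (by simp [ha])

theorem isBitSym_of_mem_bits {i : ℕ} {a : Sym}
    (h : a ∈ (Nat.bits i).map fun b => if b then Sym.one else Sym.zero) : isBitSym a = true := by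
  obtain ⟨b, -, rfl⟩ := List.mem_map.1 h
  cases b <;> rfl

theorem takeWhile_bits_append {bs : List Sym} (h : ∀ a ∈ bs, isBitSym a = true) {t : List Sym}
    (ht : NoBit t) : (bs ++ t).takeWhile isBitSym = bs := by
  rw [List.takeWhile_append_of_pos h, ht.takeWhile, List.append_nil]

open Classical in
theorem allItems_cons_tok {a : Sym} (ha : IsTok (symNum a)) (st : Prop) (sd : ℕ) (t : List Sym) :
    allItems st sd (a :: t) =
      (symNum a, t.takeWhile isBitSym, if st then sd else 0) :: allItems False sd t := by
  have h1 : (a = .comma ∨ a = .arrow) = False ∧ ¬ a = .arrow := by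
    revert ha
    cases a <;> simp [IsTok, symNum, symCode]
  rw [allItems, h1.1, if_neg h1.2, if_pos ha]; rfl

open Classical in
theorem allItems_encode (A : Formula) : ∀ (st : Prop) (sd : ℕ) {t : List Sym} (_ : NoBit t),
    allItems st sd (A.encode ++ t) = ftoks (if st then sd else 0) A ++ allItems False sd t := by
  induction A with
  | var i =>
    intro st sd t ht
    rw [Formula.encode, List.cons_append, allItems_cons_tok (by simp [IsTok, symNum, symCode]),
      takeWhile_bits_append (fun a h => isBitSym_of_mem_bits h) ht,
      allItems_bits (fun a h => isBitSym_of_mem_bits h)]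
    rfl
  | bot =>
    intro st sd t ht
    rw [Formula.encode, List.cons_append, allItems_cons_tok (by simp [IsTok, symNum, symCode])]
    rw [List.nil_append, ht.takeWhile]; rfl
  | and A B ihA ihB | or A B ihA ihB | imp A B ihA ihB =>
    intro st sd t ht
    rw [Formula.encode, List.cons_append, allItems_cons_tok (by simp [IsTok, symNum, symCode]),
      List.append_assoc, (noBit_encode _ _).takeWhile, ihA _ _ (noBit_encode _ _), ihB _ _ ht,
      if_neg not_false, ftoks]
    simp [symNum, symCode]
  | box A ih =>
    intro st sd t ht
    rw [Formula.encode, List.cons_append, allItems_cons_tok (by simp [IsTok, symNum, symCode]),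
      (noBit_encode _ _).takeWhile, ih _ _ ht, if_neg not_false, ftoks]
    simp [symNum, symCode]

theorem allItems_encodeList (As : List Formula) (sd : ℕ) (t : List Sym) :
    allItems True sd (encodeList As ++ t) = As.flatMap (ftoks sd) ++ allItems True sd t := by
  induction As with
  | nil => rfl
  | cons A As ih =>
    have : encodeList (A :: As) ++ t = A.encode ++ (Sym.comma :: (encodeList As ++ t)) := by
      simp [encodeList]
    rw [this, allItems_encode _ _ _ (by simp [NoBit, isBitSym]), allItems]
    simp [IsTok, symNum, symCode, ih]

theorem allItems_encodeSequent (Γ Δ : List Formula) :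
    allItems True 1 (encodeSequent Γ Δ) = Γ.flatMap (ftoks 1) ++ Δ.flatMap (ftoks 2) := by
  rw [encodeSequent, allItems_encodeList, allItems]
  have := allItems_encodeList Δ 2 []
  simp only [List.append_nil] at this
  simp [IsTok, symNum, symCode, this, allItems]

/-- The compound members of a sequent, with their sides. -/
def rootList (Γ Δ : List Formula) : List (ℕ × Formula) :=
  ((Γ.filter fun A => A.weight ≠ 0).map fun A => (1, A)) ++
    (Δ.filter fun A => A.weight ≠ 0).map fun A => (2, A)

open Classical in
-- Inside a formula all marks are 0, so leaves of compound members are kept; only a leaf that is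
-- itself a member, and so carries a mark, is dropped.
theorem filter_ftoks (m : ℕ) (A : Formula) : ((ftoks m A).filter fun x => RelItem x) =
    if A.weight = 0 ∧ m ≠ 0 then [] else ftoks m A := by
  induction A generalizing m with
  | var i | bot => by_cases h : m = 0 <;> simp [ftoks, RelItem, IsLeaf, Formula.weight, h]
  | and A B ihA ihB | or A B ihA ihB | imp A B ihA ihB =>
    rw [ftoks, List.filter_cons, List.filter_append, ihA, ihB]
    simp [RelItem, IsLeaf, Formula.weight]
  | box A ih =>
    rw [ftoks, List.filter_cons, ih]
    simp [RelItem, IsLeaf, Formula.weight]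

open Classical in
theorem filter_flatMap_ftoks {m : ℕ} (hm : m ≠ 0) (As : List Formula) :
    ((As.flatMap (ftoks m)).filter fun x => RelItem x) =
      (As.filter fun A => A.weight ≠ 0).flatMap (ftoks m) := by
  induction As with
  | nil => rfl
  | cons A As ih =>
    rw [List.flatMap_cons, List.filter_append, ih, filter_ftoks, List.filter_cons]
    by_cases h : A.weight = 0 <;> simp [h, hm]

theorem items_encodeSequent (Γ Δ : List Formula) :
    items (encodeSequent Γ Δ) = (rootList Γ Δ).flatMap fun x => ftoks x.1 x.2 := by
  rw [items_eq, allItems_encodeSequent, List.filter_append, filter_flatMap_ftoks (by norm_num),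
    filter_flatMap_ftoks (by norm_num), rootList, List.flatMap_append]
  simp [List.flatMap_map]

end Items
end G3

namespace G3

/-! The formulas that begin at the tokens of a word. -/

section Decode

theorem bits_injective : Function.Injective Nat.bits := by
  refine Function.LeftInverse.injective (g := fun l => l.foldr Nat.bit 0) fun n => ?_
  induction n using Nat.binaryRec' with
  | zero => simp
  | bit b n h ih => rw [Nat.bits_append_bit _ _ h]; exact congrArg _ ih

theorem bitSyms_injective :
    Function.Injective fun i => (Nat.bits i).map fun b => if b then Sym.one else Sym.zero :=
  (List.map_injective_iff.2 fun a b => by cases a <;> cases b <;> simp).comp bits_injective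

/-- The number of connectives and atoms of a formula. -/
def Formula.size : Formula → ℕ
  | .var _ => 1
  | .bot => 1
  | .and A B => A.size + B.size + 1
  | .or A B => A.size + B.size + 1
  | .imp A B => A.size + B.size + 1
  | .box A => A.size + 1

theorem Formula.size_pos (A : Formula) : 0 < A.size := by cases A <;> simp [Formula.size]

theorem length_ftoks (m : ℕ) (A : Formula) : (ftoks m A).length = A.size := by
  induction A generalizing m with
  | var i | bot => rfl
  | and A B ihA ihB | or A B ihA ihB | imp A B ihA ihB => simp [ftoks, Formula.size, ihA, ihB]
  | box A ih => simp [ftoks, Formula.size, ih]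

/-- The number of the first letter of a formula. -/
def Formula.code : Formula → ℕ
  | .var _ => 1
  | .bot => 4
  | .and _ _ => 5
  | .or _ _ => 6
  | .imp _ _ => 7
  | .box _ => 8

/-- The binary digits that follow the first letter of a formula. -/
def Formula.digits : Formula → List Sym
  | .var i => (Nat.bits i).map fun b => if b then Sym.one else Sym.zero
  | _ => []

theorem code_eq_one {A : Formula} {i : ℕ} :
    A.code = 1 ∧ A.digits = (Formula.var i).digits ↔ A = .var i := by
  constructor
  · intro h
    cases A with
    | var j => exact congrArg _ (bitSyms_injective h.2)
    | _ => simp [Formula.code] at h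
  · rintro rfl; exact ⟨rfl, rfl⟩

theorem mark_of_mem_ftoks_zero {A : Formula} : ∀ x ∈ ftoks 0 A, x.2.2 = 0 := by
  induction A with
  | var i | bot => simp [ftoks]
  | and A B ihA ihB | or A B ihA ihB | imp A B ihA ihB =>
    simp only [ftoks, List.mem_cons, List.mem_append]
    rintro x (rfl | h | h)
    exacts [rfl, ihA x h, ihB x h]
  | box A ih =>
    simp only [ftoks, List.mem_cons]
    rintro x (rfl | h)
    exacts [rfl, ih x h]

theorem exists_ftoks_eq (m : ℕ) (A : Formula) :
    ∃ t, ftoks m A = (A.code, A.digits, m) :: t ∧ ∀ x ∈ t, x.2.2 = 0 := by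
  cases A with
  | var i | bot => exact ⟨[], rfl, by simp⟩
  | and A B | or A B | imp A B =>
    refine ⟨_, rfl, fun x h => ?_⟩
    rcases List.mem_append.1 h with h | h
    exacts [mark_of_mem_ftoks_zero x h, mark_of_mem_ftoks_zero x h]
  | box A => exact ⟨_, rfl, mark_of_mem_ftoks_zero⟩

/-- Unique readability of Polish notation, at the level of items. -/
theorem ftoks_inj {A A' : Formula} {m m' : ℕ} {r r' : List Item}
    (h : ftoks m A ++ r = ftoks m' A' ++ r') : A = A' ∧ r = r' := by
  induction A generalizing A' m m' r r' with
  | var i =>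
    cases A' with
    | var j =>
      simp only [ftoks, List.singleton_append, List.cons.injEq, Prod.mk.injEq] at h
      exact ⟨congrArg _ (bitSyms_injective h.1.2.1), h.2⟩
    | _ => simp [ftoks] at h
  | bot =>
    cases A' with
    | bot => simp only [ftoks, List.singleton_append, List.cons.injEq] at h; exact ⟨rfl, h.2⟩
    | _ => simp [ftoks] at h
  | and A B ihA ihB =>
    cases A' with
    | and A' B' =>
      simp only [ftoks, List.cons_append, List.append_assoc, List.cons.injEq] at h
      obtain ⟨rfl, h1⟩ := ihA h.2
      obtain ⟨rfl, h2⟩ := ihB h1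
      exact ⟨rfl, h2⟩
    | _ => simp [ftoks] at h
  | or A B ihA ihB =>
    cases A' with
    | or A' B' =>
      simp only [ftoks, List.cons_append, List.append_assoc, List.cons.injEq] at h
      obtain ⟨rfl, h1⟩ := ihA h.2
      obtain ⟨rfl, h2⟩ := ihB h1
      exact ⟨rfl, h2⟩
    | _ => simp [ftoks] at h
  | imp A B ihA ihB =>
    cases A' with
    | imp A' B' =>
      simp only [ftoks, List.cons_append, List.append_assoc, List.cons.injEq] at h
      obtain ⟨rfl, h1⟩ := ihA h.2
      obtain ⟨rfl, h2⟩ := ihB h1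
      exact ⟨rfl, h2⟩
    | _ => simp [ftoks] at h
  | box A ih =>
    cases A' with
    | box A' =>
      simp only [ftoks, List.cons_append, List.cons.injEq] at h
      obtain ⟨rfl, h1⟩ := ih h.2
      exact ⟨rfl, h1⟩
    | _ => simp [ftoks] at h

/-- The items of `A` begin at place `u` of `J`. -/
def AtItem (J : List Item) (u : ℕ) (A : Formula) : Prop := ∃ m r, J.drop u = ftoks m A ++ r

theorem AtItem.unique {J : List Item} {u : ℕ} {A B : Formula} (hA : AtItem J u A)
    (hB : AtItem J u B) : A = B := by
  obtain ⟨m, r, h⟩ := hA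
  obtain ⟨m', r', h'⟩ := hB
  exact (ftoks_inj (h.symm.trans h')).1

theorem AtItem.size_le {J : List Item} {u : ℕ} {A : Formula} (h : AtItem J u A) :
    u + A.size ≤ J.length := by
  obtain ⟨m, r, h⟩ := h
  have := congrArg List.length h
  rw [List.length_drop, List.length_append, length_ftoks] at this
  have := A.size_pos
  omega

theorem drop_add_of_eq {J l r : List Item} {u k : ℕ} (h : J.drop u = l ++ r) (hk : l.length = k) :
    J.drop (u + k) = r := by
  rw [← List.drop_drop, h, ← hk, List.drop_left]

theorem AtItem.bin {J : List Item} {u : ℕ} {F A B : Formula} (h : AtItem J u F)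
    (hF : F = .and A B ∨ F = .or A B ∨ F = .imp A B) :
    AtItem J (u + 1) A ∧ AtItem J (u + 1 + A.size) B := by
  obtain ⟨m, r, h⟩ := h
  have : ∃ x : Item, J.drop u = [x] ++ (ftoks 0 A ++ (ftoks 0 B ++ r)) := by
    rcases hF with rfl | rfl | rfl <;> exact ⟨_, by rw [h, ftoks]; simp; rfl⟩
  obtain ⟨x, h⟩ := this
  have h1 := drop_add_of_eq h rfl
  exact ⟨⟨_, _, h1⟩, ⟨_, _, drop_add_of_eq h1 (length_ftoks _ _)⟩⟩

theorem AtItem.box {J : List Item} {u : ℕ} {A : Formula} (h : AtItem J u (.box A)) :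
    AtItem J (u + 1) A := by
  obtain ⟨m, r, h⟩ := h
  exact ⟨0, r, drop_add_of_eq (l := [(8, [], m)]) (by rw [h, ftoks]; rfl) rfl⟩

theorem AtItem.head {J : List Item} {u : ℕ} {A : Formula} (h : AtItem J u A) :
    ∃ x, J[u]? = some x ∧ x.1 = A.code := by
  obtain ⟨m, r, h⟩ := h
  have : J[u]? = (J.drop u)[0]? := by simp
  rw [this, h]
  cases A <;> simp [ftoks, Formula.code]

/-- Every token is the first letter of exactly one subformula; this is the existence half. -/
theorem exists_atItem_ftoks {A : Formula} : ∀ {m u : ℕ} (_ : u < A.size) (r : List Item),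
    ∃ B, AtItem (ftoks m A ++ r) u B := by
  induction A with
  | var i =>
    intro m u hu r
    simp only [Formula.size, Nat.lt_one_iff] at hu
    subst hu
    exact ⟨_, _, _, rfl⟩
  | bot =>
    intro m u hu r
    simp only [Formula.size, Nat.lt_one_iff] at hu
    subst hu
    exact ⟨_, _, _, rfl⟩
  | and A B ihA ihB | or A B ihA ihB | imp A B ihA ihB =>
    intro m u hu r
    rcases u with _ | u
    · exact ⟨_, _, _, rfl⟩
    · simp only [Formula.size] at hu
      by_cases h : u < A.size
      · obtain ⟨C, m', r', hC⟩ := ihA (m := 0) h (ftoks 0 B ++ r)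
        exact ⟨C, m', r', by rw [← hC]; simp [ftoks]⟩
      · obtain ⟨C, m', r', hC⟩ := ihB (m := 0) (u := u - A.size) (by omega) r
        refine ⟨C, m', r', ?_⟩
        rw [← hC]
        simp only [ftoks, List.cons_append, List.drop_succ_cons, List.append_assoc]
        rw [List.drop_append, List.drop_of_length_le (by rw [length_ftoks]; omega), length_ftoks,
          List.nil_append]
  | box A ih =>
    intro m u hu r
    rcases u with _ | u
    · exact ⟨_, _, _, rfl⟩
    · simp only [Formula.size] at hu
      obtain ⟨C, m', r', hC⟩ := ih (m := 0) (u := u) (by omega) r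
      exact ⟨C, m', r', by rw [← hC]; simp [ftoks]⟩

theorem exists_atItem (L : List (ℕ × Formula)) {u : ℕ}
    (hu : u < (L.flatMap fun x => ftoks x.1 x.2).length) :
    ∃ A, AtItem (L.flatMap fun x => ftoks x.1 x.2) u A := by
  induction L generalizing u with
  | nil => simp at hu
  | cons x L ih =>
    rw [List.flatMap_cons] at hu ⊢
    rw [List.length_append, length_ftoks] at hu
    by_cases h : u < x.2.size
    · exact exists_atItem_ftoks h _
    · obtain ⟨A, m, r, hA⟩ := ih (u := u - x.2.size) (by omega)
      refine ⟨A, m, r, ?_⟩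
      rw [← hA, List.drop_append, List.drop_of_length_le (by rw [length_ftoks]; omega),
        length_ftoks, List.nil_append]

open Classical in
noncomputable def leaves (l : List Item) : ℕ := l.countP fun x => IsLeaf x.1

open Classical in
noncomputable def bins (l : List Item) : ℕ := l.countP fun x => IsBin x.1

theorem leaves_append (l r : List Item) : leaves (l ++ r) = leaves l + leaves r :=
  List.countP_append

theorem bins_append (l r : List Item) : bins (l ++ r) = bins l + bins r :=
  List.countP_append

theorem leaves_cons (x : Item) (r : List Item) [Decidable (IsLeaf x.1)] :
    leaves (x :: r) = (if IsLeaf x.1 then 1 else 0) + leaves r := by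
  rw [leaves, List.countP_cons, add_comm]
  by_cases h : IsLeaf x.1 <;> simp [h, leaves]

theorem bins_cons (x : Item) (r : List Item) [Decidable (IsBin x.1)] :
    bins (x :: r) = (if IsBin x.1 then 1 else 0) + bins r := by
  rw [bins, List.countP_cons, add_comm]
  by_cases h : IsBin x.1 <;> simp [h, bins]

open Classical in
-- In Polish notation a formula ends where its leaves outnumber its binary connectives for the first
-- time. Boxes do not count. This justifies `width`.
theorem balance (m : ℕ) (A : Formula) : leaves (ftoks m A) = bins (ftoks m A) + 1 ∧
    ∀ k < A.size, leaves ((ftoks m A).take k) ≤ bins ((ftoks m A).take k) := by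
  have nl : leaves [] = 0 := rfl
  have nb : bins [] = 0 := rfl
  induction A generalizing m with
  | var i | bot =>
    refine ⟨?_, fun k hk => ?_⟩
    · simp [ftoks, leaves_cons, bins_cons, IsLeaf, IsBin, nl, nb]
    · simp only [Formula.size, Nat.lt_one_iff] at hk; subst hk; simp [nl]
  | and A B ihA ihB | or A B ihA ihB | imp A B ihA ihB =>
    obtain ⟨a1, a2⟩ := ihA 0
    obtain ⟨b1, b2⟩ := ihB 0
    refine ⟨?_, fun k hk => ?_⟩
    · rw [ftoks, leaves_cons, bins_cons, leaves_append, bins_append]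
      simp only [IsLeaf, IsBin, Nat.reduceEqDiff, or_self, or_true, or_false, if_true,
        if_false]
      omega
    · rcases k with _ | k
      · simp [nl]
      · simp only [Formula.size] at hk
        rw [ftoks, List.take_succ_cons, leaves_cons, bins_cons, List.take_append, leaves_append,
          bins_append, length_ftoks]
        simp only [IsLeaf, IsBin, Nat.reduceEqDiff, or_self, or_true, or_false, if_true,
          if_false]
        by_cases h : k < A.size
        · have := a2 k h
          rw [Nat.sub_eq_zero_of_le h.le, List.take_zero, nl, nb]
          omega
        · have := b2 (k - A.size) (by omega)
          rw [List.take_of_length_le (by rw [length_ftoks]; omega)]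
          omega
  | box A ih =>
    obtain ⟨a1, a2⟩ := ih 0
    refine ⟨?_, fun k hk => ?_⟩
    · rw [ftoks, leaves_cons, bins_cons]
      simp [IsLeaf, IsBin, a1]
    · rcases k with _ | k
      · simp [nl]
      · simp only [Formula.size] at hk
        rw [ftoks, List.take_succ_cons, leaves_cons, bins_cons]
        simpa [IsLeaf, IsBin] using a2 k (by omega)

open Classical in
theorem count_eq_countP {P : Item → Prop} {p : ℕ → Prop} [DecidablePred p] (l : List Item) {k : ℕ}
    (hk : k ≤ l.length) (h : ∀ i (hi : i < l.length), p i ↔ P l[i]) :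
    Nat.count p k = (l.take k).countP fun x => P x := by
  induction k with
  | zero => simp
  | succ k ih =>
    rw [Nat.count_succ, ih (by omega), List.take_succ_eq_append_getElem (by omega),
      List.countP_append, List.countP_singleton]
    simp [h k (by omega)]

theorem length_items (w : List Sym) : (items w).length = numTok w := by simp [items]

theorem getElem_items (w : List Sym) {u : ℕ} (hu : u < (items w).length) :
    (items w)[u] = itemAt w (posOf w u) := by simp [items]

open Classical in
theorem width_eq {w : List Sym} {u : ℕ} {A : Formula} (h : AtItem (items w) u A) :
    width w u = A.size := by
  have hle := h.size_le
  have hpos := A.size_pos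
  obtain ⟨m, r, e⟩ := h
  have hl : ((items w).drop u).length = numTok w - u := by rw [List.length_drop, length_items]
  rw [length_items] at hle
  have c1 : ∀ k ≤ A.size, Nat.count (fun i => IsLeaf (kd w (u + i))) k =
      leaves ((ftoks m A).take k) := fun k hk => by
    rw [count_eq_countP (P := fun x => IsLeaf x.1) ((items w).drop u) (by omega), e,
      List.take_append_of_le_length (by rw [length_ftoks]; omega), leaves]
    intro i hi
    rw [List.getElem_drop, getElem_items]; rfl
  have c2 : ∀ k ≤ A.size, Nat.count (fun i => IsBin (kd w (u + i))) k =
      bins ((ftoks m A).take k) := fun k hk => by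
    rw [count_eq_countP (P := fun x => IsBin x.1) ((items w).drop u) (by omega), e,
      List.take_append_of_le_length (by rw [length_ftoks]; omega), bins]
    intro i hi
    rw [List.getElem_drop, getElem_items]; rfl
  obtain ⟨b1, b2⟩ := balance m A
  refine bmin_eq (by omega) ?_ fun k hk => ?_
  · rw [c1 _ le_rfl, c2 _ le_rfl, List.take_of_length_le (by rw [length_ftoks])]
    exact b1
  · rw [c1 _ hk.le, c2 _ hk.le]
    have := b2 k hk
    omega

/-- The formula that begins at token `u`. -/
noncomputable def form (w : List Sym) (u : ℕ) : Formula :=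
  open Classical in if h : ∃ A, AtItem (items w) u A then h.choose else .bot

theorem AtItem.form_eq {w : List Sym} {u : ℕ} {A : Formula} (h : AtItem (items w) u A) :
    form w u = A := by
  have h' : ∃ A, AtItem (items w) u A := ⟨A, h⟩
  rw [form, dif_pos h']
  exact h'.choose_spec.unique h

section Sequent

variable {Γ Δ : List Formula} {w : List Sym} (hw : w = encodeSequent Γ Δ)

include hw

theorem atItem_form {u : ℕ} (hu : u < numTok w) : AtItem (items w) u (form w u) := by
  have : ∃ A, AtItem (items w) u A := by
    rw [← length_items] at hu
    subst hw
    rw [items_encodeSequent] at hu ⊢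
    exact exists_atItem _ hu
  obtain ⟨A, hA⟩ := this
  rwa [hA.form_eq]

theorem kd_eq {u : ℕ} (hu : u < numTok w) : kd w u = (form w u).code := by
  obtain ⟨x, h1, h2⟩ := (atItem_form hw hu).head
  rw [List.getElem?_eq_getElem (by rwa [length_items]), getElem_items, Option.some.injEq] at h1
  rw [← h2, ← h1]; rfl

theorem width_form {u : ℕ} (hu : u < numTok w) : width w u = (form w u).size :=
  width_eq (atItem_form hw hu)

theorem add_size_le {u : ℕ} (hu : u < numTok w) : u + (form w u).size ≤ numTok w := by
  rw [← length_items]; exact (atItem_form hw hu).size_le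

theorem form_bin {u : ℕ} (hu : u < numTok w) {A B : Formula}
    (hF : form w u = .and A B ∨ form w u = .or A B ∨ form w u = .imp A B) :
    form w (u + 1) = A ∧ form w (u + 1 + width w (u + 1)) = B := by
  have h := (atItem_form hw hu).bin hF
  rw [width_eq h.1]
  exact ⟨h.1.form_eq, h.2.form_eq⟩

theorem form_box {u : ℕ} (hu : u < numTok w) {A : Formula} (hF : form w u = .box A) :
    form w (u + 1) = A :=
  AtItem.form_eq (AtItem.box (hF ▸ atItem_form hw hu))

/-- A token inside another formula does not begin a member. Hence the marked tokens begin disjoint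
segments. -/
theorem mark_eq_zero_of_lt {u v : ℕ} (hu : u < numTok w) (huv : u < v)
    (hv : v < u + (form w u).size) : mark w v = 0 := by
  obtain ⟨m, r, h⟩ := atItem_form hw hu
  have hle := add_size_le hw hu
  obtain ⟨t, ht, h0⟩ := exists_ftoks_eq m (form w u)
  have hlen : t.length + 1 = (form w u).size := by rw [← length_ftoks m, ht]; rfl
  have h1 : (items w)[v]? = (ftoks m (form w u) ++ r)[v - u]? := by
    rw [← h, List.getElem?_drop]; congr 1; omega
  obtain ⟨k, hk⟩ : ∃ k, v - u = k + 1 := ⟨v - u - 1, by omega⟩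
  rw [ht, hk, List.cons_append, List.getElem?_cons_succ, List.getElem?_append_left (by omega),
    List.getElem?_eq_getElem (by rw [length_items]; omega), getElem_items,
    List.getElem?_eq_getElem (by omega), Option.some.injEq] at h1
  have := h0 _ (List.getElem_mem (l := t) (n := k) (by omega))
  rw [← h1] at this
  exact this

theorem mem_allItems {x : Item} : (∃ p < w.length + 1, IsTok (rd w p) ∧ itemAt w p = x) ↔
    x ∈ Γ.flatMap (ftoks 1) ++ Δ.flatMap (ftoks 2) := by
  classical
  rw [← allItems_encodeSequent, ← hw, allItems_eq]
  simp [and_assoc]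

/-- Unlike the list of tokens, this takes all positions into account, so that it sees the members of
weight 0 too. -/
theorem exists_root_iff {c m : ℕ} {bs : List Sym} (hc : IsTok c) (hm : m ≠ 0) :
    (∃ p < w.length + 1, rd w p = c ∧ markAt w p = m ∧
      (w.drop p).takeWhile isBitSym = bs) ↔
    (m = 1 ∧ ∃ A ∈ Γ, A.code = c ∧ A.digits = bs) ∨
      (m = 2 ∧ ∃ A ∈ Δ, A.code = c ∧ A.digits = bs) := by
  have h1 : (∃ p < w.length + 1, rd w p = c ∧ markAt w p = m ∧
      (w.drop p).takeWhile isBitSym = bs) ↔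
      ∃ p < w.length + 1, IsTok (rd w p) ∧ itemAt w p = (c, bs, m) := by
    refine exists_congr fun p => and_congr_right fun _ => ?_
    simp only [itemAt, Prod.mk.injEq]
    constructor
    · rintro ⟨rfl, h2, h3⟩; exact ⟨hc, rfl, h3, h2⟩
    · rintro ⟨-, h1, h2, h3⟩; exact ⟨h1, h3, h2⟩
  have h2 : ∀ {m'} {A : Formula}, (c, bs, m) ∈ ftoks m' A ↔
      m = m' ∧ A.code = c ∧ A.digits = bs := fun {m' A} => by
    obtain ⟨t, ht, h0⟩ := exists_ftoks_eq m' A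
    rw [ht, List.mem_cons]
    constructor
    · rintro (h | h)
      · simp only [Prod.mk.injEq] at h; exact ⟨h.2.2, h.1.symm, h.2.1.symm⟩
      · exact absurd (h0 _ h) hm
    · rintro ⟨rfl, rfl, rfl⟩; exact Or.inl rfl
  rw [h1, mem_allItems hw, List.mem_append, List.mem_flatMap, List.mem_flatMap]
  simp only [h2]
  constructor
  · rintro (⟨A, h, h'⟩ | ⟨A, h, h'⟩)
    exacts [Or.inl ⟨h'.1, A, h, h'.2⟩, Or.inr ⟨h'.1, A, h, h'.2⟩]
  · rintro (⟨h', A, h, h''⟩ | ⟨h', A, h, h''⟩)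
    exacts [Or.inl ⟨A, h, h', h''⟩, Or.inr ⟨A, h, h', h''⟩]

theorem digits_form {u i : ℕ} (hu : u < numTok w) (hi : form w u = .var i) :
    (w.drop (posOf w u)).takeWhile isBitSym = (Formula.var i).digits := by
  obtain ⟨m, r, h⟩ := atItem_form hw hu
  have h1 : (items w)[u]? = ((items w).drop u)[0]? := by simp
  rw [h, hi, List.getElem?_eq_getElem (by rwa [length_items]), getElem_items] at h1
  simp only [ftoks, List.singleton_append, List.getElem?_cons_zero, Option.some.injEq, itemAt,
    Prod.mk.injEq] at h1
  exact h1.2.1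

theorem sameBits_form {u v : ℕ} (hu : u < numTok w) (hv : v < numTok w) {i j : ℕ}
    (hi : form w u = .var i) (hj : form w v = .var j) :
    SameBits w (posOf w u) (posOf w v) ↔ i = j := by
  rw [sameBits_iff, digits_form hw hu hi, digits_form hw hv hj]
  exact bitSyms_injective.eq_iff

theorem atomAt_form {m u i : ℕ} (hm : m ≠ 0) (hu : u < numTok w) (hi : form w u = .var i) :
    AtomAt w m u ↔ (m = 1 ∧ .var i ∈ Γ) ∨ (m = 2 ∧ .var i ∈ Δ) := by
  simp only [AtomAt, sameBits_iff, digits_form hw hu hi]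
  rw [exists_root_iff hw (by simp [IsTok]) hm]
  simp only [code_eq_one, exists_eq_right]

theorem atomsClosed_iff : AtomsClosed w ↔ Sequent.IsClosed ⟨Γ, Δ⟩ := by
  have h4 : (∃ p < w.length + 1, rd w p = 4 ∧ markAt w p = 1) ↔ .bot ∈ Γ := by
    constructor
    · rintro ⟨p, hp, h1, h2⟩
      rcases (exists_root_iff hw (by simp [IsTok]) one_ne_zero).1 ⟨p, hp, h1, h2, rfl⟩ with
        ⟨-, A, h, h', -⟩ | ⟨h, -⟩
      · cases A with
        | bot => exact h
        | _ => simp [Formula.code] at h'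
      · simp at h
    · intro h
      obtain ⟨p, hp, h1, h2, -⟩ := (exists_root_iff hw (c := 4) (by simp [IsTok]) one_ne_zero).2
        (Or.inl ⟨rfl, _, h, rfl, rfl⟩)
      exact ⟨p, hp, h1, h2⟩
  have h1 : ∀ {m p}, m ≠ 0 → p < w.length + 1 → rd w p = 1 → markAt w p = m →
      ∃ i, (w.drop p).takeWhile isBitSym = (Formula.var i).digits ∧
        ((m = 1 ∧ .var i ∈ Γ) ∨ (m = 2 ∧ .var i ∈ Δ)) := fun {m p} hm hp hr hp' => by
    have key : ∀ {A : Formula}, A.code = 1 → ∃ i, A = .var i := fun {A} h => by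
      cases A with
      | var i => exact ⟨i, rfl⟩
      | _ => simp [Formula.code] at h
    rcases (exists_root_iff hw (by simp [IsTok]) hm).1 ⟨p, hp, hr, hp', rfl⟩ with
      ⟨h0, A, h, h', h''⟩ | ⟨h0, A, h, h', h''⟩
    · obtain ⟨i, rfl⟩ := key h'; exact ⟨i, h''.symm, Or.inl ⟨h0, h⟩⟩
    · obtain ⟨i, rfl⟩ := key h'; exact ⟨i, h''.symm, Or.inr ⟨h0, h⟩⟩
  rw [AtomsClosed, h4, Sequent.IsClosed, or_comm]
  refine or_congr ⟨?_, ?_⟩ Iff.rfl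
  · rintro ⟨p, hp, ⟨hr, hm⟩, q, hq, ⟨hr', hm'⟩, hs⟩
    obtain ⟨i, hi, hi'⟩ := h1 (by norm_num) hp hr hm
    obtain ⟨j, hj, hj'⟩ := h1 (by norm_num) hq hr' hm'
    rw [sameBits_iff, hi, hj] at hs
    obtain rfl : i = j := bitSyms_injective hs
    exact ⟨i, by simpa using hi', by simpa using hj'⟩
  · rintro ⟨i, hi, hi'⟩
    obtain ⟨p, hp, h1, h2, h3⟩ := (exists_root_iff hw (c := 1) (by simp [IsTok]) one_ne_zero).2
      (Or.inl ⟨rfl, _, hi, rfl, rfl⟩)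
    obtain ⟨q, hq, h1', h2', h3'⟩ := (exists_root_iff hw (c := 1) (by simp [IsTok]) two_ne_zero).2
      (Or.inr ⟨rfl, _, hi', rfl, rfl⟩)
    exact ⟨p, hp, ⟨h1, h2⟩, q, hq, ⟨h1', h2'⟩, (sameBits_iff _ _ _).2 (h3.trans h3'.symm)⟩

/-- Induction on the members: in the segment of each only the first token has a nonzero mark and
contributes to the sum. `pre` holds the items of the members already treated. -/
theorem sum_roots_aux {m : ℕ} (hm : m ≠ 0) (L : List (ℕ × Formula)) (pre : List Item)
    (h : items w = pre ++ L.flatMap fun x => ftoks x.1 x.2) :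
    (∑ u ∈ Finset.range (L.flatMap fun x => ftoks x.1 x.2).length,
      if mark w (pre.length + u) = m then ({form w (pre.length + u)} : Multiset Formula) else 0) =
      ((L.filter fun x => x.1 = m).map Prod.snd : List Formula) := by
  induction L generalizing pre with
  | nil => simp
  | cons x L ih =>
    have ih := ih (pre ++ ftoks x.1 x.2) (by rw [h]; simp)
    have hd : (items w).drop pre.length = ftoks x.1 x.2 ++ L.flatMap fun x => ftoks x.1 x.2 := by
      rw [h]; simp
    have hA : AtItem (items w) pre.length x.2 := ⟨_, _, hd⟩
    have hf := hA.form_eq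
    have hlt : pre.length < numTok w := by
      have := hA.size_le
      rw [length_items] at this
      have := x.2.size_pos
      omega
    have hmk : mark w pre.length = x.1 := by
      have h1 : (items w)[pre.length]? = ((items w).drop pre.length)[0]? := by simp
      obtain ⟨t, ht, -⟩ := exists_ftoks_eq x.1 x.2
      rw [hd, ht, List.getElem?_eq_getElem (by rwa [length_items]), getElem_items] at h1
      simp only [List.cons_append, List.getElem?_cons_zero, Option.some.injEq, itemAt,
        Prod.mk.injEq] at h1
      exact h1.2.2
    rw [List.flatMap_cons, List.length_append, Finset.sum_range_add, length_ftoks,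
      Finset.sum_eq_single 0 (fun u hu h0 => ?_)
        (fun h0 => absurd (Finset.mem_range.2 x.2.size_pos) h0), add_zero, hmk, hf]
    · simp only [List.length_append, length_ftoks, add_assoc] at ih
      rw [ih, List.filter_cons]
      by_cases hx : x.1 = m <;> simp [hx]
    · rw [if_neg]
      rw [mark_eq_zero_of_lt hw hlt (by omega) (by rw [hf]; have := Finset.mem_range.1 hu; omega)]
      exact hm.symm

theorem sum_roots {m : ℕ} (hm : m = 1 ∨ m = 2) :
    (∑ u ∈ Finset.range (numTok w), if mark w u = m then ({form w u} : Multiset Formula) else 0) =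
      ((if m = 1 then Γ else Δ).filter fun A => A.weight ≠ 0 : List Formula) := by
  have h := items_encodeSequent Γ Δ
  rw [← hw] at h
  have h1 := sum_roots_aux hw (m := m) (by omega) (rootList Γ Δ) [] h
  rw [← h, length_items] at h1
  simp only [List.length_nil, zero_add] at h1
  rw [h1]
  rcases hm with rfl | rfl <;>
    simp [rootList, List.filter_append, List.filter_map, Function.comp_def]

theorem numTok_eq : numTok w = ((rootList Γ Δ).map fun x => x.2.size).sum := by
  rw [← length_items, hw, items_encodeSequent, List.length_flatMap]
  simp [length_ftoks]

omit hw in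
theorem Formula.size_le (A : Formula) : A.size ≤ 2 * A.weight + 1 := by
  induction A <;> simp only [Formula.size, Formula.weight] <;> omega

/-- A formula of weight `k` has at most `2 * k + 1` connectives and atoms, which is at most `3 * k`
for the members that are counted, those with `k ≠ 0`. -/
theorem numTok_le : numTok w ≤ 3 * (Sequent.mk Γ Δ).weight := by
  have key : ∀ As : List Formula, ((As.filter fun A => A.weight ≠ 0).map fun x => x.size).sum ≤
      3 * (As.map Formula.weight).sum := fun As => by
    induction As with
    | nil => simp
    | cons A As ih =>
      have := A.size_le
      rw [List.filter_cons]
      by_cases h : A.weight = 0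
      · simpa [h] using ih
      · simp [h] at ih ⊢; omega
  rw [numTok_eq hw, rootList, List.map_append, List.sum_append]
  have h1 := key Γ
  have h2 := key Δ
  simp only [List.map_map, Function.comp_def, Sequent.weight, Multiset.map_coe, Multiset.sum_coe]
  simp only [ne_eq, decide_not] at h1 h2 ⊢
  omega

omit hw in
open Classical in
theorem numTok_le_length (w : List Sym) : numTok w ≤ w.length + 1 := Nat.count_le _

end Sequent

end Decode
end G3

namespace G3

open Ctx (word vals arity)

/-! Recognizing the words that encode a sequent. -/

section Valid

open Classical in
/-- One step of a scan from the right, at the letter `c` followed by `c'`. Stage 0 is failure, stages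
1 and 2 are behind a complete list of formulas on the right and on the left side, and stage
`3 + 2 * h + s` is inside a list on side `s`, before `h` formulas that end in a comma. -/
noncomputable def scanStep (c c' y : ℕ) : ℕ :=
  if IsBit c' ∧ ¬ (IsBit c ∨ c = 1) then 0
  else if IsLeaf c then (if 3 ≤ y then y + 2 else 0)
  else if c = 8 then (if 5 ≤ y then y else 0)
  else if IsBin c then (if 7 ≤ y then y - 2 else 0)
  else if c = 9 then (if y = 1 ∨ y = 2 then y + 2 else if y = 5 ∨ y = 6 then y - 2 else 0)
  else if c = 10 then (if y = 1 ∨ y = 5 then 2 else 0)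
  else if c = 3 then (if 3 ≤ y then y else 0)
  else if 3 ≤ y ∧ IsBit c' then y else 0

/-- Pending formulas are only counted, so a single number is all the memory of the scan. Round `i`
treats position `w.length - i`, starting with the last letter. -/
noncomputable def scan (w : List Sym) (i : ℕ) : ℕ :=
  recNat 1 (fun i y => scanStep (rd w (w.length - i)) (rd w (w.length - i + 1)) y) i

/-- Stage 2 is reached with an empty antecedent, stage 6 before the first formula of a nonempty one.
Digits at the very front would lack their variable letter. -/
def IsSequent (w : List Sym) : Prop :=
  (scan w w.length = 2 ∨ scan w w.length = 6) ∧ ¬ IsBit (rd w 1)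

theorem scanStep_le (c c' y : ℕ) : scanStep c c' y ≤ y + 2 := by
  unfold scanStep; split_ifs <;> omega

theorem scan_le (w : List Sym) (i : ℕ) : scan w i ≤ 2 * i + 1 := by
  induction i with
  | zero => simp [scan, recNat]
  | succ i ih => exact (scanStep_le _ _ _).trans (by change scan w i + 2 ≤ _; omega)

open Classical in
theorem LSP.isSequent {E : List Sym → ℕ} {α : Type} [Ctx α] :
    LSP E fun a : α => IsSequent (word a) := by
  have step : ∀ {β : Type} [Ctx β] {f g h : β → ℕ}, LS E f → LS E g → LS E h →
      LS E fun b => scanStep (f b) (g b) (h b) := fun hf hg hh =>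
    LSP.ite (LSP.and hg.isBit (LSP.not (LSP.or hf.isBit (hf.eq (LS.const 1))))) LS.zero
      (LSP.ite hf.isLeaf (LSP.ite ((LS.const 3).le hh) (hh.add (LS.const 2)) LS.zero)
      (LSP.ite (hf.eq (LS.const 8)) (LSP.ite ((LS.const 5).le hh) hh LS.zero)
      (LSP.ite hf.isBin (LSP.ite ((LS.const 7).le hh) (hh.sub (LS.const 2)) LS.zero)
      (LSP.ite (hf.eq (LS.const 9)) (LSP.ite (LSP.or (hh.eq (LS.const 1)) (hh.eq (LS.const 2)))
        (hh.add (LS.const 2)) (LSP.ite (LSP.or (hh.eq (LS.const 5)) (hh.eq (LS.const 6)))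
          (hh.sub (LS.const 2)) LS.zero))
      (LSP.ite (hf.eq (LS.const 10)) (LSP.ite (LSP.or (hh.eq (LS.const 1)) (hh.eq (LS.const 5)))
        (LS.const 2) LS.zero)
      (LSP.ite (hf.eq (LS.const 3)) (LSP.ite ((LS.const 3).le hh) hh LS.zero)
      (LSP.ite (LSP.and ((LS.const 3).le hh) hg.isBit) hh LS.zero)))))))
  have hs : LS E fun a : α => scan (word a) (word a).length :=
    LS.rec_of_le (init := fun _ => 1) (step := fun b : (α × ℕ) × ℕ =>
      scanStep (rd (word b) ((word b).length - b.1.2)) (rd (word b) ((word b).length - b.1.2 + 1))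
        b.2) LS.length (LS.const 1)
      (step (LS.rd (LS.length.sub LS.var.lift)) (LS.rd (LS.length.sub LS.var.lift).succ) LS.var)
      (((LS.const 2).mul LS.length).add (LS.const 1)).pb
      fun a i hi => (scan_le (word a) i).trans (by omega)
  exact LSP.and (LSP.or (hs.eq (LS.const 2)) (hs.eq (LS.const 6)))
    (LSP.not (LS.isBit (LS.rd (LS.const 1))))

noncomputable def scanList : List Sym → ℕ
  | [] => 1
  | a :: t => scanStep (symNum a) (t.head?.elim 11 symNum) (scanList t)

theorem scan_eq (w : List Sym) {i : ℕ} (hi : i ≤ w.length) :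
    scan w i = scanList (w.drop (w.length - i)) := by
  induction i with
  | zero => simp [scan, recNat, scanList]
  | succ i ih =>
    obtain ⟨p, hp⟩ : ∃ p, w.length - i = p + 1 := ⟨w.length - i - 1, by omega⟩
    have e : scan w (i + 1) =
      scanStep (rd w (w.length - i)) (rd w (w.length - i + 1)) (scan w i) := rfl
    rw [e, ih (by omega), hp, show w.length - (i + 1) = p by omega,
      List.drop_eq_getElem_cons (show p < w.length by omega), scanList, rd_succ, rd_succ,
      List.getElem?_eq_getElem (show p < w.length by omega), List.head?_drop]
    rfl

theorem isBit_head {t : List Sym} : IsBit (t.head?.elim 11 symNum) ↔ ¬ NoBit t := by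
  cases t with
  | nil => simp [IsBit, NoBit]
  | cons a t => simp [NoBit, isBit_symNum]

theorem isSequent_iff (w : List Sym) :
    IsSequent w ↔ (scanList w = 2 ∨ scanList w = 6) ∧ NoBit w := by
  rw [IsSequent, scan_eq w le_rfl, Nat.sub_self, List.drop_zero, show 1 = 0 + 1 from rfl, rd_succ]
  have := isBit_head (t := w)
  rw [List.head?_eq_getElem?] at this
  rw [this, not_not]

theorem not_isBit_head {t : List Sym} (h : NoBit t) : ¬ IsBit (t.head?.elim 11 symNum) := by
  rwa [isBit_head, not_not]

/-- What follows the lists of formulas on side `s`. -/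
def Rest : ℕ → List Sym → Prop
  | 0, t => t = []
  | _, t => ∃ Δ, t = Sym.arrow :: encodeList Δ

/-- Words that are scanned completely in stage `y`. -/
def ScanSem (y : ℕ) (t : List Sym) : Prop :=
  y = 0 ∨ (∃ s < 2, y = 1 + s ∧ Rest s t) ∨
    ∃ s < 2, ∃ (n : ℕ) (A : List Formula) (Γ : List Formula) (r : List Sym),
      y = 3 + 2 * A.length + s ∧ Rest s r ∧
      t = ((Nat.bits n).map fun b => if b then Sym.one else Sym.zero) ++
        (A.flatMap Formula.encode ++ Sym.comma :: (encodeList Γ ++ r))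

theorem noBit_stack (A Γ : List Formula) (r : List Sym) :
    NoBit (A.flatMap Formula.encode ++ Sym.comma :: (encodeList Γ ++ r)) := by
  cases A with
  | nil => simp [NoBit, isBitSym]
  | cons A As =>
    rw [List.flatMap_cons, List.append_assoc]
    exact noBit_encode _ _

theorem bits_eq_nil_of_noBit {n : ℕ} {t : List Sym}
    (h : NoBit (((Nat.bits n).map fun b => if b then Sym.one else Sym.zero) ++ t)) :
    ((Nat.bits n).map fun b => if b then Sym.one else Sym.zero) = [] := by
  rcases e : (Nat.bits n).map fun b => if b then Sym.one else Sym.zero with _ | ⟨a, l⟩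
  · exact e
  · rw [e] at h
    have h1 := h a (by simp)
    have h2 : isBitSym a = true := isBitSym_of_mem_bits (i := n) (by rw [e]; simp)
    rw [h1] at h2; cases h2

/-- Soundness of the scan: each letter completes a formula, a numeral or a list exactly as the stage
predicts. The number `n` in `ScanSem` is read from digits whose variable letter is still to come. -/
theorem scanSem_scanList (t : List Sym) : ScanSem (scanList t) t := by
  induction t with
  | nil => exact Or.inr (Or.inl ⟨0, by norm_num, rfl, rfl⟩)
  | cons a t ih =>
    rw [scanList, scanStep]
    generalize scanList t = y at ih
    have stack : 3 ≤ y → ∃ s < 2, ∃ (n : ℕ) (A : List Formula) (Γ : List Formula) (r : List Sym),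
      y = 3 + 2 * A.length + s ∧ Rest s r ∧
      t = ((Nat.bits n).map fun b => if b then Sym.one else Sym.zero) ++
        (A.flatMap Formula.encode ++ Sym.comma :: (encodeList Γ ++ r)) := fun hy => by
      rcases ih with h | ⟨s, hs, h, -⟩ | h
      · omega
      · omega
      · exact h
    have push : NoBit t → 3 ≤ y → ∃ s < 2, ∃ (A : List Formula) (Γ : List Formula) (r : List Sym),
      y = 3 + 2 * A.length + s ∧ Rest s r ∧
      t = A.flatMap Formula.encode ++ Sym.comma :: (encodeList Γ ++ r) := fun hb hy => by
      obtain ⟨s, hs, n, A, Γ, r, h1, h2, h3⟩ := stack hy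
      rw [h3] at hb
      rw [bits_eq_nil_of_noBit hb] at h3
      exact ⟨s, hs, A, Γ, r, h1, h2, h3⟩
    have fin : ∀ {s} (A : List Formula) (Γ : List Formula) (r : List Sym) {z : ℕ} {t' : List Sym},
        s < 2 → Rest s r → z = 3 + 2 * A.length + s →
        t' = A.flatMap Formula.encode ++ Sym.comma :: (encodeList Γ ++ r) → ScanSem z t' :=
      fun A Γ r _ _ hs hr hz ht => Or.inr (Or.inr ⟨_, hs, 0, A, Γ, r, hz, hr, by simpa using ht⟩)
    by_cases hb : NoBit t
    · have hb' := not_isBit_head hb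
      simp only [hb', false_and, if_false, and_false]
      cases a with
      | var =>
        rw [if_pos (by simp [IsLeaf, symNum, symCode])]
        split_ifs with hy
        · obtain ⟨s, hs, A, Γ, r, h1, h2, h3⟩ := push hb hy
          exact fin (.var 0 :: A) Γ r hs h2 (by rw [h1]; simp; ring) (by rw [h3]; simp [Formula.encode])
        · exact Or.inl rfl
      | bot =>
        rw [if_pos (by simp [IsLeaf, symNum, symCode])]
        split_ifs with hy
        · obtain ⟨s, hs, A, Γ, r, h1, h2, h3⟩ := push hb hy
          exact fin (.bot :: A) Γ r hs h2 (by rw [h1]; simp; ring) (by rw [h3]; simp [Formula.encode])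
        · exact Or.inl rfl
      | box =>
        rw [if_neg (by simp [IsLeaf, symNum, symCode]), if_pos (by simp [symNum, symCode])]
        split_ifs with hy
        · obtain ⟨s, hs, A, Γ, r, h1, h2, h3⟩ := push hb (by omega)
          rcases A with _ | ⟨B, A⟩
          · simp at h1; omega
          exact fin (.box B :: A) Γ r hs h2 (by rw [h1]; simp) (by rw [h3]; simp [Formula.encode])
        · exact Or.inl rfl
      | and =>
        rw [if_neg (by simp [IsLeaf, symNum, symCode]), if_neg (by simp [symNum, symCode]),
          if_pos (by simp [IsBin, symNum, symCode])]
        split_ifs with hy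
        · obtain ⟨s, hs, A, Γ, r, h1, h2, h3⟩ := push hb (by omega)
          rcases A with _ | ⟨B, _ | ⟨C, A⟩⟩
          · simp at h1; omega
          · simp at h1; omega
          exact fin (.and B C :: A) Γ r hs h2 (by rw [h1]; simp; omega)
            (by rw [h3]; simp [Formula.encode])
        · exact Or.inl rfl
      | or =>
        rw [if_neg (by simp [IsLeaf, symNum, symCode]), if_neg (by simp [symNum, symCode]),
          if_pos (by simp [IsBin, symNum, symCode])]
        split_ifs with hy
        · obtain ⟨s, hs, A, Γ, r, h1, h2, h3⟩ := push hb (by omega)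
          rcases A with _ | ⟨B, _ | ⟨C, A⟩⟩
          · simp at h1; omega
          · simp at h1; omega
          exact fin (.or B C :: A) Γ r hs h2 (by rw [h1]; simp; omega)
            (by rw [h3]; simp [Formula.encode])
        · exact Or.inl rfl
      | imp =>
        rw [if_neg (by simp [IsLeaf, symNum, symCode]), if_neg (by simp [symNum, symCode]),
          if_pos (by simp [IsBin, symNum, symCode])]
        split_ifs with hy
        · obtain ⟨s, hs, A, Γ, r, h1, h2, h3⟩ := push hb (by omega)
          rcases A with _ | ⟨B, _ | ⟨C, A⟩⟩
          · simp at h1; omega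
          · simp at h1; omega
          exact fin (.imp B C :: A) Γ r hs h2 (by rw [h1]; simp; omega)
            (by rw [h3]; simp [Formula.encode])
        · exact Or.inl rfl
      | comma =>
        rw [if_neg (by simp [IsLeaf, symNum, symCode]), if_neg (by simp [symNum, symCode]),
          if_neg (by simp [IsBin, symNum, symCode]), if_pos (by simp [symNum, symCode])]
        split_ifs with hy hy
        · rcases ih with h | ⟨s, hs, h, h'⟩ | ⟨s, hs, n, A, Γ, r, h1, h2, h3⟩
          · omega
          · exact fin [] [] t hs h' (by rw [h]; simp; omega) (by simp [encodeList])
          · omega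
        · obtain ⟨s, hs, A, Γ, r, h1, h2, h3⟩ := push hb (by omega)
          rcases A with _ | ⟨B, _ | ⟨C, A⟩⟩
          · simp at h1; omega
          · exact fin [] (B :: Γ) r hs h2 (by rw [h1]; simp; omega) (by rw [h3]; simp [encodeList])
          · simp at h1; omega
        · exact Or.inl rfl
      | arrow =>
        rw [if_neg (by simp [IsLeaf, symNum, symCode]), if_neg (by simp [symNum, symCode]),
          if_neg (by simp [IsBin, symNum, symCode]), if_neg (by simp [symNum, symCode]),
          if_pos (by simp [symNum, symCode])]
        split_ifs with hy
        · rcases hy with hy | hy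
          · rcases ih with h | ⟨s, hs, h, h'⟩ | ⟨s, hs, n, A, Γ, r, h1, h2, h3⟩
            · omega
            · obtain rfl : s = 0 := by omega
              obtain rfl : t = [] := h'
              exact Or.inr (Or.inl ⟨1, by norm_num, rfl, [], rfl⟩)
            · omega
          · obtain ⟨s, hs, A, Γ, r, h1, h2, h3⟩ := push hb (by omega)
            rcases A with _ | ⟨B, _ | ⟨C, A⟩⟩
            · simp at h1; omega
            · obtain rfl : s = 0 := by simp at h1; omega
              obtain rfl : r = [] := h2
              exact Or.inr (Or.inl ⟨1, by norm_num, rfl, B :: Γ, by rw [h3]; simp [encodeList]⟩)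
            · simp at h1; omega
        · exact Or.inl rfl
      | one =>
        rw [if_neg (by simp [IsLeaf, symNum, symCode]), if_neg (by simp [symNum, symCode]),
          if_neg (by simp [IsBin, symNum, symCode]), if_neg (by simp [symNum, symCode]),
          if_neg (by simp [symNum, symCode]), if_pos (by simp [symNum, symCode])]
        split_ifs with hy
        · obtain ⟨s, hs, A, Γ, r, h1, h2, h3⟩ := push hb hy
          exact Or.inr (Or.inr ⟨s, hs, 1, A, Γ, r, h1, h2, by rw [h3]; simp⟩)
        · exact Or.inl rfl
      | zero =>
        rw [if_neg (by simp [IsLeaf, symNum, symCode]), if_neg (by simp [symNum, symCode]),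
          if_neg (by simp [IsBin, symNum, symCode]), if_neg (by simp [symNum, symCode]),
          if_neg (by simp [symNum, symCode]), if_neg (by simp [symNum, symCode])]
        exact Or.inl rfl
    · have hb' := isBit_head.2 hb
      simp only [hb', true_and, and_true]
      -- A digit to the right means that the pending numeral is not empty, so its value is not 0. A
      -- digit 0 may be put in front of it only for this reason.
      have digit : 3 ≤ y → ∃ s < 2, ∃ (n : ℕ) (A : List Formula) (Γ : List Formula) (r : List Sym),
          n ≠ 0 ∧ y = 3 + 2 * A.length + s ∧ Rest s r ∧
          t = ((Nat.bits n).map fun b => if b then Sym.one else Sym.zero) ++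
            (A.flatMap Formula.encode ++ Sym.comma :: (encodeList Γ ++ r)) := fun hy => by
        obtain ⟨s, hs, n, A, Γ, r, h1, h2, h3⟩ := stack hy
        refine ⟨s, hs, n, A, Γ, r, ?_, h1, h2, h3⟩
        rintro rfl
        refine hb ?_
        rw [h3]
        simpa using noBit_stack A Γ r
      cases a with
      | var =>
        rw [if_neg (by simp [symNum, symCode]), if_pos (by simp [IsLeaf, symNum, symCode])]
        split_ifs with hy
        · obtain ⟨s, hs, n, A, Γ, r, h0, h1, h2, h3⟩ := digit hy
          exact fin (.var n :: A) Γ r hs h2 (by rw [h1]; simp; ring) (by rw [h3]; simp [Formula.encode])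
        · exact Or.inl rfl
      | one =>
        rw [if_neg (by simp [IsBit, symNum, symCode]), if_neg (by simp [IsLeaf, symNum, symCode]),
          if_neg (by simp [symNum, symCode]),
          if_neg (by simp [IsBin, symNum, symCode]), if_neg (by simp [symNum, symCode]),
          if_neg (by simp [symNum, symCode]), if_pos (by simp [symNum, symCode])]
        split_ifs with hy
        · obtain ⟨s, hs, n, A, Γ, r, h0, h1, h2, h3⟩ := digit hy
          exact Or.inr (Or.inr ⟨s, hs, 2 * n + 1, A, Γ, r, h1, h2, by
            rw [h3, Nat.bit1_bits]; simp⟩)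
        · exact Or.inl rfl
      | zero =>
        rw [if_neg (by simp [IsBit, symNum, symCode]), if_neg (by simp [IsLeaf, symNum, symCode]),
          if_neg (by simp [symNum, symCode]),
          if_neg (by simp [IsBin, symNum, symCode]), if_neg (by simp [symNum, symCode]),
          if_neg (by simp [symNum, symCode]), if_neg (by simp [symNum, symCode])]
        split_ifs with hy
        · obtain ⟨s, hs, n, A, Γ, r, h0, h1, h2, h3⟩ := digit hy
          exact Or.inr (Or.inr ⟨s, hs, 2 * n, A, Γ, r, h1, h2, by
            rw [h3, Nat.bit0_bits _ h0]; simp⟩)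
        · exact Or.inl rfl
      | _ =>
        rw [if_pos ⟨hb', by simp [IsBit, symNum, symCode]⟩]
        exact Or.inl rfl

theorem scanList_bits (n : ℕ) {t : List Sym} (h : 3 ≤ scanList t) :
    scanList (((Nat.bits n).map fun b => if b then Sym.one else Sym.zero) ++ t) = scanList t := by
  induction n using Nat.binaryRec' with
  | zero => simp
  | bit b n hn ih =>
    rw [Nat.bits_append_bit _ _ hn, List.map_cons, List.cons_append, scanList, ih]
    cases b with
    | true => simp [scanStep, IsBit, IsLeaf, IsBin, symNum, symCode, h]
    | false =>
      -- The most significant digit is written last and is 1, so a digit 0 is always followed by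
      -- another digit, as `scanStep` demands.
      have h0 : n ≠ 0 := fun h => by simpa using hn h
      have : IsBit ((((Nat.bits n).map fun b => if b then Sym.one else Sym.zero) ++ t).head?.elim 11
          symNum) := by
        rw [isBit_head]
        intro hb
        have := bits_eq_nil_of_noBit hb
        rw [List.map_eq_nil_iff] at this
        exact h0 (bits_injective (by rw [this]; simp))
      rw [scanStep, if_neg (by simp [IsBit, symNum, symCode])]
      simp only [this, and_true]
      simp [IsLeaf, IsBin, symNum, symCode, h]

theorem scanList_encode (A : Formula) : ∀ {t : List Sym}, NoBit t → 3 ≤ scanList t →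
    scanList (A.encode ++ t) = scanList t + 2 := by
  induction A with
  | var i =>
    intro t ht h
    rw [Formula.encode, List.cons_append, scanList, scanList_bits i h, scanStep]
    simp [IsBit, IsLeaf, symNum, symCode, h]
  | bot =>
    intro t ht h
    rw [Formula.encode, List.singleton_append, scanList, scanStep, if_neg (fun h => not_isBit_head ht h.1)]
    simp [IsLeaf, symNum, symCode, h]
  | and A B ihA ihB | or A B ihA ihB | imp A B ihA ihB =>
    intro t ht h
    rw [Formula.encode, List.cons_append, List.append_assoc, scanList, scanStep,
      if_neg (fun h => not_isBit_head (noBit_encode _ _) h.1), ihA (noBit_encode _ _) (by rw [ihB ht h]; omega),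
      ihB ht h]
    simp only [IsLeaf, IsBin, symNum, symCode]
    simp [show 7 ≤ scanList t + 2 + 2 by omega]
  | box A ih =>
    intro t ht h
    rw [Formula.encode, List.cons_append, scanList, scanStep,
      if_neg (fun h => not_isBit_head (noBit_encode _ _) h.1), ih ht h]
    simp [IsLeaf, symNum, symCode, h]

/-- A list leaves the scan at `1 + s` if there is nothing before its comma structure, and at `5 + s`
in front of a first formula that no comma precedes. -/
theorem scanList_encodeList (As : List Formula) {s : ℕ} (hs : s < 2) {t : List Sym}
    (h : scanList t = 1 + s ∨ scanList t = 5 + s) (ht : NoBit t) :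
    scanList (encodeList As ++ t) = 1 + s ∨ scanList (encodeList As ++ t) = 5 + s := by
  induction As with
  | nil => exact h
  | cons A As ih =>
    have e : encodeList (A :: As) ++ t = A.encode ++ Sym.comma :: (encodeList As ++ t) := by
      simp [encodeList]
    have : scanList (Sym.comma :: (encodeList As ++ t)) = 3 + s := by
      rw [scanList, scanStep, if_neg (fun h => not_isBit_head (noBit_encodeList As ht) h.1)]
      simp only [IsLeaf, IsBin, symNum, symCode]
      interval_cases s <;> rcases ih with ih | ih <;> simp [ih]
    rw [e, scanList_encode _ (by simp [NoBit, isBitSym]) (by omega), this]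
    omega

theorem isSequent_iff_exists (w : List Sym) : IsSequent w ↔ ∃ Γ Δ, w = encodeSequent Γ Δ := by
  rw [isSequent_iff]
  constructor
  · rintro ⟨h, hb⟩
    have hS := scanSem_scanList w
    generalize scanList w = y at h hS
    rcases hS with h' | ⟨s, hs, h', hr⟩ | ⟨s, hs, n, A, Γ, r, h', hr, rfl⟩
    · omega
    · obtain rfl : s = 1 := by omega
      obtain ⟨Δ, rfl⟩ := hr
      exact ⟨[], Δ, rfl⟩
    · rcases A with _ | ⟨B, _ | ⟨C, A⟩⟩
      · simp only [List.length_nil] at h'; omega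
      · obtain rfl : s = 1 := by simp only [List.length_nil, List.length_cons] at h'; omega
        obtain ⟨Δ, rfl⟩ := hr
        refine ⟨B :: Γ, Δ, ?_⟩
        rw [bits_eq_nil_of_noBit hb]
        simp [encodeSequent, encodeList]
      · simp only [List.length_cons] at h'; omega
  · rintro ⟨Γ, Δ, rfl⟩
    have h1 : scanList (Sym.arrow :: encodeList Δ) = 2 := by
      have h := scanList_encodeList Δ (s := 0) (t := []) (by norm_num) (Or.inl rfl) (by simp [NoBit])
      have hb := noBit_encodeList Δ (t := []) (by simp [NoBit])
      rw [List.append_nil] at h hb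
      rw [scanList, scanStep, if_neg (fun h => not_isBit_head hb h.1)]
      simp only [IsLeaf, IsBin, symNum, symCode]
      rcases h with h | h <;> simp [h]
    have hb : NoBit (Sym.arrow :: encodeList Δ) := by simp [NoBit, isBitSym]
    refine ⟨?_, noBit_encodeList Γ hb⟩
    exact scanList_encodeList Γ (s := 1) (by norm_num) (Or.inl h1) hb

end Valid
end G3

namespace G3

/-! The modal and deontic rules by their principal formulas. -/

section Rules

def ModalRule.num : ModalRule → ℕ
  | .LRE => 1
  | .LRM => 2
  | .LRR => 3
  | .LRC => 4
  | .LRK => 5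
  | .RN => 6
  | .LDbot => 7
  | .LDdiaE => 8
  | .LDdiaM => 9
  | .LDdiaC => 10
  | .LDstar => 11

/-- The rule with number `c` admits `m` and `n` principal formulas on the left and `k` on the
right. -/
def Admits (c m n k : ℕ) : Prop :=
  ((c = 1 ∨ c = 2) ∧ m = 1 ∧ n = 0 ∧ k = 1) ∨ ((c = 3 ∨ c = 4) ∧ 1 ≤ m ∧ n = 0 ∧ k = 1) ∨
  (c = 5 ∧ n = 0 ∧ k = 1) ∨ (c = 6 ∧ m = 0 ∧ n = 0 ∧ k = 1) ∨ (c = 7 ∧ m = 1 ∧ n = 0 ∧ k = 0) ∨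
  ((c = 8 ∨ c = 9) ∧ 1 ≤ m ∧ m ≤ 2 ∧ n = 0 ∧ k = 0) ∨ (c = 10 ∧ 1 ≤ m ∧ 1 ≤ n ∧ k = 0) ∨
  (c = 11 ∧ 1 ≤ m ∧ n = 0 ∧ k = 0)

/-- The rule with number `c` applies to the principal formulas `□P`, `□Q` on the left and `□R` on
the right, with derivable premisses. -/
def RuleSem (X : Calculus) (c : ℕ) (P Q R : Multiset Formula) : Prop :=
  Admits c P.card Q.card R.card ∧ Derivable X ⟨P + Q, R⟩ ∧
    (c = 1 ∨ c = 4 → ∀ A ∈ P, Derivable X ⟨R, {A}⟩) ∧ (c = 8 → Derivable X ⟨0, P⟩) ∧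
    (c = 10 → ∀ A ∈ P, ∀ B ∈ Q, Derivable X ⟨0, {A, B}⟩)

theorem exists_eq_boxes_unboxes_add (Γ : Multiset Formula) :
    ∃ Γ', Γ = boxes (unboxes Γ) + Γ' := by
  induction Γ using Multiset.induction with
  | empty => exact ⟨0, by simp [unboxes, boxes]⟩
  | cons A Γ ih =>
    obtain ⟨Γ', h⟩ := ih
    cases hA : A.unbox? with
    | some B =>
      obtain rfl : A = .box B := by cases A <;> simp_all [Formula.unbox?]
      refine ⟨Γ', ?_⟩
      rw [unboxes, Multiset.filterMap_cons_some _ _ _ hA, boxes, Multiset.map_cons,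
        Multiset.cons_add]
      exact congrArg _ h
    | none =>
      refine ⟨A ::ₘ Γ', ?_⟩
      rw [Multiset.add_cons, unboxes, Multiset.filterMap_cons_none _ _ hA]
      exact congrArg _ h

theorem le_unboxes_iff {P Γ : Multiset Formula} : P ≤ unboxes Γ ↔ ∃ Γ', Γ = boxes P + Γ' := by
  constructor
  · intro h
    obtain ⟨Q, hQ⟩ := Multiset.le_iff_exists_add.1 h
    obtain ⟨Γ', hΓ⟩ := exists_eq_boxes_unboxes_add Γ
    exact ⟨boxes Q + Γ', by rw [← add_assoc, ← boxes_add, ← hQ]; exact hΓ⟩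
  · rintro ⟨Γ', rfl⟩; exact le_unboxes _ _

/-- All rules have a common form: the formulas under the principal boxes give the main premiss `P, Q
⟹ R`, and only the rules numbered 1, 4, 8 and 10 have further premisses. The second multiset `Q`
serves `LDdiaC` alone. -/
theorem exists_ruleInst_iff (X : Calculus) (r : ModalRule) (S : Sequent) :
    (∃ ps, RuleInst r ps S ∧ ∀ P ∈ ps, Derivable X P) ↔
      ∃ P Q R, P + Q ≤ unboxes S.ant ∧ R ≤ unboxes S.suc ∧ RuleSem X r.num P Q R := by
  have sing : ∀ A : Formula, boxes {A} = {.box A} := fun A => by simp [boxes]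
  have key : ∀ {P Q R Γ Δ}, S = ⟨boxes (P + Q) + Γ, boxes R + Δ⟩ →
      P + Q ≤ unboxes S.ant ∧ R ≤ unboxes S.suc := by
    rintro P Q R Γ Δ rfl
    exact ⟨le_unboxes _ _, le_unboxes _ _⟩
  constructor
  · rintro ⟨ps, h, hd⟩
    cases h with
    | LRE A B Γ Δ =>
      obtain ⟨h1, h2⟩ := key (P := {A}) (Q := 0) (R := {B}) (Γ := Γ) (Δ := Δ) (by simp [sing])
      exact ⟨_, _, _, h1, h2, by simp [Admits, ModalRule.num], by simpa using hd _ (by simp),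
        by simpa using fun _ => hd ⟨{B}, {A}⟩ (by simp), by simp [ModalRule.num],
        by simp [ModalRule.num]⟩
    | LRM A B Γ Δ =>
      obtain ⟨h1, h2⟩ := key (P := {A}) (Q := 0) (R := {B}) (Γ := Γ) (Δ := Δ) (by simp [sing])
      exact ⟨_, _, _, h1, h2, by simp [Admits, ModalRule.num], by simpa using hd,
        by simp [ModalRule.num], by simp [ModalRule.num], by simp [ModalRule.num]⟩
    | LRR A B P Γ Δ =>
      obtain ⟨h1, h2⟩ := key (P := A ::ₘ P) (Q := 0) (R := {B}) (Γ := Γ) (Δ := Δ)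
        (by simp [boxes])
      exact ⟨_, _, _, h1, h2, by simp [Admits, ModalRule.num], by simpa using hd,
        by simp [ModalRule.num], by simp [ModalRule.num], by simp [ModalRule.num]⟩
    | LRC As B Γ Δ h0 =>
      obtain ⟨h1, h2⟩ := key (P := As) (Q := 0) (R := {B}) (Γ := Γ) (Δ := Δ) (by simp [sing])
      refine ⟨_, _, _, h1, h2, ?_, by simpa using hd _ (by simp), fun _ A hA => hd _ ?_,
        by simp [ModalRule.num], by simp [ModalRule.num]⟩
      · have := List.length_pos_iff.2 h0
        simp [Admits, ModalRule.num]; omega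
      · simp only [List.mem_cons, List.mem_map]
        exact Or.inr ⟨A, by simpa using hA, rfl⟩
    | LRK B P Γ Δ =>
      obtain ⟨h1, h2⟩ := key (P := P) (Q := 0) (R := {B}) (Γ := Γ) (Δ := Δ) (by simp [sing])
      exact ⟨_, _, _, h1, h2, by simp [Admits, ModalRule.num], by simpa using hd,
        by simp [ModalRule.num], by simp [ModalRule.num], by simp [ModalRule.num]⟩
    | RN B Γ Δ =>
      obtain ⟨h1, h2⟩ := key (P := 0) (Q := 0) (R := {B}) (Γ := Γ) (Δ := Δ)
        (by simp [boxes])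
      exact ⟨_, _, _, h1, h2, by simp [Admits, ModalRule.num], by simpa using hd,
        by simp [ModalRule.num], by simp [ModalRule.num], by simp [ModalRule.num]⟩
    | LDbot A Γ Δ =>
      obtain ⟨h1, h2⟩ := key (P := {A}) (Q := 0) (R := 0) (Γ := Γ) (Δ := Δ) (by simp [boxes])
      exact ⟨_, _, _, h1, h2, by simp [Admits, ModalRule.num], by simpa using hd,
        by simp [ModalRule.num], by simp [ModalRule.num], by simp [ModalRule.num]⟩
    | LDdiaE P Γ Δ h0 h2' =>
      obtain ⟨h1, h2⟩ := key (P := P) (Q := 0) (R := 0) (Γ := Γ) (Δ := Δ) (by simp [boxes])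
      have := Multiset.card_pos.2 h0
      exact ⟨_, _, _, h1, h2, by simp [Admits, ModalRule.num]; omega, by simpa using hd _ (by simp),
        by simp [ModalRule.num], fun _ => hd _ (by simp), by simp [ModalRule.num]⟩
    | LDdiaM P Γ Δ h0 h2' =>
      obtain ⟨h1, h2⟩ := key (P := P) (Q := 0) (R := 0) (Γ := Γ) (Δ := Δ) (by simp [boxes])
      have := Multiset.card_pos.2 h0
      exact ⟨_, _, _, h1, h2, by simp [Admits, ModalRule.num]; omega, by simpa using hd,
        by simp [ModalRule.num], by simp [ModalRule.num], by simp [ModalRule.num]⟩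
    | LDdiaC As Bs Γ Δ hA hB =>
      obtain ⟨h1, h2⟩ := key (P := As) (Q := Bs) (R := 0) (Γ := Γ) (Δ := Δ)
        (by rw [boxes_add]; simp [boxes])
      refine ⟨_, _, _, h1, h2, ?_, hd _ (by simp), by simp [ModalRule.num],
        by simp [ModalRule.num], fun _ A hA' B hB' => hd _ ?_⟩
      · have := List.length_pos_iff.2 hA
        have := List.length_pos_iff.2 hB
        simp [Admits, ModalRule.num]; omega
      · simp only [List.mem_cons, List.mem_map]
        exact Or.inr ⟨(A, B), by simpa [List.mem_product] using ⟨hA', hB'⟩, rfl⟩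
    | LDstar P Γ Δ h0 =>
      obtain ⟨h1, h2⟩ := key (P := P) (Q := 0) (R := 0) (Γ := Γ) (Δ := Δ) (by simp [boxes])
      have := Multiset.card_pos.2 h0
      exact ⟨_, _, _, h1, h2, by simp [Admits, ModalRule.num]; omega, by simpa using hd,
        by simp [ModalRule.num], by simp [ModalRule.num], by simp [ModalRule.num]⟩
  · rintro ⟨P, Q, R, h1, h2, hv, hm, hs1, hs2, hs3⟩
    obtain ⟨Γ, hΓ⟩ := le_unboxes_iff.1 h1
    obtain ⟨Δ, hΔ⟩ := le_unboxes_iff.1 h2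
    obtain rfl : S = ⟨boxes (P + Q) + Γ, boxes R + Δ⟩ := by cases S; simp_all
    clear h1 h2 hΓ hΔ
    have one : ∀ {P : Multiset Formula}, P.card = 1 → ∃ A, P = {A} := Multiset.card_eq_one.1
    have zero : ∀ {P : Multiset Formula}, P.card = 0 → P = 0 := Multiset.card_eq_zero.1
    have ne : ∀ {P : Multiset Formula}, 1 ≤ P.card → P ≠ 0 := fun h => Multiset.card_pos.1 h
    cases r <;> simp only [Admits, ModalRule.num, Nat.reduceEqDiff, or_self, or_false, false_or,
      false_and, true_and, or_true, OfNat.ofNat_ne_one, OfNat.one_ne_ofNat,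
      forall_const, false_imp_iff] at hv hm hs1 hs2 hs3
    case LRE =>
      obtain ⟨a, b, c⟩ := hv
      obtain ⟨A, rfl⟩ := one a
      obtain rfl := zero b
      obtain ⟨B, rfl⟩ := one c
      refine ⟨_, by simpa [sing] using RuleInst.LRE A B Γ Δ, ?_⟩
      rw [add_zero] at hm
      simpa using And.intro hm (hs1 A (by simp))
    case LRM =>
      obtain ⟨a, b, c⟩ := hv
      obtain ⟨A, rfl⟩ := one a
      obtain rfl := zero b
      obtain ⟨B, rfl⟩ := one c
      refine ⟨_, by simpa [sing] using RuleInst.LRM A B Γ Δ, ?_⟩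
      simpa using hm
    case LRR =>
      obtain ⟨a, b, c⟩ := hv
      obtain ⟨A, hA⟩ := Multiset.exists_mem_of_ne_zero (ne a)
      obtain ⟨P, rfl⟩ := Multiset.exists_cons_of_mem hA
      obtain rfl := zero b
      obtain ⟨B, rfl⟩ := one c
      refine ⟨_, by simpa [sing, boxes] using RuleInst.LRR A B P Γ Δ, ?_⟩
      simpa using hm
    case LRC =>
      obtain ⟨a, b, c⟩ := hv
      obtain rfl := zero b
      obtain ⟨B, rfl⟩ := one c
      induction P using Quotient.inductionOn with
      | _ P =>
      refine ⟨_, by simpa [sing] using RuleInst.LRC P B Γ Δ (by rintro rfl; simp at a), ?_⟩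
      simp only [List.mem_cons, List.mem_map, forall_eq_or_imp]
      refine ⟨by simpa using hm, ?_⟩
      rintro _ ⟨A, hA, rfl⟩
      exact hs1 A hA
    case LRK =>
      obtain ⟨b, c⟩ := hv
      obtain rfl := zero b
      obtain ⟨B, rfl⟩ := one c
      refine ⟨_, by simpa [sing] using RuleInst.LRK B P Γ Δ, ?_⟩
      simpa using hm
    case RN =>
      obtain ⟨a, b, c⟩ := hv
      obtain rfl := zero a
      obtain rfl := zero b
      obtain ⟨B, rfl⟩ := one c
      refine ⟨_, by simpa [boxes] using RuleInst.RN B Γ Δ, ?_⟩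
      simpa using hm
    case LDbot =>
      obtain ⟨a, b, c⟩ := hv
      obtain ⟨A, rfl⟩ := one a
      obtain rfl := zero b
      obtain rfl := zero c
      refine ⟨_, by simpa [boxes] using RuleInst.LDbot A Γ Δ, ?_⟩
      simpa using hm
    case LDdiaE =>
      obtain ⟨a, a', b, c⟩ := hv
      obtain rfl := zero b
      obtain rfl := zero c
      refine ⟨_, by simpa [boxes] using RuleInst.LDdiaE P Γ Δ (ne a) a', ?_⟩
      rw [add_zero] at hm
      simpa using And.intro hm hs2
    case LDdiaM =>
      obtain ⟨a, a', b, c⟩ := hv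
      obtain rfl := zero b
      obtain rfl := zero c
      refine ⟨_, by simpa [boxes] using RuleInst.LDdiaM P Γ Δ (ne a) a', ?_⟩
      simpa using hm
    case LDdiaC =>
      obtain ⟨a, b, c⟩ := hv
      obtain rfl := zero c
      rw [boxes_add]
      induction P using Quotient.inductionOn with
      | _ P =>
      induction Q using Quotient.inductionOn with
      | _ Q =>
      refine ⟨_, by
        simpa [boxes] using RuleInst.LDdiaC P Q Γ Δ (by rintro rfl; simp at a)
          (by rintro rfl; simp at b), ?_⟩
      simp only [List.mem_cons, List.mem_map, forall_eq_or_imp]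
      refine ⟨by simpa using hm, ?_⟩
      rintro _ ⟨⟨A, B⟩, h, rfl⟩
      rw [List.pair_mem_product] at h
      exact hs3 A h.1 B h.2
    case LDstar =>
      obtain ⟨a, b, c⟩ := hv
      obtain rfl := zero b
      obtain rfl := zero c
      refine ⟨_, by simpa [boxes] using RuleInst.LDstar P Γ Δ (ne a), ?_⟩
      simpa using hm

/-- The principal formulas `□P`, `□Q`, `□R` can be completed from `□U` on the left and `□V` on the
right. -/
def Completable (X : Calculus) (c : ℕ) (U V P Q R : Multiset Formula) : Prop :=
  ∃ P' Q' R', P' + Q' ≤ U ∧ R' ≤ V ∧ RuleSem X c (P + P') (Q + Q') (R + R')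

theorem completable_zero {X : Calculus} {c : ℕ} {P Q R : Multiset Formula} :
    Completable X c 0 0 P Q R ↔ RuleSem X c P Q R := by
  constructor
  · rintro ⟨P', Q', R', h1, h2, h⟩
    have h1 := Multiset.le_zero.1 h1
    have h2 := Multiset.le_zero.1 h2
    obtain ⟨rfl, rfl⟩ := add_eq_zero.1 h1
    subst h2
    simpa using h
  · exact fun h => ⟨0, 0, 0, by simp, by simp, by simpa using h⟩

/-- The choice of the principal multisets is made for one boxed formula at a time: it goes to the
first multiset, to the second, or is dropped. -/
theorem completable_cons_left {X : Calculus} {c : ℕ} {A : Formula} {U V P Q R : Multiset Formula} :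
    Completable X c (A ::ₘ U) V P Q R ↔ Completable X c U V (A ::ₘ P) Q R ∨
      Completable X c U V P (A ::ₘ Q) R ∨ Completable X c U V P Q R := by
  constructor
  · rintro ⟨P', Q', R', h1, h2, h⟩
    by_cases hA : A ∈ P' + Q'
    · rcases Multiset.mem_add.1 hA with hA | hA
      · obtain ⟨P', rfl⟩ := Multiset.exists_cons_of_mem hA
        rw [Multiset.cons_add, Multiset.cons_le_cons_iff] at h1
        exact Or.inl ⟨P', Q', R', h1, h2, by simpa using h⟩
      · obtain ⟨Q', rfl⟩ := Multiset.exists_cons_of_mem hA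
        rw [Multiset.add_cons, Multiset.cons_le_cons_iff] at h1
        exact Or.inr (Or.inl ⟨P', Q', R', h1, h2, by simpa using h⟩)
    · exact Or.inr (Or.inr ⟨P', Q', R', (Multiset.le_cons_of_notMem hA).1 h1, h2, h⟩)
  · rintro (⟨P', Q', R', h1, h2, h⟩ | ⟨P', Q', R', h1, h2, h⟩ | ⟨P', Q', R', h1, h2, h⟩)
    · exact ⟨A ::ₘ P', Q', R', by rw [Multiset.cons_add]; exact Multiset.cons_le_cons _ h1, h2,
        by simpa using h⟩
    · exact ⟨P', A ::ₘ Q', R', by rw [Multiset.add_cons]; exact Multiset.cons_le_cons _ h1, h2,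
        by simpa using h⟩
    · exact ⟨P', Q', R', h1.trans (Multiset.le_cons_self _ _), h2, h⟩

theorem completable_cons_right {X : Calculus} {c : ℕ} {A : Formula} {U V P Q R : Multiset Formula} :
    Completable X c U (A ::ₘ V) P Q R ↔ Completable X c U V P Q (A ::ₘ R) ∨
      Completable X c U V P Q R := by
  constructor
  · rintro ⟨P', Q', R', h1, h2, h⟩
    by_cases hA : A ∈ R'
    · obtain ⟨R', rfl⟩ := Multiset.exists_cons_of_mem hA
      rw [Multiset.cons_le_cons_iff] at h2
      exact Or.inl ⟨P', Q', R', h1, h2, by simpa using h⟩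
    · exact Or.inr ⟨P', Q', R', h1, (Multiset.le_cons_of_notMem hA).1 h2, h⟩
  · rintro (⟨P', Q', R', h1, h2, h⟩ | ⟨P', Q', R', h1, h2, h⟩)
    · exact ⟨P', Q', A ::ₘ R', h1, Multiset.cons_le_cons _ h2, by simpa using h⟩
    · exact ⟨P', Q', R', h1, h2.trans (Multiset.le_cons_self _ _), h⟩

/-- The numbers of the rules of a calculus. -/
def ruleNum (X : Calculus) (d : ℕ) : ℕ := (X.rules.map ModalRule.num).getD d 12

/-- No calculus has more than four rules. Superfluous values of `d` yield the number 12, which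
admits no principal formulas whatever. -/
theorem exists_xInst_iff {X : Calculus} {S : Sequent} {D : ℕ} (hD : 4 ≤ D) :
    (∃ ps, XInst X ps S ∧ ∀ P ∈ ps, Derivable X P) ↔
      ∃ d < D, Completable X (ruleNum X d) (unboxes S.ant) (unboxes S.suc) 0 0 0 := by
  have h1 : (∃ ps, XInst X ps S ∧ ∀ P ∈ ps, Derivable X P) ↔
      ∃ r ∈ X.rules, ∃ ps, RuleInst r ps S ∧ ∀ P ∈ ps, Derivable X P := by
    constructor
    · rintro ⟨ps, ⟨r, hr, h⟩, hd⟩; exact ⟨r, hr, ps, h, hd⟩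
    · rintro ⟨r, hr, ps, h, hd⟩; exact ⟨ps, ⟨r, hr, h⟩, hd⟩
  have h2 : X.rules.length ≤ 4 := by cases X <;> simp [Calculus.rules]
  rw [h1]
  constructor
  · rintro ⟨r, hr, h⟩
    obtain ⟨d, hd, rfl⟩ := List.getElem_of_mem hr
    refine ⟨d, by omega, ?_⟩
    have e : ruleNum X d = X.rules[d].num := by simp [ruleNum, hd]
    rw [e]
    simpa [Completable] using (exists_ruleInst_iff X _ S).1 h
  · rintro ⟨d, -, h⟩
    by_cases hd : d < X.rules.length
    · have e : ruleNum X d = X.rules[d].num := by simp [ruleNum, hd]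
      rw [e] at h
      exact ⟨_, List.getElem_mem hd, (exists_ruleInst_iff X _ S).2 (by simpa [Completable] using h)⟩
    · obtain ⟨P, Q, R, -, -, h, -⟩ := h
      have e : ruleNum X d = 12 := by
        simp [ruleNum, List.getElem?_eq_none (show X.rules.length ≤ d by omega)]
      rw [e] at h
      simp [Admits] at h

end Rules
end G3

namespace G3

open Ctx (word vals arity)

/-! Derivability as a game. A position is a sequence of digits, one for each token of the word: 0 for
absent, 1 and 2 for members of the antecedent and of the succedent. In the course of the choice of an
instance of the rule with number `phase`, 3 and 4 stand for chosen principal formulas on the left and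
5 for those on the right. `flag` is 1 if the propositional variables and `⊥` among the members of
the end-sequent belong to the position. -/

section Play

open Classical

variable (X : Calculus) (w : List Sym) (s d : ℕ)

/-- Two more entries follow the digits of the tokens in the array: the phase and, after it, the
flag. -/
noncomputable def phase : ℕ := get s (numTok w)

noncomputable def flag : ℕ := get s (numTok w + 1)

noncomputable def mkState (p f : ℕ) (g : ℕ → ℕ) : ℕ :=
  mkArr (numTok w + 2) fun v => if v < numTok w then g v else if v = numTok w then p else f

def ClosedPos : Prop :=
  (∃ u < numTok w, get s u = 1 ∧ kd w u = 4) ∨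
  (∃ u < numTok w, (get s u = 1 ∧ kd w u = 1) ∧ ∃ v < numTok w, (get s v = 2 ∧ kd w v = 1) ∧
    SameBits w (posOf w u) (posOf w v)) ∨
  (flag w s = 1 ∧ (AtomsClosed w ∨ (∃ u < numTok w, (get s u = 1 ∧ kd w u = 1) ∧ AtomAt w 2 u) ∨
    ∃ u < numTok w, (get s u = 2 ∧ kd w u = 1) ∧ AtomAt w 1 u))

/-- The first member with a propositional connective. -/
noncomputable def firstBin : ℕ :=
  bmin (numTok w) fun u => (get s u = 1 ∨ get s u = 2) ∧ IsBin (kd w u)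

/-- The first boxed formula that has not been chosen or dropped. -/
noncomputable def firstOpen : ℕ := bmin (numTok w) fun u => get s u = 1 ∨ get s u = 2

/-- The choices of a rule and of principal formulas are OR-positions; passing to the premisses of a
propositional rule or of a completed `X`-instance is an AND-position. Words that do not encode a
sequent are lost at once. -/
noncomputable def posKind : ℕ :=
  if IsSequent w then
    if phase w s = 0 then
      if ClosedPos w s then 1 else if firstBin w s < numTok w then 2 else 3
    else if firstOpen w s < numTok w then 3
    else if Admits (phase w s) (Nat.count (fun u => get s u = 3) (numTok w))
      (Nat.count (fun u => get s u = 4) (numTok w)) (Nat.count (fun u => get s u = 5) (numTok w))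
      then 2 else 0
  else 0

/-- The side of the first immediate subformula of a formula on side `m` in premiss `d` of the
propositional rule for the connective `c`; 0 if it is absent. -/
noncomputable def fstSide (c m : ℕ) : ℕ :=
  if c = 5 then (if m = 1 then 1 else if d = 0 then 2 else 0)
  else if c = 6 then (if m = 1 then (if d = 0 then 1 else 0) else 2)
  else (if m = 1 then (if d = 0 then 2 else 0) else 1)

/-- The side of the second immediate subformula. -/
noncomputable def sndSide (c m : ℕ) : ℕ :=
  if c = 5 then (if m = 1 then 1 else if d = 0 then 0 else 2)
  else if c = 6 then (if m = 1 then (if d = 0 then 0 else 1) else 2)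
  else (if m = 1 then (if d = 0 then 0 else 1) else 2)

noncomputable def propDigit (u v : ℕ) : ℕ :=
  if v = u + 1 + width w (u + 1) then sndSide d (kd w u) (get s u)
  else if v = u + 1 then fstSide d (kd w u) (get s u)
  else if v = u then 0 else get s v

noncomputable def ruleDigit (v : ℕ) : ℕ := if kd w v = 8 then get s v else 0

noncomputable def chooseDigit (u v : ℕ) : ℕ :=
  if v = u then
    if get s u = 1 then (if d = 1 then 3 else if d = 2 then 4 else 0) else (if d = 1 then 5 else 0)
  else get s v

/-- The digit of the formula under the box of token `u` in premiss `d` of a modal rule. Premiss 0 is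
the main premiss; a pair of tokens is the number of another one. -/
noncomputable def premDigit (u : ℕ) : ℕ :=
  -- The test on the remainder is needed for `numTok w = 0`, where the remainder is `d - 1`.
  if d ≠ 0 ∧ (phase w s = 1 ∨ phase w s = 4) ∧ (d - 1) % numTok w < numTok w ∧
      get s ((d - 1) % numTok w) = 3 then
    if get s u = 5 then 1 else if u = (d - 1) % numTok w then 2 else 0
  else if d ≠ 0 ∧ phase w s = 8 then (if get s u = 3 then 2 else 0)
  else if d ≠ 0 ∧ phase w s = 10 ∧ ((d - 1) % numTok w < numTok w ∧
      get s ((d - 1) % numTok w) = 3) ∧ (d - 1) / numTok w < numTok w ∧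
      get s ((d - 1) / numTok w) = 4 then
    if u = (d - 1) % numTok w ∨ u = (d - 1) / numTok w then 2 else 0
  else if get s u = 3 ∨ get s u = 4 then 1 else if get s u = 5 then 2 else 0

noncomputable def posNext : ℕ :=
  if phase w s = 0 then
    if firstBin w s < numTok w then mkState w 0 (flag w s) (propDigit w s d (firstBin w s))
    else mkState w (ruleNum X d) 0 (ruleDigit w s)
  else if firstOpen w s < numTok w then mkState w (phase w s) 0 (chooseDigit s d (firstOpen w s))
  -- The formula under a box begins one token later, so the digits are shifted by one place.
  else mkState w 0 0 fun v => if v = 0 then 0 else premDigit w s d (v - 1)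

noncomputable def posInit : ℕ := mkState w 0 1 (mark w)

/-- Pairs of tokens number the side premisses of `LDdiaC`, and the summand 4 leaves room for the
rules. Moves that a position does not need repeat another move or choose the impossible rule 12. -/
noncomputable def posMoves : ℕ := numTok w * numTok w + 4

/-- A bound for the potential of the initial position: three for each token and one for phase 0. -/
noncomputable def posDepth : ℕ := 3 * numTok w + 1

/-- A bound for the positions and the plays. -/
noncomputable def posBound : ℕ := (posMoves w + 2) ^ (posDepth w + 9)

theorem pow_numTok_le : 16 ^ (numTok w + 2) ≤ posBound w := by
  rw [posBound, posMoves, posDepth]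
  -- The base `posMoves w + 2` is at least 6, and `16 ≤ 6 ^ 2`.
  calc 16 ^ (numTok w + 2) ≤ (6 ^ 2) ^ (numTok w + 2) := Nat.pow_le_pow_left (by norm_num) _
    _ = 6 ^ (2 * (numTok w + 2)) := by rw [pow_mul]
    _ ≤ 6 ^ (3 * numTok w + 1 + 9) := Nat.pow_le_pow_right (by norm_num) (by omega)
    _ ≤ _ := Nat.pow_le_pow_left (by omega) _

theorem mkState_le (p f : ℕ) (g : ℕ → ℕ) : mkState w p f g ≤ posBound w :=
  (mkArr_lt _ _).le.trans (pow_numTok_le w)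

theorem posNext_le : posNext X w s d ≤ posBound w := by
  unfold posNext; split_ifs <;> exact mkState_le _ _ _ _

end Play

/-! ### The ingredients of the game lie in the class -/

section Space

open Classical

variable {α : Type} [Ctx α]

theorem LS.phase {f : α → ℕ} (hf : LS posBound f) :
    LS posBound fun a => G3.phase (word a) (f a) := hf.get LS.numTok

theorem LS.flag {f : α → ℕ} (hf : LS posBound f) :
    LS posBound fun a => G3.flag (word a) (f a) := hf.get LS.numTok.succ

theorem LS.mkState {p f : α → ℕ} {g : α → ℕ → ℕ} (hp : LS posBound p) (hf : LS posBound f)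
    (hg : LS posBound fun b : α × ℕ => g b.1 b.2) :
    LS posBound fun a => G3.mkState (word a) (p a) (f a) (g a) := by
  refine LS.mkArr (f := fun a v => if v < G3.numTok (word a) then g a v else
    if v = G3.numTok (word a) then p a else f a) LS.numTok.succ.succ ?_ ?_
  · exact LSP.ite (LS.lt LS.var LS.numTok) hg
      (LSP.ite (LS.eq LS.var LS.numTok) hp.lift hf.lift)
  · exact PB.param.mono fun a => pow_numTok_le _

theorem LSP.closedPos {f : α → ℕ} (hf : LS posBound f) :
    LSP posBound fun a => ClosedPos (word a) (f a) := by
  have h : ∀ {β : Type} [Ctx β] {g u : β → ℕ} (m c : ℕ), LS posBound g → LS posBound u →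
      LSP posBound fun b => G3.get (g b) (u b) = m ∧ G3.kd (word b) (u b) = c :=
    fun m c hg hu => LSP.and ((hg.get hu).eq (LS.const m)) (hu.kd.eq (LS.const c))
  refine LSP.or ?_ (LSP.or ?_ (LSP.and (hf.flag.eq (LS.const 1)) (LSP.or LSP.atomsClosed
    (LSP.or ?_ ?_))))
  · exact LSP.ex (p := fun a u => G3.get (f a) u = 1 ∧ G3.kd (word a) u = 4) LS.numTok
      (h 1 4 hf.lift LS.var)
  · exact LSP.ex (p := fun a u => (G3.get (f a) u = 1 ∧ G3.kd (word a) u = 1) ∧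
      ∃ v < G3.numTok (word a), (G3.get (f a) v = 2 ∧ G3.kd (word a) v = 1) ∧
        SameBits (word a) (G3.posOf (word a) u) (G3.posOf (word a) v)) LS.numTok
      (LSP.and (h 1 1 hf.lift LS.var)
        (LSP.ex (p := fun (b : α × ℕ) v => (G3.get (f b.1) v = 2 ∧ G3.kd (word b) v = 1) ∧
          SameBits (word b) (G3.posOf (word b) b.2) (G3.posOf (word b) v)) LS.numTok
          (LSP.and (h 2 1 hf.lift.lift LS.var) (LS.sameBits LS.var.lift.posOf LS.var.posOf))))
  · exact LSP.ex (p := fun a u => (G3.get (f a) u = 1 ∧ G3.kd (word a) u = 1) ∧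
      AtomAt (word a) 2 u) LS.numTok (LSP.and (h 1 1 hf.lift LS.var) (LS.atomAt 2 LS.var))
  · exact LSP.ex (p := fun a u => (G3.get (f a) u = 2 ∧ G3.kd (word a) u = 1) ∧
      AtomAt (word a) 1 u) LS.numTok (LSP.and (h 2 1 hf.lift LS.var) (LS.atomAt 1 LS.var))

theorem LSP.open {f u : α → ℕ} (hf : LS posBound f) (hu : LS posBound u) :
    LSP posBound fun a => G3.get (f a) (u a) = 1 ∨ G3.get (f a) (u a) = 2 :=
  LSP.or ((hf.get hu).eq (LS.const 1)) ((hf.get hu).eq (LS.const 2))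

theorem LS.firstBin {f : α → ℕ} (hf : LS posBound f) :
    LS posBound fun a => G3.firstBin (word a) (f a) :=
  LS.bmin (p := fun a u => (G3.get (f a) u = 1 ∨ G3.get (f a) u = 2) ∧ IsBin (G3.kd (word a) u))
    LS.numTok (LSP.and (LSP.open hf.lift LS.var) LS.var.kd.isBin)

theorem LS.firstOpen {f : α → ℕ} (hf : LS posBound f) :
    LS posBound fun a => G3.firstOpen (word a) (f a) :=
  LS.bmin (p := fun a u => G3.get (f a) u = 1 ∨ G3.get (f a) u = 2) LS.numTok
    (LSP.open hf.lift LS.var)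

theorem LSP.admits {c m n k : α → ℕ} (hc : LS posBound c) (hm : LS posBound m) (hn : LS posBound n)
    (hk : LS posBound k) : LSP posBound fun a => Admits (c a) (m a) (n a) (k a) := by
  have e : ∀ {f : α → ℕ} (i : ℕ), LS posBound f → LSP posBound fun a => f a = i :=
    fun i hf => hf.eq (LS.const i)
  have l : ∀ {f : α → ℕ}, LS posBound f → LSP posBound fun a => 1 ≤ f a :=
    fun hf => (LS.const 1).le hf
  exact LSP.or (LSP.and (LSP.or (e 1 hc) (e 2 hc)) (LSP.and (e 1 hm) (LSP.and (e 0 hn) (e 1 hk))))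
    (LSP.or (LSP.and (LSP.or (e 3 hc) (e 4 hc)) (LSP.and (l hm) (LSP.and (e 0 hn) (e 1 hk))))
    (LSP.or (LSP.and (e 5 hc) (LSP.and (e 0 hn) (e 1 hk)))
    (LSP.or (LSP.and (e 6 hc) (LSP.and (e 0 hm) (LSP.and (e 0 hn) (e 1 hk))))
    (LSP.or (LSP.and (e 7 hc) (LSP.and (e 1 hm) (LSP.and (e 0 hn) (e 0 hk))))
    (LSP.or (LSP.and (LSP.or (e 8 hc) (e 9 hc)) (LSP.and (l hm) (LSP.and (hm.le (LS.const 2))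
      (LSP.and (e 0 hn) (e 0 hk)))))
    (LSP.or (LSP.and (e 10 hc) (LSP.and (l hm) (LSP.and (l hn) (e 0 hk))))
    (LSP.and (e 11 hc) (LSP.and (l hm) (LSP.and (e 0 hn) (e 0 hk))))))))))

theorem LS.posKind {f : α → ℕ} (hf : LS posBound f) :
    LS posBound fun a => G3.posKind (word a) (f a) := by
  have h : ∀ m, LS posBound fun a => Nat.count (fun u => G3.get (f a) u = m) (G3.numTok (word a)) :=
    fun m => LS.count (p := fun a u => G3.get (f a) u = m) LS.numTok
      ((hf.lift.get LS.var).eq (LS.const m))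
  exact LSP.ite LSP.isSequent
    (LSP.ite (hf.phase.eq LS.zero)
      (LSP.ite (LSP.closedPos hf) (LS.const 1)
        (LSP.ite (hf.firstBin.lt LS.numTok) (LS.const 2) (LS.const 3)))
      (LSP.ite (hf.firstOpen.lt LS.numTok) (LS.const 3)
        (LSP.ite (LSP.admits hf.phase (h 3) (h 4) (h 5)) (LS.const 2) LS.zero))) LS.zero

theorem LS.fstSide {d c m : α → ℕ} (hd : LS posBound d) (hc : LS posBound c) (hm : LS posBound m) :
    LS posBound fun a => G3.fstSide (d a) (c a) (m a) := by
  have e : ∀ {f : α → ℕ} (i : ℕ), LS posBound f → LSP posBound fun a => f a = i :=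
    fun i hf => hf.eq (LS.const i)
  exact LSP.ite (e 5 hc) (LSP.ite (e 1 hm) (LS.const 1) (LSP.ite (e 0 hd) (LS.const 2) LS.zero))
    (LSP.ite (e 6 hc) (LSP.ite (e 1 hm) (LSP.ite (e 0 hd) (LS.const 1) LS.zero) (LS.const 2))
      (LSP.ite (e 1 hm) (LSP.ite (e 0 hd) (LS.const 2) LS.zero) (LS.const 1)))

theorem LS.sndSide {d c m : α → ℕ} (hd : LS posBound d) (hc : LS posBound c) (hm : LS posBound m) :
    LS posBound fun a => G3.sndSide (d a) (c a) (m a) := by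
  have e : ∀ {f : α → ℕ} (i : ℕ), LS posBound f → LSP posBound fun a => f a = i :=
    fun i hf => hf.eq (LS.const i)
  exact LSP.ite (e 5 hc) (LSP.ite (e 1 hm) (LS.const 1) (LSP.ite (e 0 hd) LS.zero (LS.const 2)))
    (LSP.ite (e 6 hc) (LSP.ite (e 1 hm) (LSP.ite (e 0 hd) LS.zero (LS.const 1)) (LS.const 2))
      (LSP.ite (e 1 hm) (LSP.ite (e 0 hd) LS.zero (LS.const 1)) (LS.const 2)))

theorem LS.propDigit {f d u v : α → ℕ} (hf : LS posBound f) (hd : LS posBound d)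
    (hu : LS posBound u) (hv : LS posBound v) :
    LS posBound fun a => G3.propDigit (word a) (f a) (d a) (u a) (v a) :=
  LSP.ite (hv.eq (hu.succ.add hu.succ.width)) (LS.sndSide hd hu.kd (hf.get hu))
    (LSP.ite (hv.eq hu.succ) (LS.fstSide hd hu.kd (hf.get hu))
      (LSP.ite (hv.eq hu) LS.zero (hf.get hv)))

theorem LS.chooseDigit {f d u v : α → ℕ} (hf : LS posBound f) (hd : LS posBound d)
    (hu : LS posBound u) (hv : LS posBound v) :
    LS posBound fun a => G3.chooseDigit (f a) (d a) (u a) (v a) :=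
  LSP.ite (hv.eq hu)
    (LSP.ite ((hf.get hu).eq (LS.const 1))
      (LSP.ite (hd.eq (LS.const 1)) (LS.const 3) (LSP.ite (hd.eq (LS.const 2)) (LS.const 4) LS.zero))
      (LSP.ite (hd.eq (LS.const 1)) (LS.const 5) LS.zero)) (hf.get hv)

theorem LS.premDigit {f d u : α → ℕ} (hf : LS posBound f) (hd : LS posBound d)
    (hu : LS posBound u) : LS posBound fun a => G3.premDigit (word a) (f a) (d a) (u a) := by
  have e : ∀ {f : α → ℕ} (i : ℕ), LS posBound f → LSP posBound fun a => f a = i :=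
    fun i hf => hf.eq (LS.const i)
  have ha := (hd.sub (LS.const 1)).mod LS.numTok
  have hb := (hd.sub (LS.const 1)).div LS.numTok
  have h0 := LSP.not (e 0 hd)
  exact LSP.ite (LSP.and h0 (LSP.and (LSP.or (e 1 hf.phase) (e 4 hf.phase))
      (LSP.and (ha.lt LS.numTok) (e 3 (hf.get ha)))))
    (LSP.ite (e 5 (hf.get hu)) (LS.const 1) (LSP.ite (hu.eq ha) (LS.const 2) LS.zero))
    (LSP.ite (LSP.and h0 (e 8 hf.phase)) (LSP.ite (e 3 (hf.get hu)) (LS.const 2) LS.zero)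
    (LSP.ite (LSP.and h0 (LSP.and (e 10 hf.phase)
      (LSP.and (LSP.and (ha.lt LS.numTok) (e 3 (hf.get ha)))
        (LSP.and (hb.lt LS.numTok) (e 4 (hf.get hb))))))
      (LSP.ite (LSP.or (hu.eq ha) (hu.eq hb)) (LS.const 2) LS.zero)
      (LSP.ite (LSP.or (e 3 (hf.get hu)) (e 4 (hf.get hu))) (LS.const 1)
        (LSP.ite (e 5 (hf.get hu)) (LS.const 2) LS.zero))))

theorem LS.getD (l : List ℕ) (c : ℕ) {d : α → ℕ} (hd : LS posBound d) :
    LS posBound fun a => l.getD (d a) c := by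
  induction l generalizing d with
  | nil => exact (LS.const c).congr fun _ => by simp
  | cons x l ih =>
    refine (LSP.ite (hd.eq LS.zero) (LS.const x) (ih (hd.sub (LS.const 1)))).congr fun a => ?_
    rcases d a with _ | n <;> simp

theorem LS.posNext (X : Calculus) {f d : α → ℕ} (hf : LS posBound f) (hd : LS posBound d) :
    LS posBound fun a => G3.posNext X (word a) (f a) (d a) :=
  LSP.ite (hf.phase.eq LS.zero)
    (LSP.ite (hf.firstBin.lt LS.numTok)
      (LS.mkState (g := fun a => G3.propDigit (word a) (f a) (d a) (G3.firstBin (word a) (f a)))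
        LS.zero hf.flag (LS.propDigit hf.lift hd.lift hf.firstBin.lift LS.var))
      (LS.mkState (g := fun a => ruleDigit (word a) (f a)) (LS.getD _ _ hd) LS.zero
        (LSP.ite (LS.var.kd.eq (LS.const 8)) (hf.lift.get LS.var) LS.zero)))
    (LSP.ite (hf.firstOpen.lt LS.numTok)
      (LS.mkState (g := fun a => G3.chooseDigit (f a) (d a) (G3.firstOpen (word a) (f a)))
        hf.phase LS.zero (LS.chooseDigit hf.lift hd.lift hf.firstOpen.lift LS.var))
      (LS.mkState (g := fun a v => if v = 0 then 0 else G3.premDigit (word a) (f a) (d a) (v - 1))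
        LS.zero LS.zero (LSP.ite (LS.var.eq LS.zero) LS.zero
          (LS.premDigit hf.lift hd.lift (LS.var.sub (LS.const 1))))))

theorem LS.posInit : LS posBound fun a : α => G3.posInit (word a) :=
  LS.mkState (g := fun a => G3.mark (word a)) LS.zero (LS.const 1) LS.var.mark

theorem LS.posMoves : LS posBound fun a : α => G3.posMoves (word a) :=
  (LS.numTok.mul LS.numTok).add (LS.const 4)

end Space
end G3

/-! ### Sums over digits, and the propositional rules in terms of sides -/

namespace G3

section Sums

variable {M : Type*} [AddCommMonoid M]

/-- The sum over the tokens below `n` of a value that depends on their digits. -/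
def sumDig (n : ℕ) (φ : ℕ → ℕ → M) (g : ℕ → ℕ) : M := ∑ u ∈ Finset.range n, φ u (g u)

theorem sumDig_congr {n : ℕ} {φ : ℕ → ℕ → M} {g g' : ℕ → ℕ} (h : ∀ u < n, g u = g' u) :
    sumDig n φ g = sumDig n φ g' :=
  Finset.sum_congr rfl fun u hu => by rw [h u (Finset.mem_range.1 hu)]

theorem sumDig_split {n u : ℕ} {φ : ℕ → ℕ → M} (g : ℕ → ℕ) (hu : u < n) (h0 : φ u 0 = 0) :
    sumDig n φ g = sumDig n φ (Function.update g u 0) + φ u (g u) := by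
  rw [sumDig, sumDig, ← Finset.sum_erase_add _ _ (Finset.mem_range.2 hu),
    ← Finset.sum_erase_add (f := fun v => φ v (Function.update g u 0 v)) _ (Finset.mem_range.2 hu),
    Function.update_self, h0, add_zero]
  congr 1
  exact Finset.sum_congr rfl fun v hv => by rw [Function.update_of_ne (Finset.ne_of_mem_erase hv)]

theorem sumDig_update {n u x : ℕ} {φ : ℕ → ℕ → M} {g : ℕ → ℕ} (hu : u < n) (h0 : φ u 0 = 0)
    (hg : g u = 0) : sumDig n φ (Function.update g u x) = sumDig n φ g + φ u x := by
  rw [sumDig_split _ hu h0, Function.update_self, Function.update_idem]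
  congr 2
  rw [← hg, Function.update_eq_self]

/-- Summation after a shift by one place. -/
theorem sumDig_shift {n : ℕ} {φ : ℕ → ℕ → M} {h : ℕ → ℕ} (h0 : ∀ u, φ u 0 = 0)
    (hn : ∀ u, u + 1 = n → h u = 0) :
    sumDig n φ (fun v => if v = 0 then 0 else h (v - 1)) = sumDig n (fun u x => φ (u + 1) x) h := by
  rcases n with _ | n
  · rfl
  · rw [sumDig, Finset.sum_range_succ', sumDig, Finset.sum_range_succ, hn n rfl]
    simp [h0]

end Sums

section Connectives

def only (i x : ℕ) (A : Formula) : Multiset Formula := if x = i then {A} else 0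

/-- All six rules as rules with two premisses; those with one premiss have it repeated, since their
sides do not depend on `d`. -/
theorem derivable_iff_premisses {X : Calculus} {F A B : Formula} {m : ℕ} (hm : m = 1 ∨ m = 2)
    (hF : F = .and A B ∨ F = .or A B ∨ F = .imp A B) (G H : Multiset Formula) :
    Derivable X ⟨G + only 1 m F, H + only 2 m F⟩ ↔ ∀ d < 2, Derivable X
      ⟨G + (only 1 (fstSide d F.code m) A + only 1 (sndSide d F.code m) B),
       H + (only 2 (fstSide d F.code m) A + only 2 (sndSide d F.code m) B)⟩ := by
  have two : ∀ P : ℕ → Prop, (∀ d < 2, P d) ↔ P 0 ∧ P 1 := fun P =>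
    ⟨fun h => ⟨h 0 (by norm_num), h 1 (by norm_num)⟩, fun h d hd => by
      interval_cases d; exacts [h.1, h.2]⟩
  have one : ∀ (A : Formula) (G : Multiset Formula), G + {A} = A ::ₘ G := fun A G => by
    rw [add_comm, Multiset.singleton_add]
  rw [two]
  rcases hm with rfl | rfl <;> rcases hF with rfl | rfl | rfl
  · have := derivable_iff_of_propInst (X := X) (PropInst.andL A B G H)
    rw [Multiset.cons_swap] at this
    simpa [only, fstSide, sndSide, Formula.code, one] using this
  · have := derivable_iff_of_propInst (X := X) (PropInst.orL A B G H)
    simpa [only, fstSide, sndSide, Formula.code, one] using this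
  · have := derivable_iff_of_propInst (X := X) (PropInst.impL A B G H)
    simpa [only, fstSide, sndSide, Formula.code, one] using this
  · have := derivable_iff_of_propInst (X := X) (PropInst.andR A B G H)
    simpa [only, fstSide, sndSide, Formula.code, one] using this
  · have := derivable_iff_of_propInst (X := X) (PropInst.orR A B G H)
    rw [Multiset.cons_swap] at this
    simpa [only, fstSide, sndSide, Formula.code, one] using this
  · have := derivable_iff_of_propInst (X := X) (PropInst.impR A B G H)
    simpa [only, fstSide, sndSide, Formula.code, one] using this

theorem fstSide_of_ne {d c m : ℕ} (hd : d ≠ 0) : fstSide d c m = fstSide 1 c m := by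
  simp [fstSide, hd]

theorem sndSide_of_ne {d c m : ℕ} (hd : d ≠ 0) : sndSide d c m = sndSide 1 c m := by
  simp [sndSide, hd]

theorem fstSide_le (d c m : ℕ) : fstSide d c m ≤ 2 := by unfold fstSide; split_ifs <;> omega

theorem sndSide_le (d c m : ℕ) : sndSide d c m ≤ 2 := by unfold sndSide; split_ifs <;> omega

end Connectives

/-! The meaning of the positions. -/

section Meaning

variable (X : Calculus) (w : List Sym) (Γ Δ : List Formula)

/-- The formulas with digit `m`. -/
noncomputable def side (m : ℕ) (g : ℕ → ℕ) : Multiset Formula :=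
  sumDig (numTok w) (fun u x => only m x (form w u)) g

/-- The formulas under the boxes of the formulas with digit `m`. -/
noncomputable def inner (m : ℕ) (g : ℕ → ℕ) : Multiset Formula :=
  sumDig (numTok w) (fun u x => only m x (form w (u + 1))) g

def atoms (f : ℕ) (Γ : List Formula) : Multiset Formula :=
  if f = 1 then (Γ.filter fun A => A.weight = 0 : List Formula) else 0

noncomputable def posSequent (f : ℕ) (g : ℕ → ℕ) : Sequent :=
  ⟨side w 1 g + atoms f Γ, side w 2 g + atoms f Δ⟩

/-- The meaning of a position. -/
def PosVal (p f : ℕ) (g : ℕ → ℕ) : Prop :=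
  (p = 0 → Derivable X (posSequent w Γ Δ f g)) ∧
    (p ≠ 0 → Completable X p (inner w 1 g) (inner w 2 g) (inner w 3 g) (inner w 4 g) (inner w 5 g))

/-- A bound for the number of moves from a position. -/
noncomputable def potential (p : ℕ) (g : ℕ → ℕ) : ℕ :=
  (if p = 0 then 1 else 0) + sumDig (numTok w) (fun u x => if x = 0 then 0 else
    if x ≤ 2 then 3 * (form w u).size else 3 * (form w u).size - 1) g

/-- The invariant of reachable positions. Disjointness of the segments keeps the potential linear in
the number of tokens and guarantees that the tokens inside a member are free to receive digits. -/
structure PosGood (p : ℕ) (g : ℕ → ℕ) : Prop where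
  le : ∀ u < numTok w, g u ≤ 5
  disj : ∀ u v, u < v → v < numTok w → g u ≠ 0 → g v ≠ 0 → u + (form w u).size ≤ v
  le_two : p = 0 → ∀ u < numTok w, g u ≤ 2
  box : p ≠ 0 → ∀ u < numTok w, g u ≠ 0 → ∃ A, form w u = .box A

variable {X w Γ Δ} {p f : ℕ} {g g' : ℕ → ℕ}

theorem side_congr (h : ∀ u < numTok w, g u = g' u) (m : ℕ) : side w m g = side w m g' :=
  sumDig_congr h

theorem inner_congr (h : ∀ u < numTok w, g u = g' u) (m : ℕ) : inner w m g = inner w m g' :=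
  sumDig_congr h

theorem PosVal.congr (h : ∀ u < numTok w, g u = g' u) :
    PosVal X w Γ Δ p f g ↔ PosVal X w Γ Δ p f g' := by
  simp only [PosVal, posSequent, side_congr h, inner_congr h]

theorem potential_congr (h : ∀ u < numTok w, g u = g' u) : potential w p g = potential w p g' := by
  rw [potential, potential, sumDig_congr h]

theorem PosGood.congr (h : ∀ u < numTok w, g u = g' u) (hg : PosGood w p g) : PosGood w p g' where
  le u hu := h u hu ▸ hg.le u hu
  disj u v huv hv := by rw [← h u (huv.trans hv), ← h v hv]; exact hg.disj u v huv hv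
  le_two hp u hu := h u hu ▸ hg.le_two hp u hu
  box hp u hu := by rw [← h u hu]; exact hg.box hp u hu

theorem only_zero {m : ℕ} (hm : m ≠ 0) (A : Formula) : only m 0 A = 0 := by
  simp [only, hm.symm]

theorem mem_side {m : ℕ} {A : Formula} : A ∈ side w m g ↔ ∃ u < numTok w, g u = m ∧ form w u = A := by
  simp only [side, sumDig, Multiset.mem_sum, Finset.mem_range, only]
  refine exists_congr fun u => and_congr_right fun _ => ?_
  by_cases h : g u = m <;> simp [h, eq_comm]

theorem mem_inner {m : ℕ} {A : Formula} :
    A ∈ inner w m g ↔ ∃ u < numTok w, g u = m ∧ form w (u + 1) = A := by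
  simp only [inner, sumDig, Multiset.mem_sum, Finset.mem_range, only]
  refine exists_congr fun u => and_congr_right fun _ => ?_
  by_cases h : g u = m <;> simp [h, eq_comm]

theorem card_inner (m : ℕ) [DecidablePred fun u => g u = m] :
    (inner w m g).card = Nat.count (fun u => g u = m) (numTok w) := by
  rw [inner, sumDig, Multiset.card_sum]
  generalize numTok w = n
  induction n with
  | zero => simp
  | succ n ih =>
    rw [Finset.sum_range_succ, ih, Nat.count_succ, only]
    split_ifs <;> simp

theorem mem_atoms {A : Formula} : A ∈ atoms f Γ ↔ f = 1 ∧ A ∈ Γ ∧ A.weight = 0 := by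
  by_cases h : f = 1 <;> simp [atoms, h]

section State

variable (hp : p < 16) (hf : f < 16)

include hp in
theorem phase_mkState : phase w (mkState w p f g) = p := by
  rw [phase, mkState, get_mkArr (by omega), if_neg (by omega), if_pos rfl, Nat.mod_eq_of_lt hp]

include hf in
theorem flag_mkState : flag w (mkState w p f g) = f := by
  rw [flag, mkState, get_mkArr (by omega), if_neg (by omega), if_neg (by omega), Nat.mod_eq_of_lt hf]

theorem get_mkState {u : ℕ} (hu : u < numTok w) (hg : g u < 16) : get (mkState w p f g) u = g u := by
  rw [mkState, get_mkArr (by omega), if_pos hu, Nat.mod_eq_of_lt hg]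

end State

end Meaning

/-! ### Each kind of move respects the meaning and lowers the potential -/

section Moves

variable {X : Calculus} {w : List Sym} {Γ Δ : List Formula} (hw : w = encodeSequent Γ Δ)
  {s : ℕ}

include hw

/-- The digit of the principal token is passed on to the first tokens of its two immediate
subformulas. Their combined length is one less, so the potential drops by at least 3. -/
theorem prop_move {u : ℕ} (hg : PosGood w 0 (get s)) (hu : u < numTok w)
    (hs : get s u = 1 ∨ get s u = 2) (hb : IsBin (kd w u)) (f : ℕ) :
    (∀ d, PosGood w 0 (propDigit w s d u) ∧
      potential w 0 (propDigit w s d u) < potential w 0 (get s)) ∧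
    ∀ D, 2 ≤ D → (PosVal X w Γ Δ 0 f (get s) ↔
      ∀ d < D, PosVal X w Γ Δ 0 f (propDigit w s d u)) := by
  obtain ⟨A, B, hF⟩ : ∃ A B, form w u = .and A B ∨ form w u = .or A B ∨ form w u = .imp A B := by
    rw [kd_eq hw hu] at hb
    cases hF : form w u with
    | and A B => exact ⟨A, B, Or.inl rfl⟩
    | or A B => exact ⟨A, B, Or.inr (Or.inl rfl)⟩
    | imp A B => exact ⟨A, B, Or.inr (Or.inr rfl)⟩
    | _ => rw [hF] at hb; simp [IsBin, Formula.code] at hb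
  obtain ⟨hA, hB⟩ := form_bin hw hu hF
  have hsz : (form w u).size = A.size + B.size + 1 := by rcases hF with h | h | h <;> rw [h] <;> rfl
  have hle := add_size_le hw hu
  have hApos := A.size_pos
  have hBpos := B.size_pos
  have hc1 : u + 1 < numTok w := by omega
  have hwd := width_form hw hc1
  rw [hA] at hwd
  rw [hwd] at hB
  set c := u + 1 + A.size with hc
  have hc2 : c < numTok w := by omega
  -- By disjointness the tokens inside the principal formula carry no digit, so nothing is
  -- overwritten.
  have z1 : get s (u + 1) = 0 := by
    by_contra h; have := hg.disj u (u + 1) (by omega) hc1 (by omega) h; omega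
  have z2 : get s c = 0 := by
    by_contra h; have := hg.disj u c (by omega) hc2 (by omega) h; omega
  have e : ∀ d, propDigit w s d u = Function.update (Function.update (Function.update (get s) u 0)
      (u + 1) (fstSide d (kd w u) (get s u))) c (sndSide d (kd w u) (get s u)) := fun d => by
    funext v
    simp only [propDigit, hwd, Function.update_apply]
    rfl
  have sum : ∀ {M : Type} [AddCommMonoid M] (φ : ℕ → ℕ → M), (∀ u, φ u 0 = 0) → ∀ d,
      sumDig (numTok w) φ (propDigit w s d u) =
        sumDig (numTok w) φ (Function.update (get s) u 0) + φ (u + 1) (fstSide d (kd w u) (get s u)) +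
          φ c (sndSide d (kd w u) (get s u)) := fun φ h0 d => by
    rw [e, sumDig_update hc2 (h0 _), sumDig_update hc1 (h0 _)]
    · rw [Function.update_of_ne (by omega)]; exact z1
    · rw [Function.update_of_ne (by omega), Function.update_of_ne (by omega)]; exact z2
  have split : ∀ {M : Type} [AddCommMonoid M] (φ : ℕ → ℕ → M), (∀ u, φ u 0 = 0) →
      sumDig (numTok w) φ (get s) =
        sumDig (numTok w) φ (Function.update (get s) u 0) + φ u (get s u) := fun φ h0 =>
    sumDig_split _ hu (h0 _)
  have val : ∀ v d, propDigit w s d u v =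
      if v = c then sndSide d (kd w u) (get s u) else if v = u + 1 then fstSide d (kd w u) (get s u)
      else if v = u then 0 else get s v := fun v d => by
    simp only [propDigit, hwd]; rfl
  refine ⟨fun d => ⟨⟨?_, ?_, ?_, fun h => absurd rfl h⟩, ?_⟩, fun D hD => ?_⟩
  · intro v hv
    have h1 := fstSide_le d (kd w u) (get s u)
    have h2 := sndSide_le d (kd w u) (get s u)
    have h3 := hg.le v hv
    rw [val]; split_ifs <;> omega
  · intro v v' hlt hv' h1 h2
    have sz : ∀ v, v ≠ c → v ≠ u + 1 → propDigit w s d u v ≠ 0 → v ≠ u ∧ get s v ≠ 0 :=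
      fun v n1 n2 h => by
        rw [val, if_neg n1, if_neg n2] at h
        split_ifs at h with h3
        exacts [absurd rfl h, ⟨h3, h⟩]
    have old : ∀ v < numTok w, v ≠ c → v ≠ u + 1 → propDigit w s d u v ≠ 0 →
        v + (form w v).size ≤ u ∨ u + (form w u).size ≤ v := fun v hv n1 n2 h => by
      obtain ⟨h3, h4⟩ := sz v n1 n2 h
      rcases lt_or_gt_of_ne h3 with h5 | h5
      · exact Or.inl (hg.disj v u h5 hu h4 (by omega))
      · exact Or.inr (hg.disj u v h5 hv (by omega) h4)
    by_cases a1 : v = c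
    · subst a1
      rw [hB]
      have := old v' hv' (by omega) (by omega) h2
      omega
    by_cases a2 : v = u + 1
    · subst a2
      rw [hA]
      by_cases b1 : v' = c
      · omega
      have := old v' hv' b1 (by omega) h2
      omega
    have o1 := old v (by omega) a1 a2 h1
    by_cases b1 : v' = c
    · omega
    by_cases b2 : v' = u + 1
    · omega
    exact hg.disj v v' hlt hv' (sz v a1 a2 h1).2 (sz v' b1 b2 h2).2
  · intro _ v hv
    have h1 := fstSide_le d (kd w u) (get s u)
    have h2 := sndSide_le d (kd w u) (get s u)
    have h3 := hg.le_two rfl v hv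
    rw [val]; split_ifs <;> omega
  · rw [potential, potential, sum _ (by simp), split _ (by simp)]
    simp only [hA, hB]
    have h1 : ∀ x S, (if x = 0 then 0 else if x ≤ 2 then 3 * S else 3 * S - 1) ≤ 3 * S :=
      fun x S => by split_ifs <;> omega
    have h2 := h1 (fstSide d (kd w u) (get s u)) A.size
    have h3 := h1 (sndSide d (kd w u) (get s u)) B.size
    rw [if_neg (show get s u ≠ 0 by omega), if_pos (show get s u ≤ 2 by omega)]
    omega
  -- Moves `d ≥ 2` repeat the second premiss.
  · have two : (∀ d < D, PosVal X w Γ Δ 0 f (propDigit w s d u)) ↔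
        ∀ d < 2, PosVal X w Γ Δ 0 f (propDigit w s d u) := by
      refine ⟨fun h d hd => h d (by omega), fun h d hd => ?_⟩
      by_cases h0 : d = 0
      · exact h d (by omega)
      · have : propDigit w s d u = propDigit w s 1 u := by
          rw [e, e, fstSide_of_ne h0, sndSide_of_ne h0]
        rw [this]; exact h 1 (by norm_num)
    have pv : ∀ g, PosVal X w Γ Δ 0 f g ↔ Derivable X (posSequent w Γ Δ f g) := fun g => by
      simp [PosVal]
    rw [two]
    simp only [pv, posSequent, side]
    rw [split _ (fun u => only_zero one_ne_zero _), split _ (fun u => only_zero two_ne_zero _)]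
    simp only [sum (fun u x => only 1 x (form w u)) (fun u => only_zero one_ne_zero _),
      sum (fun u x => only 2 x (form w u)) (fun u => only_zero two_ne_zero _)]
    have key := derivable_iff_premisses (X := X) hs hF
      (sumDig (numTok w) (fun u x => only 1 x (form w u)) (Function.update (get s) u 0) + atoms f Γ)
      (sumDig (numTok w) (fun u x => only 2 x (form w u)) (Function.update (get s) u 0) + atoms f Δ)
    rw [← kd_eq hw hu] at key
    simp only [hA, hB]
    simpa only [add_assoc, add_left_comm, add_comm] using key

end Moves
end G3

namespace G3

section Moves

variable {X : Calculus} {w : List Sym} {Γ Δ : List Formula} (hw : w = encodeSequent Γ Δ)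
  {s : ℕ}

include hw

theorem kd_eq_one {u : ℕ} (hu : u < numTok w) : kd w u = 1 ↔ ∃ i, form w u = .var i := by
  rw [kd_eq hw hu]
  cases form w u <;> simp [Formula.code]

theorem kd_eq_four {u : ℕ} (hu : u < numTok w) : kd w u = 4 ↔ form w u = .bot := by
  rw [kd_eq hw hu]
  cases form w u <;> simp [Formula.code]

theorem kd_eq_eight {u : ℕ} (hu : u < numTok w) : kd w u = 8 ↔ ∃ A, form w u = .box A := by
  rw [kd_eq hw hu]
  cases form w u <;> simp [Formula.code]

/-- A clash may occur between two tokens, between two atoms represented by the flag, or between a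
token and such an atom; the clauses of `ClosedPos` cover these cases. -/
theorem closedPos_iff :
    ClosedPos w s ↔ (posSequent w Γ Δ (flag w s) (get s)).IsClosed := by
  have hbot : .bot ∈ (posSequent w Γ Δ (flag w s) (get s)).ant ↔
      (∃ u < numTok w, get s u = 1 ∧ kd w u = 4) ∨ (flag w s = 1 ∧ .bot ∈ Γ) := by
    simp only [posSequent, Multiset.mem_add, mem_side, mem_atoms, Formula.weight, and_true]
    refine or_congr (exists_congr fun u => and_congr_right fun hu => ?_) Iff.rfl
    rw [kd_eq_four hw hu]
  have var1 : ∀ i, .var i ∈ (posSequent w Γ Δ (flag w s) (get s)).ant ↔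
      (∃ u < numTok w, get s u = 1 ∧ form w u = .var i) ∨ (flag w s = 1 ∧ .var i ∈ Γ) := fun i => by
    simp only [posSequent, Multiset.mem_add, mem_side, mem_atoms, Formula.weight, and_true]
  have var2 : ∀ i, .var i ∈ (posSequent w Γ Δ (flag w s) (get s)).suc ↔
      (∃ u < numTok w, get s u = 2 ∧ form w u = .var i) ∨ (flag w s = 1 ∧ .var i ∈ Δ) := fun i => by
    simp only [posSequent, Multiset.mem_add, mem_side, mem_atoms, Formula.weight, and_true]
  rw [Sequent.IsClosed, hbot]
  simp only [var1, var2]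
  rw [ClosedPos, atomsClosed_iff hw, Sequent.IsClosed]
  constructor
  · rintro (h | ⟨u, hu, ⟨h1, h2⟩, v, hv, ⟨h3, h4⟩, h5⟩ | ⟨hf, (⟨i, h1, h2⟩ | h) | h | h⟩)
    · exact Or.inr (Or.inl h)
    · obtain ⟨i, hi⟩ := (kd_eq_one hw hu).1 h2
      obtain ⟨j, hj⟩ := (kd_eq_one hw hv).1 h4
      obtain rfl := (sameBits_form hw hu hv hi hj).1 h5
      exact Or.inl ⟨i, Or.inl ⟨u, hu, h1, hi⟩, Or.inl ⟨v, hv, h3, hj⟩⟩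
    · exact Or.inl ⟨i, Or.inr ⟨hf, by simpa using h1⟩, Or.inr ⟨hf, by simpa using h2⟩⟩
    · exact Or.inr (Or.inr ⟨hf, by simpa using h⟩)
    · obtain ⟨u, hu, ⟨h1, h2⟩, h3⟩ := h
      obtain ⟨i, hi⟩ := (kd_eq_one hw hu).1 h2
      rw [atomAt_form hw two_ne_zero hu hi] at h3
      exact Or.inl ⟨i, Or.inl ⟨u, hu, h1, hi⟩, Or.inr ⟨hf, by simpa using h3⟩⟩
    · obtain ⟨u, hu, ⟨h1, h2⟩, h3⟩ := h
      obtain ⟨i, hi⟩ := (kd_eq_one hw hu).1 h2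
      rw [atomAt_form hw one_ne_zero hu hi] at h3
      exact Or.inl ⟨i, Or.inr ⟨hf, by simpa using h3⟩, Or.inl ⟨u, hu, h1, hi⟩⟩
  · rintro (⟨i, ⟨u, hu, h1, hi⟩ | ⟨hf, h1⟩, ⟨v, hv, h2, hj⟩ | ⟨hf', h2⟩⟩ | h | ⟨hf, h⟩)
    · exact Or.inr (Or.inl ⟨u, hu, ⟨h1, (kd_eq_one hw hu).2 ⟨i, hi⟩⟩, v, hv,
        ⟨h2, (kd_eq_one hw hv).2 ⟨i, hj⟩⟩, (sameBits_form hw hu hv hi hj).2 rfl⟩)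
    · refine Or.inr (Or.inr ⟨hf', Or.inr (Or.inl ⟨u, hu, ⟨h1, (kd_eq_one hw hu).2 ⟨i, hi⟩⟩, ?_⟩)⟩)
      rw [atomAt_form hw two_ne_zero hu hi]
      exact Or.inr ⟨rfl, h2⟩
    · refine Or.inr (Or.inr ⟨hf, Or.inr (Or.inr ⟨v, hv, ⟨h2, (kd_eq_one hw hv).2 ⟨i, hj⟩⟩, ?_⟩)⟩)
      rw [atomAt_form hw one_ne_zero hv hj]
      exact Or.inl ⟨rfl, h1⟩
    · exact Or.inr (Or.inr ⟨hf, Or.inl (Or.inl ⟨i, by simpa using h1, by simpa using h2⟩)⟩)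
    · exact Or.inl h
    · exact Or.inr (Or.inr ⟨hf, Or.inl (Or.inr (by simpa using h))⟩)

/-- Members represented by the flag have weight 0, so a propositional rule would need a token that
begins with a binary connective. -/
theorem not_propInst (h : ∀ u < numTok w, get s u = 1 ∨ get s u = 2 → ¬ IsBin (kd w u)) (f : ℕ)
    (ps : List Sequent) : ¬ PropInst ps (posSequent w Γ Δ f (get s)) := by
  intro hp
  have key : ∀ (F : Formula), (F ∈ (posSequent w Γ Δ f (get s)).ant ∨
      F ∈ (posSequent w Γ Δ f (get s)).suc) → F.weight = 0 ∨ ¬ IsBin F.code := by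
    intro F hF
    simp only [posSequent, Multiset.mem_add, mem_side, mem_atoms] at hF
    rcases hF with (⟨u, hu, h1, rfl⟩ | h1) | (⟨u, hu, h1, rfl⟩ | h1)
    · rw [← kd_eq hw hu]; exact Or.inr (h u hu (Or.inl h1))
    · exact Or.inl h1.2.2
    · rw [← kd_eq hw hu]; exact Or.inr (h u hu (Or.inr h1))
    · exact Or.inl h1.2.2
  generalize posSequent w Γ Δ f (get s) = S at hp key
  cases hp with
  | andL A B => simpa [Formula.weight, IsBin, Formula.code] using key (.and A B) (by simp)
  | andR A B => simpa [Formula.weight, IsBin, Formula.code] using key (.and A B) (by simp)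
  | orL A B => simpa [Formula.weight, IsBin, Formula.code] using key (.or A B) (by simp)
  | orR A B => simpa [Formula.weight, IsBin, Formula.code] using key (.or A B) (by simp)
  | impL A B => simpa [Formula.weight, IsBin, Formula.code] using key (.imp A B) (by simp)
  | impR A B => simpa [Formula.weight, IsBin, Formula.code] using key (.imp A B) (by simp)

omit hw in
theorem unboxes_add (M N : Multiset Formula) : unboxes (M + N) = unboxes M + unboxes N :=
  Multiset.filterMap_add _ _ _

omit hw in
theorem unboxes_atoms (f : ℕ) (Γ : List Formula) : unboxes (atoms f Γ) = 0 := by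
  refine Multiset.eq_zero_of_forall_notMem fun A hA => ?_
  obtain ⟨B, hB, h⟩ := (Multiset.mem_filterMap Formula.unbox? _).1 hA
  have := (mem_atoms.1 hB).2.2
  cases B <;> simp_all [Formula.unbox?, Formula.weight]

theorem unboxes_side {m : ℕ} (hm : m ≠ 0) :
    unboxes (side w m (get s)) = inner w m (ruleDigit w s) := by
  have sum : ∀ (n : ℕ) (F : ℕ → Multiset Formula), unboxes (∑ u ∈ Finset.range n, F u) =
      ∑ u ∈ Finset.range n, unboxes (F u) := fun n F => by
    induction n with
    | zero => simp [unboxes]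
    | succ n ih => rw [Finset.sum_range_succ, Finset.sum_range_succ, unboxes_add, ih]
  rw [side, inner, sumDig, sumDig, sum]
  refine Finset.sum_congr rfl fun u hu => ?_
  have hu := Finset.mem_range.1 hu
  rw [ruleDigit]
  by_cases h : kd w u = 8
  · obtain ⟨A, hA⟩ := (kd_eq_eight hw hu).1 h
    rw [if_pos h, hA, form_box hw hu hA, only, only]
    split_ifs
    · rfl
    · rfl
  · have : (form w u).unbox? = none := by
      rw [kd_eq hw hu] at h
      cases hF : form w u <;> simp_all [Formula.code, Formula.unbox?]
    rw [if_neg h, only_zero hm, only]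
    split_ifs
    · rw [← Multiset.cons_zero, unboxes, Multiset.filterMap_cons_none _ _ this]; rfl
    · rfl

omit hw in
theorem ruleNum_pos (X : Calculus) (d : ℕ) : 0 < ruleNum X d ∧ ruleNum X d < 16 := by
  by_cases hd : d < X.rules.length
  · have e : ruleNum X d = X.rules[d].num := by simp [ruleNum, hd]
    rw [e]; cases X.rules[d] <;> simp [ModalRule.num]
  · have e : ruleNum X d = 12 := by
      simp [ruleNum, List.getElem?_eq_none (show X.rules.length ≤ d by omega)]
    rw [e]; norm_num

/-- Only boxed members are kept, as the rest would be weakening context. None is chosen yet, so the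
parts for digits 3 to 5 are empty. The potential drops by 1 because the phase is no longer 0. -/
theorem rule_move (hg : PosGood w 0 (get s)) {f : ℕ}
    (hc : ¬ (posSequent w Γ Δ f (get s)).IsClosed)
    (hb : ∀ u < numTok w, get s u = 1 ∨ get s u = 2 → ¬ IsBin (kd w u)) :
    (∀ d, PosGood w (ruleNum X d) (ruleDigit w s) ∧
      potential w (ruleNum X d) (ruleDigit w s) < potential w 0 (get s)) ∧
    ∀ D, 4 ≤ D → (PosVal X w Γ Δ 0 f (get s) ↔
      ∃ d < D, PosVal X w Γ Δ (ruleNum X d) 0 (ruleDigit w s)) := by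
  have hz : ∀ u, ruleDigit w s u = 0 ∨ (kd w u = 8 ∧ ruleDigit w s u = get s u) := fun u => by
    rw [ruleDigit]; split_ifs with h
    exacts [Or.inr ⟨h, rfl⟩, Or.inl rfl]
  have hpos := fun d => (ruleNum_pos X d).1.ne'
  refine ⟨fun d => ⟨⟨?_, ?_, ?_, ?_⟩, ?_⟩, fun D hD => ?_⟩
  · intro u hu; have := hg.le u hu; rcases hz u with h | h <;> omega
  · intro u v huv hv h1 h2
    rcases hz u with h | h
    · exact absurd h h1
    rcases hz v with h' | h'
    · exact absurd h' h2
    exact hg.disj u v huv hv (h.2 ▸ h1) (h'.2 ▸ h2)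
  · exact fun h => absurd h (hpos d)
  · intro _ u hu h1
    rcases hz u with h | h
    · exact absurd h h1
    · exact (kd_eq_eight hw hu).1 h.1
  · rw [potential, potential, if_neg (hpos d), if_pos rfl]
    have : sumDig (numTok w) (fun u x => if x = 0 then 0 else
        if x ≤ 2 then 3 * (form w u).size else 3 * (form w u).size - 1) (ruleDigit w s) ≤
        sumDig (numTok w) (fun u x => if x = 0 then 0 else
        if x ≤ 2 then 3 * (form w u).size else 3 * (form w u).size - 1) (get s) := by
      refine Finset.sum_le_sum fun u _ => ?_
      rcases hz u with h | h
      · simp [h]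
      · rw [h.2]
    omega
  · have h1 : PosVal X w Γ Δ 0 f (get s) ↔ Derivable X (posSequent w Γ Δ f (get s)) := by
      simp [PosVal]
    rw [h1, derivable_iff_of_irreducible hc (not_propInst hw hb f), exists_xInst_iff hD]
    refine exists_congr fun d => and_congr_right fun _ => ?_
    have h2 : ∀ m, 2 < m → inner w m (ruleDigit w s) = 0 := fun m hm => by
      refine Multiset.eq_zero_of_forall_notMem fun A hA => ?_
      obtain ⟨u, hu, h, -⟩ := mem_inner.1 hA
      have := hg.le_two rfl u hu
      rcases hz u with h' | h' <;> omega
    have e1 : unboxes (posSequent w Γ Δ f (get s)).ant = inner w 1 (ruleDigit w s) := by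
      rw [posSequent, unboxes_add, unboxes_atoms, add_zero, unboxes_side hw one_ne_zero]
    have e2 : unboxes (posSequent w Γ Δ f (get s)).suc = inner w 2 (ruleDigit w s) := by
      rw [posSequent, unboxes_add, unboxes_atoms, add_zero, unboxes_side hw two_ne_zero]
    rw [e1, e2, PosVal, h2 3 (by norm_num), h2 4 (by norm_num), h2 5 (by norm_num)]
    simp [hpos d]

omit hw in
-- The three moves are the cases of `completable_cons_left`, or the two of `completable_cons_right`.
-- A chosen formula counts one less than an open one, a dropped one nothing. The flag plays no role
-- while an instance is chosen.
theorem choose_move {u p : ℕ} (hp : p ≠ 0) (hg : PosGood w p (get s)) (hu : u < numTok w)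
    (hs : get s u = 1 ∨ get s u = 2) :
    (∀ d, PosGood w p (chooseDigit s d u) ∧
      potential w p (chooseDigit s d u) < potential w p (get s)) ∧
    ∀ D f f', 3 ≤ D → (PosVal X w Γ Δ p f (get s) ↔
      ∃ d < D, PosVal X w Γ Δ p f' (chooseDigit s d u)) := by
  set y : ℕ → ℕ := fun d => if get s u = 1 then (if d = 1 then 3 else if d = 2 then 4 else 0) else
    (if d = 1 then 5 else 0) with hy
  have e : ∀ d, chooseDigit s d u = Function.update (get s) u (y d) := fun d => by
    funext v
    simp only [chooseDigit, Function.update_apply, hy]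
  have hval : ∀ d, y d = 0 ∨ (3 ≤ y d ∧ y d ≤ 5) := fun d => by
    simp only [hy]; split_ifs <;> omega
  have hz : ∀ d v, chooseDigit s d u v ≠ 0 → get s v ≠ 0 := fun d v h => by
    rw [e, Function.update_apply] at h
    split_ifs at h with h'
    · subst h'; omega
    · exact h
  have split : ∀ {M : Type} [AddCommMonoid M] (φ : ℕ → ℕ → M), (∀ u, φ u 0 = 0) →
      sumDig (numTok w) φ (get s) =
        sumDig (numTok w) φ (Function.update (get s) u 0) + φ u (get s u) := fun φ h0 =>
    sumDig_split _ hu (h0 _)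
  have sum : ∀ {M : Type} [AddCommMonoid M] (φ : ℕ → ℕ → M), (∀ u, φ u 0 = 0) → ∀ d,
      sumDig (numTok w) φ (chooseDigit s d u) =
        sumDig (numTok w) φ (Function.update (get s) u 0) + φ u (y d) := fun φ h0 d => by
    rw [e, sumDig_split _ hu (h0 _), Function.update_self, Function.update_idem]
  refine ⟨fun d => ⟨⟨?_, ?_, fun h => absurd h hp, ?_⟩, ?_⟩, fun D f f' hD => ?_⟩
  · intro v hv
    have := hg.le v hv
    have := hval d
    rw [e, Function.update_apply]; split_ifs <;> omega
  · exact fun v v' h hv h1 h2 => hg.disj v v' h hv (hz d v h1) (hz d v' h2)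
  · exact fun _ v hv h => hg.box hp v hv (hz d v h)
  · have hpos := (form w u).size_pos
    rw [potential, potential, sum _ (by simp), split _ (by simp), if_neg (show get s u ≠ 0 by omega),
      if_pos (show get s u ≤ 2 by omega)]
    have := hval d
    split_ifs <;> omega
  · have pv : ∀ f g, PosVal X w Γ Δ p f g ↔ Completable X p (inner w 1 g) (inner w 2 g)
        (inner w 3 g) (inner w 4 g) (inner w 5 g) := fun f g => by simp [PosVal, hp]
    set g := Function.update (get s) u 0
    set A := form w (u + 1)
    have es : ∀ m, m ≠ 0 → inner w m (get s) = inner w m g + only m (get s u) A := fun m hm =>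
      split (fun u x => only m x (form w (u + 1))) (fun u => only_zero hm _)
    have ed : ∀ m, m ≠ 0 → ∀ d, inner w m (chooseDigit s d u) = inner w m g + only m (y d) A :=
      fun m hm => sum (fun u x => only m x (form w (u + 1))) (fun u => only_zero hm _)
    have one : ∀ (A : Formula) (G : Multiset Formula), G + {A} = A ::ₘ G := fun A G => by
      rw [add_comm, Multiset.singleton_add]
    simp only [pv, es _ one_ne_zero, es _ two_ne_zero, es 3 (by norm_num), es 4 (by norm_num),
      es 5 (by norm_num), ed _ one_ne_zero, ed _ two_ne_zero, ed 3 (by norm_num),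
      ed 4 (by norm_num), ed 5 (by norm_num)]
    rcases hs with hs | hs
    · have y1 : y 1 = 3 := by simp [hy, hs]
      have y2 : y 2 = 4 := by simp [hy, hs]
      have y0 : ∀ d, d ≠ 1 → d ≠ 2 → y d = 0 := fun d h1 h2 => by simp [hy, hs, h1, h2]
      simp only [hs, only, one, if_true, Nat.reduceEqDiff, if_false, add_zero]
      rw [completable_cons_left]
      constructor
      · rintro (h | h | h)
        · exact ⟨1, by omega, by simpa [y1, one] using h⟩
        · exact ⟨2, by omega, by simpa [y2, one] using h⟩
        · exact ⟨0, by omega, by simpa [y0 0] using h⟩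
      · rintro ⟨d, -, h⟩
        by_cases h1 : d = 1
        · subst h1; exact Or.inl (by simpa [y1, one] using h)
        by_cases h2 : d = 2
        · subst h2; exact Or.inr (Or.inl (by simpa [y2, one] using h))
        exact Or.inr (Or.inr (by simpa [y0 d h1 h2] using h))
    · have y1 : y 1 = 5 := by simp [hy, hs]
      have y0 : ∀ d, d ≠ 1 → y d = 0 := fun d h1 => by simp [hy, hs, h1]
      simp only [hs, only, one, if_true, Nat.reduceEqDiff, if_false, add_zero]
      rw [completable_cons_right]
      constructor
      · rintro (h | h)
        · exact ⟨1, by omega, by simpa [y1, one] using h⟩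
        · exact ⟨0, by omega, by simpa [y0 0] using h⟩
      · rintro ⟨d, -, h⟩
        by_cases h1 : d = 1
        · subst h1; exact Or.inl (by simpa [y1, one] using h)
        exact Or.inr (by simpa [y0 d h1] using h)

end Moves
end G3

namespace G3

/-! ### The premisses of modal and deontic rules -/

section Premisses

variable {X : Calculus} {w : List Sym} {Γ Δ : List Formula} {s : ℕ}

theorem premDigit_cases (w : List Sym) (s d u : ℕ) :
    premDigit w s d u ≤ 2 ∧ (premDigit w s d u ≠ 0 → 3 ≤ get s u) := by
  unfold premDigit
  split_ifs with h1 h2 h3 h4 h5 h6 h7 h8 h9 <;> refine ⟨by omega, fun _ => ?_⟩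
  · omega
  · rw [h3, h1.2.2.2]
  · omega
  · omega
  · omega
  · rcases h7 with h7 | h7 <;> rw [h7] <;> omega
  · omega
  · omega
  · omega
  · omega

variable (hw : w = encodeSequent Γ Δ)

include hw

/-- The last token cannot be a box, as a box is followed by a formula. Thus the shift by one place
loses no digit. -/
theorem premDigit_last (hg : PosGood w (phase w s) (get s)) (hp : phase w s ≠ 0) (d u : ℕ)
    (hu : u + 1 = numTok w) : premDigit w s d u = 0 := by
  by_contra h
  have h3 := (premDigit_cases w s d u).2 h
  obtain ⟨A, hA⟩ := hg.box hp u (by omega) (by omega)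
  have := add_size_le hw (u := u) (by omega)
  rw [hA, Formula.size] at this
  have := A.size_pos
  omega

/-- The segment of a formula under a box is that of the boxed formula without its first token, so
disjointness is inherited. -/
theorem prem_good (hg : PosGood w (phase w s) (get s)) (hp : phase w s ≠ 0) (d : ℕ) :
    PosGood w 0 fun v => if v = 0 then 0 else premDigit w s d (v - 1) := by
  refine ⟨fun v _ => ?_, fun v v' hv hv' h1 h2 => ?_, fun _ v _ => ?_, fun h => absurd rfl h⟩
  · have := (premDigit_cases w s d (v - 1)).1
    split_ifs <;> omega
  · obtain ⟨u, rfl⟩ := Nat.exists_eq_succ_of_ne_zero (n := v) (by rintro rfl; simp at h1)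
    obtain ⟨u', rfl⟩ := Nat.exists_eq_succ_of_ne_zero (n := v') (by omega)
    have h1 := (premDigit_cases w s d u).2 (by simpa using h1)
    have h2 := (premDigit_cases w s d u').2 (by simpa using h2)
    have h3 := hg.disj u u' (by omega) (by omega) (by omega) (by omega)
    obtain ⟨A, hA⟩ := hg.box hp u (by omega) (by omega)
    rw [hA, Formula.size] at h3
    rw [Nat.succ_eq_add_one, form_box hw (by omega) hA]
    omega
  · have := (premDigit_cases w s d (v - 1)).1
    split_ifs <;> omega

/-- A chosen box of size `k` counts `3 * k - 1`, the formula under it at most `3 * (k - 1)`. Each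
principal formula therefore gains 2, while the return to phase 0 costs 1; this is why there must be
at least one. -/
theorem prem_potential (hg : PosGood w (phase w s) (get s)) (hp : phase w s ≠ 0)
    (h3 : ∃ u < numTok w, 3 ≤ get s u) (d : ℕ) :
    potential w 0 (fun v => if v = 0 then 0 else premDigit w s d (v - 1)) <
      potential w (phase w s) (get s) := by
  rw [potential, potential, if_pos rfl, if_neg hp,
    sumDig_shift (by simp) (premDigit_last hw hg hp d)]
  obtain ⟨u, hu, h3⟩ := h3
  have h1 : 2 ≤ ∑ u ∈ Finset.range (numTok w), if 3 ≤ get s u then 2 else 0 := by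
    refine le_trans ?_ (Finset.single_le_sum (f := fun u => if 3 ≤ get s u then 2 else 0)
      (fun _ _ => Nat.zero_le _) (Finset.mem_range.2 hu))
    simp [h3]
  have h2 : sumDig (numTok w) (fun u x => if x = 0 then 0 else
      if x ≤ 2 then 3 * (form w (u + 1)).size else 3 * (form w (u + 1)).size - 1)
        (premDigit w s d) + (∑ u ∈ Finset.range (numTok w), if 3 ≤ get s u then 2 else 0) ≤
      sumDig (numTok w) (fun u x => if x = 0 then 0 else
        if x ≤ 2 then 3 * (form w u).size else 3 * (form w u).size - 1) (get s) := by
    rw [sumDig, sumDig, ← Finset.sum_add_distrib]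
    refine Finset.sum_le_sum fun v hv => ?_
    have hv := Finset.mem_range.1 hv
    obtain ⟨c1, c2⟩ := premDigit_cases w s d v
    by_cases h : 3 ≤ get s v
    · obtain ⟨A, hA⟩ := hg.box hp v hv (by omega)
      rw [form_box hw hv hA, hA, Formula.size]
      have := A.size_pos
      split_ifs <;> omega
    · have : premDigit w s d v = 0 := by by_contra h'; exact h (c2 h')
      simp [this, h]
  omega

open Classical in
-- Evaluates the sequent of each move: a side premiss if the number of the move denotes one, and
-- otherwise the main premiss again.
theorem prem_val (hg : PosGood w (phase w s) (get s)) (hp : phase w s ≠ 0) (d : ℕ) :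
    PosVal X w Γ Δ 0 0 (fun v => if v = 0 then 0 else premDigit w s d (v - 1)) ↔
      if d ≠ 0 ∧ (phase w s = 1 ∨ phase w s = 4) ∧ (d - 1) % numTok w < numTok w ∧
        get s ((d - 1) % numTok w) = 3 then
        Derivable X ⟨inner w 5 (get s), {form w ((d - 1) % numTok w + 1)}⟩
      else if d ≠ 0 ∧ phase w s = 8 then Derivable X ⟨0, inner w 3 (get s)⟩
      else if d ≠ 0 ∧ phase w s = 10 ∧ ((d - 1) % numTok w < numTok w ∧
          get s ((d - 1) % numTok w) = 3) ∧ (d - 1) / numTok w < numTok w ∧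
          get s ((d - 1) / numTok w) = 4 then
        Derivable X ⟨0, {form w ((d - 1) % numTok w + 1), form w ((d - 1) / numTok w + 1)}⟩
      else Derivable X ⟨inner w 3 (get s) + inner w 4 (get s), inner w 5 (get s)⟩ := by
  have hT : ∀ m, m ≠ 0 → side w m (fun v => if v = 0 then 0 else premDigit w s d (v - 1)) =
      ∑ u ∈ Finset.range (numTok w), only m (premDigit w s d u) (form w (u + 1)) := fun m hm =>
    sumDig_shift (fun u => only_zero hm _) (premDigit_last hw hg hp d)
  have hat : ∀ Γ, atoms 0 Γ = 0 := fun Γ => by simp [atoms]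
  have h0 : PosVal X w Γ Δ 0 0 (fun v => if v = 0 then 0 else premDigit w s d (v - 1)) ↔
      Derivable X ⟨∑ u ∈ Finset.range (numTok w), only 1 (premDigit w s d u) (form w (u + 1)),
        ∑ u ∈ Finset.range (numTok w), only 2 (premDigit w s d u) (form w (u + 1))⟩ := by
    simp only [PosVal, posSequent, hT 1 one_ne_zero, hT 2 two_ne_zero, hat, add_zero]
    simp
  rw [h0]
  have point : ∀ a < numTok w, (∑ u ∈ Finset.range (numTok w),
      if u = a then ({form w (u + 1)} : Multiset Formula) else 0) = {form w (a + 1)} := fun a ha => by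
    rw [Finset.sum_ite_eq', if_pos (Finset.mem_range.2 ha)]
  set a := (d - 1) % numTok w
  set b := (d - 1) / numTok w
  have seq : ∀ {P Q R S : Multiset Formula}, P = R → Q = S →
      (Derivable X ⟨P, Q⟩ ↔ Derivable X ⟨R, S⟩) := by rintro P Q R S rfl rfl; rfl
  split_ifs with h1 h2 h3
  · have e : ∀ u, premDigit w s d u = if get s u = 5 then 1 else if u = a then 2 else 0 := fun u => by
      rw [premDigit, if_pos h1]
    simp only [e]
    refine seq (Finset.sum_congr rfl fun u _ => ?_)
      (Eq.trans (Finset.sum_congr rfl fun u _ => ?_) (point a h1.2.2.1))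
    · simp only [only]; split_ifs <;> simp_all
    · by_cases hu : u = a
      · simp [only, hu, h1.2.2.2]
      · simp only [only, hu, if_false]; split_ifs <;> simp_all
  · have e : ∀ u, premDigit w s d u = if get s u = 3 then 2 else 0 := fun u => by
      rw [premDigit, if_neg h1, if_pos h2]
    simp only [e]
    refine seq (Finset.sum_eq_zero fun u _ => ?_) (Finset.sum_congr rfl fun u _ => ?_)
    · simp only [only]; split_ifs <;> simp_all
    · simp only [only]; split_ifs <;> simp_all
  · have e : ∀ u, premDigit w s d u = if u = a ∨ u = b then 2 else 0 := fun u => by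
      rw [premDigit, if_neg h1, if_neg h2, if_pos h3]
    -- The two tokens are distinct since their digits are 3 and 4.
    have hab : a ≠ b := fun h => by
      have := h3.2.2.1.2
      rw [h, h3.2.2.2.2] at this; omega
    simp only [e]
    refine seq (Finset.sum_eq_zero fun u _ => ?_) ?_
    · simp only [only]; split_ifs <;> simp_all
    · rw [Multiset.insert_eq_cons, ← Multiset.singleton_add, ← point a h3.2.2.1.1,
        ← point b h3.2.2.2.1, ← Finset.sum_add_distrib]
      refine Finset.sum_congr rfl fun u _ => ?_
      by_cases ha : u = a
      · have hb : u ≠ b := fun h => hab (ha.symm.trans h)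
        simp [only, ha, hab]
      · by_cases hb : u = b <;> simp [only, ha, hb, hab.symm]
  · have e : ∀ u, premDigit w s d u =
        if get s u = 3 ∨ get s u = 4 then 1 else if get s u = 5 then 2 else 0 := fun u => by
      rw [premDigit, if_neg h1, if_neg h2, if_neg h3]
    simp only [e]
    refine seq ?_ (Finset.sum_congr rfl fun u _ => ?_)
    · rw [inner, inner, sumDig, sumDig, ← Finset.sum_add_distrib]
      refine Finset.sum_congr rfl fun u _ => ?_
      by_cases h3 : get s u = 3
      · simp [only, h3]
      by_cases h4 : get s u = 4
      · simp [only, h4]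
      by_cases h5 : get s u = 5 <;> simp [only, h3, h4, h5]
    · simp only [only]; split_ifs <;> simp_all

/-- When every box is decided there is nothing left to complete, and the value is that of the rule
itself: admissible numbers of principal formulas and derivable premisses, each of which is some
move. -/
theorem prem_move (hg : PosGood w (phase w s) (get s)) (hp : phase w s ≠ 0)
    (hs : ∀ u < numTok w, ¬ (get s u = 1 ∨ get s u = 2)) (f : ℕ) :
    PosVal X w Γ Δ (phase w s) f (get s) ↔
      Admits (phase w s) (inner w 3 (get s)).card (inner w 4 (get s)).card
        (inner w 5 (get s)).card ∧
      ∀ d < posMoves w,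
        PosVal X w Γ Δ 0 0 (fun v => if v = 0 then 0 else premDigit w s d (v - 1)) := by
  have h1 : inner w 1 (get s) = 0 := Multiset.eq_zero_of_forall_notMem fun A hA => by
    obtain ⟨u, hu, h, -⟩ := mem_inner.1 hA
    exact hs u hu (Or.inl h)
  have h2 : inner w 2 (get s) = 0 := Multiset.eq_zero_of_forall_notMem fun A hA => by
    obtain ⟨u, hu, h, -⟩ := mem_inner.1 hA
    exact hs u hu (Or.inr h)
  have hv : PosVal X w Γ Δ (phase w s) f (get s) ↔ RuleSem X (phase w s) (inner w 3 (get s))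
      (inner w 4 (get s)) (inner w 5 (get s)) := by
    rw [PosVal, h1, h2, completable_zero]
    simp [hp]
  rw [hv, RuleSem]
  refine and_congr_right fun _ => ?_
  simp only [prem_val hw hg hp]
  constructor
  · rintro ⟨hm, c1, c2, c3⟩ d hd
    split_ifs with h1 h2 h3
    · exact c1 h1.2.1 _ (mem_inner.2 ⟨_, h1.2.2.1, h1.2.2.2, rfl⟩)
    · exact c2 h2.2
    · exact c3 h3.2.1 _ (mem_inner.2 ⟨_, h3.2.2.1.1, h3.2.2.1.2, rfl⟩) _
        (mem_inner.2 ⟨_, h3.2.2.2.1, h3.2.2.2.2, rfl⟩)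
    · exact hm
  · intro h
    refine ⟨by simpa using h 0 (by simp [posMoves]), fun hc A hA => ?_, fun hc => ?_,
      fun hc A hA B hB => ?_⟩
    · obtain ⟨a, ha, ha', rfl⟩ := mem_inner.1 hA
      -- The side premiss for the principal formula at token `a` has the number `a + 1`.
      have := h (a + 1) (by rw [posMoves]; nlinarith)
      rw [Nat.add_sub_cancel, Nat.mod_eq_of_lt ha, if_pos ⟨by omega, hc, ha, ha'⟩] at this
      exact this
    · have := h 1 (by simp [posMoves])
      rw [if_neg (by omega), if_pos ⟨one_ne_zero, hc⟩] at this
      exact this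
    · obtain ⟨a, ha, ha', rfl⟩ := mem_inner.1 hA
      obtain ⟨b, hb, hb', rfl⟩ := mem_inner.1 hB
      -- Remainder and quotient by `numTok w` recover the two tokens `a` and `b`.
      have := h (a + numTok w * b + 1) (by
        rw [posMoves]
        have : numTok w * (b + 1) ≤ numTok w * numTok w := Nat.mul_le_mul_left _ hb
        rw [Nat.mul_add] at this
        omega)
      rw [Nat.add_sub_cancel, Nat.add_mul_mod_self_left, Nat.mod_eq_of_lt ha,
        Nat.add_mul_div_left _ _ (by omega), Nat.div_eq_of_lt ha, zero_add, if_neg (by omega),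
        if_neg (by omega), if_pos ⟨by omega, hc, ⟨ha, ha'⟩, hb, hb'⟩] at this
      exact this

end Premisses
end G3

/-! ### Correctness of the game -/

namespace G3

open Ctx (word vals arity)

section Correct

variable {X : Calculus} {w : List Sym} {Γ Δ : List Formula} (hw : w = encodeSequent Γ Δ)

/-- Storing a position in an array loses nothing, because all digits of a good position are below
16. -/
theorem mkState_spec {p f : ℕ} {g : ℕ → ℕ} (hp : p < 16) (hf : f < 16) (hg : PosGood w p g) :
    PosGood w (phase w (mkState w p f g)) (get (mkState w p f g)) ∧
    potential w (phase w (mkState w p f g)) (get (mkState w p f g)) = potential w p g ∧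
    (PosVal X w Γ Δ (phase w (mkState w p f g)) (flag w (mkState w p f g)) (get (mkState w p f g)) ↔
      PosVal X w Γ Δ p f g) := by
  have h : ∀ u < numTok w, get (mkState w p f g) u = g u := fun u hu =>
    get_mkState hu (by have := hg.le u hu; omega)
  rw [phase_mkState hp, flag_mkState hf]
  exact ⟨hg.congr fun u hu => (h u hu).symm, potential_congr h, PosVal.congr h⟩

include hw

/-- Brings the four kinds of moves together: a good position is decided in agreement with its
meaning, or its meaning is the conjunction or disjunction of those of its successors, which are good
and have smaller potential. -/
theorem pos_step {s : ℕ} (hg : PosGood w (phase w s) (get s)) :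
    (posKind w s = 1 ∧ PosVal X w Γ Δ (phase w s) (flag w s) (get s)) ∨
    (posKind w s = 0 ∧ ¬ PosVal X w Γ Δ (phase w s) (flag w s) (get s)) ∨
    ((posKind w s = 2 ∨ posKind w s = 3) ∧
      (∀ d, PosGood w (phase w (posNext X w s d)) (get (posNext X w s d)) ∧
        potential w (phase w (posNext X w s d)) (get (posNext X w s d)) <
          potential w (phase w s) (get s)) ∧
      (posKind w s = 2 → (PosVal X w Γ Δ (phase w s) (flag w s) (get s) ↔ ∀ d < posMoves w,
        PosVal X w Γ Δ (phase w (posNext X w s d)) (flag w (posNext X w s d))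
          (get (posNext X w s d)))) ∧
      (posKind w s = 3 → (PosVal X w Γ Δ (phase w s) (flag w s) (get s) ↔ ∃ d < posMoves w,
        PosVal X w Γ Δ (phase w (posNext X w s d)) (flag w (posNext X w s d))
          (get (posNext X w s d))))) := by
  have hD : 4 ≤ posMoves w := by rw [posMoves]; omega
  have hlt : ∀ u, get s u < 16 := fun u => Nat.mod_lt _ (by norm_num)
  have hseq : IsSequent w := (isSequent_iff_exists w).2 ⟨Γ, Δ, hw⟩
  by_cases hp : phase w s = 0
  · by_cases hc : ClosedPos w s
    · refine Or.inl ⟨by rw [posKind, if_pos hseq, if_pos hp, if_pos hc], ?_⟩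
      exact ⟨fun _ => .closed ((closedPos_iff hw).1 hc), fun h => absurd hp h⟩
    obtain ⟨b1, b2, b3⟩ := bmin_spec (numTok w)
      fun u => (get s u = 1 ∨ get s u = 2) ∧ IsBin (kd w u)
    change firstBin w s ≤ _ at b1
    change ∀ i < firstBin w s, _ at b2
    change firstBin w s < _ → _ at b3
    refine Or.inr (Or.inr ?_)
    by_cases hb : firstBin w s < numTok w
    · have hk : posKind w s = 2 := by
        rw [posKind, if_pos hseq, if_pos hp, if_neg hc, if_pos hb]
      have hn : ∀ d, posNext X w s d =
          mkState w 0 (flag w s) (propDigit w s d (firstBin w s)) := fun d => by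
        rw [posNext, if_pos hp, if_pos hb]
      obtain ⟨h1, h2⟩ := b3 hb
      rw [hp] at hg ⊢
      obtain ⟨m1, m2⟩ := prop_move (X := X) hw hg hb h1 h2 (flag w s)
      have hf : flag w s < 16 := hlt _
      have sp := fun d => mkState_spec (X := X) (Γ := Γ) (Δ := Δ) (p := 0) (by norm_num) hf (m1 d).1
      refine ⟨Or.inl hk, fun d => ?_, fun _ => ?_, fun h => by omega⟩
      · rw [hn]
        exact ⟨(sp d).1, (sp d).2.1.trans_lt (m1 d).2⟩
      · rw [m2 (posMoves w) (by omega)]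
        refine forall_congr' fun d => imp_congr_right fun _ => ?_
        rw [hn]
        exact (sp d).2.2.symm
    · have hk : posKind w s = 3 := by
        rw [posKind, if_pos hseq, if_pos hp, if_neg hc, if_neg hb]
      have hn : ∀ d, posNext X w s d = mkState w (ruleNum X d) 0 (ruleDigit w s) := fun d => by
        rw [posNext, if_pos hp, if_neg hb]
      rw [hp] at hg ⊢
      have hb' : firstBin w s = numTok w := by omega
      obtain ⟨m1, m2⟩ := rule_move (X := X) hw hg (f := flag w s)
        (fun h => hc ((closedPos_iff hw).2 h)) fun u hu h h' => b2 u (by omega) ⟨h, h'⟩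
      have sp := fun d => mkState_spec (X := X) (Γ := Γ) (Δ := Δ) (ruleNum_pos X d).2
        (show 0 < 16 by norm_num) (m1 d).1
      refine ⟨Or.inr hk, fun d => ?_, fun h => by omega, fun _ => ?_⟩
      · rw [hn]
        exact ⟨(sp d).1, (sp d).2.1.trans_lt (m1 d).2⟩
      · rw [m2 _ hD]
        refine exists_congr fun d => and_congr_right fun _ => ?_
        rw [hn]
        exact (sp d).2.2.symm
  · obtain ⟨b1, b2, b3⟩ := bmin_spec (numTok w) fun u => get s u = 1 ∨ get s u = 2
    change firstOpen w s ≤ _ at b1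
    change ∀ i < firstOpen w s, _ at b2
    change firstOpen w s < _ → _ at b3
    by_cases hb : firstOpen w s < numTok w
    · refine Or.inr (Or.inr ?_)
      have hk : posKind w s = 3 := by rw [posKind, if_pos hseq, if_neg hp, if_pos hb]
      have hn : ∀ d, posNext X w s d =
          mkState w (phase w s) 0 (chooseDigit s d (firstOpen w s)) := fun d => by
        rw [posNext, if_neg hp, if_pos hb]
      obtain ⟨m1, m2⟩ := choose_move (X := X) (Γ := Γ) (Δ := Δ) hp hg hb (b3 hb)
      have sp := fun d => mkState_spec (X := X) (Γ := Γ) (Δ := Δ) (hlt _ : phase w s < 16)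
        (show 0 < 16 by norm_num) (m1 d).1
      refine ⟨Or.inr hk, fun d => ?_, fun h => by omega, fun _ => ?_⟩
      · rw [hn]
        exact ⟨(sp d).1, (sp d).2.1.trans_lt (m1 d).2⟩
      · rw [m2 (posMoves w) (flag w s) 0 (by omega)]
        refine exists_congr fun d => and_congr_right fun _ => ?_
        rw [hn]
        exact (sp d).2.2.symm
    · have hb' : firstOpen w s = numTok w := by omega
      have m2 := prem_move (X := X) (Γ := Γ) (Δ := Δ) hw hg hp (fun u hu => b2 u (by omega))
        (flag w s)
      by_cases ha : Admits (phase w s) (inner w 3 (get s)).card (inner w 4 (get s)).card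
        (inner w 5 (get s)).card
      · refine Or.inr (Or.inr ?_)
        have hk : posKind w s = 2 := by
          rw [posKind, if_pos hseq, if_neg hp, if_neg hb, if_pos]
          simpa only [card_inner] using ha
        have hn : ∀ d, posNext X w s d =
            mkState w 0 0 fun v => if v = 0 then 0 else premDigit w s d (v - 1) := fun d => by
          rw [posNext, if_neg hp, if_neg hb]
        have hex : ∃ u < numTok w, 3 ≤ get s u := by
          have : (inner w 3 (get s)).card ≠ 0 ∨ (inner w 5 (get s)).card ≠ 0 := by
            unfold Admits at ha; omega
          rcases this with h | h
          · obtain ⟨A, hA⟩ := Multiset.card_pos_iff_exists_mem.1 (Nat.pos_of_ne_zero h)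
            obtain ⟨u, hu, h, -⟩ := mem_inner.1 hA
            exact ⟨u, hu, h.ge⟩
          · obtain ⟨A, hA⟩ := Multiset.card_pos_iff_exists_mem.1 (Nat.pos_of_ne_zero h)
            obtain ⟨u, hu, h, -⟩ := mem_inner.1 hA
            exact ⟨u, hu, by omega⟩
        have sp := fun d => mkState_spec (X := X) (Γ := Γ) (Δ := Δ) (p := 0) (f := 0) (by norm_num)
          (by norm_num) (prem_good hw hg hp d)
        refine ⟨Or.inl hk, fun d => ?_, fun _ => ?_, fun h => by omega⟩
        · rw [hn]
          exact ⟨(sp d).1, (sp d).2.1.trans_lt (prem_potential hw hg hp hex d)⟩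
        · rw [m2]
          refine (and_iff_right ha).trans (forall_congr' fun d => imp_congr_right fun _ => ?_)
          rw [hn]
          exact (sp d).2.2.symm
      · refine Or.inr (Or.inl ⟨?_, fun h => ha (m2.1 h).1⟩)
        rw [posKind, if_pos hseq, if_neg hp, if_neg hb, if_neg]
        simpa only [card_inner] using ha

/-- Induction on a bound for the potential, which bounds the length of plays as well. -/
theorem game_correct (k : ℕ) : ∀ s, PosGood w (phase w s) (get s) →
    potential w (phase w s) (get s) ≤ k →
    Bdd (posKind w) (posNext X w) (posMoves w) k s ∧
      (gval (posKind w) (posNext X w) (posMoves w) k s ↔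
        PosVal X w Γ Δ (phase w s) (flag w s) (get s)) := by
  induction k with
  | zero =>
    intro s hg hk
    rcases pos_step (X := X) hw hg with ⟨h1, h2⟩ | ⟨h1, h2⟩ | ⟨-, h, -⟩
    · simp [Bdd, gval, h1, h2]
    · simp [Bdd, gval, h1, h2]
    · have := (h 0).2; omega
  | succ k ih =>
    intro s hg hk
    rcases pos_step (X := X) hw hg with ⟨h1, h2⟩ | ⟨h1, h2⟩ | ⟨h1, h2, h3, h4⟩
    · simp [Bdd, gval, h1, h2]
    · simp [Bdd, gval, h1, h2]
    · have ih' := fun d => ih _ (h2 d).1 (by have := (h2 d).2; omega)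
      refine ⟨fun _ d _ => (ih' d).1, ?_⟩
      rcases h1 with h1 | h1
      · rw [h3 h1, gval]
        simp [h1, fun d => (ih' d).2]
      · rw [h4 h1, gval]
        simp [h1, fun d => (ih' d).2]

omit hw in
theorem mark_le (w : List Sym) (u : ℕ) : mark w u ≤ 2 := by
  unfold mark markAt sideAt; split_ifs <;> omega

theorem good_mark : PosGood w 0 (mark w) where
  le u _ := (mark_le w u).trans (by norm_num)
  disj u v huv hv _ h := by
    by_contra h'
    exact h (mark_eq_zero_of_lt hw (by omega) huv (by omega))
  le_two _ u _ := mark_le w u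
  box h := absurd rfl h

omit hw in
-- Disjoint segments that end before `b` have total length at most `b`; the last one is split off.
theorem sum_size_le {p : ℕ} {g : ℕ → ℕ} (hg : PosGood w p g) : ∀ n ≤ numTok w, ∀ b,
    (∀ u < n, g u ≠ 0 → u + (form w u).size ≤ b) →
    (∑ u ∈ Finset.range n, if g u = 0 then 0 else (form w u).size) ≤ b := by
  intro n
  induction n with
  | zero => simp
  | succ n ih =>
    intro hn b hb
    rw [Finset.sum_range_succ]
    split_ifs with h
    · exact ih (by omega) b fun u hu h => hb u (by omega) h
    · have := ih (by omega) n fun u hu h' => hg.disj u n hu (by omega) h' h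
      have := hb n (by omega) h
      omega

theorem potential_mark : potential w 0 (mark w) ≤ posDepth w := by
  have h := sum_size_le (good_mark hw) (numTok w) le_rfl (numTok w) fun u hu _ => add_size_le hw hu
  have h' : sumDig (numTok w) (fun u x => if x = 0 then 0 else
      if x ≤ 2 then 3 * (form w u).size else 3 * (form w u).size - 1) (mark w) =
      3 * ∑ u ∈ Finset.range (numTok w), if mark w u = 0 then 0 else (form w u).size := by
    rw [sumDig, Finset.mul_sum]
    refine Finset.sum_congr rfl fun u _ => ?_
    rw [if_pos (mark_le w u)]
    split_ifs <;> rfl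
  rw [potential, posDepth, if_pos rfl, h']
  omega

theorem posSequent_mark : posSequent w Γ Δ 1 (mark w) = ⟨Γ, Δ⟩ := by
  have h1 := sum_roots hw (m := 1) (Or.inl rfl)
  have h2 := sum_roots hw (m := 2) (Or.inr rfl)
  have key : ∀ L : List Formula, ((L.filter fun A => A.weight ≠ 0 : List Formula) :
      Multiset Formula) + (L.filter fun A => A.weight = 0 : List Formula) = L := fun L => by
    have := Multiset.filter_add_not (fun A : Formula => A.weight = 0) (L : Multiset Formula)
    rw [add_comm] at this
    simpa using this
  have e1 : side w 1 (mark w) = (Γ.filter fun A => A.weight ≠ 0 : List Formula) := h1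
  have e2 : side w 2 (mark w) = (Δ.filter fun A => A.weight ≠ 0 : List Formula) := h2
  rw [posSequent, e1, e2, atoms, atoms, if_pos rfl, if_pos rfl, key, key]

theorem init_correct :
    Bdd (posKind w) (posNext X w) (posMoves w) (posDepth w) (posInit w) ∧
      (gval (posKind w) (posNext X w) (posMoves w) (posDepth w) (posInit w) ↔
        Derivable X ⟨Γ, Δ⟩) := by
  obtain ⟨h1, h2, h3⟩ := mkState_spec (X := X) (Γ := Γ) (Δ := Δ) (f := 1) (by norm_num)
    (by norm_num) (good_mark hw)
  have h := game_correct (X := X) hw (posDepth w) (posInit w) h1 (h2.le.trans (potential_mark hw))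
  refine ⟨h.1, h.2.trans (h3.trans ?_)⟩
  rw [PosVal, posSequent_mark hw]
  simp

end Correct

/-! ### Space bounds -/

section Space

theorem posKind_eq_zero {w : List Sym} (h : ¬ IsSequent w) (s : ℕ) : posKind w s = 0 := by
  rw [posKind, if_neg h]

/-- The evaluation must terminate on every word; on one that encodes no sequent the initial position
is already lost. -/
theorem bdd_posInit (X : Calculus) (w : List Sym) :
    Bdd (posKind w) (posNext X w) (posMoves w) (posDepth w) (posInit w) := by
  by_cases h : IsSequent w
  · obtain ⟨Γ, Δ, hw⟩ := (isSequent_iff_exists w).1 h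
    exact (init_correct hw).1
  · rw [posDepth, Bdd, posKind_eq_zero h]
    simp

theorem mem_derivabilityLanguage_iff (X : Calculus) (w : List Sym) :
    w ∈ derivabilityLanguage X ↔
      gval (posKind w) (posNext X w) (posMoves w) (posDepth w) (posInit w) := by
  constructor
  · rintro ⟨Γ, Δ, hw, h⟩
    exact (init_correct hw).2.2 h
  · intro h
    by_cases hs : IsSequent w
    · obtain ⟨Γ, Δ, hw⟩ := (isSequent_iff_exists w).1 hs
      exact ⟨Γ, Δ, hw, (init_correct hw).2.1 h⟩
    · rw [posDepth, gval, posKind_eq_zero hs] at h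
      simp at h

theorem LSP.mem_derivabilityLanguage (X : Calculus) :
    LSP posBound fun w : List Sym => w ∈ derivabilityLanguage X := by
  refine LSP.congr (LSP.game (kind := posKind) (next := posNext X) (D := posMoves) (L := posDepth)
    (init := posInit) (LS.posKind (α := List Sym × ℕ) LS.var)
    (LS.posNext (α := (List Sym × ℕ) × ℕ) X LS.var.lift LS.var) LS.posInit LS.posMoves
    (fun w s d => posNext_le X w s d) (fun w => mkState_le w _ _ _)
    (fun w => by rw [posMoves]; omega) ?_ (bdd_posInit X))
    fun w => (mem_derivabilityLanguage_iff X w).symm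
  refine PB.mono PB.param fun w => ?_
  exact Nat.pow_le_pow_right (by omega) (Nat.le_add_right _ _)

/-- The counters are at most a fixed power of `ctxSize posBound w`, so the exponent of a power of
two above the latter measures the space up to a factor. Both space bounds are obtained from this by
estimating `posBound`. -/
theorem exists_machine_derivabilityLanguage (X : Calculus) :
    ∃ (M : OfflineTM Sym) (C : ℕ), M.Decides (derivabilityLanguage X) ∧
      ∀ (w : List Sym) (e : ℕ), (w.length + 2) * posBound w ≤ 2 ^ e →
        M.SpaceAtMost w (C * (e + 1)) := by
  obtain ⟨f, ⟨c, K, hc⟩, hf⟩ := LSP.mem_derivabilityLanguage X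
  obtain ⟨M, K', hM, hs⟩ := c.exists_machine (derivabilityLanguage X)
    (fun w => ctxSize posBound w ^ K) fun w => by
      refine ⟨_, _, (hc w).2 _ le_rfl, ?_⟩
      refine (hf w).trans ?_
      simp [store, vals]
  refine ⟨M, K' * (K + 4), hM, fun w e he t => (hs w t).trans ?_⟩
  have h1 : ctxSize posBound w ≤ 2 ^ e := by
    refine le_trans ?_ he
    have h2 : 2 ≤ posBound w := by
      refine le_trans ?_ (pow_numTok_le w)
      calc 2 ≤ 16 ^ 1 := by norm_num
        _ ≤ _ := Nat.pow_le_pow_right (by norm_num) (by omega)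
    have : ctxSize posBound w = w.length + 0 + posBound w + 2 := rfl
    rw [this]
    nlinarith
  have h2 : Nat.log 2 (ctxSize posBound w ^ K) ≤ e * K := by
    calc _ ≤ Nat.log 2 ((2 ^ e) ^ K) := Nat.log_mono_right (Nat.pow_le_pow_left h1 K)
      _ = e * K := by rw [← pow_mul, Nat.log_pow (by norm_num)]
  calc _ ≤ K' * (e * K + 4) := Nat.mul_le_mul_left _ (by omega)
    _ ≤ K' * (K + 4) * (e + 1) := by
      rw [mul_assoc]
      exact Nat.mul_le_mul_left _ (by nlinarith)

theorem posBound_le_of_sequent {Γ Δ : List Formula} {w : List Sym} (hw : w = encodeSequent Γ Δ) :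
    posBound w ≤ 2 ^ (114 * ((Sequent.mk Γ Δ).weight * Nat.log 2 (Sequent.mk Γ Δ).weight + 1)) := by
  have hN := numTok_le hw
  set n := (Sequent.mk Γ Δ).weight
  set L := Nat.log 2 n with hL
  set N := numTok w
  have h1 : n < 2 ^ (L + 1) := Nat.lt_pow_succ_log_self (by norm_num) n
  have h2 : 1 ≤ 2 ^ (L + 1) := Nat.one_le_two_pow
  -- From `N ≤ 3 * n` and `n < 2 ^ (L + 1)`: the left side is at most `9 * 2 ^ (2 * L + 2) + 6`,
  -- hence at most `16 * 2 ^ (2 * L + 2)`.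
  have h3 : N * N + 4 + 2 ≤ 2 ^ (2 * L + 6) := by
    have e : 2 ^ (2 * L + 6) = 16 * (2 ^ (L + 1) * 2 ^ (L + 1)) := by ring
    rw [e]
    nlinarith [Nat.mul_le_mul hN hN, Nat.mul_le_mul h1.le h1.le]
  -- Expanding `(2 * L + 6) * (9 * n + 10)` and using `L ≤ n * L` and `n ≤ n * L + 1` gives at most
  -- `92 * (n * L) + 114`.
  have h4 : (2 * L + 6) * (3 * N + 1 + 9) ≤ 114 * (n * L + 1) := by
    have a1 : L ≤ n * L := by
      rcases Nat.eq_zero_or_pos n with h | h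
      · simp [hL, h]
      · exact Nat.le_mul_of_pos_left _ h
    have a2 : n ≤ n * L + 1 := by
      rcases Nat.eq_zero_or_pos L with h | h
      · rw [h] at h1; omega
      · have := Nat.le_mul_of_pos_right n h; omega
    have a3 : (2 * L + 6) * (3 * N + 1 + 9) ≤ (2 * L + 6) * (9 * n + 10) :=
      Nat.mul_le_mul_left _ (by omega)
    nlinarith
  calc posBound w ≤ (2 ^ (2 * L + 6)) ^ (3 * N + 1 + 9) := Nat.pow_le_pow_left h3 _
    _ = 2 ^ ((2 * L + 6) * (3 * N + 1 + 9)) := by rw [← pow_mul]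
    _ ≤ _ := Nat.pow_le_pow_right (by norm_num) h4

/-- A cruder estimate in the length, valid for words that encode no sequent as well, as the
definition of `PSPACE` speaks of all words. -/
theorem posBound_le (w : List Sym) :
    posBound w ≤ 2 ^ (2 * (w.length + 4) * (3 * w.length + 13)) := by
  have hN := numTok_le_length w
  set N := numTok w
  have h1 : N + 3 ≤ 2 ^ (N + 3) := Nat.lt_two_pow_self.le
  have h3 : N * N + 4 + 2 ≤ 2 ^ (2 * (N + 3)) := by
    have e : 2 ^ (2 * (N + 3)) = 2 ^ (N + 3) * 2 ^ (N + 3) := by rw [two_mul, pow_add]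
    rw [e]
    exact le_trans (by ring_nf; omega) (Nat.mul_le_mul h1 h1)
  calc posBound w ≤ (2 ^ (2 * (N + 3))) ^ (3 * N + 1 + 9) := Nat.pow_le_pow_left h3 _
    _ = 2 ^ (2 * (N + 3) * (3 * N + 1 + 9)) := by rw [← pow_mul]
    _ ≤ _ := Nat.pow_le_pow_right (by norm_num)
      (Nat.mul_le_mul (Nat.mul_le_mul_left _ (by omega)) (by omega))

theorem exists_machine_space (X : Calculus) :
    ∃ (M : OfflineTM Sym) (c : ℕ), M.Decides (derivabilityLanguage X) ∧
      ∀ Γ Δ : List Formula, M.SpaceAtMost (encodeSequent Γ Δ)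
        (c * ((Sequent.mk Γ Δ).weight * Nat.log 2 (Sequent.mk Γ Δ).weight +
          Nat.log 2 (encodeSequent Γ Δ).length + 1)) := by
  obtain ⟨M, C, hM, hs⟩ := exists_machine_derivabilityLanguage X
  refine ⟨M, C * 117, hM, fun Γ Δ t => ?_⟩
  have h1 := posBound_le_of_sequent (rfl : encodeSequent Γ Δ = encodeSequent Γ Δ)
  set w := encodeSequent Γ Δ
  set q := (Sequent.mk Γ Δ).weight * Nat.log 2 (Sequent.mk Γ Δ).weight
  have h2 : w.length + 2 ≤ 2 ^ (Nat.log 2 w.length + 2) := by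
    have := Nat.lt_pow_succ_log_self (b := 2) (by norm_num) w.length
    rw [pow_succ]
    omega
  refine (hs w (Nat.log 2 w.length + 2 + 114 * (q + 1)) ?_ t).trans ?_
  · rw [pow_add]; exact Nat.mul_le_mul h2 h1
  · rw [mul_assoc]
    exact Nat.mul_le_mul_left _ (by omega)

theorem derivabilityLanguage_mem_PSPACE (X : Calculus) : derivabilityLanguage X ∈ PSPACE Sym := by
  obtain ⟨M, C, hM, hs⟩ := exists_machine_derivabilityLanguage X
  refine ⟨M, .C C * ((.X + 2) + 2 * (.X + 4) * (3 * .X + 13) + 1), hM, fun w t => ?_⟩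
  refine (hs w ((w.length + 2) + 2 * (w.length + 4) * (3 * w.length + 13)) ?_ t).trans ?_
  · rw [pow_add]; exact Nat.mul_le_mul Nat.lt_two_pow_self.le (posBound_le w)
  · simp

end Space
end G3

theorem mainTheorem5 (X : G3.Calculus) :
    -- the search procedure: instance orderings exist, every run stops, with the right answer
    (Nonempty (G3.InstanceOrder X) ∧
      ∀ (ord : G3.InstanceOrder X) (S : G3.Sequent),
        G3.SearchTerminates ord S ∧ G3.SearchCorrect ord S) ∧
    -- the space bound, in the weight of the end-sequent
    (∃ (M : G3.OfflineTM G3.Sym) (c : ℕ), M.Decides (G3.derivabilityLanguage X) ∧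
      ∀ Γ Δ : List G3.Formula,
        M.SpaceAtMost (G3.encodeSequent Γ Δ)
          (c * ((G3.Sequent.mk Γ Δ).weight * Nat.log 2 (G3.Sequent.mk Γ Δ).weight +
            Nat.log 2 (G3.encodeSequent Γ Δ).length + 1))) ∧
    G3.derivabilityLanguage X ∈ G3.PSPACE G3.Sym :=
  ⟨⟨G3.nonempty_instanceOrder X, fun ord S => ⟨G3.searchTerminates ord S, G3.searchCorrect ord S⟩⟩,
    G3.exists_machine_space X, G3.derivabilityLanguage_mem_PSPACE X⟩
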